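/- Let $\epsilon,\dot\epsilon\in\{\pm1\}$. An $(\epsilon,\dot\epsilon)$-space is a finite dimensional complex vector space $\mathbf V$ with a non-degenerate $\epsilon$-symmetric bilinear form $\langle\,,\rangle$, a conjugate linear map $J$ with $J^2=\epsilon\dot\epsilon$ and $\langle Ju,Jv\rangle=\overline{\langle u,v\rangle}$, and a linear isometry $L$ with $L^2=\dot\epsilon$, $LJ=JL$, such that $(u,v)\mapsto\langle Lu,Jv\rangle$ is positive definite. Its real group $G=G_{\mathbf V}$ consists of the isometries commuting with $J$, its Lie algebra is $\mathfrak g_{\mathbb R}$, and $\mathbf K$ is the group of the isometries commuting with $L$; $G$ is real orthogonal when $(\epsilon,\dot\epsilon)=(1,1)$. The signature of an $L$-stable subquotient is the pair $(n^+,n^-)$ of dimensions of the eigenspaces of $L$ for $\pm1$ if $\dot\epsilon=1$, and for $\pm\mathbf i$ if $\dot\epsilon=-1$; $\check{(n^+,n^-)}:=(n^-,n^+)$. For a nilpotent $G$-orbit $\mathscr O_{\mathbb R}\subset\mathbf i\mathfrak g_{\mathbb R}$, its signed Young diagram $\ddot{\mathbf D}(\mathscr O_{\mathbb R})$ is the sequence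 of the signatures of $\mathrm{Ker}(Y^{j+1})/\mathrm{Ker}(Y^j)$, $j\ge0$, where $Y$ is any element of the $\mathbf K$-orbit corresponding to $\mathscr O_{\mathbb R}$ under the Kostant–Sekiguchi correspondence. Let $\mathbf V$ be an $(\epsilon,\dot\epsilon)$-space, and let $\mathbf V^-$ be the $(\epsilon,\dot\epsilon)$-space with the same vector space and $J$, with form $-\langle\,,\rangle$ and with $-L$ in place of $L$; then $G_{\mathbf V^-}=G_{\mathbf V}=:G$. Let $\mathbf V^\perp=\mathbf E_0\oplus\mathbf V^-\oplus\mathbf E_0'$ be an $(\epsilon,\dot\epsilon)$-space, where $\mathbf V^-$ is an $(\epsilon,\dot\epsilon)$-subspace, $\mathbf E_0$ is $J$-stable and totally isotropic, $\mathbf E_0'=L(\mathbf E_0)$, and $\mathbf V^-$ is the orthogonal complement of $\mathbf E_0\oplus\mathbf E_0'$. Let $P_{\mathbf E_0}$ be the parabolic subgroup of $G_{\mathbf V^\perp}$ stabilizing $\mathbf E_0$, and $\mathfrak n$ the Lie algebra of its unipotent radical. For a nilpotent $G$-orbit $\mathscr O_{\mathbb R}\subset\mathbf i\mathfrak g_{\mathbb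 R}$, viewed as an orbit of the Levi subgroup $G\times \mathrm{GL}_{\mathbf E_0}$, let $\mathrm{Ind}\,\mathscr O_{\mathbb R}$ be the set of the nilpotent $G_{\mathbf V^\perp}$-orbits in $\mathbf i\mathfrak g_{\mathbf V^\perp,\mathbb R}$ that meet $\mathscr O_{\mathbb R}+\mathbf i\mathfrak n$ in a non-empty relatively open subset. For a nilpotent element $X$ let $C_{P_{\mathbf E_0}}(X)$ and $C_{G_{\mathbf V^\perp}}(X)$ be the component groups of the centralizers of $X$ in $P_{\mathbf E_0}$ and $G_{\mathbf V^\perp}$. Let $\mathscr O_{\mathbb R}\subset\mathbf i\mathfrak g_{\mathbb R}$ be a nilpotent $G$-orbit, and let $[d_1,\dots,d_k]$ be its signed Young diagram computed in $\mathbf V^-$ (if $\mathbf V=0$, put $d_1=(0,0)$). Put $l=\dim\mathbf E_0$ and let $c_1$ be the dimension of the kernel of an element of $\mathscr O_{\mathbb R}$. Assume that $l\ge c_1$, and that $l-c_1$ is odd if $G$ is real orthogonal. In what follows zero entries at the end of a diagram are ignored. (a) Suppose that $G$ is a real orthogonal group. Then $\mathrm{Ind}\,\mathscr O_{\mathbb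 R}$ consists of a single orbit $\mathscr O^\perp_{\mathbb R}$, and $$\ddot{\mathbf D}(\mathscr O^\perp_{\mathbb R})=[d_1+s+(1,1),\ \check d_1+\check s,\ d_1,\dots,d_k],\qquad s=\left(\tfrac{l-c_1-1}2,\tfrac{l-c_1-1}2\right).$$ For every $X\in\mathscr O^\perp_{\mathbb R}\cap(\mathscr O_{\mathbb R}+\mathbf i\mathfrak n)$ the natural map $C_{P_{\mathbf E_0}}(X)\to C_{G_{\mathbf V^\perp}}(X)$ is injective and its image has index $2$. (b) Otherwise, $\mathrm{Ind}\,\mathscr O_{\mathbb R}$ is the set of all nilpotent $G_{\mathbf V^\perp}$-orbits $\mathscr O^\perp_{\mathbb R}$ in $\mathbf i\mathfrak g_{\mathbf V^\perp,\mathbb R}$ such that $$\ddot{\mathbf D}(\mathscr O^\perp_{\mathbb R})=[d_1+s,\ \check d_1+\check s,\ d_1,\dots,d_k]$$ for a signature $s$ of a $(-\epsilon,-\dot\epsilon)$-space of dimension $l-c_1$. For every $\mathscr O^\perp_{\mathbb R}\in\mathrm{Ind}\,\mathscr O_{\mathbb R}$ and every $X\in\mathscr O^\perp_{\mathbb R}\cap(\mathscr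 O_{\mathbb R}+\mathbf i\mathfrak n)$ the natural map $C_{P_{\mathbf E_0}}(X)\to C_{G_{\mathbf V^\perp}}(X)$ is an isomorphism. -/

import Mathlib

open Module Topology

noncomputable section

/-- An invertible operator composed with its inverse. -/
theorem unit_apply_inv {V : Type*} [NormedAddCommGroup V] [NormedSpace ℂ V] (a : (V →L[ℂ] V)ˣ)
    (w : V) : (a : V →L[ℂ] V) (((a⁻¹ : (V →L[ℂ] V)ˣ) : V →L[ℂ] V) w) = w :=
  congrArg (fun T : V →L[ℂ] V => T w) a.mul_inv

/-- The inverse of an invertible operator composed with the operator. -/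
theorem unit_inv_apply {V : Type*} [NormedAddCommGroup V] [NormedSpace ℂ V] (a : (V →L[ℂ] V)ˣ)
    (w : V) : ((a⁻¹ : (V →L[ℂ] V)ˣ) : V →L[ℂ] V) ((a : V →L[ℂ] V) w) = w :=
  congrArg (fun T : V →L[ℂ] V => T w) a.inv_mul

/-! ### Formed spaces with a real form and a Cartan form -/

/-- An `(ε, η)`-space (`η` is the second sign, written `ε` with a dot): a complex vector space `V`
with a non-degenerate `ε`-symmetric bilinear form, a conjugate linear `J` with `J² = ε η` and
`⟨Ju, Jv⟩ = conj ⟨u, v⟩`, and a linear isometry `L` with `L² = η`, such that `LJ = JL` and the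
form `(u, v) ↦ ⟨Lu, Jv⟩` (automatically Hermitian) is positive definite. -/
structure EpsSpace (ε η : ℤˣ) (V : Type*) [AddCommGroup V] [Module ℂ V] where
  form : V →ₗ[ℂ] V →ₗ[ℂ] ℂ
  J : V →ₛₗ[starRingEnd ℂ] V
  L : V →ₗ[ℂ] V
  symm : ∀ u v, form u v = ((ε : ℤ) : ℂ) * form v u
  nondegenerate : ∀ u, (∀ v, form u v = 0) → u = 0
  J_J : ∀ v, J (J v) = (((ε * η : ℤˣ) : ℤ) : ℂ) • v
  form_J : ∀ u v, form (J u) (J v) = (starRingEnd ℂ) (form u v)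
  L_L : ∀ v, L (L v) = ((η : ℤ) : ℂ) • v
  form_L : ∀ u v, form (L u) (L v) = form u v
  L_J : ∀ v, L (J v) = J (L v)
  pos : ∀ v, v ≠ 0 → 0 < (form (L v) (J v)).re

namespace EpsSpace

section Linear

variable {ε η : ℤˣ} {V : Type*} [AddCommGroup V] [Module ℂ V]

/-- The space `V⁻`: the same vector space and the same `J`, with the form and `L` negated. -/
def neg (S : EpsSpace ε η V) : EpsSpace ε η V where
  form := -S.form
  J := S.J
  L := -S.L
  symm u v := by
    have h := S.symm u v
    simp only [LinearMap.neg_apply, h, mul_neg]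
  nondegenerate u h := S.nondegenerate u fun v => by simpa using h v
  J_J := S.J_J
  form_J u v := by simp [S.form_J u v]
  L_L v := by simp [S.L_L v]
  form_L u v := by simp [S.form_L u v]
  L_J v := by simp [S.L_J v]
  pos v hv := by simpa using S.pos v hv

/-- The eigenvalue of `L` that counts as `+`: it is `1` if `η = 1` and `i` if `η = -1`. -/
def plusEigenvalue (η : ℤˣ) : ℂ := if η = 1 then 1 else Complex.I

/-- The dimension of the `μ`-eigenspace of `L` on the subquotient `A / B` (for `L`-stable `B ≤ A`):
that eigenspace is the image in `V / B` of the set of all `v ∈ A` with `L v - μ v ∈ B`. -/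
def eigenDim (S : EpsSpace ε η V) (A B : Submodule ℂ V) (μ : ℂ) : ℕ :=
  finrank ℂ ((A ⊓ B.comap (S.L - μ • LinearMap.id)).map B.mkQ)

/-- The signature `(n⁺, n⁻)` of an `L`-stable subquotient `A / B`. -/
def signSubquotient (S : EpsSpace ε η V) (A B : Submodule ℂ V) : ℕ × ℕ :=
  (S.eigenDim A B (plusEigenvalue η), S.eigenDim A B (-plusEigenvalue η))

/-- The signature of the whole space. -/
def sign (S : EpsSpace ε η V) : ℕ × ℕ := S.signSubquotient ⊤ ⊥

end Linear

section Groups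

variable {ε η : ℤˣ} {V : Type*} [NormedAddCommGroup V] [NormedSpace ℂ V]

/-- The complex isometry group of the form. (The norm on `V` only serves to give the algebra of
endomorphisms of the finite dimensional space `V` its usual topology.) -/
def isometryGroup (S : EpsSpace ε η V) : Subgroup (V →L[ℂ] V)ˣ where
  carrier := {g | ∀ u v, S.form ((g : V →L[ℂ] V) u) ((g : V →L[ℂ] V) v) = S.form u v}
  one_mem' := by intro u v; simp
  mul_mem' := by
    intro a b ha hb u v
    exact (ha _ _).trans (hb u v)
  inv_mem' := by
    intro a ha u v
    simp only [Set.mem_ofPred_eq] at ha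
    rw [← ha, unit_apply_inv, unit_apply_inv]

/-- The invertible operators commuting with a given map `T : V → V`. -/
def commutingGroup (T : V → V) : Subgroup (V →L[ℂ] V)ˣ where
  carrier := {g | ∀ v, (g : V →L[ℂ] V) (T v) = T ((g : V →L[ℂ] V) v)}
  one_mem' := by intro v; simp
  mul_mem' := by
    intro a b ha hb v
    exact (congrArg _ (hb v)).trans (ha _)
  inv_mem' := by
    intro a ha v
    simp only [Set.mem_ofPred_eq] at ha
    conv_lhs => rw [← unit_apply_inv a v, ← ha, unit_inv_apply]

/-- The real classical group `G`: the isometries commuting with `J`. -/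
def realGroup (S : EpsSpace ε η V) : Subgroup (V →L[ℂ] V)ˣ :=
  S.isometryGroup ⊓ commutingGroup S.J

/-- The complex group `K`: the isometries commuting with `L`. -/
def cartanGroup (S : EpsSpace ε η V) : Subgroup (V →L[ℂ] V)ˣ :=
  S.isometryGroup ⊓ commutingGroup S.L

/-- The complex Lie algebra of the isometry group, as a set of operators. -/
def lieAlg (S : EpsSpace ε η V) : Set (V →L[ℂ] V) :=
  {X | ∀ u v, S.form (X u) v + S.form u (X v) = 0}

/-- The space `i 𝔤_ℝ`, where `𝔤_ℝ` is the Lie algebra of `G`, i.e. the set of elements of the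
complex Lie algebra commuting with `J`. As `J` is conjugate linear, the elements of `i 𝔤_ℝ` are the
ones anticommuting with `J`. -/
def iLieReal (S : EpsSpace ε η V) : Set (V →L[ℂ] V) :=
  {X | X ∈ S.lieAlg ∧ ∀ v, X (S.J v) = -S.J (X v)}

/-- `O` is a nilpotent `G`-orbit in `i 𝔤_ℝ`. -/
def IsNilOrbit (S : EpsSpace ε η V) (O : Set (V →L[ℂ] V)) : Prop :=
  ∃ X ∈ S.iLieReal, IsNilpotent X ∧
    O = {Y | ∃ g ∈ S.realGroup, Y = (g : V →L[ℂ] V) * X * ((g⁻¹ : (V →L[ℂ] V)ˣ) : V →L[ℂ] V)}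

/-- `h, e, f` are the images of the standard basis `H, E, F` of `𝔰𝔩₂(ℂ)` under a Lie algebra
homomorphism into the complex Lie algebra of the isometry group that intertwines entrywise complex
conjugation with conjugation by `J`, and the conjugation by the matrix `(0, 1; -1, 0)` (which maps
`H, E, F` to `-H, -F, -E`) with the conjugation by `L`. -/
structure IsCompatibleTriple (S : EpsSpace ε η V) (h e f : V →L[ℂ] V) : Prop where
  h_mem : h ∈ S.lieAlg
  e_mem : e ∈ S.lieAlg
  f_mem : f ∈ S.lieAlg
  lie_h_e : h * e - e * h = (2 : ℂ) • e
  lie_h_f : h * f - f * h = -((2 : ℂ) • f)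
  lie_e_f : e * f - f * e = h
  J_h : ∀ v, h (S.J v) = S.J (h v)
  J_e : ∀ v, e (S.J v) = S.J (e v)
  J_f : ∀ v, f (S.J v) = S.J (f v)
  L_h : ∀ v, S.L (h v) = -h (S.L v)
  L_e : ∀ v, S.L (e v) = -f (S.L v)
  L_f : ∀ v, S.L (f v) = -e (S.L v)

/-- The Kostant–Sekiguchi correspondence: a nilpotent `G`-orbit `O` in `i 𝔤_ℝ` is sent to the
`K`-orbit of `φ (1/2 (1, i; i, -1))`, for any compatible `φ : 𝔰𝔩₂(ℂ) → 𝔤` with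
`φ (i E) ∈ O`. -/
def kostantSekiguchi (S : EpsSpace ε η V) (O : Set (V →L[ℂ] V)) : Set (V →L[ℂ] V) :=
  {Y | ∃ h e f, S.IsCompatibleTriple h e f ∧ Complex.I • e ∈ O ∧ ∃ k ∈ S.cartanGroup,
    Y = (k : V →L[ℂ] V) * ((1 / 2 : ℂ) • (h + Complex.I • e + Complex.I • f)) *
      ((k⁻¹ : (V →L[ℂ] V)ˣ) : V →L[ℂ] V)}

/-- The signatures of the `L`-stable subquotients `Ker Y^(j+1) / Ker Y^j`, `j = 0, 1, 2, …`. -/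
def kerSignatures (S : EpsSpace ε η V) (Y : V →L[ℂ] V) (j : ℕ) : ℕ × ℕ :=
  S.signSubquotient (LinearMap.ker ((Y ^ (j + 1) : V →L[ℂ] V) : V →ₗ[ℂ] V))
    (LinearMap.ker ((Y ^ j : V →L[ℂ] V) : V →ₗ[ℂ] V))

open Classical in
/-- The signed Young diagram of a nilpotent `G`-orbit `O` in `i 𝔤_ℝ`, as the sequence of the
signatures of its columns, continued by `(0, 0)` beyond the last column: pick any element `Y` of the
Kostant–Sekiguchi orbit of `O` and take the signatures of `Ker Y^(j+1) / Ker Y^j`. -/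
def signedDiagram (S : EpsSpace ε η V) (O : Set (V →L[ℂ] V)) : ℕ → ℕ × ℕ :=
  if hO : (S.kostantSekiguchi O).Nonempty then S.kerSignatures hO.some else 0

end Groups

end EpsSpace

/-- `s` is the signature of an `(ε, η)`-space of dimension `m`. -/
def IsSignatureOfDim (ε η : ℤˣ) (m : ℕ) (s : ℕ × ℕ) : Prop :=
  ∃ S : EpsSpace ε η (Fin m → ℂ), S.sign = s

/-- The sequence `[a, b, d₁, d₂, …]` obtained by putting two columns to the left of a diagram. -/
def addTwoColumns (a b : ℕ × ℕ) (d : ℕ → ℕ × ℕ) : ℕ → ℕ × ℕ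
  | 0 => a
  | 1 => b
  | j + 2 => d j

/-! ### The parabolic subgroup and induced orbits -/

section Parabolic

variable {ε η : ℤˣ} {V W : Type*} [NormedAddCommGroup V] [NormedSpace ℂ V]
  [NormedAddCommGroup W] [NormedSpace ℂ W]

/-- An orthogonal decomposition `W = V ⊕ (E ⊕ E')` of `(ε, η)`-spaces, where `E` is a `J`-stable
totally isotropic subspace, `E' = L(E)`, and `V` is embedded by `incl` as an `(ε, η)`-subspace.
(Positivity of `⟨Lu, Ju⟩` implies that `E ⊕ E'` is a non-degenerate subspace, so that it and its
orthogonal complement indeed decompose `W`.) -/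
structure LeviDecomposition (S : EpsSpace ε η V) (T : EpsSpace ε η W) where
  E : Submodule ℂ W
  J_mem : ∀ w ∈ E, T.J w ∈ E
  isotropic : ∀ u ∈ E, ∀ w ∈ E, T.form u w = 0
  incl : V →ₗ[ℂ] W
  form_incl : ∀ u v, T.form (incl u) (incl v) = S.form u v
  J_incl : ∀ v, T.J (incl v) = incl (S.J v)
  L_incl : ∀ v, T.L (incl v) = incl (S.L v)
  mem_range_incl : ∀ w, w ∈ LinearMap.range incl ↔ ∀ u ∈ E ⊔ E.map T.L, T.form u w = 0

namespace LeviDecomposition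

variable {S : EpsSpace ε η V} {T : EpsSpace ε η W}

/-- The subspace `E' = L(E)`. -/
def E' (D : LeviDecomposition S T) : Submodule ℂ W := D.E.map T.L

/-- The real parabolic subgroup of the real group of `W` stabilizing `E`. -/
def parabolic (D : LeviDecomposition S T) : Subgroup (W →L[ℂ] W)ˣ where
  carrier := {g | g ∈ T.realGroup ∧ ∀ w, (g : W →L[ℂ] W) w ∈ D.E ↔ w ∈ D.E}
  one_mem' := ⟨one_mem _, fun w => by simp⟩
  mul_mem' := by
    rintro a b ⟨ha, ha'⟩ ⟨hb, hb'⟩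
    refine ⟨mul_mem ha hb, fun w => ?_⟩
    exact (ha' _).trans (hb' w)
  inv_mem' := by
    rintro a ⟨ha, ha'⟩
    refine ⟨inv_mem ha, fun w => ?_⟩
    rw [← ha', unit_apply_inv]

/-- `i 𝔫`, where `𝔫` is the Lie algebra of the unipotent radical of the parabolic subgroup: the
elements of `i 𝔤_ℝ` that act by `0` on the graded pieces of the flag `0 ⊆ E ⊆ E^⊥ ⊆ W`
(for elements of `𝔤`, vanishing on `E` implies that `W` is mapped into `E^⊥`). -/
def iNilradical (D : LeviDecomposition S T) : Set (W →L[ℂ] W) :=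
  {N | N ∈ T.iLieReal ∧ (∀ w ∈ D.E, N w = 0) ∧
    ∀ w, (∀ u ∈ D.E, T.form u w = 0) → N w ∈ D.E}

/-- `X'` is the image of the operator `X` on `V` under the inclusion of Lie algebras: it is `X` on
`V` and `0` on `E ⊕ E'`. -/
def IsExtension (D : LeviDecomposition S T) (X : V →L[ℂ] V) (X' : W →L[ℂ] W) : Prop :=
  (∀ v, X' (D.incl v) = D.incl (X v)) ∧ ∀ w ∈ D.E ⊔ D.E', X' w = 0

/-- `O + i 𝔫`, the preimage of the orbit `O` (viewed as an orbit of the Levi subgroup) in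
`i (𝔤_W / 𝔫)^*`, which is identified with `i 𝔭` through the trace form. -/
def fiber (D : LeviDecomposition S T) (O : Set (V →L[ℂ] V)) : Set (W →L[ℂ] W) :=
  {Y | ∃ X ∈ O, ∃ X', D.IsExtension X X' ∧ ∃ N ∈ D.iNilradical, Y = X' + N}

/-- The set of the nilpotent orbits induced from `O`: the nilpotent orbits that meet `O + i 𝔫` in a
non-empty relatively open subset. -/
def induced (D : LeviDecomposition S T) (O : Set (V →L[ℂ] V)) : Set (Set (W →L[ℂ] W)) :=
  {O' | T.IsNilOrbit O' ∧ (O' ∩ D.fiber O).Nonempty ∧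
    ∃ U : Set (W →L[ℂ] W), IsOpen U ∧ O' ∩ D.fiber O = U ∩ D.fiber O}

end LeviDecomposition

end Parabolic

/-! ### Component groups -/

section Components

instance connectedComponentOfOne_normal (H : Type*) [TopologicalSpace H] [Group H]
    [IsTopologicalGroup H] : (Subgroup.connectedComponentOfOne H).Normal where
  conj_mem n hn g := by
    have hc : Continuous fun x : H => g * x * g⁻¹ := by fun_prop
    have h := hc.image_connectedComponent_subset 1 (Set.mem_image_of_mem _ hn)
    have h1 : g * 1 * g⁻¹ = 1 := by group
    rw [h1] at h
    exact h

/-- The component group `H / H°` of a topological group. -/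
abbrev ComponentGroup (H : Type*) [TopologicalSpace H] [Group H] [IsTopologicalGroup H] : Type _ :=
  H ⧸ Subgroup.connectedComponentOfOne H

/-- The homomorphism of component groups induced by an inclusion of subgroups. -/
def componentMap {A : Type*} [TopologicalSpace A] [Group A] [IsTopologicalGroup A]
    {H₁ H₂ : Subgroup A} (h : H₁ ≤ H₂) : ComponentGroup H₁ →* ComponentGroup H₂ :=
  QuotientGroup.map _ _ (Subgroup.inclusion h) (by
    intro x hx
    have hc : Continuous (Subgroup.inclusion h) := by
      exact Continuous.subtype_mk continuous_subtype_val _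
    have h' := hc.image_connectedComponent_subset 1 (Set.mem_image_of_mem _ hx)
    rw [map_one] at h'
    exact h')

/-- The centralizer in a group `H` of operators of an operator `X`. -/
def centralizerIn {W : Type*} [NormedAddCommGroup W] [NormedSpace ℂ W]
    (H : Subgroup (W →L[ℂ] W)ˣ) (X : W →L[ℂ] W) : Subgroup (W →L[ℂ] W)ˣ :=
  H ⊓ EpsSpace.commutingGroup X

variable {ε η : ℤˣ} {V W : Type*} [NormedAddCommGroup V] [NormedSpace ℂ V]
  [NormedAddCommGroup W] [NormedSpace ℂ W]

theorem LeviDecomposition.centralizer_le {S : EpsSpace ε η V} {T : EpsSpace ε η W}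
    (D : LeviDecomposition S T) (X : W →L[ℂ] W) :
    centralizerIn D.parabolic X ≤ centralizerIn T.realGroup X :=
  inf_le_inf_right _ fun _ h => h.1

/-- The natural map `C_P(X) → C_G(X)` between the component groups of the centralizers of `X` in
the parabolic subgroup and in the real group of `W`. -/
def LeviDecomposition.componentMap {S : EpsSpace ε η V} {T : EpsSpace ε η W}
    (D : LeviDecomposition S T) (X : W →L[ℂ] W) :
    ComponentGroup (centralizerIn D.parabolic X) →*
      ComponentGroup (centralizerIn T.realGroup X) :=
  _root_.componentMap (D.centralizer_le X)

end Components

end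

/-!
The signed Young diagram of a nilpotent orbit is defined through the Kostant-Sekiguchi
correspondence, but it can be read off from an element `X` of the orbit itself. Put `κ = 1` if
`η = 1` and `κ = i` otherwise. The forms `κ ⟨X ^ j v, J u⟩` are Hermitian for `X ∈ i 𝔤`, and the
entries of the diagram are the differences of the signatures of these forms for consecutive `j`
(`IsNilOrbit.signedDiagram_add`, the signatures are called `nilIndex`). The reason is that every
nilpotent orbit has an element in an `𝔰𝔩₂`-triple that is compatible with `L`
(`IsNilOrbit.exists_isCompatibleTriple`). The space then has a basis of chains that start from
orthonormal lowest weight vectors, each of which is mapped by `L` to a multiple of the highest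
weight vector of its chain (`exists_isChainBasis`); on such a basis the Hermitian forms are
explicit, and so is the action of `L` on the kernels of the Cayley transform of the triple
(`exists_cayley`). The chain basis also shows that a nilpotent orbit is determined by its diagram
(`IsNilOrbit.eq_of_signedDiagram_eq`).

The elements of `O + i 𝔫` are the lifts `Y` of elements `X` of `O`: they vanish on `E`, preserve
`E^⊥ = V ⊕ E`, and induce `X` on `E^⊥ / E` (`IsLift`, `mem_fiber_iff`). A lift is generic if its
kernel meets `E^⊥` in `E` only and is as small as parity permits. Generic lifts form an open and
dense subset of `O + i 𝔫` (`isOpen_isGeneric`, `IsLift.exists_isGeneric_mem`), so an induced orbit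
consists of elements conjugate to generic lifts. For a generic lift the projection of the range of
`Y` to `V` is onto, whence the form for `Y ^ (j + 2)` is a pull-back of the form for `X ^ j`
(`IsLift.nilIndex_add_two`), and the signature for `j = 0` is that of `V` plus `(l, l)`
(`IsLift.nilIndex_zero`). What remains free is the signature of the form for `Y` itself. If
`ker Y = E`, that form is the sum of the form for `X`, of a split form of signature `(c₁, c₁)`, and
of the form of a `(-ε, -η)`-space of dimension `l - c₁`, which is given by `⟨Y u, v⟩` on a
complement of `Y⁻¹(E) ∩ E^⊥` in `Y⁻¹(E)` (`IsLift.exists_epsSpace`). Every `(-ε, -η)`-space of this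
dimension occurs (`exists_isLift_of_epsSpace`). Since signatures are locally constant on the lifts
with kernel `E`, each resulting orbit is relatively open.

In the real orthogonal case the form `⟨Y u, v⟩` is alternating, so that `ker Y` has dimension
`l + 1` when `l - c₁` is odd. Moreover `J` preserves the alternating form, and the Hermitian form
for `Y` has as many positive as negative squares (`IsLift.nilIndex_one_orthogonal`). Its signature
is therefore forced, and there is a single induced orbit.

For the component groups, if `ker Y = E`, then the centralizer of `Y` in the whole group stabilizes
`E`, so the two centralizers coincide (`componentMap_bijective`). In the real orthogonal case the
form induced on `ker Y / (ker Y ∩ range Y)` is a hyperbolic plane. It contains exactly two isotropic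
lines, one of which comes from `E`, and the centralizer permutes them; a reflection interchanges
them. The stabilizer of `E` is thus open of index two in the centralizer (`componentMap_index_two`).
-/

noncomputable section

/-! ### Hermitian forms and positive square roots -/

section Hermitian

variable {V V' : Type*} [AddCommGroup V] [Module ℂ V] [AddCommGroup V'] [Module ℂ V']

/-- A Hermitian form, conjugate linear in the first variable, given as a plain function. -/
structure IsHerm (Φ : V → V → ℂ) : Prop where
  add_right : ∀ u v w, Φ u (v + w) = Φ u v + Φ u w
  smul_right : ∀ u (c : ℂ) v, Φ u (c • v) = c * Φ u v
  conj_symm : ∀ u v, (starRingEnd ℂ) (Φ v u) = Φ u v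

namespace IsHerm

variable {Φ : V → V → ℂ} (h : IsHerm Φ)
include h

theorem add_left (u v w : V) : Φ (u + v) w = Φ u w + Φ v w := by
  rw [← h.conj_symm, h.add_right, map_add, h.conj_symm, h.conj_symm]

theorem smul_left (c : ℂ) (u v : V) : Φ (c • u) v = (starRingEnd ℂ) c * Φ u v := by
  rw [← h.conj_symm, h.smul_right, map_mul, h.conj_symm]

theorem zero_right (u : V) : Φ u 0 = 0 := by simpa using h.smul_right u 0 0

theorem zero_left (u : V) : Φ 0 u = 0 := by simpa using h.smul_left 0 0 u

theorem neg_right (u v : V) : Φ u (-v) = -Φ u v := by simpa using h.smul_right u (-1) v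

theorem neg_left (u v : V) : Φ (-u) v = -Φ u v := by simpa using h.smul_left (-1) u v

theorem sub_right (u v w : V) : Φ u (v - w) = Φ u v - Φ u w := by
  rw [sub_eq_add_neg, h.add_right, h.neg_right, sub_eq_add_neg]

theorem sub_left (u v w : V) : Φ (u - v) w = Φ u w - Φ v w := by
  rw [sub_eq_add_neg, h.add_left, h.neg_left, sub_eq_add_neg]

theorem sum_right {ι : Type*} (s : Finset ι) (u : V) (v : ι → V) :
    Φ u (∑ i ∈ s, v i) = ∑ i ∈ s, Φ u (v i) := by
  classical
  induction s using Finset.induction_on with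
  | empty => simp [h.zero_right]
  | insert a s ha ih => rw [Finset.sum_insert ha, Finset.sum_insert ha, h.add_right, ih]

theorem sum_left {ι : Type*} (s : Finset ι) (u : ι → V) (v : V) :
    Φ (∑ i ∈ s, u i) v = ∑ i ∈ s, Φ (u i) v := by
  rw [← h.conj_symm, h.sum_right, map_sum]
  exact Finset.sum_congr rfl fun i _ => h.conj_symm _ _

theorem neg : IsHerm fun u v => -Φ u v where
  add_right u v w := by rw [h.add_right]; ring
  smul_right u c v := by rw [h.smul_right]; ring
  conj_symm u v := by rw [map_neg, h.conj_symm]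

theorem comap (f : V' →ₗ[ℂ] V) : IsHerm fun u v => Φ (f u) (f v) where
  add_right u v w := by rw [map_add, h.add_right]
  smul_right u c v := by rw [map_smul, h.smul_right]
  conj_symm u v := h.conj_symm _ _

/-- A Hermitian form on pairwise orthogonal vectors is a weighted sum of squares. -/
theorem sum_self_of_orthogonal {ι : Type*} [Fintype ι] (v : ι → V)
    (ho : ∀ i j, i ≠ j → Φ (v i) (v j) = 0) (c : ι → ℂ) :
    Φ (∑ i, c i • v i) (∑ i, c i • v i) = ∑ i, (Complex.normSq (c i) : ℂ) * Φ (v i) (v i) := by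
  classical
  rw [h.sum_left]
  refine Finset.sum_congr rfl fun i _ => ?_
  rw [h.sum_right, Finset.sum_eq_single i]
  · rw [h.smul_left, h.smul_right, ← mul_assoc, Complex.normSq_eq_conj_mul_self]
  · intro j _ hj
    rw [h.smul_left, h.smul_right, ho i j hj.symm]
    simp
  · simp

end IsHerm

/-- A Hermitian inner product, given as a plain function. -/
structure IsInner (P : V → V → ℂ) : Prop extends IsHerm P where
  pos : ∀ v, v ≠ 0 → 0 < (P v v).re

namespace IsInner

variable {P : V → V → ℂ} (h : IsInner P)
include h

theorem eq_zero_of_self {v : V} (hv : P v v = 0) : v = 0 := by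
  by_contra hne
  have := h.pos v hne
  simp [hv] at this

theorem nonneg (v : V) : 0 ≤ (P v v).re := by
  by_cases hv : v = 0
  · simp [hv, h.zero_left]
  · exact (h.pos v hv).le

theorem eq_of_forall {v w : V} (hvw : ∀ u, P u v = P u w) : v = w := by
  rw [← sub_eq_zero]
  apply h.eq_zero_of_self
  rw [h.sub_right, hvw, sub_self]

/-- The inner product as an instance for the general theory of inner product spaces. -/
abbrev core : InnerProductSpace.Core ℂ V where
  inner := P
  conj_inner_symm u v := h.conj_symm u v
  re_inner_nonneg v := h.nonneg v
  definite _ := h.eq_zero_of_self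
  add_left := h.add_left
  smul_left u v c := h.smul_left c u v

theorem linearIndependent_of_orthonormal {ι : Type*} [DecidableEq ι] (v : ι → V)
    (ho : ∀ i j, P (v i) (v j) = if i = j then 1 else 0) : LinearIndependent ℂ v := by
  rw [linearIndependent_iff']
  intro s c hc i hi
  have := congrArg (P (v i)) hc
  rw [h.sum_right, h.zero_right, Finset.sum_eq_single i] at this
  · simpa [h.smul_right, ho] using this
  · intro j _ hj
    simp [h.smul_right, ho, hj.symm]
  · exact fun hn => absurd hi hn

variable [FiniteDimensional ℂ V]

theorem exists_orthonormal_basis (U : Submodule ℂ V) :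
    ∃ b : Basis (Fin (finrank ℂ U)) ℂ U,
      ∀ i j, P (b i : V) (b j : V) = if i = j then 1 else 0 := by
  let _ : NormedAddCommGroup V := @InnerProductSpace.Core.toNormedAddCommGroup ℂ V _ _ _ h.core
  let _ : InnerProductSpace ℂ V := InnerProductSpace.ofCore h.core.toCore
  refine ⟨(stdOrthonormalBasis ℂ U).toBasis, fun i j => ?_⟩
  have := (stdOrthonormalBasis ℂ U).orthonormal
  rw [orthonormal_iff_ite] at this
  have h2 := this i j
  rw [OrthonormalBasis.coe_toBasis]
  exact h2

/-- The spectral theorem for an operator that is self-adjoint for `P`. -/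
theorem exists_eigenbasis (A : V →ₗ[ℂ] V) (hA : ∀ u v, P (A u) v = P u (A v)) :
    ∃ (b : Basis (Fin (finrank ℂ V)) ℂ V) (μ : Fin (finrank ℂ V) → ℝ),
      (∀ i, A (b i) = (μ i : ℂ) • b i) ∧ ∀ i j, P (b i) (b j) = if i = j then 1 else 0 := by
  let _ : NormedAddCommGroup V := @InnerProductSpace.Core.toNormedAddCommGroup ℂ V _ _ _ h.core
  let _ : InnerProductSpace ℂ V := InnerProductSpace.ofCore h.core.toCore
  have hs : A.IsSymmetric := fun u v => hA u v
  refine ⟨(hs.eigenvectorBasis rfl).toBasis, hs.eigenvalues rfl, fun i => ?_, fun i j => ?_⟩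
  · rw [OrthonormalBasis.coe_toBasis]
    exact hs.apply_eigenvectorBasis rfl i
  · have := (hs.eigenvectorBasis rfl).orthonormal
    rw [orthonormal_iff_ite] at this
    have h2 := this i j
    rw [OrthonormalBasis.coe_toBasis]
    exact h2

/-- A sesquilinear form is represented by an operator. -/
theorem exists_riesz (B : V → V →ₗ[ℂ] ℂ) (hadd : ∀ u u' v, B (u + u') v = B u v + B u' v)
    (hsmul : ∀ (c : ℂ) u v, B (c • u) v = (starRingEnd ℂ) c * B u v) :
    ∃ A : V →ₗ[ℂ] V, ∀ u v, P u (A v) = B u v := by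
  obtain ⟨b, -, -, hb⟩ := h.exists_eigenbasis 0 (by simp [h.zero_left, h.zero_right])
  have hsum : ∀ (s : Finset (Fin (finrank ℂ V))) (c : Fin (finrank ℂ V) → ℂ) (v : V),
      B (∑ i ∈ s, c i • b i) v = ∑ i ∈ s, (starRingEnd ℂ) (c i) * B (b i) v := by
    classical
    intro s c v
    induction s using Finset.induction_on with
    | empty => simpa using hsmul 0 0 v
    | insert a s ha ih => rw [Finset.sum_insert ha, Finset.sum_insert ha, hadd, hsmul, ih]
  refine ⟨∑ i, (B (b i)).smulRight (b i), fun u v => ?_⟩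
  rw [← b.sum_repr u, hsum, h.sum_left]
  refine Finset.sum_congr rfl fun i _ => ?_
  rw [h.smul_left, LinearMap.sum_apply, h.sum_right, Finset.sum_eq_single i]
  · simp [h.smul_right, hb]
  · intro j _ hj
    simp [h.smul_right, hb, hj.symm]
  · simp

/-- The positive square root of a positive operator is a real polynomial in it, hence commutes with
whatever commutes with the operator. -/
theorem exists_sqrt (A : V →ₗ[ℂ] V) (hA : ∀ u v, P (A u) v = P u (A v))
    (hpos : ∀ v, v ≠ 0 → 0 < (P v (A v)).re) :
    ∃ p : Polynomial ℝ, Polynomial.aeval A (p.map (algebraMap ℝ ℂ)) *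
        Polynomial.aeval A (p.map (algebraMap ℝ ℂ)) = A ∧
      ∀ v, v ≠ 0 → 0 < (P v (Polynomial.aeval A (p.map (algebraMap ℝ ℂ)) v)).re := by
  classical
  obtain ⟨b, μ, hμ, hb⟩ := h.exists_eigenbasis A hA
  have hμpos : ∀ i, 0 < μ i := fun i => by
    have := hpos (b i) (b.ne_zero i)
    rw [hμ, h.smul_right, hb] at this
    simpa using this
  -- interpolate the square root at the eigenvalues
  let s : Finset ℝ := Finset.univ.image μ
  let p : Polynomial ℝ := Lagrange.interpolate s id Real.sqrt
  have hp : ∀ i, p.eval (μ i) = Real.sqrt (μ i) := fun i =>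
    Lagrange.eval_interpolate_at_node (v := id) Real.sqrt (Set.injOn_id _)
      (Finset.mem_image_of_mem μ (Finset.mem_univ i))
  have hpb : ∀ i, Polynomial.aeval A (p.map (algebraMap ℝ ℂ)) (b i)
      = (Real.sqrt (μ i) : ℂ) • b i := fun i => by
    have hev : (b i) ∈ Module.End.eigenspace A (μ i : ℂ) := by
      rw [Module.End.mem_eigenspace_iff]; exact hμ i
    have h2 := Module.End.aeval_apply_of_hasEigenvector (p := p.map (algebraMap ℝ ℂ))
      (f := A) (μ := (μ i : ℂ)) (x := b i) ⟨hev, b.ne_zero i⟩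
    rw [h2]
    congr 1
    rw [← hp i]
    have := Polynomial.eval_map_algebraMap (R := ℝ) (B := ℂ) p (μ i : ℂ)
    rw [this]
    have h3 := Polynomial.aeval_algebraMap_apply (A := ℝ) ℂ (μ i) p
    simpa using h3
  refine ⟨p, ?_, fun v hv => ?_⟩
  · apply b.ext
    intro i
    rw [Module.End.mul_apply, hpb, map_smul, hpb, smul_smul, ← Complex.ofReal_mul,
      Real.mul_self_sqrt (hμpos i).le, hμ]
  · have hv2 : ∃ i, b.repr v i ≠ 0 := by
      by_contra! hc
      exact hv (b.repr.map_eq_zero_iff.mp (Finsupp.ext hc))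
    have key : P v (Polynomial.aeval A (p.map (algebraMap ℝ ℂ)) v)
        = ∑ i, ((Complex.normSq (b.repr v i) * Real.sqrt (μ i) : ℝ) : ℂ) := by
      conv_lhs => rw [← b.sum_repr v]
      rw [map_sum, h.sum_left]
      refine Finset.sum_congr rfl fun i _ => ?_
      rw [h.sum_right, Finset.sum_eq_single i]
      · rw [h.smul_left, map_smul, h.smul_right, hpb, h.smul_right, hb]
        simp only [if_true, mul_one, Complex.ofReal_mul]
        rw [Complex.normSq_eq_conj_mul_self]
        ring
      · intro j _ hj
        rw [h.smul_left, map_smul, h.smul_right, hpb, h.smul_right, hb]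
        simp [hj.symm]
      · simp
    rw [key, ← Complex.ofReal_sum, Complex.ofReal_re]
    obtain ⟨i, hi⟩ := hv2
    refine Finset.sum_pos' (fun j _ => mul_nonneg (Complex.normSq_nonneg _) (Real.sqrt_nonneg _)) ⟨i, Finset.mem_univ _, ?_⟩
    have := Complex.normSq_pos.mpr hi
    have := Real.sqrt_pos.mpr (hμpos i)
    positivity

end IsInner

end Hermitian

/-! ### Indices of inertia -/

section Index

variable {V V' : Type*} [AddCommGroup V] [Module ℂ V] [AddCommGroup V'] [Module ℂ V']

/-- The positive index of inertia of a Hermitian form: the largest dimension of a subspace on which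
it is positive definite. -/
def posIndex (Φ : V → V → ℂ) : ℕ :=
  sSup {n | ∃ A : Submodule ℂ V, finrank ℂ A = n ∧ ∀ u ∈ A, u ≠ 0 → 0 < (Φ u u).re}

/-- The negative index of inertia. -/
def negIndex (Φ : V → V → ℂ) : ℕ := posIndex fun u v => -Φ u v

theorem exists_isInner [FiniteDimensional ℂ V] : ∃ P : V → V → ℂ, IsInner P := by
  let b := finBasis ℂ V
  refine ⟨fun u v => ∑ i, (starRingEnd ℂ) (b.repr u i) * b.repr v i,
    { add_right := ?_, smul_right := ?_, conj_symm := ?_, pos := ?_ }⟩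
  · intro u v w
    simp [mul_add, Finset.sum_add_distrib]
  · intro u c v
    simp only [map_smul, Finsupp.smul_apply, smul_eq_mul, Finset.mul_sum]
    exact Finset.sum_congr rfl fun i _ => by ring
  · intro u v
    rw [map_sum]
    exact Finset.sum_congr rfl fun i _ => by simp [mul_comm]
  · intro v hv
    have : ∃ i, b.repr v i ≠ 0 := by
      by_contra! hc
      exact hv (b.repr.map_eq_zero_iff.mp (Finsupp.ext hc))
    obtain ⟨i, hi⟩ := this
    simp only [← Complex.normSq_eq_conj_mul_self, ← Complex.ofReal_sum, Complex.ofReal_re]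
    exact Finset.sum_pos' (fun j _ => Complex.normSq_nonneg _)
      ⟨i, Finset.mem_univ _, Complex.normSq_pos.mpr hi⟩

section

variable [FiniteDimensional ℂ V] (Φ : V → V → ℂ)

theorem bddAbove_finrank_posDef :
    BddAbove {n | ∃ A : Submodule ℂ V, finrank ℂ A = n ∧ ∀ u ∈ A, u ≠ 0 → 0 < (Φ u u).re} := by
  refine ⟨finrank ℂ V, ?_⟩
  rintro n ⟨A, rfl, -⟩
  exact A.finrank_le

theorem exists_finrank_eq_posIndex :
    ∃ A : Submodule ℂ V, finrank ℂ A = posIndex Φ ∧ ∀ u ∈ A, u ≠ 0 → 0 < (Φ u u).re := by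
  have := Nat.sSup_mem (s := {n | ∃ A : Submodule ℂ V, finrank ℂ A = n ∧
    ∀ u ∈ A, u ≠ 0 → 0 < (Φ u u).re}) ⟨0, ⊥, by simp, by simp⟩ (bddAbove_finrank_posDef Φ)
  exact this

theorem exists_finrank_eq_negIndex :
    ∃ A : Submodule ℂ V, finrank ℂ A = negIndex Φ ∧ ∀ u ∈ A, u ≠ 0 → (Φ u u).re < 0 := by
  obtain ⟨A, hA, h⟩ := exists_finrank_eq_posIndex fun u v => -Φ u v
  exact ⟨A, hA, fun u hu hu0 => by simpa using h u hu hu0⟩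

variable {Φ}

theorem le_posIndex (A : Submodule ℂ V) (hA : ∀ u ∈ A, u ≠ 0 → 0 < (Φ u u).re) :
    finrank ℂ A ≤ posIndex Φ :=
  le_csSup (bddAbove_finrank_posDef Φ) ⟨A, rfl, hA⟩

/-- A subspace on which the form is negative semidefinite is disjoint from the positive definite
ones. -/
theorem finrank_add_posIndex_le (C : Submodule ℂ V) (hC : ∀ u ∈ C, (Φ u u).re ≤ 0) :
    finrank ℂ C + posIndex Φ ≤ finrank ℂ V := by
  obtain ⟨A, hA, h⟩ := exists_finrank_eq_posIndex Φ
  have hd : C ⊓ A = ⊥ := by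
    rw [eq_bot_iff]
    rintro u ⟨hu, hu'⟩
    by_contra hne
    have h1 := h u hu' hne
    have h2 := hC u hu
    linarith
  have h1 := Submodule.finrank_sup_add_finrank_inf_eq C A
  rw [hd, finrank_bot] at h1
  have := (C ⊔ A).finrank_le
  omega

theorem finrank_add_negIndex_le (C : Submodule ℂ V) (hC : ∀ u ∈ C, 0 ≤ (Φ u u).re) :
    finrank ℂ C + negIndex Φ ≤ finrank ℂ V :=
  finrank_add_posIndex_le C fun u hu => by simpa using hC u hu

/-- Pairwise orthogonal vectors of positive square bound the positive index from below. -/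
theorem card_le_posIndex (h : IsHerm Φ) {ι : Type*} [Fintype ι] (v : ι → V)
    (ho : ∀ i j, i ≠ j → Φ (v i) (v j) = 0) (hp : ∀ i, 0 < (Φ (v i) (v i)).re) :
    Fintype.card ι ≤ posIndex Φ := by
  have hpos : ∀ c : ι → ℂ, c ≠ 0 →
      0 < (Φ (∑ i, c i • v i) (∑ i, c i • v i)).re := fun c hc => by
    rw [h.sum_self_of_orthogonal v ho, Complex.re_sum]
    obtain ⟨i, hi⟩ := Function.ne_iff.mp hc
    simp only [Complex.re_ofReal_mul]
    exact Finset.sum_pos' (fun j _ => mul_nonneg (Complex.normSq_nonneg _) (hp j).le)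
      ⟨i, Finset.mem_univ _, mul_pos (Complex.normSq_pos.mpr hi) (hp i)⟩
  have hli : LinearIndependent ℂ v := by
    rw [Fintype.linearIndependent_iff]
    intro c hc
    by_contra! hne
    obtain ⟨i, hi⟩ := hne
    have := hpos c (fun h0 => hi (congrFun h0 i))
    rw [hc, h.zero_left] at this
    simp at this
  rw [← finrank_span_eq_card hli]
  apply le_posIndex
  intro u hu hu0
  obtain ⟨c, rfl⟩ := (Submodule.mem_span_range_iff_exists_fun ℂ).mp hu
  refine hpos c fun h0 => hu0 ?_
  simp [h0]

theorem card_le_negIndex (h : IsHerm Φ) {ι : Type*} [Fintype ι] (v : ι → V)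
    (ho : ∀ i j, i ≠ j → Φ (v i) (v j) = 0) (hp : ∀ i, (Φ (v i) (v i)).re < 0) :
    Fintype.card ι ≤ negIndex Φ :=
  card_le_posIndex h.neg v (fun i j hij => by simp [ho i j hij]) fun i => by simpa using hp i

/-- The sum of a maximal positive definite subspace and of the radical is positive semidefinite. -/
theorem posIndex_add_negIndex_add_le (h : IsHerm Φ) (R : Submodule ℂ V)
    (hR : ∀ u ∈ R, ∀ v, Φ v u = 0) :
    posIndex Φ + negIndex Φ + finrank ℂ R ≤ finrank ℂ V := by
  obtain ⟨A, hA, hp⟩ := exists_finrank_eq_posIndex Φ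
  have hAR : A ⊓ R = ⊥ := by
    rw [eq_bot_iff]
    rintro u ⟨hu, hu'⟩
    by_contra hne
    have h1 := hp u hu hne
    rw [hR u hu'] at h1
    simp at h1
  have h1 := Submodule.finrank_sup_add_finrank_inf_eq A R
  rw [hAR, finrank_bot] at h1
  have h2 : ∀ u ∈ A ⊔ R, 0 ≤ (Φ u u).re := by
    intro u hu
    obtain ⟨a, ha, r, hr, rfl⟩ := Submodule.mem_sup.mp hu
    rw [h.add_right, h.add_left, hR r hr, ← h.conj_symm r a, hR r hr]
    by_cases ha0 : a = 0
    · simp [ha0, h.zero_left]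
    · simpa using (hp a ha ha0).le
  have := finrank_add_negIndex_le _ h2
  omega

/-- Sylvester's law of inertia. -/
theorem posIndex_add_negIndex_add (h : IsHerm Φ) (R : Submodule ℂ V)
    (hR : ∀ u, u ∈ R ↔ ∀ v, Φ v u = 0) :
    posIndex Φ + negIndex Φ + finrank ℂ R = finrank ℂ V := by
  classical
  refine le_antisymm (posIndex_add_negIndex_add_le h R fun u hu => (hR u).mp hu) ?_
  -- diagonalize the form with respect to an auxiliary inner product
  obtain ⟨P, hP⟩ := exists_isInner (V := V)
  obtain ⟨A, hA⟩ := hP.exists_riesz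
    (fun u => { toFun := Φ u, map_add' := h.add_right u, map_smul' := h.smul_right u })
    (fun u u' v => h.add_left u u' v) (fun c u v => h.smul_left c u v)
  change ∀ u v, P u (A v) = Φ u v at hA
  obtain ⟨b, μ, hμ, hb⟩ := hP.exists_eigenbasis A
    (fun u v => by rw [← hP.conj_symm, hA, hA, h.conj_symm])
  have hΦ : ∀ i j, Φ (b i) (b j) = if i = j then (μ j : ℂ) else 0 := fun i j => by
    rw [← hA, hμ, hP.smul_right, hb]
    split_ifs <;> simp
  have h1 := card_le_posIndex h (fun i : {i // 0 < μ i} => b i)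
    (fun i j hij => by rw [hΦ, if_neg (fun hc => hij (Subtype.ext hc))])
    (fun i => by rw [hΦ]; simpa using i.2)
  have h2 := card_le_negIndex h (fun i : {i // μ i < 0} => b i)
    (fun i j hij => by rw [hΦ, if_neg (fun hc => hij (Subtype.ext hc))])
    (fun i => by rw [hΦ]; simpa using i.2)
  have h3 : Fintype.card {i // μ i = 0} ≤ finrank ℂ R := by
    have hmem : ∀ i : {i // μ i = 0}, b i ∈ R := fun i => by
      rw [hR]
      intro v
      rw [← hA, hμ, i.2]
      simp [hP.zero_right]
    have hli : LinearIndependent ℂ (fun i : {i // μ i = 0} => (⟨b i, hmem i⟩ : R)) := by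
      apply LinearIndependent.of_comp R.subtype
      exact b.linearIndependent.comp _ Subtype.val_injective
    exact hli.fintype_card_le_finrank
  have h4 : Fintype.card (Fin (finrank ℂ V)) = Fintype.card {i // 0 < μ i} +
      Fintype.card {i // μ i < 0} + Fintype.card {i // μ i = 0} := by
    simp only [Fintype.card_subtype]
    rw [← Finset.card_union_of_disjoint, ← Finset.card_union_of_disjoint, ← Finset.card_univ]
    · congr 1
      ext i
      simp only [Finset.mem_univ, Finset.mem_union, Finset.mem_filter, true_and, true_iff]
      rcases lt_trichotomy (μ i) 0 with hlt | heq | hgt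
      · exact Or.inl (Or.inr hlt)
      · exact Or.inr heq
      · exact Or.inl (Or.inl hgt)
    · rw [Finset.disjoint_left]
      intro i
      simp only [Finset.mem_univ, Finset.mem_union, Finset.mem_filter, true_and]
      rintro (hi | hi) h0 <;> linarith
    · rw [Finset.disjoint_left]
      intro i
      simp only [Finset.mem_univ, Finset.mem_filter, true_and]
      intro hi h0
      linarith
  rw [Fintype.card_fin] at h4
  omega

variable [FiniteDimensional ℂ V']

/-- The index does not change under pullback by a surjective map. -/
theorem posIndex_comap {Φ' : V' → V' → ℂ} (h' : IsHerm Φ') (f : V →ₗ[ℂ] V')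
    (hf : Function.Surjective f) (hΦ : ∀ u, Φ u u = Φ' (f u) (f u)) :
    posIndex Φ = posIndex Φ' := by
  apply le_antisymm
  · obtain ⟨A, hA, hp⟩ := exists_finrank_eq_posIndex Φ
    have hinj : Function.Injective (f.domRestrict A) := by
      rw [← LinearMap.ker_eq_bot, eq_bot_iff]
      rintro ⟨u, hu⟩ hu'
      have hfu : f u = 0 := by simpa using hu'
      by_contra hne
      have := hp u hu (fun h0 => hne (by simpa using h0))
      rw [hΦ, hfu, h'.zero_left] at this
      simp at this
    rw [← hA, ← LinearMap.finrank_range_of_inj hinj]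
    apply le_posIndex
    rintro _ ⟨⟨u, hu⟩, rfl⟩ hne
    simp only [LinearMap.domRestrict_apply] at hne ⊢
    rw [← hΦ]
    exact hp u hu (fun h0 => hne (by simp [h0]))
  · obtain ⟨g, hg⟩ := f.exists_rightInverse_of_surjective (LinearMap.range_eq_top.mpr hf)
    have hg' : ∀ v, f (g v) = v := fun v => LinearMap.congr_fun hg v
    obtain ⟨A, hA, hp⟩ := exists_finrank_eq_posIndex Φ'
    have hinj : Function.Injective (g.domRestrict A) := by
      intro u v huv
      apply Subtype.ext
      rw [← hg' u, ← hg' v]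
      exact congrArg f huv
    rw [← hA, ← LinearMap.finrank_range_of_inj hinj]
    apply le_posIndex
    rintro _ ⟨⟨u, hu⟩, rfl⟩ hne
    simp only [LinearMap.domRestrict_apply] at hne ⊢
    rw [hΦ, hg']
    exact hp u hu (fun h0 => hne (by simp [h0]))

theorem negIndex_comap {Φ' : V' → V' → ℂ} (h' : IsHerm Φ') (f : V →ₗ[ℂ] V')
    (hf : Function.Surjective f) (hΦ : ∀ u, Φ u u = Φ' (f u) (f u)) :
    negIndex Φ = negIndex Φ' :=
  posIndex_comap h'.neg f hf fun u => by rw [hΦ]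

omit [FiniteDimensional ℂ V] [FiniteDimensional ℂ V'] in
/-- A conjugate linear injection preserves dimensions, since it is an equivalence over the field
automorphism given by conjugation. -/
theorem finrank_map_semilinear (J : V →ₛₗ[starRingEnd ℂ] V') (hJ : Function.Injective J)
    (A : Submodule ℂ V) : finrank ℂ (A.map J) = finrank ℂ A := by
  have h := rank_eq_of_equiv_equiv (R := ℂ) (R' := ℂ) (M := A) (M₁ := A) (starRingEnd ℂ)
    (AddEquiv.refl _)
  have e := Submodule.equivMapOfInjective J hJ A
  have := lift_rank_eq_of_equiv_equiv (R := ℂ) (R' := ℂ) (M := A) (M' := A.map J) (starRingEnd ℂ)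
    e.toAddEquiv (starRingAut (R := ℂ)).bijective (fun r m => e.map_smulₛₗ r m)
  have h2 := congrArg Cardinal.toNat this
  simpa [finrank] using h2.symm

/-- A form whose diagonal changes sign under an injective conjugate linear map is split. -/
theorem posIndex_eq_negIndex (J : V →ₛₗ[starRingEnd ℂ] V) (hJ : Function.Injective J)
    (hΦ : ∀ u, (Φ (J u) (J u)).re = -(Φ u u).re) : posIndex Φ = negIndex Φ := by
  apply le_antisymm
  · obtain ⟨A, hA, hp⟩ := exists_finrank_eq_posIndex Φ
    rw [← hA, ← finrank_map_semilinear J hJ A]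
    apply le_posIndex
    rintro _ ⟨u, hu, rfl⟩ hne
    rw [Complex.neg_re, hΦ, neg_neg]
    exact hp u hu (fun h0 => hne (by simp [h0]))
  · obtain ⟨A, hA, hp⟩ := exists_finrank_eq_negIndex Φ
    rw [← hA, ← finrank_map_semilinear J hJ A]
    apply le_posIndex
    rintro _ ⟨u, hu, rfl⟩ hne
    rw [hΦ]
    have := hp u hu (fun h0 => hne (by simp [h0]))
    linarith

end

/-- Positivity on a subspace is an open condition on the form. -/
theorem eventually_posDef {E W : Type*} [TopologicalSpace E] [NormedAddCommGroup W]
    [NormedSpace ℂ W] [FiniteDimensional ℂ W] (q : E → W → ℝ)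
    (hq : Continuous fun p : E × W => q p.1 p.2)
    (hs : ∀ x (c : ℝ) u, q x ((c : ℂ) • u) = c ^ 2 * q x u) (A : Submodule ℂ W) (x₀ : E)
    (h : ∀ u ∈ A, u ≠ 0 → 0 < q x₀ u) : ∀ᶠ x in 𝓝 x₀, ∀ u ∈ A, u ≠ 0 → 0 < q x u := by
  -- by homogeneity it suffices to consider the unit sphere of `A`, which is compact
  have hK : IsCompact ((A : Set W) ∩ Metric.sphere 0 1) := by
    have : ProperSpace W := FiniteDimensional.proper ℂ W
    exact (isCompact_sphere _ _).inter_left A.closed_of_finiteDimensional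
  have h1 : ∀ u ∈ (A : Set W) ∩ Metric.sphere 0 1,
      ∀ᶠ p : E × W in 𝓝 x₀ ×ˢ 𝓝 u, 0 < q p.1 p.2 := fun u hu => by
    rw [← nhds_prod_eq]
    refine continuousAt_const.eventually_lt hq.continuousAt ?_
    refine h u hu.1 (fun h0 => ?_)
    have := hu.2
    simp [h0] at this
  have h2 := hK.eventually_forall_of_forall_eventually (P := fun x u => 0 < q x u)
    (x₀ := x₀) (fun u hu => by rw [nhds_prod_eq]; exact h1 u hu)
  filter_upwards [h2] with x hx u hu hu0
  have hn : ‖u‖ ≠ 0 := norm_ne_zero_iff.mpr hu0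
  have h3 := hx (((‖u‖⁻¹ : ℝ) : ℂ) • u) ⟨A.smul_mem _ hu, by
    rw [mem_sphere_zero_iff_norm, norm_smul, Complex.norm_real, norm_inv, norm_norm,
      inv_mul_cancel₀ hn]⟩
  rw [hs] at h3
  exact (mul_pos_iff_of_pos_left (by positivity)).mp h3

end Index

/-! ### Ranks in pencils of linear maps -/

section Rank

variable {V W : Type*} [AddCommGroup V] [Module ℂ V] [AddCommGroup W] [Module ℂ W]
  [FiniteDimensional ℂ V]

/-- Along an affine line of linear maps, the dimension of the kernel takes its smallest value up to
finitely many exceptions. -/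
theorem finite_setOf_lt_finrank_ker (A B : V →ₗ[ℂ] W) (t₀ : ℂ) :
    {t : ℂ | finrank ℂ (LinearMap.ker (A + t₀ • B)) < finrank ℂ (LinearMap.ker (A + t • B))}.Finite
    := by
  -- `S` is a left inverse of `A + t₀ B` on a complement `C` of its kernel; the determinant of
  -- `S (A + t B)` on `C` is a polynomial in `t` with value `1` at `t₀`, and the kernel of `A + t B`
  -- is disjoint from `C` unless `t` is a root
  obtain ⟨C, hC⟩ := (LinearMap.ker (A + t₀ • B)).exists_isCompl
  have hinj : LinearMap.ker ((A + t₀ • B) ∘ₗ C.subtype) = ⊥ := by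
    rw [eq_bot_iff]
    rintro ⟨u, hu⟩ hu'
    have : u ∈ LinearMap.ker (A + t₀ • B) ⊓ C := ⟨by simpa using hu', hu⟩
    rw [hC.inf_eq_bot] at this
    simpa using this
  obtain ⟨S, hS⟩ := LinearMap.exists_leftInverse_of_injective _ hinj
  let b := finBasis ℂ C
  let M := LinearMap.toMatrix b b (S ∘ₗ A ∘ₗ C.subtype)
  let N := LinearMap.toMatrix b b (S ∘ₗ B ∘ₗ C.subtype)
  let p : Polynomial ℂ := (M.map Polynomial.C + (Polynomial.X : Polynomial ℂ) •
    N.map Polynomial.C).det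
  have hp : ∀ t, p.eval t = (M + t • N).det := fun t => by
    change (Polynomial.evalRingHom t) p = _
    rw [RingHom.map_det]
    congr 1
    ext i j
    simp only [RingHom.mapMatrix_apply, Matrix.map_apply, Matrix.add_apply, Matrix.smul_apply,
      smul_eq_mul, Polynomial.coe_evalRingHom, Polynomial.eval_add, Polynomial.eval_mul,
      Polynomial.eval_C, Polynomial.eval_X]
  have hMN : ∀ t, M + t • N = LinearMap.toMatrix b b (S ∘ₗ (A + t • B) ∘ₗ C.subtype) := fun t => by
    rw [← map_smul, ← map_add]
    congr 1
    ext u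
    simp
  have hp0 : p ≠ 0 := fun h0 => by
    have := hp t₀
    rw [h0, hMN, hS, LinearMap.toMatrix_id, Matrix.det_one] at this
    simp at this
  refine (Polynomial.finite_setOfPred_isRoot hp0).subset fun t ht => ?_
  by_contra hroot
  have hdet : (M + t • N).det ≠ 0 := fun h0 => hroot (by
    change p.eval t = 0
    rw [hp, h0])
  rw [hMN, LinearMap.det_toMatrix] at hdet
  have hker : LinearMap.ker (S ∘ₗ (A + t • B) ∘ₗ C.subtype) = ⊥ := by
    by_contra hne
    exact hdet (LinearMap.det_eq_zero_iff_ker_ne_bot.mpr hne)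
  have hd : LinearMap.ker (A + t • B) ⊓ C = ⊥ := by
    rw [eq_bot_iff]
    rintro u ⟨hu, hu'⟩
    have : (⟨u, hu'⟩ : C) ∈ LinearMap.ker (S ∘ₗ (A + t • B) ∘ₗ C.subtype) := by
      rw [LinearMap.mem_ker, LinearMap.comp_apply, LinearMap.comp_apply, Submodule.subtype_apply,
        LinearMap.mem_ker.mp hu, map_zero]
    rw [hker] at this
    simpa using this
  have h1 := Submodule.finrank_sup_add_finrank_inf_eq (LinearMap.ker (A + t • B)) C
  rw [hd, finrank_bot] at h1
  have h2 := (LinearMap.ker (A + t • B) ⊔ C).finrank_le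
  have h3 := Submodule.finrank_add_eq_of_isCompl hC
  have h4 : finrank ℂ (LinearMap.ker (A + t₀ • B)) < finrank ℂ (LinearMap.ker (A + t • B)) := ht
  omega

/-- The parameter of a pencil can be made real without enlarging the kernel. This turns complex
solutions of linear problems with a real structure into real ones. -/
theorem exists_real_finrank_ker_le (A B : V →ₗ[ℂ] W) (t₀ : ℂ) :
    ∃ t : ℝ, finrank ℂ (LinearMap.ker (A + (t : ℂ) • B)) ≤
      finrank ℂ (LinearMap.ker (A + t₀ • B)) := by
  by_contra! h
  have hf := (finite_setOf_lt_finrank_ker A B t₀).preimage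
    (Complex.ofReal_injective.injOn (s := _))
  exact Set.infinite_univ (hf.subset fun t _ => h t)

end Rank

/-- The dimension of the intersection of the kernel with a fixed subspace is upper semicontinuous.
-/
theorem isOpen_setOf_finrank_ker_inf_le {W : Type*} [NormedAddCommGroup W] [NormedSpace ℂ W]
    [FiniteDimensional ℂ W] (U : Submodule ℂ W) (r : ℕ) :
    IsOpen {X : W →L[ℂ] W | finrank ℂ ↥(LinearMap.ker (X : W →ₗ[ℂ] W) ⊓ U) ≤ r} := by
  have key : ∀ X : W →L[ℂ] W, finrank ℂ (LinearMap.range ((X : W →ₗ[ℂ] W).domRestrict U)) +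
      finrank ℂ ↥(LinearMap.ker (X : W →ₗ[ℂ] W) ⊓ U) = finrank ℂ U := fun X => by
    rw [← LinearMap.finrank_range_add_finrank_ker ((X : W →ₗ[ℂ] W).domRestrict U)]
    congr 1
    rw [LinearMap.ker_domRestrict, inf_comm, ← Submodule.map_comap_subtype,
      Submodule.finrank_map_subtype_eq]
  have h := (isOpen_setOfPred_nat_le_rank (𝕜 := ℂ) (E := U) (F := W) (finrank ℂ U - r)).preimage
    (f := fun X : W →L[ℂ] W => X.comp U.subtypeL) (by fun_prop)
  convert h using 1
  ext X
  simp only [Set.mem_ofPred_eq, Set.mem_preimage]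
  have h2 : ((X.comp U.subtypeL : U →L[ℂ] W) : U →ₗ[ℂ] W) = (X : W →ₗ[ℂ] W).domRestrict U := rfl
  rw [h2, LinearMap.rank, ← finrank_eq_rank, Nat.cast_le]
  have := key X
  omega

/-! ### Cartan involutions -/

section Polynomials

variable {V V' : Type*} [AddCommGroup V] [Module ℂ V] [AddCommGroup V'] [Module ℂ V']

/-- The value of a real polynomial at an operator. -/
abbrev realAeval (p : Polynomial ℝ) (A : V →ₗ[ℂ] V) : V →ₗ[ℂ] V :=
  Polynomial.aeval A (p.map (algebraMap ℝ ℂ))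

/-- A real-linear map intertwining two operators intertwines their values under a real polynomial.
This applies to conjugate linear maps as well as to linear ones. -/
theorem realAeval_intertwine (p : Polynomial ℝ) (A : V →ₗ[ℂ] V) (A' : V' →ₗ[ℂ] V') (T : V → V')
    (hadd : ∀ u v, T (u + v) = T u + T v) (hs : ∀ (c : ℝ) v, T ((c : ℂ) • v) = (c : ℂ) • T v)
    (hT : ∀ v, T (A v) = A' (T v)) (v : V) : T (realAeval p A v) = realAeval p A' (T v) := by
  induction p using Polynomial.induction_on' with
  | add p q hp hq =>
    simp only [realAeval, Polynomial.map_add, map_add, LinearMap.add_apply] at hp hq ⊢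
    rw [hadd, hp, hq]
  | monomial n c =>
    have hpow : ∀ n v, T ((A ^ n) v) = (A' ^ n) (T v) := by
      intro n
      induction n with
      | zero => simp
      | succ n ih => intro v; rw [pow_succ', pow_succ', Module.End.mul_apply, hT, ih,
          Module.End.mul_apply]
    simp only [realAeval, Polynomial.map_monomial, Polynomial.aeval_monomial, Module.End.mul_apply,
      Module.algebraMap_end_apply]
    rw [← hpow]
    exact hs c _

theorem IsInner.realAeval_symm {P : V → V → ℂ} (h : IsInner P) (p : Polynomial ℝ) (A : V →ₗ[ℂ] V)
    (hA : ∀ u v, P (A u) v = P u (A v)) (u v : V) :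
    P (realAeval p A u) v = P u (realAeval p A v) := by
  induction p using Polynomial.induction_on' with
  | add p q hp hq =>
    simp only [realAeval, Polynomial.map_add, map_add, LinearMap.add_apply] at hp hq ⊢
    rw [h.add_left, h.add_right, hp, hq]
  | monomial n c =>
    have hpow : ∀ n u v, P ((A ^ n) u) v = P u ((A ^ n) v) := by
      intro n
      induction n with
      | zero => simp
      | succ n ih =>
        intro u v
        rw [pow_succ', Module.End.mul_apply, hA, ih, ← Module.End.mul_apply, ← pow_succ, ← pow_succ']
    simp only [realAeval, Polynomial.map_monomial, Polynomial.aeval_monomial, Module.End.mul_apply,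
      Module.algebraMap_end_apply]
    rw [h.smul_left, h.smul_right, hpow]
    simp

/-- The polar decomposition of an injective map between spaces with inner products: the pulled
back inner product is `P (s u) (s v)` for a positive operator `s`, which commutes with whatever
commutes with the operator `A` representing it. -/
theorem IsInner.exists_polar [FiniteDimensional ℂ V] {P : V → V → ℂ} (h : IsInner P)
    {P' : V' → V' → ℂ} (h' : IsInner P') (g : V →ₗ[ℂ] V') (hg : Function.Injective g) :
    ∃ A s : V →ₗ[ℂ] V, (∀ u v, P u (A v) = P' (g u) (g v)) ∧ Function.Injective s ∧
      (∀ u v, P (s u) (s v) = P' (g u) (g v)) ∧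
      ∀ T : V → V, (∀ u v, T (u + v) = T u + T v) → (∀ (c : ℝ) v, T ((c : ℂ) • v) = (c : ℂ) • T v) →
        (∀ v, T (A v) = A (T v)) → ∀ v, T (s v) = s (T v) := by
  have hc := h'.toIsHerm.comap g
  obtain ⟨A, hA⟩ := h.exists_riesz
    (fun u => { toFun := fun v => P' (g u) (g v), map_add' := hc.add_right u, map_smul' := hc.smul_right u })
    (fun u u' v => hc.add_left u u' v) (fun c u v => hc.smul_left c u v)
  change ∀ u v, P u (A v) = P' (g u) (g v) at hA
  have hsymm : ∀ u v, P (A u) v = P u (A v) := fun u v => by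
    rw [← h.conj_symm, hA, hA, h'.conj_symm]
  obtain ⟨p, hp, hpos⟩ := h.exists_sqrt A hsymm (fun v hv => by
    rw [hA]
    exact h'.pos _ (fun h0 => hv (hg (by rw [h0, map_zero]))))
  refine ⟨A, realAeval p A, hA, ?_, fun u v => ?_, fun T h1 h2 h3 => ?_⟩
  · intro u v huv
    rw [← sub_eq_zero]
    by_contra hne
    have := hpos _ hne
    rw [map_sub, sub_eq_zero.mpr huv, h.zero_right] at this
    simp at this
  · rw [h.realAeval_symm p A hsymm, ← Module.End.mul_apply, hp, hA]
  · exact realAeval_intertwine p A A T h1 h2 h3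

end Polynomials

theorem units_coe_mul_self (ε : ℤˣ) : ((ε : ℤ) : ℂ) * ((ε : ℤ) : ℂ) = 1 := by
  rcases Int.units_eq_one_or ε with rfl | rfl <;> simp

theorem conj_units_coe (ε : ℤˣ) : (starRingEnd ℂ) ((ε : ℤ) : ℂ) = ((ε : ℤ) : ℂ) := by simp

section

variable {ε η : ℤˣ} {V : Type*} [AddCommGroup V] [Module ℂ V]

theorem units_coe_smul_smul (ε : ℤˣ) (v : V) : ((ε : ℤ) : ℂ) • ((ε : ℤ) : ℂ) • v = v := by
  rw [smul_smul, units_coe_mul_self, one_smul]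

namespace EpsSpace

variable (S : EpsSpace ε η V)

/-- The positive definite Hermitian form of an `(ε, η)`-space, conjugate linear in the first
variable. -/
def ip (u v : V) : ℂ := S.form (S.L v) (S.J u)

theorem form_eq_ip (u v : V) : S.form v (S.J u) = ((η : ℤ) : ℂ) * S.ip u (S.L v) := by
  rw [ip, S.L_L, map_smul, LinearMap.smul_apply, smul_eq_mul, ← mul_assoc, units_coe_mul_self,
    one_mul]

theorem isInner_ip : IsInner S.ip where
  add_right u v w := by simp [ip]
  smul_right u c v := by simp [ip]
  conj_symm u v := by
    rw [ip, ip, ← S.form_J, S.J_J, ← S.L_J, S.symm, map_smul, LinearMap.smul_apply, smul_eq_mul,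
      ← S.form_L, S.L_L, map_smul, smul_eq_mul, Units.val_mul, Int.cast_mul]
    linear_combination (S.form (S.L v) (S.J u)) *
      (((η : ℤ) : ℂ) * ((η : ℤ) : ℂ) * units_coe_mul_self ε + units_coe_mul_self η)
  pos v hv := S.pos v hv

theorem J_inj : Function.Injective S.J := by
  intro u v huv
  have := congrArg S.J huv
  rw [S.J_J, S.J_J] at this
  have h2 := congrArg (fun w => (((ε * η : ℤˣ) : ℤ) : ℂ) • w) this
  simpa only [units_coe_smul_smul] using h2

theorem J_surj : Function.Surjective S.J := fun v =>
  ⟨(((ε * η : ℤˣ) : ℤ) : ℂ) • S.J v, by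
    rw [map_smulₛₗ, conj_units_coe, S.J_J, units_coe_smul_smul]⟩

theorem ip_L (u v : V) : S.ip (S.L u) (S.L v) = S.ip u v := by
  rw [ip, ip, ← S.L_J, S.form_L]

theorem ip_J (u v : V) : S.ip (S.J u) (S.J v) = (starRingEnd ℂ) (S.ip u v) := by
  rw [ip, ip, S.L_J, S.form_J]

theorem ip_L_left (u v : V) : S.ip (S.L u) v = ((η : ℤ) : ℂ) * S.ip u (S.L v) := by
  rw [← S.ip_L u, S.L_L, S.isInner_ip.smul_right, ← mul_assoc, units_coe_mul_self, one_mul]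

/-- A formed space with a conjugate linear `J` admits an `L`: the phase in the polar decomposition
of the form relative to any `J`-invariant inner product. It sends an operator to minus its adjoint
if both lie in the real Lie algebra. -/
theorem exists_of_inner [FiniteDimensional ℂ V] (form : V →ₗ[ℂ] V →ₗ[ℂ] ℂ)
    (J : V →ₛₗ[starRingEnd ℂ] V) (symm : ∀ u v, form u v = ((ε : ℤ) : ℂ) * form v u)
    (nondeg : ∀ u, (∀ v, form u v = 0) → u = 0)
    (J_J : ∀ v, J (J v) = (((ε * η : ℤˣ) : ℤ) : ℂ) • v)
    (form_J : ∀ u v, form (J u) (J v) = (starRingEnd ℂ) (form u v))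
    {P : V → V → ℂ} (hP : IsInner P) (hJ : ∀ u v, P (J u) (J v) = (starRingEnd ℂ) (P u v)) :
    ∃ S : EpsSpace ε η V, S.form = form ∧ S.J = J ∧
      ∀ e f : V →ₗ[ℂ] V, (∀ u v, P (e u) v = P u (f v)) →
        (∀ u v, form (e u) v + form u (e v) = 0) → (∀ u v, form (f u) v + form u (f v) = 0) →
        (∀ v, e (J v) = J (e v)) → (∀ v, f (J v) = J (f v)) →
        ∀ v, S.L (e v) = -f (S.L v) := by
  have hη := units_coe_mul_self η
  have J_surj : Function.Surjective J := fun v =>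
    ⟨(((ε * η : ℤˣ) : ℤ) : ℂ) • J v, by
      rw [map_smulₛₗ, conj_units_coe, J_J, units_coe_smul_smul]⟩
  -- the operator `A` represents `⟨v, J u⟩` and its adjoint is `η A`, so that `Q = η A ^ 2` is
  -- positive; with the positive square root `s` of `Q` the phase of `A` is `A⁻¹ s`
  obtain ⟨A, hA⟩ := hP.exists_riesz (fun u => form.flip (J u))
    (fun u u' v => by simp) (fun c u v => by simp)
  simp only [LinearMap.flip_apply] at hA
  have hstar : ∀ u v, P (A u) v = ((η : ℤ) : ℂ) * P u (A v) := fun u v => by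
    rw [← hP.conj_symm, hA, hA, ← form_J, J_J, map_smul, smul_eq_mul, symm, Units.val_mul,
      Int.cast_mul]
    linear_combination (((η : ℤ) : ℂ) * form v (J u)) * units_coe_mul_self ε
  have hAJ : ∀ v, A (J v) = J (A v) := fun v => by
    apply hP.eq_of_forall
    intro u
    obtain ⟨u, rfl⟩ := J_surj u
    rw [hA, hJ, hA, form_J]
  have hinj : Function.Injective A := by
    rw [← LinearMap.ker_eq_bot, eq_bot_iff]
    intro v hv
    refine nondeg v fun w => ?_
    obtain ⟨u, rfl⟩ := J_surj w
    rw [← hA, LinearMap.mem_ker.mp hv, hP.zero_right]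
  let B : V →ₗ[ℂ] V := (LinearEquiv.ofInjectiveEndo A hinj).symm
  have hAB : ∀ v, A (B v) = v := fun v => (LinearEquiv.ofInjectiveEndo A hinj).apply_symm_apply v
  have hBA : ∀ v, B (A v) = v := fun v => (LinearEquiv.ofInjectiveEndo A hinj).symm_apply_apply v
  let Q : V →ₗ[ℂ] V := ((η : ℤ) : ℂ) • (A ∘ₗ A)
  have hQ : ∀ v, Q v = ((η : ℤ) : ℂ) • A (A v) := fun v => rfl
  have hPQ : ∀ u v, P u (Q v) = P (A u) (A v) := fun u v => by
    rw [hQ, hP.smul_right, hstar]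
  have hQs : ∀ u v, P (Q u) v = P u (Q v) := fun u v => by
    rw [← hP.conj_symm, hPQ, hPQ, hP.conj_symm]
  obtain ⟨p, hp, hpos⟩ := hP.exists_sqrt Q hQs (fun v hv => by
    rw [hPQ]
    exact hP.pos _ (fun h0 => hv (hinj (by rw [h0, map_zero]))))
  set s := realAeval p Q with hs
  have hss : ∀ v, s (s v) = ((η : ℤ) : ℂ) • A (A v) := fun v => LinearMap.congr_fun hp v
  have hcomm : ∀ C : V →ₗ[ℂ] V, (∀ v, C (A (A v)) = A (A (C v))) → ∀ v, C (s v) = s (C v) :=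
    fun C hC => realAeval_intertwine p Q Q C (map_add C) (fun c v => map_smul C _ v)
      (fun v => by rw [hQ, map_smul, hC, hQ])
  have hsA := hcomm A fun v => rfl
  have hsB := hcomm B fun v => by rw [hBA, hAB]
  have hsJ : ∀ v, J (s v) = s (J v) :=
    realAeval_intertwine p Q Q J (map_add J) (fun c v => by rw [map_smulₛₗ, Complex.conj_ofReal])
      (fun v => by rw [hQ, map_smulₛₗ, conj_units_coe, ← hAJ, ← hAJ, hQ])
  have hBJ : ∀ v, B (J v) = J (B v) := fun v => hinj (by rw [hAB, hAJ, hAB])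
  have hsP : ∀ u v, P (s u) v = P u (s v) := hP.realAeval_symm p Q hQs
  have hBP : ∀ u v, P (B u) v = ((η : ℤ) : ℂ) * P u (B v) := fun u v => by
    conv_rhs => rw [← hAB u, hstar, hAB, ← mul_assoc, hη, one_mul]
  let L : V →ₗ[ℂ] V := B ∘ₗ s
  have hL : ∀ v, L v = B (s v) := fun v => rfl
  have hLP : ∀ u v, P (L u) v = ((η : ℤ) : ℂ) * P u (L v) := fun u v => by
    rw [hL, hBP, hsP, hL, hsB]
  have hAL : ∀ v, A (L v) = s v := fun v => by rw [hL, hAB]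
  have hLL : ∀ v, L (L v) = ((η : ℤ) : ℂ) • v := fun v => by
    rw [hL, hL, ← hsB, hss, map_smul, map_smul, hBA, hBA]
  have hLJ : ∀ v, L (J v) = J (L v) := fun v => by rw [hL, ← hsJ, hBJ, hL]
  refine ⟨⟨form, J, L, symm, nondeg, J_J, form_J, hLL, fun u v => ?_, hLJ, fun v hv => ?_⟩,
    rfl, rfl, ?_⟩
  · obtain ⟨v, rfl⟩ := J_surj v
    rw [hLJ, ← hA, ← hA, hLP, hAL, hL, hss, map_smul, hBA, hP.smul_right, ← mul_assoc, hη,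
      one_mul]
  · rw [← hA, hAL]
    exact hpos v hv
  -- `A` carries `e` to `-f` and `f` to `-e`, so `s` commutes with `e`
  · intro e f hef he hf heJ hfJ v
    change L (e v) = -f (L v)
    have hfe : ∀ u v, P (f u) v = P u (e v) := fun u v => by
      rw [← hP.conj_symm, ← hef, hP.conj_symm]
    have h1 : ∀ v, A (e v) = -f (A v) := fun v => by
      apply hP.eq_of_forall
      intro u
      have := he v (J u)
      rw [hA, hP.neg_right, ← hef, hA, ← heJ]
      linear_combination this
    have h2 : ∀ v, A (f v) = -e (A v) := fun v => by
      apply hP.eq_of_forall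
      intro u
      have := hf v (J u)
      rw [hA, hP.neg_right, ← hfe, hA, ← hfJ]
      linear_combination this
    have h3 := hcomm e fun v => by
      rw [h1, map_neg, h2, neg_neg]
    apply hinj
    rw [hAL, map_neg, h2, neg_neg, hAL, h3]

/-- Any two choices of `L` on the same formed space are conjugate under the real group. -/
theorem exists_conj_L [FiniteDimensional ℂ V] (S S' : EpsSpace ε η V) (hf : S'.form = S.form)
    (hJ : S'.J = S.J) : ∃ s : V →ₗ[ℂ] V, (∀ u v, S.form (s u) (s v) = S.form u v) ∧
      (∀ v, s (S.J v) = S.J (s v)) ∧ ∀ v, s (S'.L v) = S.L (s v) := by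
  have hη := units_coe_mul_self η
  have hP := S.isInner_ip
  -- `A = L⁻¹ L'` represents the second inner product in terms of the first, and `B = A⁻¹` is
  -- conjugate to `A` under `L`; the square roots `s` of `A` and `t` of `B` are inverse to each
  -- other
  let A : V →ₗ[ℂ] V := ((η : ℤ) : ℂ) • (S.L ∘ₗ S'.L)
  let B : V →ₗ[ℂ] V := ((η : ℤ) : ℂ) • (S'.L ∘ₗ S.L)
  have hA : ∀ v, A v = ((η : ℤ) : ℂ) • S.L (S'.L v) := fun v => rfl
  have hB : ∀ v, B v = ((η : ℤ) : ℂ) • S'.L (S.L v) := fun v => rfl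
  have hPA : ∀ u v, S.ip u (A v) = S'.ip u v := fun u v => by
    rw [ip, ip, hA, map_smul, S.L_L, units_coe_smul_smul, hf, hJ]
  have hAs : ∀ u v, S.ip (A u) v = S.ip u (A v) := fun u v => by
    rw [← hP.conj_symm, hPA, hPA, S'.isInner_ip.conj_symm]
  have hAB : ∀ v, A (B v) = v := fun v => by
    simp only [hA, hB, map_smul, S.L_L, S'.L_L, units_coe_smul_smul]
  have hBA : ∀ v, B (A v) = v := fun v => by
    simp only [hA, hB, map_smul, S.L_L, S'.L_L, units_coe_smul_smul]
  have hLA : ∀ v, S.L (A v) = S'.L v := fun v => by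
    rw [hA, map_smul, S.L_L, units_coe_smul_smul]
  have hBL : ∀ v, B (S.L v) = S'.L v := fun v => by
    rw [hB, S.L_L, map_smul, units_coe_smul_smul]
  obtain ⟨p, hp, hpos⟩ := hP.exists_sqrt A hAs (fun v hv => by
    rw [hPA]; exact S'.isInner_ip.pos v hv)
  set s := realAeval p A with hs
  set t := realAeval p B with ht
  have hss : ∀ v, s (s v) = A v := fun v => LinearMap.congr_fun hp v
  have hLs : ∀ v, S.L (s v) = t (S.L v) :=
    realAeval_intertwine p A B S.L (map_add _) (fun c v => map_smul _ _ v)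
      (fun v => by rw [hLA, hBL])
  have hLsurj : ∀ v, ∃ w, v = S.L w := fun v => ⟨((η : ℤ) : ℂ) • S.L v, by
    rw [map_smul, S.L_L, units_coe_smul_smul]⟩
  have htt : ∀ v, t (t v) = B v := fun v => by
    obtain ⟨w, rfl⟩ := hLsurj v
    rw [← hLs, ← hLs, hss, hLA, hBL]
  have hBt : ∀ v, A (t v) = t (A v) :=
    realAeval_intertwine p B B A (map_add _) (fun c v => map_smul _ _ v)
      (fun v => by rw [hAB, hBA])
  have hst : ∀ v, t (s v) = s (t v) :=
    realAeval_intertwine p A A t (map_add _) (fun c v => map_smul _ _ v) (fun v => (hBt v).symm)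
  have htpos : ∀ v, v ≠ 0 → 0 < (S.ip v (t v)).re := fun v hv => by
    obtain ⟨w, rfl⟩ := hLsurj v
    rw [← hLs, S.ip_L]
    exact hpos w (fun h0 => hv (by rw [h0, map_zero]))
  -- `s t` is an involution without eigenvalue `-1`
  have hst1 : ∀ v, s (t v) = v := fun v => by
    have key : ∀ w, s (t w) = -w → w = 0 := fun w hw => by
      by_contra hne
      have htw : t w ≠ 0 := fun h0 => hne (by simpa [h0] using hw.symm)
      have h1 := hpos (t w) htw
      rw [hw, hP.neg_right, ← hP.conj_symm] at h1
      have h2 := htpos w hne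
      simp at h1
      linarith
    have h0 := key (s (t v) - v) (by
      rw [map_sub, map_sub, hst (t v), htt, hss, hAB, neg_sub])
    exact sub_eq_zero.mp h0
  have hsLs : ∀ v, s (S.L (s v)) = S.L v := fun v => by rw [hLs, hst1]
  have hsJ : ∀ v, S.J (s v) = s (S.J v) :=
    realAeval_intertwine p A A S.J (map_add _) (fun c v => by rw [map_smulₛₗ, Complex.conj_ofReal]) (fun v => by
      rw [hA, hA, map_smulₛₗ, conj_units_coe, ← S.L_J, ← hJ, ← S'.L_J])
  refine ⟨s, fun u v => ?_, fun v => (hsJ v).symm, fun v => ?_⟩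
  · obtain ⟨v, rfl⟩ := S.J_surj v
    rw [← hsJ, S.form_eq_ip, S.form_eq_ip, hP.realAeval_symm p A hAs, hsLs]
  · rw [← hLA, ← hss, hsLs]

end EpsSpace

/-! ### Representations of `𝔰𝔩₂` -/

section JacobsonMorozov

variable {V : Type*} [AddCommGroup V] [Module ℂ V]

/-- The commutator of `e ^ (n + 1)` with `y`, if `e` commutes with `[e, y]`. -/
theorem pow_mul_of_commute_lie (e y : End ℂ V) (hz : Commute e (e * y - y * e)) (n : ℕ) :
    e ^ (n + 1) * y = y * e ^ (n + 1) + ((n : ℂ) + 1) • ((e * y - y * e) * e ^ n) := by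
  have hn : ∀ n, e ^ n * (e * y - y * e) = (e * y - y * e) * e ^ n := fun n => (hz.pow_left n).eq
  induction n with
  | zero => simp
  | succ n ih =>
    have h1 : e ^ (n + 1 + 1) * y
        = e ^ (n + 1) * (e * y - y * e) + (e ^ (n + 1) * y) * e := by
      rw [pow_succ]; noncomm_ring
    rw [h1, ih, hn, add_mul, smul_mul_assoc, mul_assoc, mul_assoc, ← pow_succ, ← pow_succ]
    push_cast
    module

/-- If `e` commutes with `[e, y]` and `e v = 0`, then `e ^ k y ^ k v = k! [e, y] ^ k v`; hence a
nilpotent `e` forces `[e, y]` to be nilpotent on such `v`. -/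
theorem pow_apply_pow_of_commute_lie (e y : End ℂ V) (hz : Commute e (e * y - y * e)) {v : V} (hv : e v = 0)
    (k : ℕ) : (e ^ k) ((y ^ k) v) = (k.factorial : ℂ) • ((e * y - y * e) ^ k) v := by
  induction k with
  | zero => simp
  | succ k ih =>
    have h1 : (e ^ (k + 1)) ((y ^ k) v) = 0 := by
      rw [pow_succ', Module.End.mul_apply, ih, map_smul, ← Module.End.mul_apply,
        (hz.pow_right k).eq, Module.End.mul_apply, hv, map_zero, smul_zero]
    rw [pow_succ' y, Module.End.mul_apply, ← Module.End.mul_apply (e ^ (k + 1)) y,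
      pow_mul_of_commute_lie e y hz, LinearMap.add_apply, LinearMap.smul_apply,
      Module.End.mul_apply, Module.End.mul_apply, h1, ih, map_zero, zero_add, map_smul,
      ← Module.End.mul_apply _ ((e * y - y * e) ^ k), ← pow_succ', smul_smul, Nat.factorial_succ]
    push_cast
    rfl

variable [FiniteDimensional ℂ V]

/-- A nilpotent `e` is orthogonal, for the trace form, to the kernel of `ad e ∘ ad e`. -/
theorem trace_mul_eq_zero_of_commute_lie (e y : End ℂ V) (he : IsNilpotent e)
    (hz : Commute e (e * y - y * e)) : LinearMap.trace ℂ V (e * y) = 0 := by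
  by_contra htr
  rw [Module.End.trace_eq_sum_roots_charpoly_of_splits (IsAlgClosed.splits _)] at htr
  have : ∃ lam ∈ (e * y).charpoly.roots, lam ≠ 0 := by
    by_contra! hc
    exact htr (Multiset.sum_eq_zero hc)
  obtain ⟨lam, hlam, hne⟩ := this
  have hev : (e * y).HasEigenvalue lam := by
    rw [Module.End.hasEigenvalue_iff_isRoot_charpoly]
    exact (Polynomial.mem_roots'.mp hlam).2
  obtain ⟨v, hv⟩ := hev.exists_hasEigenvector
  have hv0 := hv.2
  have hvl : (e * y) v = lam • v := hv.apply_eq_smul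
  obtain ⟨N, hN⟩ := he
  -- the last nonzero vector `e ^ p v` is an eigenvector of `[e, y]`
  have hex : ∃ p, (e ^ (p + 1)) v = 0 := ⟨N, by rw [pow_succ, hN]; simp⟩
  classical
  let p := Nat.find hex
  have hp : (e ^ (p + 1)) v = 0 := Nat.find_spec hex
  have hp' : (e ^ p) v ≠ 0 := by
    rcases Nat.eq_zero_or_pos p with h0 | h0
    · rw [h0]; simpa using hv0
    · have := Nat.find_min hex (m := p - 1) (by omega)
      rwa [Nat.sub_add_cancel h0] at this
  set w := (e ^ p) v with hw
  set z := e * y - y * e with hzdef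
  have hew : e w = 0 := by rw [hw, ← Module.End.mul_apply, ← pow_succ']; exact hp
  have hzw : ((p : ℂ) + 1) • z w = lam • w := by
    have h1 := LinearMap.congr_fun (pow_mul_of_commute_lie e y hz p) v
    rw [LinearMap.add_apply, LinearMap.smul_apply, Module.End.mul_apply y, hp, map_zero, zero_add,
      Module.End.mul_apply _ (e ^ p), pow_succ, mul_assoc, Module.End.mul_apply (e ^ p), hvl,
      map_smul] at h1
    exact h1.symm
  have hp1 : (p : ℂ) + 1 ≠ 0 := by exact_mod_cast Nat.succ_ne_zero p
  have hzw' : z w = (lam / ((p : ℂ) + 1)) • w := by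
    rw [div_eq_inv_mul, mul_smul, ← hzw, smul_smul, inv_mul_cancel₀ hp1, one_smul]
  have hpow : ∀ k, (z ^ k) w = (lam / ((p : ℂ) + 1)) ^ k • w := by
    intro k
    induction k with
    | zero => simp
    | succ k ih => rw [pow_succ, Module.End.mul_apply, hzw', map_smul, ih, smul_smul, pow_succ']
  have h2 := pow_apply_pow_of_commute_lie e y hz hew N
  rw [hN, LinearMap.zero_apply, ← hzdef, hpow, smul_smul] at h2
  rcases smul_eq_zero.mp h2.symm with h3 | h3
  · have : (lam / ((p : ℂ) + 1)) ^ N ≠ 0 := pow_ne_zero _ (div_ne_zero hne hp1)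
    have h4 : (N.factorial : ℂ) ≠ 0 := by exact_mod_cast N.factorial_ne_zero
    exact mul_ne_zero h4 this h3
  · exact hp' h3

/-- Every linear functional on operators is a trace against an operator. -/
theorem exists_trace_mul_eq (φ : End ℂ V →ₗ[ℂ] ℂ) :
    ∃ y : End ℂ V, ∀ a, φ a = LinearMap.trace ℂ V (y * a) := by
  classical
  let b := finBasis ℂ V
  -- write operators as sums of operators of rank one
  have hdec : ∀ a : End ℂ V, a = ∑ i, (b.coord i).smulRight (a (b i)) := fun a => by
    apply b.ext
    intro j
    rw [LinearMap.sum_apply, Finset.sum_eq_single j]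
    · simp
    · intro i _ hij
      simp [hij.symm]
    · simp
  let ψ : Fin (finrank ℂ V) → V →ₗ[ℂ] ℂ := fun i =>
    { toFun := fun v => φ ((b.coord i).smulRight v)
      map_add' := fun u v => by
        rw [← map_add]; congr 1; ext; simp
      map_smul' := fun c v => by
        rw [RingHom.id_apply, ← map_smul]; congr 1; ext w
        rw [LinearMap.smulRight_apply, LinearMap.smul_apply, LinearMap.smulRight_apply, smul_comm] }
  refine ⟨∑ i, (ψ i).smulRight (b i), fun a => ?_⟩
  conv_lhs => rw [hdec a]
  have hy : ∀ v j, b.coord j ((∑ i, (ψ i).smulRight (b i)) v) = ψ j v := fun v j => by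
    rw [LinearMap.sum_apply, map_sum, Finset.sum_eq_single j]
    · simp
    · intro i _ hij
      rw [LinearMap.smulRight_apply, map_smul, Basis.coord_apply, b.repr_self_apply, if_neg hij,
        smul_zero]
    · simp
  conv_rhs => rw [hdec a, Finset.mul_sum, map_sum]
  rw [map_sum]
  refine Finset.sum_congr rfl fun i _ => ?_
  have h1 : (∑ i, (ψ i).smulRight (b i)) * (b.coord i).smulRight (a (b i))
      = (b.coord i).smulRight ((∑ i, (ψ i).smulRight (b i)) (a (b i))) := by
    ext v
    simp only [Module.End.mul_apply, LinearMap.smulRight_apply, map_smul]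
  rw [h1, LinearMap.trace_smulRight, hy]
  rfl

/-- The trace form is non-degenerate. -/
theorem eq_zero_of_trace_mul (w : End ℂ V) (h : ∀ a, LinearMap.trace ℂ V (w * a) = 0) : w = 0 := by
  let b := finBasis ℂ V
  ext v
  apply b.ext_elem
  intro i
  have h1 : w * (b.coord i).smulRight v = (b.coord i).smulRight (w v) := by
    ext u
    simp only [Module.End.mul_apply, LinearMap.smulRight_apply, map_smul]
  have := h ((b.coord i).smulRight v)
  rw [h1, LinearMap.trace_smulRight] at this
  simpa using this

/-- A nilpotent `e` lies in the range of `(ad e) ^ 2`: the range is the orthogonal of the kernel of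
`(ad e) ^ 2` for the trace form, and `e` is orthogonal to this kernel. -/
theorem exists_lie_lie_eq (e : End ℂ V) (he : IsNilpotent e) :
    ∃ y : End ℂ V, e * (e * y - y * e) - (e * y - y * e) * e = -((2 : ℂ) • e) := by
  let T : End ℂ V →ₗ[ℂ] End ℂ V :=
    { toFun := fun y => e * (e * y - y * e) - (e * y - y * e) * e
      map_add' := fun a b => by noncomm_ring
      map_smul' := fun c a => by
        simp only [mul_smul_comm, smul_mul_assoc, ← smul_sub, RingHom.id_apply] }
  have hT : ∀ y, T y = e * (e * y - y * e) - (e * y - y * e) * e := fun y => rfl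
  by_cases hmem : e ∈ LinearMap.range T
  · obtain ⟨y, hy⟩ := hmem
    refine ⟨-((2 : ℂ) • y), ?_⟩
    rw [← hT, map_neg, map_smul, hy]
  · exfalso
    -- a functional that separates `e` from the range is a trace against an element of the kernel
    obtain ⟨φ, hφe, hφ⟩ := Submodule.exists_le_ker_of_notMem hmem
    obtain ⟨y, hy⟩ := exists_trace_mul_eq φ
    have h1 : e * (e * y - y * e) - (e * y - y * e) * e = 0 := by
      apply eq_zero_of_trace_mul
      intro a
      have h2 : φ (T a) = 0 := hφ ⟨a, rfl⟩
      rw [hy, hT] at h2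
      rw [← h2]
      have c1 := LinearMap.trace_mul_comm ℂ (e * e * y) a
      have c2 := LinearMap.trace_mul_comm ℂ (e * y) (e * a)
      have c3 := LinearMap.trace_mul_comm ℂ e (y * a * e)
      have c4 := LinearMap.trace_mul_comm ℂ e (e * y * a)
      have c5 := LinearMap.trace_mul_comm ℂ e (y * e * a)
      have c6 := LinearMap.trace_mul_comm ℂ e (e * (y * a))
      have c7 := LinearMap.trace_mul_comm ℂ e ((y * a) * e)
      simp only [mul_sub, sub_mul, map_sub, mul_assoc] at *
      linear_combination c6 + c7 - 2 * c5
    refine hφe ?_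
    rw [hy, LinearMap.trace_mul_comm]
    exact trace_mul_eq_zero_of_commute_lie e y he (sub_eq_zero.mp h1)

end JacobsonMorozov

/-- `h, e, f` satisfy the relations of the standard basis of `𝔰𝔩₂`. In contrast to `IsSl2Triple`,
the zero triple is allowed. -/
structure IsSl2 {A : Type*} [Ring A] [Algebra ℂ A] (h e f : A) : Prop where
  he : h * e - e * h = (2 : ℂ) • e
  hf : h * f - f * h = -((2 : ℂ) • f)
  ef : e * f - f * e = h

section Sl2

variable {V : Type*} [AddCommGroup V] [Module ℂ V] {h e f : End ℂ V}

/-- If `[h, e] = 2 e` and `[e, f] = h` then `h - k` maps `ker e ∩ im e ^ k` to `im e ^ (k + 1)`. -/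
theorem sub_smul_mem_range_pow (he : h * e - e * h = (2 : ℂ) • e) (ef : e * f - f * e = h)
    (k : ℕ) (u : V) (hu : (e ^ (k + 1)) u = 0) :
    ((k : ℂ) + 1) • (h ((e ^ k) u) - (k : ℂ) • (e ^ k) u) = (e ^ (k + 1)) (f u) := by
  -- the commutators of `h` and `f` with the powers of `e`
  have h1 : ∀ k : ℕ, h * e ^ k = e ^ k * h + (2 * (k : ℂ)) • e ^ k := by
    intro k
    induction k with
    | zero => simp
    | succ k ih =>
      rw [pow_succ, ← mul_assoc, ih, add_mul, mul_assoc, sub_eq_iff_eq_add.mp he, smul_mul_assoc,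
        mul_add, mul_smul_comm, mul_assoc]
      push_cast
      module
  have h2 : ∀ k : ℕ, e ^ (k + 1) * f = f * e ^ (k + 1) +
      ((k : ℂ) + 1) • (h * e ^ k - (k : ℂ) • e ^ k) := by
    intro k
    induction k with
    | zero => simp [← ef]
    | succ k ih =>
      have h3 : e ^ (k + 1 + 1) * f = e ^ (k + 1) * h + (e ^ (k + 1) * f) * e := by
        rw [pow_succ, ← ef]; noncomm_ring
      have h4 : e ^ (k + 1) * h = h * e ^ (k + 1) - (2 * ((k + 1 : ℕ) : ℂ)) • e ^ (k + 1) := by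
        rw [h1 (k + 1)]; simp
      rw [h3, ih, h4, add_mul, smul_mul_assoc, sub_mul, smul_mul_assoc, mul_assoc, mul_assoc,
        ← pow_succ, ← pow_succ]
      push_cast
      module
  have h3 := LinearMap.congr_fun (h2 k) u
  rw [Module.End.mul_apply, LinearMap.add_apply, Module.End.mul_apply, hu, map_zero, zero_add,
    LinearMap.smul_apply, LinearMap.sub_apply, Module.End.mul_apply, LinearMap.smul_apply] at h3
  exact h3.symm

theorem h_mem_ker (he : h * e - e * h = (2 : ℂ) • e) {x : V} (hx : e x = 0) : e (h x) = 0 := by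
  have := LinearMap.congr_fun he x
  simp only [LinearMap.sub_apply, Module.End.mul_apply, hx, map_zero, LinearMap.smul_apply,
    smul_zero, zero_sub, neg_eq_zero] at this
  exact this

/-- The eigenvalues of `h` on `ker e` are natural numbers. -/
theorem eq_zero_of_eigenvalue_ne_nat (he : h * e - e * h = (2 : ℂ) • e)
    (ef : e * f - f * e = h) (hn : IsNilpotent e) {μ : ℂ} (hμ : ∀ k : ℕ, μ ≠ k) {x : V}
    (hx : e x = 0) (hh : h x = μ • x) : x = 0 := by
  obtain ⟨N, hN⟩ := hn
  -- the vector `x` lies in the range of all powers of `e`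
  have key : ∀ k : ℕ, x ∈ LinearMap.range (e ^ k) := by
    intro k
    induction k with
    | zero => simp
    | succ k ih =>
      obtain ⟨u, hu⟩ := ih
      have h1 := sub_smul_mem_range_pow he ef k u (by
        rw [pow_succ', Module.End.mul_apply, hu, hx])
      rw [hu, hh, ← sub_smul, smul_smul] at h1
      have hc : ((k : ℂ) + 1) * (μ - k) ≠ 0 :=
        mul_ne_zero (by exact_mod_cast Nat.succ_ne_zero k) (sub_ne_zero.mpr (hμ k))
      rw [← inv_smul_smul₀ hc x, h1]
      exact Submodule.smul_mem _ _ ⟨_, rfl⟩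
  obtain ⟨u, hu⟩ := key N
  rw [← hu, hN, LinearMap.zero_apply]

/-- The space `ker e` is spanned by eigenvectors of `h` with natural eigenvalues. -/
theorem ker_inf_range_pow_le (he : h * e - e * h = (2 : ℂ) • e)
    (ef : e * f - f * e = h) (hn : IsNilpotent e) (k : ℕ) :
    LinearMap.ker e ⊓ LinearMap.range (e ^ k) ≤
      ⨆ j : {j : ℕ // k ≤ j}, LinearMap.ker e ⊓ LinearMap.ker (h - (j : ℂ) • (1 : End ℂ V)) := by
  obtain ⟨N, hN⟩ := hn
  by_cases hk : N ≤ k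
  · rintro x ⟨-, u, rfl⟩
    rw [pow_eq_zero_of_le hk hN, LinearMap.zero_apply]
    exact zero_mem _
  push Not at hk
  -- downward induction on `k`, as `h - k` maps the left side for `k` to the left side for `k + 1`
  -- and is invertible on the right side for `k + 1`
  induction h_eq : N - k generalizing k with
  | zero => omega
  | succ d ih =>
    have ih' : LinearMap.ker e ⊓ LinearMap.range (e ^ (k + 1)) ≤
      ⨆ j : {j : ℕ // k + 1 ≤ j},
        LinearMap.ker e ⊓ LinearMap.ker (h - (j : ℂ) • (1 : End ℂ V)) := by
      by_cases hk' : k + 1 < N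
      · exact ih (k + 1) hk' (by omega)
      · rintro x ⟨-, u, rfl⟩
        rw [pow_eq_zero_of_le (by omega) hN, LinearMap.zero_apply]
        exact zero_mem _
    rintro x ⟨hx, u, rfl⟩
    have h1 := sub_smul_mem_range_pow he ef k u (by
      rw [pow_succ', Module.End.mul_apply]; exact hx)
    set x := (e ^ k) u with hxdef
    have hc : (k : ℂ) + 1 ≠ 0 := by exact_mod_cast Nat.succ_ne_zero k
    have h2 : h x - (k : ℂ) • x ∈ LinearMap.ker e ⊓ LinearMap.range (e ^ (k + 1)) := by
      refine ⟨?_, ?_⟩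
      · rw [SetLike.mem_coe, LinearMap.mem_ker, map_sub, map_smul, h_mem_ker he hx, LinearMap.mem_ker.mp hx]
        simp
      · rw [← inv_smul_smul₀ hc (h x - (k : ℂ) • x), h1]
        exact Submodule.smul_mem _ _ ⟨_, rfl⟩
    have h3 := ih' h2
    have h4 : (⨆ j : {j : ℕ // k + 1 ≤ j},
        LinearMap.ker e ⊓ LinearMap.ker (h - (j : ℂ) • (1 : End ℂ V))) ≤
        (⨆ j : {j : ℕ // k + 1 ≤ j},
          LinearMap.ker e ⊓ LinearMap.ker (h - (j : ℂ) • (1 : End ℂ V))).map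
            (h - (k : ℂ) • (1 : End ℂ V)) := by
      refine iSup_le fun j w hw => ?_
      have hj : ((j : ℕ) : ℂ) - k ≠ 0 := by
        rw [sub_ne_zero]
        have := j.2
        exact_mod_cast (by omega : (j : ℕ) ≠ k)
      refine ⟨((j : ℂ) - k)⁻¹ • w, Submodule.smul_mem _ _ (Submodule.mem_iSup_of_mem j hw), ?_⟩
      have hw2 : h w = (j : ℂ) • w := by
        have := hw.2
        rw [SetLike.mem_coe, LinearMap.mem_ker, LinearMap.sub_apply, sub_eq_zero] at this
        simpa using this
      rw [map_smul, LinearMap.sub_apply, hw2, LinearMap.smul_apply, Module.End.one_apply,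
        ← sub_smul, inv_smul_smul₀ hj]
    obtain ⟨y, hy, hyx⟩ := h4 h3
    have hmono : (⨆ j : {j : ℕ // k + 1 ≤ j},
        LinearMap.ker e ⊓ LinearMap.ker (h - (j : ℂ) • (1 : End ℂ V))) ≤
        ⨆ j : {j : ℕ // k ≤ j}, LinearMap.ker e ⊓ LinearMap.ker (h - (j : ℂ) • (1 : End ℂ V)) :=
      iSup_le fun j => le_iSup (fun j : {j : ℕ // k ≤ j} =>
        LinearMap.ker e ⊓ LinearMap.ker (h - (j : ℂ) • (1 : End ℂ V))) ⟨j, by have := j.2; omega⟩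
    have hker : (⨆ j : {j : ℕ // k + 1 ≤ j},
        LinearMap.ker e ⊓ LinearMap.ker (h - (j : ℂ) • (1 : End ℂ V))) ≤ LinearMap.ker e :=
      iSup_le fun j => inf_le_left
    have h5 : x - y ∈ ⨆ j : {j : ℕ // k ≤ j},
        LinearMap.ker e ⊓ LinearMap.ker (h - (j : ℂ) • (1 : End ℂ V)) := by
      refine Submodule.mem_iSup_of_mem ⟨k, le_rfl⟩ ⟨Submodule.sub_mem _ hx (hker hy), ?_⟩
      rw [SetLike.mem_coe, LinearMap.mem_ker, map_sub, hyx]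
      simp
    have := Submodule.add_mem _ h5 (hmono hy)
    rwa [sub_add_cancel] at this

namespace IsSl2

variable (t : IsSl2 h e f)
include t

theorem symm : IsSl2 (-h) f e where
  he := by rw [← neg_inj, ← t.hf]; noncomm_ring
  hf := by rw [← t.he]; noncomm_ring
  ef := by rw [← t.ef]; noncomm_ring

end IsSl2

/-- The space of lowest weight vectors of weight `-n`. -/
def lowest (h f : End ℂ V) (n : ℕ) : Submodule ℂ V :=
  LinearMap.ker f ⊓ LinearMap.ker (h + (n : ℂ) • (1 : End ℂ V))

theorem mem_lowest {n : ℕ} {u : V} :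
    u ∈ lowest h f n ↔ f u = 0 ∧ h u = -((n : ℂ) • u) := by
  simp [lowest, eq_neg_iff_add_eq_zero]

namespace IsSl2

variable (t : IsSl2 h e f)
include t

theorem ker_inf_range_le (hn : IsNilpotent f) (k : ℕ) :
    LinearMap.ker f ⊓ LinearMap.range (f ^ k) ≤ ⨆ j : {j : ℕ // k ≤ j}, lowest h f j := by
  refine (ker_inf_range_pow_le t.symm.he t.symm.ef hn k).trans (iSup_mono fun j => ?_)
  rintro x ⟨hx, hx'⟩
  refine mem_lowest.mpr ⟨hx, ?_⟩
  rw [SetLike.mem_coe, LinearMap.mem_ker, LinearMap.sub_apply, sub_eq_zero,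
    LinearMap.neg_apply] at hx'
  rw [← neg_eq_iff_eq_neg, hx']
  simp

theorem ker_le (hn : IsNilpotent f) : LinearMap.ker f ≤ ⨆ j, lowest h f j := by
  intro x hx
  have := t.ker_inf_range_le hn 0 ⟨hx, by simp⟩
  exact (iSup_le fun j : {j : ℕ // 0 ≤ j} => le_iSup (lowest h f) j.1) this

variable {n : ℕ} {u : V} (hu : u ∈ lowest h f n)
include hu

/-- The weights of the vectors in the chain of a lowest weight vector of weight `-n`. -/
theorem h_pow (k : ℕ) : h ((e ^ k) u) = (2 * (k : ℂ) - n) • (e ^ k) u := by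
  induction k with
  | zero => simp [(mem_lowest.mp hu).2]
  | succ k ih =>
    have h1 := LinearMap.congr_fun t.he ((e ^ k) u)
    simp only [LinearMap.sub_apply, Module.End.mul_apply, LinearMap.smul_apply] at h1
    rw [pow_succ', Module.End.mul_apply, sub_eq_iff_eq_add.mp h1, ih, map_smul]
    push_cast
    module

theorem f_pow_succ (k : ℕ) :
    f ((e ^ (k + 1)) u) = (((k : ℂ) + 1) * (n - k)) • (e ^ k) u := by
  induction k with
  | zero =>
    have h1 := LinearMap.congr_fun t.ef u
    simp only [LinearMap.sub_apply, Module.End.mul_apply, (mem_lowest.mp hu).1, map_zero, zero_sub,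
      (mem_lowest.mp hu).2, neg_inj] at h1
    simp [h1]
  | succ k ih =>
    have h1 := LinearMap.congr_fun t.ef ((e ^ (k + 1)) u)
    simp only [LinearMap.sub_apply, Module.End.mul_apply] at h1
    rw [pow_succ', Module.End.mul_apply, ← sub_eq_iff_eq_add'.mpr (sub_eq_iff_eq_add.mp h1), ih,
      t.h_pow hu, map_smul, ← Module.End.mul_apply, ← pow_succ']
    push_cast
    module

/-- The chain of the lowest weight vector `u` is traversed downwards by `f`; the case `m = 0`
recovers a multiple of `u`. -/
theorem f_pow_e_pow {m : ℕ} (hm : m ≤ n) (k : ℕ) : (f ^ k) ((e ^ (k + m)) u) =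
    (((m + k).descFactorial k * (n - m).descFactorial k : ℕ) : ℂ) • (e ^ m) u := by
  induction k with
  | zero => simp
  | succ k ih =>
    have h1 : (f ^ (k + 1)) ((e ^ (k + 1 + m)) u) = (f ^ k) (f ((e ^ (k + m + 1)) u)) := by
      rw [pow_succ f, Module.End.mul_apply]
      congr 4
      omega
    rw [h1, t.f_pow_succ hu, map_smul, ih, smul_smul]
    congr 1
    rw [← Nat.add_assoc, Nat.succ_descFactorial_succ, Nat.descFactorial_succ]
    by_cases hk : k ≤ n - m
    · push_cast [hk, hm]
      ring
    · rw [Nat.descFactorial_of_lt (by omega : n - m < k)]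
      simp

theorem f_pow_e_pow_self (k : ℕ) :
    (f ^ k) ((e ^ k) u) = ((k.factorial * n.descFactorial k : ℕ) : ℂ) • u := by
  have := t.f_pow_e_pow hu (Nat.zero_le n) k
  simpa [Nat.descFactorial_self] using this

theorem f_pow_e_pow_of_lt {k m : ℕ} (hkm : m < k) : (f ^ k) ((e ^ m) u) = 0 := by
  obtain ⟨d, rfl⟩ := Nat.exists_eq_add_of_lt hkm
  have : f ^ (m + d + 1) = f ^ d * f * f ^ m := by rw [← pow_succ, ← pow_add]; congr 1; omega
  rw [this, Module.End.mul_apply, Module.End.mul_apply, t.f_pow_e_pow_self hu, map_smul,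
    (mem_lowest.mp hu).1, smul_zero, map_zero]

/-- The chain of a lowest weight vector of weight `-n` has length at most `n + 1`: the vector
`e ^ (n + 1) u` is again annihilated by `f`, but it has positive weight. -/
theorem e_pow_eq_zero (hn : IsNilpotent f) {k : ℕ} (hk : n < k) : (e ^ k) u = 0 := by
  have h1 : (e ^ (n + 1)) u = 0 := by
    refine eq_zero_of_eigenvalue_ne_nat t.symm.he t.symm.ef hn (μ := -((n : ℂ) + 2)) ?_ ?_ ?_
    · intro k hk
      have : ((n + 2 + k : ℕ) : ℂ) = 0 := by
        push_cast
        rw [← hk]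
        ring
      have h2 : n + 2 + k = 0 := by exact_mod_cast this
      omega
    · rw [t.f_pow_succ hu]
      simp
    · rw [LinearMap.neg_apply, t.h_pow hu]
      push_cast
      module
  obtain ⟨d, rfl⟩ := Nat.exists_eq_add_of_lt hk
  have : e ^ (n + d + 1) = e ^ d * e ^ (n + 1) := by rw [← pow_add]; congr 1; omega
  rw [this, Module.End.mul_apply, h1, map_zero]

theorem e_pow_ne_zero (hu0 : u ≠ 0) {k : ℕ} (hk : k ≤ n) : (e ^ k) u ≠ 0 := by
  intro h0
  have := t.f_pow_e_pow_self hu k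
  rw [h0, map_zero, eq_comm, smul_eq_zero] at this
  rcases this with h1 | h1
  · have h2 : 0 < k.factorial * n.descFactorial k :=
      mul_pos k.factorial_pos (Nat.descFactorial_pos.mpr hk)
    rw [Nat.cast_eq_zero] at h1
    omega
  · exact hu0 h1

omit hu

/-- The vectors `e ^ k u`, `k ≤ n`, for a basis of `ker f` consisting of lowest weight vectors `u`
of weight `-n`, form a basis of the representation. -/
theorem linearIndependent_chain {β : Type*} [Fintype β] (n : β → ℕ) (u : β → V)
    (hu : ∀ b, u b ∈ lowest h f (n b)) (hli : LinearIndependent ℂ u) :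
    LinearIndependent ℂ fun x : Σ b, Fin (n b + 1) => (e ^ (x.2 : ℕ)) (u x.1) := by
  classical
  rw [Fintype.linearIndependent_iff] at hli ⊢
  intro c hc
  let N := Finset.univ.sup n
  have hN : ∀ b, n b ≤ N := fun b => Finset.le_sup (Finset.mem_univ b)
  have key : ∀ d, ∀ b (k : Fin (n b + 1)), N < k + d → c ⟨b, k⟩ = 0 := by
    intro d
    induction d with
    | zero => intro b k hk; have := hN b; omega
    | succ d ih =>
      intro b k hk
      by_cases hk' : N < k + d
      · exact ih b k hk'
      -- apply `f ^ k` and compare the coefficients of the lowest weight vectors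
      have h1 := congrArg (f ^ (k : ℕ)) hc
      rw [map_zero, map_sum, Fintype.sum_sigma] at h1
      have h2 : ∀ b', ∑ k' : Fin (n b' + 1), (f ^ (k : ℕ)) (c ⟨b', k'⟩ • (e ^ (k' : ℕ)) (u b'))
          = (∑ k' : Fin (n b' + 1), if (k' : ℕ) = k then c ⟨b', k'⟩ *
            (((k : ℕ).factorial * (n b').descFactorial k : ℕ) : ℂ) else 0) • u b' := fun b' => by
        rw [Finset.sum_smul]
        refine Finset.sum_congr rfl fun k' _ => ?_
        rw [map_smul]
        rcases lt_trichotomy (k' : ℕ) k with hlt | heq | hgt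
        · rw [t.f_pow_e_pow_of_lt (hu b') hlt, if_neg hlt.ne, smul_zero, zero_smul]
        · rw [if_pos heq, heq, t.f_pow_e_pow_self (hu b'), smul_smul]
        · rw [ih b' k' (by omega), if_neg hgt.ne', zero_smul, zero_smul]
      simp only [h2] at h1
      have h3 := hli _ h1 b
      rw [Finset.sum_eq_single k, if_pos rfl] at h3
      · rcases mul_eq_zero.mp h3 with h4 | h4
        · exact h4
        · exfalso
          have h5 : 0 < (k : ℕ).factorial * (n b).descFactorial k :=
            mul_pos (Nat.factorial_pos _) (Nat.descFactorial_pos.mpr (by omega))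
          rw [Nat.cast_eq_zero] at h4
          omega
      · intro k' _ hk'
        rw [if_neg (fun h0 => hk' (Fin.ext h0))]
      · simp
  rintro ⟨b, k⟩
  exact key (N + 1) b k (by omega)

/-- The chains of lowest weight vectors that span `ker f` span the representation: the kernel of
`f ^ (j + 1)` is spanned modulo that of `f ^ j` by the vectors `e ^ j w`, where `w` is a lowest weight
vector of weight at most `-j`. -/
theorem span_chain (hn : IsNilpotent f) {β : Type*} (n : β → ℕ) (u : β → V)
    (hu : ∀ b, u b ∈ lowest h f (n b)) (hs : LinearMap.ker f ≤ Submodule.span ℂ (Set.range u)) :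
    ⊤ ≤ Submodule.span ℂ (Set.range fun x : Σ b, Fin (n b + 1) => (e ^ (x.2 : ℕ)) (u x.1)) := by
  set X := Submodule.span ℂ (Set.range fun x : Σ b, Fin (n b + 1) => (e ^ (x.2 : ℕ)) (u x.1))
  have h1 : ∀ j w, f w = 0 → (e ^ j) w ∈ X := by
    intro j w hw
    have h2 : Submodule.span ℂ (Set.range u) ≤ X.comap (e ^ j) := by
      rw [Submodule.span_le]
      rintro _ ⟨b, rfl⟩
      change (e ^ j) (u b) ∈ X
      by_cases hj : j ≤ n b
      · exact Submodule.subset_span ⟨⟨b, ⟨j, by omega⟩⟩, rfl⟩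
      · rw [t.e_pow_eq_zero (hu b) hn (by omega)]
        exact zero_mem _
    exact h2 (hs hw)
  have h2 : ∀ j, LinearMap.ker (f ^ j) ≤ X := by
    intro j
    induction j with
    | zero => intro v hv; have : v = 0 := by simpa using hv
              rw [this]; exact zero_mem _
    | succ j ih =>
      intro v hv
      have h3 : (f ^ j) v ∈ LinearMap.ker f ⊓ LinearMap.range (f ^ j) := by
        refine ⟨?_, v, rfl⟩
        rw [SetLike.mem_coe, LinearMap.mem_ker, ← Module.End.mul_apply, ← pow_succ']
        exact hv
      have h4 : (⨆ i : {i : ℕ // j ≤ i}, lowest h f i) ≤ X.map (f ^ j) := by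
        refine iSup_le fun i w hw => ?_
        have hc : ((j.factorial * (i : ℕ).descFactorial j : ℕ) : ℂ) ≠ 0 := by
          have : 0 < j.factorial * (i : ℕ).descFactorial j :=
            mul_pos j.factorial_pos (Nat.descFactorial_pos.mpr i.2)
          exact_mod_cast this.ne'
        refine ⟨((j.factorial * (i : ℕ).descFactorial j : ℕ) : ℂ)⁻¹ • (e ^ j) w,
          X.smul_mem _ (h1 j w (mem_lowest.mp hw).1), ?_⟩
        rw [map_smul, t.f_pow_e_pow_self hw, inv_smul_smul₀ hc]
      obtain ⟨y, hy, hyv⟩ := h4 (t.ker_inf_range_le hn j h3)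
      have h5 : v - y ∈ LinearMap.ker (f ^ j) := by
        rw [LinearMap.mem_ker, map_sub, hyv, sub_self]
      have := X.add_mem (ih h5) hy
      rwa [sub_add_cancel] at this
  obtain ⟨N, hN⟩ := hn
  intro v _
  exact h2 N (by rw [hN]; simp)

end IsSl2

end Sl2

section Sl2Inner

variable {V : Type*} [AddCommGroup V] [Module ℂ V] [FiniteDimensional ℂ V] {h e f : End ℂ V}

/-- The operator `x ↦ a x - x a`. -/
def adOp (a : End ℂ V) : End ℂ (End ℂ V) := LinearMap.mulLeft ℂ a - LinearMap.mulRight ℂ a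

omit [FiniteDimensional ℂ V] in
theorem adOp_apply (a x : End ℂ V) : adOp a x = a * x - x * a := rfl

omit [FiniteDimensional ℂ V] in
theorem isNilpotent_adOp {a : End ℂ V} (ha : IsNilpotent a) : IsNilpotent (adOp a) :=
  (LinearMap.commute_mulLeft_right a a).isNilpotent_sub
    ((LinearMap.isNilpotent_mulLeft_iff ℂ a).mpr ha)
    ((LinearMap.isNilpotent_mulRight_iff ℂ a).mpr ha)

omit [FiniteDimensional ℂ V] in
theorem adOp_lie (a b : End ℂ V) : adOp a * adOp b - adOp b * adOp a = adOp (a * b - b * a) := by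
  ext1 x
  simp only [LinearMap.sub_apply, Module.End.mul_apply, adOp_apply]
  noncomm_ring

omit [FiniteDimensional ℂ V] in
theorem adOp_smul (c : ℂ) (a : End ℂ V) : adOp (c • a) = c • adOp a := by
  ext1 x
  simp only [LinearMap.smul_apply, adOp_apply, smul_mul_assoc, mul_smul_comm, smul_sub]

omit [FiniteDimensional ℂ V] in
/-- The operator `ad h` does not have the eigenvalue `-2` on the centralizer of `e`. -/
theorem eq_zero_of_adOp_eq {f' x : End ℂ V} (hn : IsNilpotent e)
    (he : h * e - e * h = (2 : ℂ) • e) (ef : e * f' - f' * e = h)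
    (hx : e * x - x * e = 0) (hh : h * x - x * h = -((2 : ℂ) • x)) : x = 0 := by
  refine eq_zero_of_eigenvalue_ne_nat (h := adOp h) (e := adOp e) (f := adOp f') (μ := -2)
    ?_ ?_ (isNilpotent_adOp hn) ?_ hx ?_
  · rw [adOp_lie, he, adOp_smul]
  · rw [adOp_lie, ef]
  · intro k hk
    have : ((2 + k : ℕ) : ℂ) = 0 := by push_cast; rw [← hk]; ring
    have h2 : 2 + k = 0 := by exact_mod_cast this
    omega
  · rw [adOp_apply, hh, neg_smul]

omit [FiniteDimensional ℂ V] in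
/-- In an `𝔰𝔩₂`-triple with nilpotent `e`, the element `f` is determined by `h` and `e`. -/
theorem IsSl2.f_unique {f' : End ℂ V} (hn : IsNilpotent e) (t : IsSl2 h e f) (t' : IsSl2 h e f') :
    f = f' := by
  rw [← sub_eq_zero]
  refine eq_zero_of_adOp_eq hn t.he t.ef ?_ ?_
  · have : e * (f - f') - (f - f') * e = (e * f - f * e) - (e * f' - f' * e) := by noncomm_ring
    rw [this, t.ef, t'.ef, sub_self]
  · have : h * (f - f') - (f - f') * h = (h * f - f * h) - (h * f' - f' * h) := by noncomm_ring
    rw [this, t.hf, t'.hf, smul_sub]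
    abel

/-- Morozov's lemma. The operator `ad h + 2` maps the candidate `f'` into the centralizer of `e` and
is invertible there, so `f'` can be corrected by an element of the centralizer. -/
theorem exists_isSl2_of_lie {f' : End ℂ V} (hn : IsNilpotent e)
    (he : h * e - e * h = (2 : ℂ) • e) (ef : e * f' - f' * e = h) : ∃ f, IsSl2 h e f := by
  have h1 : adOp h * adOp e - adOp e * adOp h = (2 : ℂ) • adOp e := by
    rw [adOp_lie, he, adOp_smul]
  have hmaps : ∀ x ∈ LinearMap.ker (adOp e),
      (adOp h + (2 : ℂ) • (1 : End ℂ (End ℂ V))) x ∈ LinearMap.ker (adOp e) := fun x hx => by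
    rw [LinearMap.add_apply]
    exact add_mem (h_mem_ker h1 hx) (Submodule.smul_mem _ _ hx)
  let g := (adOp h + (2 : ℂ) • (1 : End ℂ (End ℂ V))).restrict hmaps
  have hg : Function.Injective g := by
    rw [← LinearMap.ker_eq_bot, eq_bot_iff]
    rintro ⟨x, hx⟩ hx'
    have h3 : adOp h x + (2 : ℂ) • x = 0 := congrArg Subtype.val hx'
    have : x = 0 := eq_zero_of_adOp_eq hn he ef hx (eq_neg_of_add_eq_zero_left h3)
    simp [this]
  have hx : adOp h f' + (2 : ℂ) • f' ∈ LinearMap.ker (adOp e) := by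
    have h4 := LinearMap.congr_fun h1 f'
    simp only [LinearMap.sub_apply, Module.End.mul_apply, LinearMap.smul_apply] at h4
    have h5 : adOp h (adOp e f') = 0 := by rw [adOp_apply e, ef, adOp_apply, sub_self]
    rw [h5, zero_sub] at h4
    rw [LinearMap.mem_ker, map_add, map_smul, ← h4]
    abel
  obtain ⟨⟨y, hy⟩, hgy⟩ := LinearMap.surjective_of_injective hg ⟨_, hx⟩
  have h6 : adOp h y + (2 : ℂ) • y = adOp h f' + (2 : ℂ) • f' := congrArg Subtype.val hgy
  have h7 : e * y - y * e = 0 := hy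
  refine ⟨f' - y, he, ?_, ?_⟩
  · have h8 : h * (f' - y) - (f' - y) * h = adOp h f' - adOp h y := by
      rw [adOp_apply, adOp_apply]; noncomm_ring
    have h9 : adOp h f' = adOp h y + (2 : ℂ) • y - (2 : ℂ) • f' := by rw [h6]; abel
    rw [h8, h9, smul_sub]
    abel
  · have : e * (f' - y) - (f' - y) * e = (e * f' - f' * e) - (e * y - y * e) := by noncomm_ring
    rw [this, h7, ef, sub_zero]

/-- A finite dimensional representation of `𝔰𝔩₂` has an inner product for which `e` and `f` are
adjoint to each other: make the vectors `e ^ k u` of a basis of chains orthogonal, of suitable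
lengths. -/
theorem IsSl2.exists_inner (t : IsSl2 h e f) (hn : IsNilpotent f) :
    ∃ P : V → V → ℂ, IsInner P ∧ ∀ u v, P (e u) v = P u (f v) := by
  classical
  have hspan : LinearMap.ker f ≤ Submodule.span ℂ (⋃ n, (lowest h f n : Set V)) := by
    rw [← Submodule.iSup_eq_span]
    exact t.ker_le hn
  obtain ⟨s, hs, hspan', hli⟩ := exists_linearIndependent ℂ (⋃ n, (lowest h f n : Set V))
  have hfin : Finite s := hli.finite
  let _ : Fintype s := Fintype.ofFinite s
  have hex : ∀ b : s, ∃ n, (b : V) ∈ lowest h f n := fun b => by simpa using hs b.2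
  choose n hu using hex
  have hli2 := t.linearIndependent_chain n (fun b : s => (b : V)) hu hli
  have hsp2 := t.span_chain hn n (fun b : s => (b : V)) hu (by
    rw [Subtype.range_coe, hspan']; exact hspan)
  let X := Basis.mk hli2 hsp2
  have hX : ∀ x, X x = (e ^ (x.2 : ℕ)) (x.1 : V) := fun x => Basis.mk_apply hli2 hsp2 x
  -- the squared lengths `k! n! / (n - k)!` that are forced by adjointness and `f_pow_succ`
  let w : (Σ b : s, Fin (n b + 1)) → ℝ :=
    fun x => (((x.2 : ℕ).factorial * (n x.1).descFactorial x.2 : ℕ) : ℝ)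
  have hw : ∀ x, 0 < w x := fun x => by
    have : 0 < (x.2 : ℕ).factorial * (n x.1).descFactorial x.2 :=
      mul_pos (Nat.factorial_pos _) (Nat.descFactorial_pos.mpr (by omega))
    change (0 : ℝ) < (((x.2 : ℕ).factorial * (n x.1).descFactorial x.2 : ℕ) : ℝ)
    exact_mod_cast this
  let P : V → V → ℂ := fun u v => ∑ x, (starRingEnd ℂ) (X.repr u x) * ((w x : ℂ) * X.repr v x)
  have hP : IsInner P :=
    { add_right := fun u v v' => by simp [P, mul_add, Finset.sum_add_distrib]
      smul_right := fun u c v => by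
        simp only [P, map_smul, Finsupp.smul_apply, smul_eq_mul, Finset.mul_sum]
        exact Finset.sum_congr rfl fun i _ => by ring
      conj_symm := fun u v => by
        simp only [P, map_sum]
        refine Finset.sum_congr rfl fun i _ => ?_
        rw [map_mul, map_mul, Complex.conj_conj, Complex.conj_ofReal]
        ring
      pos := fun v hv => by
        have : ∃ i, X.repr v i ≠ 0 := by
          by_contra! hc
          exact hv (X.repr.map_eq_zero_iff.mp (Finsupp.ext hc))
        obtain ⟨i, hi⟩ := this
        have h1 : P v v = ((∑ x, w x * Complex.normSq (X.repr v x) : ℝ) : ℂ) := by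
          rw [Complex.ofReal_sum]
          refine Finset.sum_congr rfl fun i _ => ?_
          rw [Complex.ofReal_mul, Complex.normSq_eq_conj_mul_self]
          ring
        rw [h1, Complex.ofReal_re]
        exact Finset.sum_pos' (fun j _ => mul_nonneg (hw j).le (Complex.normSq_nonneg _))
          ⟨i, Finset.mem_univ _, mul_pos (hw i) (Complex.normSq_pos.mpr hi)⟩ }
  refine ⟨P, hP, ?_⟩
  have hPX : ∀ x y, P (X x) (X y) = if x = y then (w x : ℂ) else 0 := fun x y => by
    simp only [P, Basis.repr_self]
    rw [Finset.sum_eq_single x]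
    · by_cases hxy : x = y
      · subst hxy; simp
      · rw [if_neg hxy, Finsupp.single_eq_of_ne hxy]; simp
    · intro z _ hz
      rw [Finsupp.single_eq_of_ne hz]; simp
    · simp
  -- the Gram matrix of the chains, for arbitrary exponents
  have hPe : ∀ (b b' : s) (k k' : ℕ), P ((e ^ k) (b : V)) ((e ^ k') (b' : V)) =
      if b = b' ∧ k = k' then ((k.factorial * (n b).descFactorial k : ℕ) : ℂ) else 0 := by
    intro b b' k k'
    by_cases hk : k ≤ n b
    · by_cases hk' : k' ≤ n b'
      · have h1 := hPX ⟨b, ⟨k, by omega⟩⟩ ⟨b', ⟨k', by omega⟩⟩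
        rw [hX, hX] at h1
        rw [h1]
        by_cases hb : b = b'
        · subst hb
          by_cases hkk : k = k'
          · subst hkk; simp [w]
          · rw [if_neg, if_neg]
            · exact fun hc => hkk hc.2
            · intro hc
              apply hkk
              have := congrArg (fun z : Σ b, Fin (n b + 1) => (z.2 : ℕ)) hc
              exact this
        · rw [if_neg, if_neg]
          · exact fun hc => hb hc.1
          · exact fun hc => hb (congrArg Sigma.fst hc)
      · rw [t.e_pow_eq_zero (hu b') hn (by omega : n b' < k'), hP.zero_right, if_neg]
        rintro ⟨rfl, rfl⟩
        exact hk' hk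
    · rw [t.e_pow_eq_zero (hu b) hn (by omega : n b < k), hP.zero_left,
        Nat.descFactorial_of_lt (by omega : n b < k)]
      simp
  -- adjointness on the basis vectors
  have hbasis : ∀ x y, P (e (X x)) (X y) = P (X x) (f (X y)) := by
    rintro ⟨b, k⟩ ⟨b', ⟨k', hk'⟩⟩
    rw [hX, hX, ← Module.End.mul_apply, ← pow_succ', hPe]
    rcases k' with - | m
    · simp [(mem_lowest.mp (hu b')).1, hP.zero_right]
    · simp only
      rw [t.f_pow_succ (hu b'), hP.smul_right, hPe]
      by_cases hc : b = b' ∧ (k : ℕ) = m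
      · obtain ⟨rfl, rfl⟩ := hc
        rw [if_pos ⟨rfl, rfl⟩, if_pos ⟨rfl, rfl⟩, Nat.factorial_succ, Nat.descFactorial_succ]
        have : (k : ℕ) ≤ n b := by omega
        push_cast [this]
        ring
      · rw [if_neg hc, if_neg (fun h0 => hc ⟨h0.1, by omega⟩), mul_zero]
  intro u v
  rw [← X.sum_repr u, ← X.sum_repr v, map_sum, map_sum, hP.sum_left, hP.sum_left]
  refine Finset.sum_congr rfl fun x _ => ?_
  rw [hP.sum_right, hP.sum_right]
  refine Finset.sum_congr rfl fun y _ => ?_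
  rw [map_smul, map_smul, hP.smul_left, hP.smul_left, hP.smul_right, hP.smul_right, hbasis]

end Sl2Inner

/-! ### Triples in the real Lie algebra -/

section RealTriple

namespace EpsSpace

variable {ε η : ℤˣ} {V : Type*} [AddCommGroup V] [Module ℂ V] (S : EpsSpace ε η V)

theorem eq_of_form_left {u v : V} (h : ∀ w, S.form u w = S.form v w) : u = v := by
  rw [← sub_eq_zero]
  exact S.nondegenerate _ fun w => by rw [map_sub, LinearMap.sub_apply, h, sub_self]

/-- The operators `a` and `a'` are adjoint up to sign for the form. -/
def IsSkewPair (a a' : End ℂ V) : Prop := ∀ u v, S.form (a' u) v = -S.form u (a v)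

/-- The operators `a` and `a'` are conjugate under `J`. -/
def IsConjPair (a a' : End ℂ V) : Prop := ∀ v, a' (S.J v) = S.J (a v)

variable {S} {a a' b b' : End ℂ V}

theorem IsSkewPair.lie (h : S.IsSkewPair a a') (h' : S.IsSkewPair b b') :
    S.IsSkewPair (a * b - b * a) (a' * b' - b' * a') := fun u v => by
  simp only [LinearMap.sub_apply, Module.End.mul_apply, map_sub, h _ _, h' _ _]
  ring

theorem IsSkewPair.add (h : S.IsSkewPair a a') (h' : S.IsSkewPair b b') :
    S.IsSkewPair (a + b) (a' + b') := fun u v => by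
  simp only [LinearMap.add_apply, map_add, h _ _, h' _ _]
  ring

theorem IsSkewPair.smul (h : S.IsSkewPair a a') (c : ℂ) : S.IsSkewPair (c • a) (c • a') :=
  fun u v => by simp only [LinearMap.smul_apply, map_smul, h _ _, smul_neg]

theorem IsSkewPair.neg (h : S.IsSkewPair a a') : S.IsSkewPair (-a) (-a') :=
  fun u v => by simp only [LinearMap.neg_apply, map_neg, h _ _]

theorem IsSkewPair.symm (h : S.IsSkewPair a a') : S.IsSkewPair a' a := fun u v => by
  rw [S.symm, ← neg_eq_iff_eq_neg.mpr (h v u), S.symm u]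
  ring

theorem IsSkewPair.unique (h : S.IsSkewPair a a') (h' : S.IsSkewPair a b) : a' = b := by
  ext u
  exact S.eq_of_form_left fun w => by rw [h, h']

theorem exists_isSkewPair [FiniteDimensional ℂ V] (a : End ℂ V) : ∃ a', S.IsSkewPair a a' := by
  have hinj : Function.Injective S.form := fun u v h =>
    S.eq_of_form_left fun w => LinearMap.congr_fun h w
  let F : V ≃ₗ[ℂ] (V →ₗ[ℂ] ℂ) := LinearEquiv.ofInjectiveOfFinrankEq S.form hinj
    (Subspace.dual_finrank_eq).symm
  let G : V →ₗ[ℂ] (V →ₗ[ℂ] ℂ) := -S.form.compl₂ a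
  refine ⟨F.symm.toLinearMap ∘ₗ G, fun u v => ?_⟩
  have : F (F.symm (G u)) = G u := F.apply_symm_apply _
  exact LinearMap.congr_fun this v

theorem IsConjPair.lie (h : S.IsConjPair a a') (h' : S.IsConjPair b b') :
    S.IsConjPair (a * b - b * a) (a' * b' - b' * a') := fun v => by
  simp only [LinearMap.sub_apply, Module.End.mul_apply, map_sub, h _, h' _]

theorem IsConjPair.add (h : S.IsConjPair a a') (h' : S.IsConjPair b b') :
    S.IsConjPair (a + b) (a' + b') := fun v => by
  simp only [LinearMap.add_apply, map_add, h _, h' _]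

theorem IsConjPair.neg (h : S.IsConjPair a a') : S.IsConjPair (-a) (-a') := fun v => by
  simp only [LinearMap.neg_apply, map_neg, h _]

theorem IsConjPair.smul (h : S.IsConjPair a a') {c : ℂ} (hc : starRingEnd ℂ c = c) :
    S.IsConjPair (c • a) (c • a') := fun v => by
  simp only [LinearMap.smul_apply, map_smulₛₗ, h _, hc]

theorem IsConjPair.symm (h : S.IsConjPair a a') : S.IsConjPair a' a := fun v => by
  apply S.J_inj
  rw [← h, S.J_J, S.J_J, map_smul]

theorem IsConjPair.unique (h : S.IsConjPair a a') (h' : S.IsConjPair a b) : a' = b := by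
  ext u
  obtain ⟨u, rfl⟩ := S.J_surj u
  rw [h, h']

theorem exists_isConjPair (a : End ℂ V) : ∃ a', S.IsConjPair a a' := by
  let a' : End ℂ V :=
    { toFun := fun v => (((ε * η : ℤˣ) : ℤ) : ℂ) • S.J (a (S.J v))
      map_add' := fun u v => by simp only [map_add, smul_add]
      map_smul' := fun c v => by
        simp only [map_smulₛₗ, RingHom.id_apply, Complex.conj_conj]
        rw [smul_comm] }
  refine ⟨a', fun v => ?_⟩
  change (((ε * η : ℤˣ) : ℤ) : ℂ) • S.J (a (S.J (S.J v))) = S.J (a v)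
  rw [S.J_J, map_smul, map_smulₛₗ, conj_units_coe, units_coe_smul_smul]

theorem IsSkewPair.conj (h : S.IsSkewPair a a) (h' : S.IsConjPair a a') : S.IsSkewPair a' a' :=
  fun u v => by
    obtain ⟨u, rfl⟩ := S.J_surj u
    obtain ⟨v, rfl⟩ := S.J_surj v
    rw [h', h', S.form_J, S.form_J, h, map_neg]

/-- The Jacobson–Morozov theorem in the real Lie algebra: average a solution of
`[e, [e, y]] = -2 e` over the two involutions that define this Lie algebra. -/
theorem exists_isSl2_real [FiniteDimensional ℂ V] {e : End ℂ V} (hn : IsNilpotent e)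
    (hs : S.IsSkewPair e e) (hJ : S.IsConjPair e e) :
    ∃ h f, IsSl2 h e f ∧ S.IsSkewPair h h ∧ S.IsSkewPair f f ∧ S.IsConjPair h h ∧
      S.IsConjPair f f := by
  -- the set of solutions is convex and stable under both involutions
  let Sol : End ℂ V → Prop := fun y =>
    e * (e * y - y * e) - (e * y - y * e) * e = -((2 : ℂ) • e)
  have hmid : ∀ y z, Sol y → Sol z → Sol ((1 / 2 : ℂ) • (y + z)) := fun y z hy hz => by
    have h1 : e * (e * ((1 / 2 : ℂ) • (y + z)) - ((1 / 2 : ℂ) • (y + z)) * e) -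
        (e * ((1 / 2 : ℂ) • (y + z)) - ((1 / 2 : ℂ) • (y + z)) * e) * e =
        (1 / 2 : ℂ) • ((e * (e * y - y * e) - (e * y - y * e) * e) +
          (e * (e * z - z * e) - (e * z - z * e) * e)) := by
      simp only [mul_smul_comm, smul_mul_assoc, ← smul_sub]
      congr 1
      noncomm_ring
    change e * (e * ((1 / 2 : ℂ) • (y + z)) - ((1 / 2 : ℂ) • (y + z)) * e) -
        (e * ((1 / 2 : ℂ) • (y + z)) - ((1 / 2 : ℂ) • (y + z)) * e) * e = -((2 : ℂ) • e)
    rw [h1, hy, hz, ← two_smul ℂ, smul_smul]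
    norm_num
  obtain ⟨y, hy⟩ := exists_lie_lie_eq e hn
  obtain ⟨y', hy'⟩ := S.exists_isSkewPair y
  have hSy' : Sol y' := (hs.lie (hs.lie hy')).unique (by rw [hy]; exact (hs.smul 2).neg)
  set z := (1 / 2 : ℂ) • (y + y') with hz
  have hSz : Sol z := hmid y y' hy hSy'
  have hzs : S.IsSkewPair z z := by
    have := (hy'.add hy'.symm).smul (1 / 2 : ℂ)
    rwa [add_comm y' y] at this
  obtain ⟨z', hz'⟩ := S.exists_isConjPair z
  have hSz' : Sol z' := (hJ.lie (hJ.lie hz')).unique (by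
    rw [show e * (e * z - z * e) - (e * z - z * e) * e = -((2 : ℂ) • e) from hSz]
    exact (hJ.smul (map_ofNat _ 2)).neg)
  set w := (1 / 2 : ℂ) • (z + z') with hw
  have hSw : Sol w := hmid z z' hSz hSz'
  have hws : S.IsSkewPair w w := (hzs.add (hzs.conj hz')).smul _
  have hwJ : S.IsConjPair w w := by
    have := (hz'.add hz'.symm).smul (c := (1 / 2 : ℂ)) (by rw [map_div₀, map_one, map_ofNat])
    rwa [add_comm z' z] at this
  set h := e * w - w * e with hh
  have he : h * e - e * h = (2 : ℂ) • e := by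
    rw [← neg_inj, neg_sub]; exact hSw
  obtain ⟨f, t⟩ := exists_isSl2_of_lie hn he rfl
  have hhs : S.IsSkewPair h h := hs.lie hws
  have hhJ : S.IsConjPair h h := hJ.lie hwJ
  refine ⟨h, f, t, hhs, ?_, hhJ, ?_⟩
  -- the element `f` is real since it is determined by `h` and `e`
  · obtain ⟨f', hf'⟩ := S.exists_isSkewPair f
    have t' : IsSl2 h e f' := ⟨he, (hhs.lie hf').unique (by rw [t.hf]; exact (hf'.smul 2).neg),
      (hs.lie hf').unique (by rw [t.ef]; exact hhs)⟩
    rwa [← t.f_unique hn t'] at hf'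
  · obtain ⟨f', hf'⟩ := S.exists_isConjPair f
    have t' : IsSl2 h e f' := ⟨he, (hhJ.lie hf').unique (by
      rw [t.hf]; exact (hf'.smul (map_ofNat _ 2)).neg),
      (hJ.lie hf').unique (by rw [t.ef]; exact hhJ)⟩
    rwa [← t.f_unique hn t'] at hf'

/-- A nilpotent element `e` of the real Lie algebra lies in an `𝔰𝔩₂`-triple of real elements such
that `f` is the image of `e` under the Cartan involution for some choice of `L`. -/
theorem exists_isSl2_cartan [FiniteDimensional ℂ V] {e : End ℂ V} (hn : IsNilpotent e)
    (hs : S.IsSkewPair e e) (hJ : S.IsConjPair e e) :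
    ∃ h f, IsSl2 h e f ∧ S.IsSkewPair h h ∧ S.IsSkewPair f f ∧ S.IsConjPair h h ∧
      S.IsConjPair f f ∧ ∃ S' : EpsSpace ε η V, S'.form = S.form ∧ S'.J = S.J ∧
        ∀ v, S'.L (e v) = -f (S'.L v) := by
  obtain ⟨h, f, t, hhs, hfs, hhJ, hfJ⟩ := S.exists_isSl2_real hn hs hJ
  refine ⟨h, f, t, hhs, hfs, hhJ, hfJ, ?_⟩
  obtain ⟨P, hP, hPe⟩ := t.symm.exists_inner hn
  -- average the inner product over `J`
  let Q : V → V → ℂ := fun u v => P u v + starRingEnd ℂ (P (S.J u) (S.J v))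
  have hPe' : ∀ u v, P (e u) v = P u (f v) := fun u v => by
    rw [← hP.conj_symm, ← hPe, hP.conj_symm]
  have hQ : IsInner Q :=
    { add_right := fun u v w => by simp only [Q, map_add, hP.add_right]; ring
      smul_right := fun u c v => by
        simp only [Q, map_smulₛₗ, hP.smul_right, map_mul, Complex.conj_conj]; ring
      conj_symm := fun u v => by
        simp only [Q, map_add, hP.conj_symm]
      pos := fun v hv => by
        have h1 := hP.pos v hv
        have h2 := hP.pos (S.J v) fun h0 => hv (S.J_inj (by rw [h0, map_zero]))
        simp only [Q, Complex.add_re, Complex.conj_re]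
        linarith }
  have hQJ : ∀ u v, Q (S.J u) (S.J v) = starRingEnd ℂ (Q u v) := fun u v => by
    simp only [Q, S.J_J, hP.smul_left, hP.smul_right, map_add, map_mul, conj_units_coe,
      Complex.conj_conj]
    rw [← mul_assoc, units_coe_mul_self]
    ring
  have hQe : ∀ u v, Q (e u) v = Q u (f v) := fun u v => by
    simp only [Q]
    rw [hPe', ← hJ, ← hfJ, hPe']
  obtain ⟨S', h1, h2, h3⟩ := exists_of_inner S.form S.J S.symm S.nondegenerate S.J_J S.form_J hQ hQJ
  exact ⟨S', h1, h2, h3 e f hQe (fun u v => by rw [hs, neg_add_cancel])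
    (fun u v => by rw [hfs, neg_add_cancel]) hJ hfJ⟩

end EpsSpace

end RealTriple

/-! ### Nilpotent orbits and compatible triples -/

section Orbits

namespace EpsSpace

variable {ε η : ℤˣ} {V : Type*} [NormedAddCommGroup V] [NormedSpace ℂ V]
  (S : EpsSpace ε η V)

/-- The orbit of `X` under the real group. -/
def orbit (X : V →L[ℂ] V) : Set (V →L[ℂ] V) :=
  {Y | ∃ g ∈ S.realGroup, Y = (g : V →L[ℂ] V) * X * ((g⁻¹ : (V →L[ℂ] V)ˣ) : V →L[ℂ] V)}

variable {S}

theorem mem_orbit_self (X : V →L[ℂ] V) : X ∈ S.orbit X := ⟨1, one_mem _, by simp⟩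

theorem orbit_eq_of_mem {X Y : V →L[ℂ] V} (h : Y ∈ S.orbit X) : S.orbit Y = S.orbit X := by
  obtain ⟨g, hg, rfl⟩ := h
  ext Z
  constructor
  · rintro ⟨k, hk, rfl⟩
    refine ⟨k * g, mul_mem hk hg, ?_⟩
    simp only [mul_inv_rev, Units.val_mul, mul_assoc]
  · rintro ⟨k, hk, rfl⟩
    refine ⟨k * g⁻¹, mul_mem hk (inv_mem hg), ?_⟩
    simp only [mul_inv_rev, Units.val_mul, inv_inv, mul_assoc, Units.inv_mul_cancel_left]

theorem conj_mem_iLieReal {X : V →L[ℂ] V} (hX : X ∈ S.iLieReal) {g : (V →L[ℂ] V)ˣ}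
    (hg : g ∈ S.realGroup) :
    (g : V →L[ℂ] V) * X * ((g⁻¹ : (V →L[ℂ] V)ˣ) : V →L[ℂ] V) ∈ S.iLieReal := by
  have hgi := inv_mem hg
  constructor
  · intro u v
    have h1 := hX.1 (((g⁻¹ : (V →L[ℂ] V)ˣ) : V →L[ℂ] V) u) (((g⁻¹ : (V →L[ℂ] V)ˣ) : V →L[ℂ] V) v)
    rw [← hg.1, ← hg.1 (((g⁻¹ : (V →L[ℂ] V)ˣ) : V →L[ℂ] V) u), unit_apply_inv, unit_apply_inv] at h1
    exact h1
  · intro v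
    have h1 := hgi.2 v
    have h2 := hX.2 (((g⁻¹ : (V →L[ℂ] V)ˣ) : V →L[ℂ] V) v)
    simp only [mul_apply_eq_comp]
    rw [h1, h2, map_neg, hg.2]

theorem IsNilOrbit.of_mem {O : Set (V →L[ℂ] V)} (hO : S.IsNilOrbit O) {X : V →L[ℂ] V}
    (hX : X ∈ O) : X ∈ S.iLieReal ∧ IsNilpotent X ∧ O = S.orbit X := by
  obtain ⟨Y, hY, hn, rfl⟩ := hO
  have h1 := orbit_eq_of_mem hX
  obtain ⟨g, hg, rfl⟩ := hX
  refine ⟨conj_mem_iLieReal hY hg, ?_, h1.symm⟩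
  obtain ⟨n, hn⟩ := hn
  refine ⟨n, ?_⟩
  have := Units.conj_pow g Y n
  rw [this, hn]
  simp

theorem isNilOrbit_orbit {X : V →L[ℂ] V} (hX : X ∈ S.iLieReal) (hn : IsNilpotent X) :
    S.IsNilOrbit (S.orbit X) := ⟨X, hX, hn, rfl⟩

/-- An injective isometry commuting with `J`, as an element of the real group. -/
theorem exists_mem_realGroup [FiniteDimensional ℂ V] (s : V →ₗ[ℂ] V)
    (hs : ∀ u v, S.form (s u) (s v) = S.form u v) (hJ : ∀ v, s (S.J v) = S.J (s v)) :
    ∃ g ∈ S.realGroup, ∀ v, (g : V →L[ℂ] V) v = s v := by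
  have hinj : Function.Injective s := by
    rw [← LinearMap.ker_eq_bot, eq_bot_iff]
    intro v hv
    refine S.nondegenerate v fun w => ?_
    rw [← hs, LinearMap.mem_ker.mp hv, map_zero, LinearMap.zero_apply]
  let E := (LinearEquiv.ofInjectiveEndo s hinj).toContinuousLinearEquiv
  let g : (V →L[ℂ] V)ˣ := ContinuousLinearEquiv.toUnit E
  have hg : ∀ v, (g : V →L[ℂ] V) v = s v := fun v => rfl
  exact ⟨g, ⟨fun u v => by rw [hg, hg, hs], fun v => by rw [hg, hg, hJ]⟩, hg⟩

/-- Every nilpotent orbit contains `i e` for some compatible triple. -/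
theorem IsNilOrbit.exists_isCompatibleTriple [FiniteDimensional ℂ V] {O : Set (V →L[ℂ] V)}
    (hO : S.IsNilOrbit O) : ∃ h e f, S.IsCompatibleTriple h e f ∧ Complex.I • e ∈ O := by
  obtain ⟨X, hX, hn, rfl⟩ := hO
  -- the triple of `e = -i X` is compatible with some `L'`; transport it to `L` by an element `g` of
  -- the real group
  let e : End ℂ V := (-Complex.I) • (X : V →ₗ[ℂ] V)
  have he : ∀ v, e v = (-Complex.I) • X v := fun v => rfl
  have hen : IsNilpotent e := by
    obtain ⟨n, hn⟩ := hn
    refine ⟨n, ?_⟩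
    rw [smul_pow, ← ContinuousLinearMap.toLinearMap_pow, hn]
    simp
  have hes : S.IsSkewPair e e := fun u v => by
    have := hX.1 u v
    simp only [he, map_smul, LinearMap.smul_apply, smul_eq_mul]
    linear_combination (-Complex.I) * this
  have heJ : S.IsConjPair e e := fun v => by
    simp only [he, map_smulₛₗ, hX.2, map_neg, Complex.conj_I, neg_neg, smul_neg, neg_smul]
  obtain ⟨h, f, t, hhs, hfs, hhJ, hfJ, S', h1, h2, h3⟩ := exists_isSl2_cartan hen hes heJ
  obtain ⟨s, hs, hsJ, hsL⟩ := S.exists_conj_L S' h1 h2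
  obtain ⟨g, hg, hgs⟩ := exists_mem_realGroup s hs hsJ
  have hgi := inv_mem hg
  let c : End ℂ V → (V →L[ℂ] V) := fun a =>
    (g : V →L[ℂ] V) * LinearMap.toContinuousLinearMap a * ((g⁻¹ : (V →L[ℂ] V)ˣ) : V →L[ℂ] V)
  have hc : ∀ a v, c a v = (g : V →L[ℂ] V) (a (((g⁻¹ : (V →L[ℂ] V)ˣ) : V →L[ℂ] V) v)) := fun a v => rfl
  have hcg : ∀ a v, c a ((g : V →L[ℂ] V) v) = (g : V →L[ℂ] V) (a v) := fun a v => by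
    rw [hc, unit_inv_apply]
  have hsurj : ∀ v, ∃ w, v = (g : V →L[ℂ] V) w := fun v => ⟨_, (unit_apply_inv g v).symm⟩
  have hLg : ∀ v, S.L ((g : V →L[ℂ] V) v) = (g : V →L[ℂ] V) (S'.L v) := fun v => by
    rw [hgs, hgs, hsL]
  have hlie : ∀ a b, c a * c b - c b * c a = c (a * b - b * a) := fun a b => by
    ext v
    obtain ⟨v, rfl⟩ := hsurj v
    simp only [sub_apply, mul_apply_eq_comp, hcg,
      LinearMap.sub_apply, Module.End.mul_apply, map_sub]
  have hsm : ∀ (z : ℂ) a, c (z • a) = z • c a := fun z a => by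
    ext v
    simp only [hc, smul_apply, LinearMap.smul_apply, map_smul]
  have hneg : ∀ a, c (-a) = -c a := fun a => by
    ext v
    simp only [hc, neg_apply, LinearMap.neg_apply, map_neg]
  have hmem : ∀ a, S.IsSkewPair a a → c a ∈ S.lieAlg := fun a ha u v => by
    obtain ⟨u, rfl⟩ := hsurj u
    obtain ⟨v, rfl⟩ := hsurj v
    rw [hcg, hcg, hg.1, hg.1, ha, neg_add_cancel]
  have hJ : ∀ a, S.IsConjPair a a → ∀ v, c a (S.J v) = S.J (c a v) := fun a ha v => by
    obtain ⟨v, rfl⟩ := hsurj v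
    rw [hcg, ← hg.2, hcg, ha, ← hg.2]
  have hLf : ∀ v, S'.L (f v) = -e (S'.L v) := fun v => by
    have h4 := congrArg S'.L (h3 (S'.L v))
    rw [S'.L_L, map_neg, S'.L_L, map_smul, map_smul] at h4
    have h5 := congrArg (fun w => ((η : ℤ) : ℂ) • w) h4
    simp only [smul_neg, units_coe_smul_smul] at h5
    rw [h5, neg_neg]
  have hLh : ∀ v, S'.L (h v) = -h (S'.L v) := fun v => by
    rw [← t.ef]
    simp only [LinearMap.sub_apply, Module.End.mul_apply, map_sub, h3, hLf, map_neg]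
    abel
  have hL : ∀ a b : End ℂ V, (∀ v, S'.L (a v) = -b (S'.L v)) →
      ∀ v, S.L (c a v) = -c b (S.L v) := fun a b hab v => by
    obtain ⟨v, rfl⟩ := hsurj v
    rw [hcg, hLg, hLg, hcg, hab, map_neg]
  refine ⟨c h, c e, c f, ⟨hmem h hhs, hmem e hes, hmem f hfs, ?_, ?_, ?_, hJ h hhJ, hJ e heJ,
    hJ f hfJ, hL h h hLh, hL e f h3, hL f e hLf⟩, g, hg, ?_⟩
  · rw [hlie, t.he, hsm]
  · rw [hlie, t.hf, hneg, hsm]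
  · rw [hlie, t.ef]
  · ext v
    obtain ⟨v, rfl⟩ := hsurj v
    rw [smul_apply, hcg, he, mul_apply_eq_comp,
      mul_apply_eq_comp, unit_inv_apply, map_smul, smul_smul]
    simp

end EpsSpace

end Orbits

section PlusEigenvalue

open EpsSpace

theorem plusEigenvalue_mul_self (η : ℤˣ) : plusEigenvalue η * plusEigenvalue η = ((η : ℤ) : ℂ) := by
  rcases Int.units_eq_one_or η with rfl | rfl <;> simp [plusEigenvalue, show ¬ (-1 : ℤˣ) = 1 by decide]

theorem conj_plusEigenvalue (η : ℤˣ) :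
    (starRingEnd ℂ) (plusEigenvalue η) = ((η : ℤ) : ℂ) * plusEigenvalue η := by
  rcases Int.units_eq_one_or η with rfl | rfl <;> simp [plusEigenvalue, show ¬ (-1 : ℤˣ) = 1 by decide]

theorem plusEigenvalue_ne_zero (η : ℤˣ) : plusEigenvalue η ≠ 0 := by
  intro h
  have h1 := plusEigenvalue_mul_self η
  have h2 := units_coe_mul_self η
  rw [h, mul_zero] at h1
  rw [← h1, mul_zero] at h2
  exact zero_ne_one h2

theorem conj_plusEigenvalue_mul (η : ℤˣ) :
    (starRingEnd ℂ) (plusEigenvalue η) * plusEigenvalue η = 1 := by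
  rw [conj_plusEigenvalue, mul_assoc, plusEigenvalue_mul_self, units_coe_mul_self]

end PlusEigenvalue

/-! ### The Hermitian forms of a nilpotent element -/

namespace EpsSpace

section NilForm

variable {ε η : ℤˣ} {V : Type*} [AddCommGroup V] [Module ℂ V] (S : EpsSpace ε η V)

/-- The operator `X` is self-adjoint for the sesquilinear form `(u, v) ↦ ⟨u, J v⟩`. -/
def IsSelfAdj (X : End ℂ V) : Prop := ∀ u v, S.form (X u) (S.J v) = S.form u (S.J (X v))

/-- The Hermitian form `κ ⟨X ^ j v, J u⟩`, where the eigenvalue `κ` of `L` that counts as `+`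
makes it Hermitian. -/
def nilForm (X : End ℂ V) (j : ℕ) (u v : V) : ℂ :=
  plusEigenvalue η * S.form ((X ^ j) v) (S.J u)

/-- The signature of the form `nilForm`. -/
def nilIndex (X : End ℂ V) (j : ℕ) : ℕ × ℕ :=
  (posIndex (S.nilForm X j), negIndex (S.nilForm X j))

variable {S} {X : End ℂ V}

theorem IsSelfAdj.pow (h : S.IsSelfAdj X) (j : ℕ) (u v : V) :
    S.form ((X ^ j) u) (S.J v) = S.form u (S.J ((X ^ j) v)) := by
  induction j generalizing u v with
  | zero => rfl
  | succ j ih =>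
    rw [pow_succ', Module.End.mul_apply, h, ih, ← Module.End.mul_apply, ← pow_succ,
      ← pow_succ']

theorem IsSelfAdj.isHerm (h : S.IsSelfAdj X) (j : ℕ) : IsHerm (S.nilForm X j) where
  add_right u v w := by simp [nilForm, mul_add]
  smul_right u c v := by simp [nilForm]; ring
  conj_symm u v := by
    rw [nilForm, nilForm, map_mul, ← S.form_J, S.J_J, map_smul, smul_eq_mul, S.symm, h.pow,
      conj_plusEigenvalue, Units.val_mul, Int.cast_mul]
    linear_combination (plusEigenvalue η * S.form v (S.J ((X ^ j) u))) *
      (((ε : ℤ) : ℂ) * ((ε : ℤ) : ℂ) * units_coe_mul_self η + units_coe_mul_self ε)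

/-- The radical of `nilForm X j` is the kernel of `X ^ j`. -/
theorem mem_ker_pow_iff_nilForm (j : ℕ) (u : V) :
    u ∈ LinearMap.ker (X ^ j) ↔ ∀ v, S.nilForm X j v u = 0 := by
  rw [LinearMap.mem_ker]
  constructor
  · intro h v
    rw [nilForm, h, map_zero, LinearMap.zero_apply, mul_zero]
  · intro h
    refine S.nondegenerate _ fun w => ?_
    obtain ⟨v, rfl⟩ := S.J_surj w
    exact (mul_eq_zero.mp (h v)).resolve_left (plusEigenvalue_ne_zero η)

theorem IsSelfAdj.nilIndex_add_finrank_ker [FiniteDimensional ℂ V] (h : S.IsSelfAdj X) (j : ℕ) :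
    (S.nilIndex X j).1 + (S.nilIndex X j).2 + finrank ℂ (LinearMap.ker (X ^ j)) = finrank ℂ V :=
  posIndex_add_negIndex_add (h.isHerm j) _ (mem_ker_pow_iff_nilForm j)

end NilForm

/-! ### Chain bases of a triple -/

section Chains

variable {ε η : ℤˣ} {V : Type*} [AddCommGroup V] [Module ℂ V] (S : EpsSpace ε η V)
  {h e f : End ℂ V}

/-- An `𝔰𝔩₂`-triple in the complex Lie algebra of the isometry group, for which `e` is real and
`f` is the image of `e` under the Cartan involution. -/
structure IsCartanTriple (h e f : End ℂ V) : Prop extends IsSl2 h e f where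
  skew_e : S.IsSkewPair e e
  conj_e : S.IsConjPair e e
  L_e : ∀ v, S.L (e v) = -f (S.L v)
  nil_e : IsNilpotent e

/-- The lowest weight vectors `u` of weight `-n` for which `L u` is `σ κ (-i) ^ n / n! e ^ n u`. -/
def lowestSign (h e f : End ℂ V) (n : ℕ) (σ : ℤˣ) : Submodule ℂ V :=
  lowest h f n ⊓ LinearMap.ker (S.L - (((σ : ℤ) : ℂ) * plusEigenvalue η *
    ((-Complex.I) ^ n / (n.factorial : ℂ))) • e ^ n)

/-- A basis of the kernel of `f` that consists of orthonormal elements `u b` of the spaces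
`lowestSign`. -/
structure IsChainBasis (h e f : End ℂ V) {β : Type*} (n : β → ℕ) (σ : β → ℤˣ) (u : β → V) :
    Prop where
  mem : ∀ b, u b ∈ S.lowestSign h e f (n b) (σ b)
  ip_self : ∀ b, S.ip (u b) (u b) = 1
  ip_ne : ∀ b b', b ≠ b' → S.ip (u b) (u b') = 0
  span : LinearMap.ker f ≤ Submodule.span ℂ (Set.range u)

variable {S}

theorem mem_lowestSign {n : ℕ} {σ : ℤˣ} {u : V} : u ∈ S.lowestSign h e f n σ ↔
    u ∈ lowest h f n ∧ S.L u = (((σ : ℤ) : ℂ) * plusEigenvalue η *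
      ((-Complex.I) ^ n / (n.factorial : ℂ))) • (e ^ n) u := by
  rw [lowestSign, Submodule.mem_inf, LinearMap.mem_ker, LinearMap.sub_apply, LinearMap.smul_apply,
    sub_eq_zero]

namespace IsCartanTriple

variable (t : S.IsCartanTriple h e f)
include t

theorem L_f (v : V) : S.L (f v) = -e (S.L v) := by
  have h4 := congrArg S.L (t.L_e (S.L v))
  rw [S.L_L, map_neg, S.L_L, map_smul, map_smul] at h4
  have h5 := congrArg (fun w => ((η : ℤ) : ℂ) • w) h4
  simp only [smul_neg, units_coe_smul_smul] at h5
  rw [h5, neg_neg]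

theorem L_h (v : V) : S.L (h v) = -h (S.L v) := by
  rw [← t.ef]
  simp only [LinearMap.sub_apply, Module.End.mul_apply, map_sub, t.L_e, t.L_f, map_neg]
  abel

theorem L_e_pow (k : ℕ) (v : V) : S.L ((e ^ k) v) = (-1 : ℂ) ^ k • (f ^ k) (S.L v) := by
  induction k with
  | zero => simp
  | succ k ih =>
    rw [pow_succ', Module.End.mul_apply, t.L_e, ih, map_smul, pow_succ' f, Module.End.mul_apply,
      pow_succ', neg_one_mul, neg_smul]

theorem L_f_pow (k : ℕ) (v : V) : S.L ((f ^ k) v) = (-1 : ℂ) ^ k • (e ^ k) (S.L v) := by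
  induction k with
  | zero => simp
  | succ k ih =>
    rw [pow_succ', Module.End.mul_apply, t.L_f, ih, map_smul, pow_succ' e, Module.End.mul_apply,
      pow_succ', neg_one_mul, neg_smul]

omit t in
theorem L_inj : Function.Injective S.L := fun u v huv => by
  have h1 := congrArg (fun w => ((η : ℤ) : ℂ) • S.L w) huv
  simpa only [S.L_L, units_coe_smul_smul] using h1

theorem nil_f : IsNilpotent f := by
  obtain ⟨k, hk⟩ := t.nil_e
  refine ⟨k, ?_⟩
  ext v
  apply L_inj (S := S)
  rw [t.L_f_pow, hk]
  simp

theorem ip_e (u v : V) : S.ip (e u) v = S.ip u (f v) := by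
  rw [ip, ip, ← t.conj_e, ← neg_eq_iff_eq_neg.mpr (t.skew_e _ _), t.L_f, map_neg,
    LinearMap.neg_apply]

theorem ip_f (u v : V) : S.ip (f u) v = S.ip u (e v) := by
  rw [← S.isInner_ip.conj_symm, ← t.ip_e, S.isInner_ip.conj_symm]

theorem ip_e_pow (k : ℕ) (u v : V) : S.ip ((e ^ k) u) v = S.ip u ((f ^ k) v) := by
  induction k generalizing u v with
  | zero => rfl
  | succ k ih =>
    rw [pow_succ', Module.End.mul_apply, t.ip_e, ih, ← Module.End.mul_apply, ← pow_succ]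

theorem ip_h (u v : V) : S.ip (h u) v = S.ip u (h v) := by
  have hP := S.isInner_ip
  rw [← t.ef]
  simp only [LinearMap.sub_apply, Module.End.mul_apply, hP.sub_left, hP.sub_right, t.ip_e, t.ip_f]

theorem isSelfAdj : S.IsSelfAdj (Complex.I • e) := fun u v => by
  have h1 := t.skew_e u (S.J v)
  rw [t.conj_e] at h1
  simp only [LinearMap.smul_apply, map_smul, map_smulₛₗ S.J, Complex.conj_I, h1, smul_eq_mul]
  ring

/-- The space of lowest weight vectors of weight `-n` is the sum of its parts of sign `1` and `-1`,
since `i ^ n / n! f ^ n L` acts on it by an operator of square `η`. -/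
theorem lowest_le (n : ℕ) : lowest h f n ≤ S.lowestSign h e f n 1 ⊔ S.lowestSign h e f n (-1) := by
  intro u hu
  have hu' := mem_lowest.mp hu
  set κ := plusEigenvalue η with hκ
  have hκκ : κ * κ = ((η : ℤ) : ℂ) := plusEigenvalue_mul_self η
  have hηη := units_coe_mul_self η
  have hfac : (n.factorial : ℂ) ≠ 0 := Nat.cast_ne_zero.mpr n.factorial_ne_zero
  have hII : Complex.I ^ n * (-Complex.I) ^ n = 1 := by
    rw [← mul_pow]; simp
  have hneg : (-Complex.I) ^ n = (-1 : ℂ) ^ n * Complex.I ^ n := by rw [← mul_pow]; simp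
  have hfe : (f ^ n) ((e ^ n) u) = ((n.factorial : ℂ) * n.factorial) • u := by
    rw [t.f_pow_e_pow_self hu, Nat.descFactorial_self, Nat.cast_mul]
  have h11 : (-1 : ℂ) ^ n * (-1) ^ n = 1 := by rw [← mul_pow]; simp
  -- the image `T` of `u` under the operator `i ^ n / n! f ^ n L`
  let T : V := (Complex.I ^ n / (n.factorial : ℂ)) • (f ^ n) (S.L u)
  have hT : T = ((-Complex.I) ^ n / (n.factorial : ℂ)) • S.L ((e ^ n) u) := by
    have h1 : (-Complex.I) ^ n / (n.factorial : ℂ) * (-1) ^ n = Complex.I ^ n / (n.factorial : ℂ) := by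
      rw [hneg]
      linear_combination (Complex.I ^ n / (n.factorial : ℂ)) * h11
    rw [t.L_e_pow, smul_smul, h1]
  have hTmem : T ∈ lowest h f n := by
    refine mem_lowest.mpr ⟨?_, ?_⟩
    · have h1 : f ((f ^ n) (S.L u)) = 0 := by
        have h2 := t.L_e_pow (n + 1) u
        rw [t.e_pow_eq_zero hu t.nil_f (Nat.lt_succ_self n), map_zero] at h2
        have h3 := (smul_eq_zero.mp h2.symm).resolve_left (pow_ne_zero _ (by norm_num))
        rwa [pow_succ', Module.End.mul_apply] at h3
      rw [map_smul, h1, smul_zero]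
    · have h1 := t.h_pow hu n
      have h2 := t.L_h ((e ^ n) u)
      rw [h1, map_smul] at h2
      rw [hT, map_smul, ← neg_eq_iff_eq_neg.mpr h2]
      module
  have hLT : S.L T = (((η : ℤ) : ℂ) * ((-Complex.I) ^ n / (n.factorial : ℂ))) • (e ^ n) u := by
    rw [hT, map_smul, S.L_L, smul_smul, mul_comm]
  have hLu : S.L u = ((-Complex.I) ^ n / (n.factorial : ℂ)) • (e ^ n) T := by
    have h1 : S.L ((f ^ n) ((e ^ n) u)) = (-1 : ℂ) ^ n • (e ^ n) (S.L ((e ^ n) u)) :=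
      t.L_f_pow n _
    have h2 : (e ^ n) T = ((-Complex.I) ^ n / (n.factorial : ℂ)) • (e ^ n) (S.L ((e ^ n) u)) := by
      rw [hT, map_smul]
    have h3 : (e ^ n) (S.L ((e ^ n) u)) = ((-1 : ℂ) ^ n * ((n.factorial : ℂ) * n.factorial)) • S.L u := by
      rw [hfe, map_smul] at h1
      rw [← smul_smul, h1, smul_smul, h11, one_smul]
    rw [h2, h3, smul_smul, smul_smul, mul_assoc]
    have : ((-Complex.I) ^ n / (n.factorial : ℂ)) * (((-Complex.I) ^ n / (n.factorial : ℂ)) *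
        ((-1 : ℂ) ^ n * ((n.factorial : ℂ) * n.factorial))) = 1 := by
      field_simp
      linear_combination hII + ((-Complex.I) ^ n * (-1) ^ n) * hneg + (-Complex.I) ^ n * Complex.I ^ n * h11
    rw [this, one_smul]
  clear_value T
  have key : ∀ σ : ℤˣ, u + (((σ : ℤ) : ℂ) * ((η : ℤ) : ℂ) * κ) • T ∈ S.lowestSign h e f n σ := by
    intro σ
    refine mem_lowestSign.mpr ⟨add_mem hu (Submodule.smul_mem _ _ hTmem), ?_⟩
    rw [← hκ, map_add, map_smul, hLT, hLu, map_add, map_smul, smul_add, smul_smul,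
      smul_smul]
    have hσ := units_coe_mul_self σ
    have e1 : ((σ : ℤ) : ℂ) * ((η : ℤ) : ℂ) * κ * (((η : ℤ) : ℂ) * ((-Complex.I) ^ n / (n.factorial : ℂ)))
        = ((σ : ℤ) : ℂ) * κ * ((-Complex.I) ^ n / (n.factorial : ℂ)) := by
      linear_combination (((σ : ℤ) : ℂ) * κ * ((-Complex.I) ^ n / (n.factorial : ℂ))) * hηη
    have e2 : ((σ : ℤ) : ℂ) * κ * ((-Complex.I) ^ n / (n.factorial : ℂ)) *
        (((σ : ℤ) : ℂ) * ((η : ℤ) : ℂ) * κ) = (-Complex.I) ^ n / (n.factorial : ℂ) := by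
      linear_combination ((-Complex.I) ^ n / (n.factorial : ℂ)) *
        (((σ : ℤ) : ℂ) * ((σ : ℤ) : ℂ) * ((η : ℤ) : ℂ) * hκκ + ((σ : ℤ) : ℂ) * ((σ : ℤ) : ℂ) * hηη + hσ)
    rw [e1, e2, add_comm]
  have hu2 : u = (1 / 2 : ℂ) • (u + ((((1 : ℤˣ) : ℤ) : ℂ) * ((η : ℤ) : ℂ) * κ) • T) +
      (1 / 2 : ℂ) • (u + ((((-1 : ℤˣ) : ℤ) : ℂ) * ((η : ℤ) : ℂ) * κ) • T) := by
    push_cast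
    module
  rw [hu2]
  exact Submodule.add_mem_sup (Submodule.smul_mem _ _ (key 1)) (Submodule.smul_mem _ _ (key (-1)))

/-- The spaces `lowestSign` are pairwise orthogonal: those of different weights since `h` is
self-adjoint, those of different signs since `L` is unitary. -/
theorem ip_lowestSign {n n' : ℕ} {σ σ' : ℤˣ} {u u' : V} (hu : u ∈ S.lowestSign h e f n σ)
    (hu' : u' ∈ S.lowestSign h e f n' σ') (hne : n ≠ n' ∨ σ ≠ σ') : S.ip u u' = 0 := by
  have hP := S.isInner_ip
  obtain ⟨h1, h2⟩ := mem_lowestSign.mp hu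
  obtain ⟨h1', h2'⟩ := mem_lowestSign.mp hu'
  by_cases hn : n = n'
  · subst hn
    have hσ : σ' = -σ := by
      rcases Int.units_eq_one_or σ with rfl | rfl <;> rcases Int.units_eq_one_or σ' with rfl | rfl <;>
        simp_all
    have h3 := S.ip_L u u'
    have hfac : (n.factorial : ℂ) ≠ 0 := Nat.cast_ne_zero.mpr n.factorial_ne_zero
    rw [h2, h2', hP.smul_left, hP.smul_right, t.ip_e_pow, t.f_pow_e_pow_self h1', hP.smul_right,
      Nat.descFactorial_self, hσ] at h3
    have hκ := conj_plusEigenvalue_mul η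
    have hII : Complex.I ^ n * (-Complex.I) ^ n = 1 := by
      rw [← mul_pow]; simp
    have hσσ := units_coe_mul_self σ
    simp only [map_mul, map_div₀, map_pow, map_neg, Complex.conj_I, neg_neg, conj_units_coe,
      map_natCast, Units.val_neg, Int.cast_neg, Nat.cast_mul] at h3
    have h4 : ((σ : ℤ) : ℂ) * (starRingEnd ℂ) (plusEigenvalue η) * (Complex.I ^ n / (n.factorial : ℂ)) *
        (-((σ : ℤ) : ℂ) * plusEigenvalue η * ((-Complex.I) ^ n / (n.factorial : ℂ)) *
        (((n.factorial : ℂ) * n.factorial) * S.ip u u')) = - S.ip u u' := by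
      field_simp
      linear_combination -S.ip u u' * (((starRingEnd ℂ) (plusEigenvalue η) * plusEigenvalue η) *
        (Complex.I ^ n * (-Complex.I) ^ n) * hσσ + (Complex.I ^ n * (-Complex.I) ^ n) * hκ + hII)
    rw [h4] at h3
    linear_combination (-1 / 2 : ℂ) * h3
  · have h3 := t.ip_h u u'
    rw [(mem_lowest.mp h1).2, (mem_lowest.mp h1').2, ← neg_smul, ← neg_smul, hP.smul_left,
      hP.smul_right] at h3
    simp only [map_neg, map_natCast] at h3
    have h4 : ((n' : ℂ) - n) * S.ip u u' = 0 := by linear_combination h3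
    refine (mul_eq_zero.mp h4).resolve_left ?_
    exact fun h0 => hn (by exact_mod_cast (sub_eq_zero.mp h0).symm)

/-- Take orthonormal bases of the spaces `lowestSign`. -/
theorem exists_isChainBasis [FiniteDimensional ℂ V] : ∃ (β : Type) (_ : Fintype β) (n : β → ℕ)
    (σ : β → ℤˣ) (u : β → V), S.IsChainBasis h e f n σ u := by
  classical
  obtain ⟨N, hN⟩ := t.nil_e
  have hbd : ∀ n, N ≤ n → lowest h f n = ⊥ := fun n hn => by
    rw [eq_bot_iff]
    intro u hu
    by_contra hne
    refine t.e_pow_ne_zero hu hne hn ?_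
    rw [hN, LinearMap.zero_apply]
  choose b hb using fun p : Fin N × ℤˣ =>
    S.isInner_ip.exists_orthonormal_basis (S.lowestSign h e f p.1 p.2)
  let β := Σ p : Fin N × ℤˣ, Fin (finrank ℂ (S.lowestSign h e f p.1 p.2))
  refine ⟨β, inferInstance, fun x => x.1.1, fun x => x.1.2, fun x => (b x.1 x.2 : V),
    ⟨fun x => (b x.1 x.2).2, fun x => ?_, ?_, ?_⟩⟩
  · simpa using hb x.1 x.2 x.2
  · rintro ⟨p, i⟩ ⟨p', i'⟩ hne
    by_cases hp : p = p'
    · subst hp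
      have hi : i ≠ i' := fun h0 => hne (by rw [h0])
      simpa [hi] using hb p i i'
    · refine t.ip_lowestSign (b p i).2 (b p' i').2 ?_
      by_contra! hc
      exact hp (Prod.ext (Fin.ext hc.1) hc.2)
  · refine (t.ker_le t.nil_f).trans (iSup_le fun n => ?_)
    by_cases hn : N ≤ n
    · rw [hbd n hn]; exact bot_le
    push Not at hn
    refine (t.lowest_le n).trans ?_
    have key : ∀ σ : ℤˣ, S.lowestSign h e f n σ ≤ Submodule.span ℂ (Set.range fun x : β =>
        (b x.1 x.2 : V)) := by
      intro σ u hu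
      have h1 := (b (⟨n, hn⟩, σ)).sum_repr ⟨u, hu⟩
      have h2 := congrArg Subtype.val h1
      rw [AddSubmonoidClass.coe_finsetSum] at h2
      rw [← show _ = u from h2]
      exact Submodule.sum_mem _ fun i _ => Submodule.smul_mem _ _
        (Submodule.subset_span ⟨⟨(⟨n, hn⟩, σ), i⟩, rfl⟩)
    exact sup_le (key 1) (key (-1))

end IsCartanTriple

end Chains

end EpsSpace

/-! ### The signatures of the Hermitian forms on chains -/

namespace EpsSpace

section ChainIndex

variable {ε η : ℤˣ} {V : Type*} [AddCommGroup V] [Module ℂ V]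
  {S : EpsSpace ε η V} {h e f : End ℂ V}

/-- The number of positive squares that a chain of length `n + 1` and of sign `τ` contributes to
the form `nilForm X j`. -/
def posCount (τ : ℤˣ) (n j : ℕ) : ℕ := if τ = 1 then (n + 2 - j) / 2 else (n + 1 - j) / 2

theorem posCount_add (τ : ℤˣ) (n j : ℕ) :
    posCount τ n j + posCount (-τ) n j + min j (n + 1) = n + 1 := by
  rcases Int.units_eq_one_or τ with rfl | rfl <;>
    simp only [posCount, neg_neg, if_true, show ¬ (-1 : ℤˣ) = 1 by decide, if_false] <;> omega

namespace IsChainBasis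

variable {β : Type*} {n : β → ℕ} {σ : β → ℤˣ} {u : β → V}
  (t : S.IsCartanTriple h e f) (c : S.IsChainBasis h e f n σ u)
include t c

omit t in
theorem mem_lowest (b : β) : u b ∈ lowest h f (n b) := (mem_lowestSign.mp (c.mem b)).1

omit t in
theorem L_apply (b : β) : S.L (u b) = (((σ b : ℤ) : ℂ) * plusEigenvalue η *
    ((-Complex.I) ^ n b / ((n b).factorial : ℂ))) • (e ^ n b) (u b) :=
  (mem_lowestSign.mp (c.mem b)).2

omit t in
theorem ip_apply [DecidableEq β] (b b' : β) : S.ip (u b) (u b') = if b = b' then 1 else 0 := by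
  split_ifs with hb
  · rw [hb, c.ip_self]
  · exact c.ip_ne b b' hb

omit t in
theorem linearIndependent : LinearIndependent ℂ u := by
  classical
  exact S.isInner_ip.linearIndependent_of_orthonormal u c.ip_apply

theorem linearIndependent_chain [Fintype β] :
    LinearIndependent ℂ fun x : Σ b, Fin (n b + 1) => (e ^ (x.2 : ℕ)) (u x.1) :=
  t.toIsSl2.linearIndependent_chain n u c.mem_lowest c.linearIndependent

/-- The basis formed by the chains. -/
def basis [Fintype β] : Basis (Σ b, Fin (n b + 1)) ℂ V :=
  Basis.mk (c.linearIndependent_chain t) (t.toIsSl2.span_chain t.nil_f n u c.mem_lowest c.span)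

theorem basis_apply [Fintype β] (x : Σ b, Fin (n b + 1)) :
    c.basis t x = (e ^ (x.2 : ℕ)) (u x.1) := Basis.mk_apply _ _ _

theorem sum_eq_finrank [Fintype β] : ∑ b, (n b + 1) = finrank ℂ V := by
  rw [finrank_eq_card_basis (c.basis t), Fintype.card_sigma]
  simp

/-- The vectors of the chains are pairwise orthogonal. -/
theorem ip_chain [DecidableEq β] (b b' : β) (k k' : ℕ) :
    S.ip ((e ^ k) (u b)) ((e ^ k') (u b')) =
      if b = b' ∧ k = k' then ((k.factorial * (n b).descFactorial k : ℕ) : ℂ) else 0 := by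
  have hP := S.isInner_ip
  have key : ∀ b b' k k', k' < k → S.ip ((e ^ k) (u b)) ((e ^ k') (u b')) = 0 := by
    intro b b' k k' hk
    rw [t.ip_e_pow, t.f_pow_e_pow_of_lt (c.mem_lowest b') hk, hP.zero_right]
  rcases lt_trichotomy k k' with hk | hk | hk
  · rw [← hP.conj_symm, key _ _ _ _ hk, map_zero, if_neg (fun h0 => hk.ne h0.2)]
  · subst hk
    rw [t.ip_e_pow, t.f_pow_e_pow_self (c.mem_lowest b'), hP.smul_right, c.ip_apply]
    by_cases hb : b = b'
    · subst hb; simp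
    · simp [hb]
  · rw [key _ _ _ _ hk, if_neg (fun h0 => hk.ne' h0.2)]

/-- The forms `nilForm` on the chains. -/
theorem form_chain [DecidableEq β] (b b' : β) (m : ℕ) :
    plusEigenvalue η * S.form (((Complex.I • e) ^ m) (u b)) (S.J (u b')) =
      if b = b' ∧ m = n b then (((σ b * (-1) ^ n b : ℤˣ) : ℤ) : ℂ) * ((n b).factorial : ℂ) else 0 := by
  have hP := S.isInner_ip
  rw [S.form_eq_ip, smul_pow, LinearMap.smul_apply, map_smul, t.L_e_pow, c.L_apply, map_smul,
    hP.smul_right, hP.smul_right, hP.smul_right, ← t.ip_e_pow, c.ip_chain t]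
  by_cases hc : b' = b ∧ m = n b
  · obtain ⟨rfl, rfl⟩ := hc
    have hfac : ((n b').factorial : ℂ) ≠ 0 := Nat.cast_ne_zero.mpr (Nat.factorial_ne_zero _)
    have hII : Complex.I ^ n b' * (-Complex.I) ^ n b' = 1 := by rw [← mul_pow]; simp
    simp only [and_self, if_true, Nat.descFactorial_self]
    have hd : (-Complex.I) ^ n b' / ((n b').factorial : ℂ) *
        (((n b').factorial : ℂ) * ((n b').factorial : ℂ)) =
        (-Complex.I) ^ n b' * ((n b').factorial : ℂ) := by field_simp
    have h1 := plusEigenvalue_mul_self η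
    push_cast
    linear_combination (plusEigenvalue η * ((η : ℤ) : ℂ) * Complex.I ^ n b' * (-1) ^ n b' *
      ((σ b' : ℤ) : ℂ) * plusEigenvalue η) * hd +
      (((n b').factorial : ℂ) * ((σ b' : ℤ) : ℂ) * (-1) ^ n b') *
      (((η : ℤ) : ℂ) * (Complex.I ^ n b' * (-Complex.I) ^ n b') * h1 +
        (Complex.I ^ n b' * (-Complex.I) ^ n b') * units_coe_mul_self η + hII)
  · rw [if_neg hc, if_neg (fun h0 => hc ⟨h0.1.symm, h0.2⟩)]
    ring

theorem nilForm_chain [DecidableEq β] (b b' : β) (j k k' : ℕ) :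
    S.nilForm (Complex.I • e) j (((Complex.I • e) ^ k) (u b)) (((Complex.I • e) ^ k') (u b')) =
      if b = b' ∧ j + k + k' = n b then
        (((σ b * (-1) ^ n b : ℤˣ) : ℤ) : ℂ) * ((n b).factorial : ℂ) else 0 := by
  have h1 : ((Complex.I • e) ^ j) (((Complex.I • e) ^ k') (u b')) =
      ((Complex.I • e) ^ (j + k')) (u b') := by rw [pow_add, Module.End.mul_apply]
  rw [nilForm, ← t.isSelfAdj.pow, h1, ← Module.End.mul_apply, ← pow_add, c.form_chain t]
  by_cases hb : b = b'
  · subst hb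
    simp only [true_and]
    congr 1
    simp only [eq_iff_iff]
    constructor <;> intro h0 <;> omega
  · rw [if_neg (fun h0 => hb h0.1.symm), if_neg (fun h0 => hb h0.1)]

/-- Symmetric and antisymmetric combinations of opposite vectors in the chains diagonalize
`nilForm`. -/
theorem sum_posCount_le [Fintype β] [FiniteDimensional ℂ V] (j : ℕ) (ρ : ℤˣ) :
    ∑ b, posCount (ρ * (σ b * (-1) ^ n b)) (n b) j ≤
      posIndex fun v w => ((ρ : ℤ) : ℂ) * S.nilForm (Complex.I • e) j v w := by
  classical
  have hH := t.isSelfAdj.isHerm j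
  have hch := c.nilForm_chain t
  set X := Complex.I • e with hX
  -- the form pairs `X ^ k u` with `X ^ (n - j - k) u`; the combination `z` of these two vectors
  -- with the sign `ρ τ` has a square of sign `ρ`
  let τ : β → ℤˣ := fun b => σ b * (-1) ^ n b
  let z : (Σ b, Fin (posCount (ρ * τ b) (n b) j)) → V := fun x =>
    (X ^ (x.2 : ℕ)) (u x.1) + (((ρ * τ x.1 : ℤˣ) : ℤ) : ℂ) • (X ^ (n x.1 - j - x.2)) (u x.1)
  have hbd : ∀ x : Σ b, Fin (posCount (ρ * τ b) (n b) j),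
      2 * (x.2 : ℕ) + j ≤ n x.1 ∧ (2 * (x.2 : ℕ) + j = n x.1 → ρ * τ x.1 = 1) := by
    rintro ⟨b, i, hi⟩
    simp only [posCount] at hi ⊢
    split_ifs at hi with h1
    · refine ⟨by omega, fun _ => h1⟩
    · refine ⟨by omega, fun _ => by omega⟩
  have hform : ∀ x y, S.nilForm X j (z x) (z y) =
      if x = y then ((ρ : ℤ) : ℂ) * ((n x.1).factorial : ℂ) *
        (2 + if 2 * (x.2 : ℕ) + j = n x.1 then 2 else 0) else 0 := by
    rintro ⟨b, i⟩ ⟨b', i'⟩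
    have hb1 := hbd ⟨b, i⟩
    have hb2 := hbd ⟨b', i'⟩
    simp only at hb1 hb2
    simp only [z, hH.add_left, hH.add_right, hH.smul_left, hH.smul_right, conj_units_coe, hch]
    by_cases hbb : b = b'
    · subst hbb
      have hρ := units_coe_mul_self ρ
      have hτ := units_coe_mul_self (τ b)
      have hτe : ((σ b * (-1) ^ n b : ℤˣ) : ℤ) = (τ b : ℤ) := rfl
      by_cases hii : i = i'
      · subst hii
        have h3 : j + (i : ℕ) + (n b - j - i) = n b := by omega
        have h4 : j + (n b - j - i) + (i : ℕ) = n b := by omega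
        by_cases hm : 2 * (i : ℕ) + j = n b
        · have h1 : j + (i : ℕ) + i = n b := by omega
          have h2 : j + (n b - j - i) + (n b - j - i) = n b := by omega
          have h5 : ((ρ : ℤ) : ℂ) * ((τ b : ℤ) : ℂ) = 1 := by
            have := congrArg (fun z : ℤˣ => ((z : ℤ) : ℂ)) (hb1.2 hm)
            simpa only [Units.val_mul, Int.cast_mul, Units.val_one, Int.cast_one] using this
          simp only [h1, h2, h3, h4, hm, and_self, if_true]
          rw [hτe]
          have h6 : ((τ b : ℤ) : ℂ) = ((ρ : ℤ) : ℂ) := by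
            linear_combination ((ρ : ℤ) : ℂ) * h5 - ((τ b : ℤ) : ℂ) * hρ
          rw [Units.val_mul ρ (τ b), Int.cast_mul, h6]
          linear_combination ((n b).factorial : ℂ) * (((ρ : ℤ) : ℂ) + ((ρ : ℤ) : ℂ) *
            (((ρ : ℤ) : ℂ) * ((ρ : ℤ) : ℂ) + 1) + ((ρ : ℤ) : ℂ)) * hρ
        · have h1 : ¬ j + (i : ℕ) + i = n b := by omega
          have h2 : ¬ j + (n b - j - i) + (n b - j - i) = n b := by omega
          simp only [h1, h2, h3, h4, hm, and_self, if_true, if_false, and_false]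
          rw [hτe, Units.val_mul ρ (τ b), Int.cast_mul]
          linear_combination 2 * ((ρ : ℤ) : ℂ) * ((n b).factorial : ℂ) * hτ
      · have hii' : (i : ℕ) ≠ i' := fun h0 => hii (Fin.ext h0)
        have h1 : ¬ j + (i : ℕ) + i' = n b := by omega
        have h2 : ¬ j + (i : ℕ) + (n b - j - i') = n b := by omega
        have h3 : ¬ j + (n b - j - i) + (i' : ℕ) = n b := by omega
        have h4 : ¬ j + (n b - j - i) + (n b - j - i') = n b := by omega
        simp [h1, h2, h3, h4, hii]
    · have : ¬ ((⟨b, i⟩ : Σ b, Fin (posCount (ρ * τ b) (n b) j)) = ⟨b', i'⟩) :=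
        fun h0 => hbb (congrArg Sigma.fst h0)
      simp [hbb, this]
  have hH' : IsHerm fun v w => ((ρ : ℤ) : ℂ) * S.nilForm X j v w :=
    { add_right := fun u v w => by rw [hH.add_right, mul_add]
      smul_right := fun u a v => by rw [hH.smul_right]; ring
      conj_symm := fun u v => by rw [map_mul, conj_units_coe, hH.conj_symm] }
  have := card_le_posIndex hH' z (fun x y hxy => by rw [hform, if_neg hxy, mul_zero]) (fun x => by
    rw [hform, if_pos rfl]
    have h1 : ((ρ : ℤ) : ℂ) * (((ρ : ℤ) : ℂ) * ((n x.1).factorial : ℂ) *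
        (2 + if 2 * (x.2 : ℕ) + j = n x.1 then 2 else 0)) =
        (((n x.1).factorial * (2 + if 2 * (x.2 : ℕ) + j = n x.1 then 2 else 0) : ℕ) : ℂ) := by
      push_cast
      linear_combination ((n x.1).factorial : ℂ) *
        (2 + if 2 * (x.2 : ℕ) + j = n x.1 then 2 else 0) * units_coe_mul_self ρ
    rw [h1, Complex.natCast_re, Nat.cast_pos]
    exact mul_pos (Nat.factorial_pos _) (by omega))
  rw [Fintype.card_sigma] at this
  simpa using this

/-- The last `j` vectors of each chain lie in the kernel of `e ^ j`. -/
theorem le_finrank_ker_pow [Fintype β] [FiniteDimensional ℂ V] (j : ℕ) :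
    ∑ b, min j (n b + 1) ≤ finrank ℂ (LinearMap.ker ((Complex.I • e) ^ j)) := by
  let g : (Σ b, Fin (min j (n b + 1))) → Σ b, Fin (n b + 1) := fun x =>
    ⟨x.1, ⟨n x.1 - x.2, by omega⟩⟩
  have hg : Function.Injective g := by
    rintro ⟨b, i⟩ ⟨b', i'⟩ hx
    have hb : b = b' := congrArg Sigma.fst hx
    subst hb
    have hi : n b - (i : ℕ) = n b - i' := congrArg (fun x : Σ b, Fin (n b + 1) => (x.2 : ℕ)) hx
    have : i = i' := Fin.ext (by omega)
    rw [this]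
  have hli := (c.linearIndependent_chain t).comp g hg
  have h1 := finrank_span_eq_card hli
  rw [Fintype.card_sigma] at h1
  simp only [Fintype.card_fin] at h1
  rw [← h1]
  apply Submodule.finrank_mono
  rw [Submodule.span_le]
  rintro _ ⟨⟨b, i⟩, rfl⟩
  rw [SetLike.mem_coe, LinearMap.mem_ker, smul_pow, LinearMap.smul_apply]
  change Complex.I ^ j • (e ^ j) ((e ^ (n b - (i : ℕ))) (u b)) = 0
  rw [← Module.End.mul_apply, ← pow_add, t.e_pow_eq_zero (c.mem_lowest b) t.nil_f (by omega),
    smul_zero]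

/-- The lower bounds for the two indices and for the dimension of the radical add up to the
dimension of the space, so that they are equalities. -/
theorem nilIndex_eq [Fintype β] [FiniteDimensional ℂ V] (j : ℕ) :
    S.nilIndex (Complex.I • e) j = (∑ b, posCount (σ b * (-1) ^ n b) (n b) j,
      ∑ b, posCount (-(σ b * (-1) ^ n b)) (n b) j) ∧
    finrank ℂ (LinearMap.ker ((Complex.I • e) ^ j)) = ∑ b, min j (n b + 1) := by
  have h1 := c.sum_posCount_le t j 1
  have h2 := c.sum_posCount_le t j (-1)
  have h3 := c.le_finrank_ker_pow t j
  have h4 := t.isSelfAdj.nilIndex_add_finrank_ker j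
  simp only [one_mul, Units.val_one, Int.cast_one, neg_mul, Units.val_neg, Int.cast_neg] at h1 h2
  rw [← c.sum_eq_finrank t, ← Finset.sum_congr rfl fun b _ => posCount_add (σ b * (-1) ^ n b) (n b) j,
    Finset.sum_add_distrib, Finset.sum_add_distrib] at h4
  change _ ≤ (S.nilIndex (Complex.I • e) j).1 at h1
  change _ ≤ (S.nilIndex (Complex.I • e) j).2 at h2
  refine ⟨Prod.ext ?_ ?_, ?_⟩ <;> (try dsimp only) <;> omega

end IsChainBasis

end ChainIndex

end EpsSpace

/-! ### Eigenspaces of `L` on the subquotients -/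

namespace EpsSpace

section Signature

variable {ε η : ℤˣ} {V : Type*} [AddCommGroup V] [Module ℂ V] [FiniteDimensional ℂ V]
  (S : EpsSpace ε η V)

/-- The eigenspaces of `L` on a subquotient are independent. -/
theorem eigenDim_add_le {A B : Submodule ℂ V} (hBA : B ≤ A) (hL : ∀ v ∈ B, S.L v ∈ B) {μ : ℂ}
    (hμ : μ ≠ 0) : S.eigenDim A B μ + S.eigenDim A B (-μ) + finrank ℂ B ≤ finrank ℂ A := by
  have h1 : finrank ℂ (A.map B.mkQ) + finrank ℂ B = finrank ℂ A := by
    rw [← LinearMap.finrank_range_add_finrank_ker (B.mkQ.domRestrict A)]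
    congr 1
    · rw [LinearMap.range_domRestrict]
    · rw [LinearMap.ker_domRestrict, Submodule.ker_mkQ, ← Submodule.finrank_map_subtype_eq,
        Submodule.map_comap_subtype, inf_eq_right.mpr hBA]
  rw [← h1]
  refine Nat.add_le_add_right ?_ _
  have hle : ∀ ν : ℂ, (A ⊓ B.comap (S.L - ν • LinearMap.id)).map B.mkQ ≤ A.map B.mkQ := fun ν =>
    Submodule.map_mono inf_le_left
  have hd : (A ⊓ B.comap (S.L - μ • LinearMap.id)).map B.mkQ ⊓
      (A ⊓ B.comap (S.L - (-μ) • LinearMap.id)).map B.mkQ = ⊥ := by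
    rw [eq_bot_iff]
    rintro _ ⟨⟨v, ⟨-, hv⟩, rfl⟩, w, ⟨-, hw⟩, hvw⟩
    have hvw' : w - v ∈ B := (Submodule.Quotient.eq B).mp hvw
    have hv' : S.L v - μ • v ∈ B := hv
    have hw' : S.L w - (-μ) • w ∈ B := hw
    have h2 : (2 * μ) • v ∈ B := by
      have h3 := B.sub_mem (B.sub_mem (B.sub_mem hw' hv') (hL _ hvw')) (B.smul_mem μ hvw')
      rw [map_sub] at h3
      convert h3 using 1
      module
    have h3 := B.smul_mem (2 * μ)⁻¹ h2
    rw [smul_smul, inv_mul_cancel₀ (mul_ne_zero two_ne_zero hμ), one_smul] at h3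
    rw [Submodule.mem_bot]
    exact (Submodule.Quotient.mk_eq_zero B).mpr h3
  have h2 := Submodule.finrank_sup_add_finrank_inf_eq
    ((A ⊓ B.comap (S.L - μ • LinearMap.id)).map B.mkQ)
    ((A ⊓ B.comap (S.L - (-μ) • LinearMap.id)).map B.mkQ)
  rw [hd, finrank_bot, add_zero] at h2
  rw [eigenDim, eigenDim, ← h2]
  exact Submodule.finrank_mono (sup_le (hle _) (hle _))

omit [FiniteDimensional ℂ V] in
theorem finrank_ker_eq_of_intertwine {A B : End ℂ V} (M : V ≃ₗ[ℂ] V) {a : ℂ} (ha : a ≠ 0)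
    (hM : ∀ v, A (M v) = a • M (B v)) : finrank ℂ (LinearMap.ker A) = finrank ℂ (LinearMap.ker B) := by
  have : LinearMap.ker A = (LinearMap.ker B).map (M : V →ₗ[ℂ] V) := by
    ext v
    constructor
    · intro hv
      refine ⟨M.symm v, ?_, M.apply_symm_apply v⟩
      have h1 := hM (M.symm v)
      rw [M.apply_symm_apply, LinearMap.mem_ker.mp hv, eq_comm, smul_eq_zero] at h1
      exact M.map_eq_zero_iff.mp (h1.resolve_left ha)
    · rintro ⟨w, hw, rfl⟩
      rw [SetLike.mem_coe, LinearMap.mem_ker] at hw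
      rw [LinearMap.mem_ker, LinearEquiv.coe_coe, hM, hw, map_zero, smul_zero]
  rw [this]
  exact LinearEquiv.finrank_map_eq M _

end Signature

section ChainSignature

variable {ε η : ℤˣ} {V : Type*} [AddCommGroup V] [Module ℂ V] [FiniteDimensional ℂ V]
  {S : EpsSpace ε η V} {h e f : End ℂ V}

theorem IsCartanTriple.finrank_ker_f_pow (t : S.IsCartanTriple h e f) (j : ℕ) :
    finrank ℂ (LinearMap.ker (f ^ j)) = finrank ℂ (LinearMap.ker ((Complex.I • e) ^ j)) := by
  let L : V ≃ₗ[ℂ] V := LinearEquiv.ofInjectiveEndo S.L L_inj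
  refine finrank_ker_eq_of_intertwine L (pow_ne_zero j Complex.I_ne_zero) fun v => ?_
  change (f ^ j) (S.L v) = _ • S.L (((Complex.I • e) ^ j) v)
  have h1 : Complex.I ^ j * (Complex.I ^ j * (-1) ^ j) = 1 := by
    rw [← mul_pow, ← mul_pow]
    simp
  rw [smul_pow, LinearMap.smul_apply, map_smul, t.L_e_pow, smul_smul, smul_smul, mul_assoc, h1, one_smul]

/-- The signatures of the kernels of the powers of an operator `Z` that is conjugate to `f`, by an
operator `M` for which the vectors `M (u b)` are eigenvectors of `L`. -/
theorem IsChainBasis.signSubquotient_eq {β : Type*} [Fintype β] {n : β → ℕ} {σ : β → ℤˣ} {u : β → V}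
    (t : S.IsCartanTriple h e f) (c : S.IsChainBasis h e f n σ u) (M : V ≃ₗ[ℂ] V) (Z : End ℂ V)
    (hZ : ∀ v, Z (M v) = (Complex.I / 2) • M (f v))
    (hM : ∀ b, S.L (M (u b)) = (((σ b : ℤ) : ℂ) * plusEigenvalue η) • M (u b))
    (hLZ : ∀ v, S.L (Z v) = -Z (S.L v)) (j : ℕ) :
    S.signSubquotient (LinearMap.ker (Z ^ (j + 1))) (LinearMap.ker (Z ^ j)) =
      ((Finset.univ.filter fun b => j ≤ n b ∧ σ b * (-1) ^ j = 1).card,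
        (Finset.univ.filter fun b => j ≤ n b ∧ -(σ b * (-1) ^ j) = 1).card) := by
  classical
  have hI2 : (Complex.I / 2 : ℂ) ≠ 0 := by simp
  have hZk : ∀ k v, (Z ^ k) (M v) = (Complex.I / 2) ^ k • M ((f ^ k) v) := by
    intro k
    induction k with
    | zero => simp
    | succ k ih =>
      intro v
      rw [pow_succ, Module.End.mul_apply, hZ, map_smul, ih, smul_smul, ← pow_succ', pow_succ f,
        Module.End.mul_apply]
  have hLk : ∀ k v, S.L ((Z ^ k) v) = (-1 : ℂ) ^ k • (Z ^ k) (S.L v) := by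
    intro k
    induction k with
    | zero => simp
    | succ k ih =>
      intro v
      rw [pow_succ', Module.End.mul_apply, hLZ, ih, map_smul, pow_succ' (-1 : ℂ), Module.End.mul_apply,
        neg_one_mul, neg_smul]
  have hker : ∀ k, finrank ℂ (LinearMap.ker (Z ^ k)) = ∑ b, min k (n b + 1) := fun k => by
    rw [finrank_ker_eq_of_intertwine M (pow_ne_zero k hI2) (hZk k), t.finrank_ker_f_pow,
      (c.nilIndex_eq t k).2]
  have hLB : ∀ v ∈ LinearMap.ker (Z ^ j), S.L v ∈ LinearMap.ker (Z ^ j) := fun v hv => by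
    have h1 := hLk j v
    rw [LinearMap.mem_ker.mp hv, map_zero, eq_comm, smul_eq_zero] at h1
    exact h1.resolve_left (pow_ne_zero _ (by norm_num))
  have hle := S.eigenDim_add_le (A := LinearMap.ker (Z ^ (j + 1))) (B := LinearMap.ker (Z ^ j))
    (fun v hv => by
      rw [LinearMap.mem_ker, pow_succ', Module.End.mul_apply, LinearMap.mem_ker.mp hv, map_zero])
    hLB (plusEigenvalue_ne_zero η)
  -- the vectors `M (e ^ j u)` of the chains of suitable sign are independent eigenvectors modulo
  -- `ker Z ^ j`; these lower bounds add up to the dimension of the subquotient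
  have hlow : ∀ ρ : ℤˣ, (Finset.univ.filter fun b => j ≤ n b ∧ ρ * (σ b * (-1) ^ j) = 1).card ≤
      S.eigenDim (LinearMap.ker (Z ^ (j + 1))) (LinearMap.ker (Z ^ j))
        (((ρ : ℤ) : ℂ) * plusEigenvalue η) := by
    intro ρ
    let ι := {b // j ≤ n b ∧ ρ * (σ b * (-1) ^ j) = 1}
    let d : ι → ℂ := fun b => (Complex.I / 2) ^ j * ((j.factorial * (n b).descFactorial j : ℕ) : ℂ)
    have hd : ∀ b, d b ≠ 0 := fun b => mul_ne_zero (pow_ne_zero _ hI2) (Nat.cast_ne_zero.mpr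
      (mul_pos (Nat.factorial_pos _) (Nat.descFactorial_pos.mpr b.2.1)).ne')
    have hZw : ∀ b : ι, (Z ^ j) (M ((e ^ j) (u b))) = d b • M (u b) := fun b => by
      rw [hZk, t.f_pow_e_pow_self (c.mem_lowest b), map_smul, smul_smul]
    let B := LinearMap.ker (Z ^ j)
    have hli : LinearIndependent ℂ fun b : ι => B.mkQ (M ((e ^ j) (u b))) := by
      refine LinearIndependent.of_comp (B.liftQ (Z ^ j) le_rfl) ?_
      have h1 : LinearIndependent ℂ fun b : ι => M (u b) :=
        (c.linearIndependent.comp (fun b : ι => (b : β)) Subtype.val_injective).map'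
          (M : V →ₗ[ℂ] V) M.ker
      have h2 := h1.units_smul fun b => Units.mk0 (d b) (hd b)
      convert h2 using 1
      ext b
      simp only [Function.comp_apply, Submodule.mkQ_apply, Submodule.liftQ_apply, hZw]
      rfl
    have h3 := finrank_span_eq_card hli
    rw [← Fintype.card_subtype, ← h3]
    apply Submodule.finrank_mono
    rw [Submodule.span_le]
    rintro _ ⟨b, rfl⟩
    refine ⟨M ((e ^ j) (u b)), ⟨?_, ?_⟩, rfl⟩
    · rw [SetLike.mem_coe, LinearMap.mem_ker, hZk, t.f_pow_e_pow_of_lt (c.mem_lowest b)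
        (Nat.lt_succ_self j), map_zero, smul_zero]
    · change (Z ^ j) (S.L (M ((e ^ j) (u b))) - (((ρ : ℤ) : ℂ) * plusEigenvalue η) •
        M ((e ^ j) (u b))) = 0
      have h4 := hLk j (M ((e ^ j) (u b)))
      rw [hZw, map_smul, hM] at h4
      have h5 : (Z ^ j) (S.L (M ((e ^ j) (u b)))) = (-1 : ℂ) ^ j • d b •
          (((σ b : ℤ) : ℂ) * plusEigenvalue η) • M (u b) := by
        rw [h4, smul_smul, ← mul_pow]
        simp
      have h6 : ((ρ : ℤ) : ℂ) = ((σ b : ℤ) : ℂ) * (-1) ^ j := by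
        have h7 : ρ = σ b * (-1) ^ j := by
          have h8 := b.2.2
          rw [mul_eq_one_iff_eq_inv, Int.units_inv_eq_self] at h8
          exact h8
        have h9 := congrArg (fun z : ℤˣ => ((z : ℤ) : ℂ)) h7
        push_cast at h9
        exact h9
      rw [map_sub, map_smul, h5, hZw, h6, sub_eq_zero, smul_smul, smul_smul, smul_smul]
      congr 1
      ring
  have h1 := hlow 1
  have h2 := hlow (-1)
  simp only [one_mul, Units.val_one, Int.cast_one, neg_mul, Units.val_neg, Int.cast_neg] at h1 h2
  rw [hker, hker] at hle
  have hsum : ∑ b, min (j + 1) (n b + 1) =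
      (Finset.univ.filter fun b => j ≤ n b ∧ σ b * (-1) ^ j = 1).card +
        (Finset.univ.filter fun b => j ≤ n b ∧ -(σ b * (-1) ^ j) = 1).card +
        ∑ b, min j (n b + 1) := by
    rw [Finset.card_filter, Finset.card_filter, ← Finset.sum_add_distrib, ← Finset.sum_add_distrib]
    refine Finset.sum_congr rfl fun b _ => ?_
    rcases Int.units_eq_one_or (σ b * (-1) ^ j) with h3 | h3 <;>
      by_cases hj : j ≤ n b <;>
      simp only [h3, hj, true_and, false_and, if_true, if_false, neg_neg,
        show ¬ (-1 : ℤˣ) = 1 by decide] <;> omega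
  refine Prod.ext ?_ ?_
  · change S.eigenDim _ _ _ = _
    dsimp only
    omega
  · change S.eigenDim _ _ _ = _
    dsimp only
    omega

/-- A chain of length `n + 1` loses its square in degree `j` to the sign of `L` on the subquotient
`Ker Z ^ (j + 1) / Ker Z ^ j`. -/
theorem posCount_succ (σ : ℤˣ) (n j : ℕ) : posCount (σ * (-1) ^ n) n j =
    posCount (σ * (-1) ^ n) n (j + 1) + if j ≤ n ∧ σ * (-1) ^ j = 1 then 1 else 0 := by
  have h1 : ¬ (-1 : ℤˣ) = 1 := by decide
  rcases Int.units_eq_one_or σ with rfl | rfl <;>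
    rcases Nat.even_or_odd' n with ⟨m, rfl | rfl⟩ <;>
    rcases Nat.even_or_odd' j with ⟨k, rfl | rfl⟩ <;>
    simp only [posCount, pow_add, pow_one, pow_mul, neg_one_sq, one_pow, mul_one, one_mul, h1,
      mul_neg, neg_neg, if_true, if_false, and_true, and_false] <;>
    (try split_ifs) <;> omega

/-- The signatures of the subquotients are the differences of the signatures of the forms `nilForm`.
-/
theorem IsChainBasis.add_nilIndex {β : Type*} [Fintype β] {n : β → ℕ} {σ : β → ℤˣ} {u : β → V}
    (t : S.IsCartanTriple h e f) (c : S.IsChainBasis h e f n σ u) (j : ℕ) :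
    (((Finset.univ.filter fun b => j ≤ n b ∧ σ b * (-1) ^ j = 1).card,
        (Finset.univ.filter fun b => j ≤ n b ∧ -(σ b * (-1) ^ j) = 1).card) : ℕ × ℕ) +
      S.nilIndex (Complex.I • e) (j + 1) = S.nilIndex (Complex.I • e) j := by
  rw [(c.nilIndex_eq t j).1, (c.nilIndex_eq t (j + 1)).1, Finset.card_filter, Finset.card_filter]
  refine Prod.ext ?_ ?_
  · simp only [Prod.fst_add]
    rw [← Finset.sum_add_distrib]
    refine Finset.sum_congr rfl fun b _ => ?_
    rw [posCount_succ (σ b) (n b) j, add_comm]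
  · simp only [Prod.snd_add]
    rw [← Finset.sum_add_distrib]
    refine Finset.sum_congr rfl fun b _ => ?_
    have h1 := posCount_succ (-σ b) (n b) j
    rw [neg_mul, neg_mul] at h1
    rw [h1, add_comm]

end ChainSignature

/-! ### The Cayley transform -/

section Cayley

/-- The Cayley transform: conjugation by `G = exp (-i e)` maps `i / 2 f` to
`1 / 2 (h + i e + i f)`, and the vectors `G u` are eigenvectors of `L` for `u` in `lowestSign`. -/
theorem IsCartanTriple.exists_cayley {ε η : ℤˣ} {V : Type*} [AddCommGroup V] [Module ℂ V]
    [FiniteDimensional ℂ V] {S : EpsSpace ε η V} {h e f : End ℂ V} (t : S.IsCartanTriple h e f) :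
    ∃ G : V ≃ₗ[ℂ] V, (∀ v, ((1 / 2 : ℂ) • (h + Complex.I • e + Complex.I • f)) (G v) =
        (Complex.I / 2) • G (f v)) ∧
      ∀ n σ, ∀ u ∈ S.lowestSign h e f n σ,
        S.L (G u) = (((σ : ℤ) : ℂ) * plusEigenvalue η) • G u := by
  obtain ⟨N, hN⟩ := t.nil_e
  let a : ℕ → ℂ := fun k => (-Complex.I) ^ k / (k.factorial : ℂ)
  have ha0 : a 0 = 1 := by simp [a]
  have ha : ∀ k : ℕ, ((k : ℂ) + 1) * a (k + 1) = -Complex.I * a k := fun k => by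
    have : (k.factorial : ℂ) ≠ 0 := Nat.cast_ne_zero.mpr k.factorial_ne_zero
    have h2 : ((k : ℂ) + 1) ≠ 0 := Nat.cast_add_one_ne_zero k
    simp only [a, Nat.factorial_succ]
    push_cast
    field_simp
    ring
  have hpow : ∀ k : ℕ, N ≤ k → e ^ k = 0 := fun k hk => by
    rw [← Nat.sub_add_cancel hk, pow_add, hN, mul_zero]
  -- `G` is the exponential series of `-i e`, which ends since `e` is nilpotent; the sums below are
  -- its first and second derivatives
  let G : End ℂ V := ∑ k ∈ Finset.range (N + 1), a k • e ^ k
  have hG : G = ∑ k ∈ Finset.range (N + 2), a k • e ^ k := by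
    rw [Finset.sum_range_succ _ (N + 1), hpow _ (by omega), smul_zero, add_zero]
  have hD0 : ∑ k ∈ Finset.range (N + 2), ((k : ℂ) * a k) • e ^ (k - 1) = -Complex.I • G := by
    rw [Finset.sum_range_succ']
    simp only [Nat.cast_zero, zero_mul, zero_smul, add_zero, Nat.cast_add, Nat.cast_one, ha,
      Nat.add_sub_cancel, mul_smul, ← Finset.smul_sum]
    rfl
  have hD1 : ∑ k ∈ Finset.range (N + 2), ((k : ℂ) * a k) • e ^ k = -Complex.I • (e * G) := by
    rw [← mul_smul_comm, ← hD0, Finset.mul_sum]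
    refine Finset.sum_congr rfl fun k _ => ?_
    rcases k with - | k
    · simp
    · rw [mul_smul_comm, Nat.add_sub_cancel, ← pow_succ']
  have hD2 : ∑ k ∈ Finset.range (N + 2), ((k : ℂ) * (k - 1) * a k) • e ^ (k - 1) = -(e * G) := by
    have h1 : ∑ k ∈ Finset.range (N + 1), ((k : ℂ) * a k) • e ^ k = -Complex.I • (e * G) := by
      rw [← hD1, Finset.sum_range_succ _ (N + 1), hpow _ (by omega), smul_zero, add_zero]
    rw [Finset.sum_range_succ']
    simp only [Nat.cast_zero, zero_mul, zero_smul, add_zero, Nat.cast_add, Nat.cast_one,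
      Nat.add_sub_cancel, add_sub_cancel_right]
    have h2 : ∀ k : ℕ, (((k : ℂ) + 1) * k * a (k + 1)) • e ^ k =
        (-Complex.I) • ((k : ℂ) * a k) • e ^ k := fun k => by
      rw [smul_smul]
      congr 1
      linear_combination (k : ℂ) * ha k
    simp only [h2]
    rw [← Finset.smul_sum, h1, smul_smul]
    simp
  -- commutation with the powers of `e`, and by summation with `G`
  have hhe : ∀ k : ℕ, h * e ^ k = e ^ k * h + (2 * (k : ℂ)) • e ^ k := by
    intro k
    induction k with
    | zero => simp
    | succ k ih =>
      have h1 : h * e = e * h + (2 : ℂ) • e := by rw [← t.he]; abel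
      rw [pow_succ, ← mul_assoc, ih, add_mul, mul_assoc, h1, mul_add, smul_mul_assoc, mul_smul_comm,
        ← mul_assoc]
      push_cast
      module
  have hfe : ∀ k : ℕ, f * e ^ k = e ^ k * f - (k : ℂ) • (e ^ (k - 1) * h) -
      ((k : ℂ) * (k - 1)) • e ^ (k - 1) := by
    intro k
    induction k with
    | zero => simp
    | succ k ih =>
      have h1 : f * e = e * f - h := by rw [← t.ef]; abel
      have h2 : (k : ℂ) • (e ^ (k - 1) * e) = (k : ℂ) • e ^ k := by
        rcases k with - | k
        · simp
        · rw [Nat.add_sub_cancel, pow_succ]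
      have h3 : (k : ℂ) • (e ^ (k - 1) * h * e) = (k : ℂ) • (e ^ k * h) + (2 * (k : ℂ)) • e ^ k := by
        have h4 : h * e = e * h + (2 : ℂ) • e := by rw [← t.he]; abel
        rw [mul_assoc, h4, mul_add, smul_add, ← mul_assoc, ← smul_mul_assoc, h2, smul_mul_assoc,
          mul_smul_comm, smul_comm, h2, smul_smul]
      have h5 : ((k : ℂ) * (k - 1)) • (e ^ (k - 1) * e) = ((k : ℂ) * (k - 1)) • e ^ k := by
        rw [mul_comm, mul_smul, h2, smul_smul]
      rw [pow_succ, ← mul_assoc, ih, sub_mul, sub_mul, mul_assoc (e ^ k), h1, mul_sub,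
        smul_mul_assoc, smul_mul_assoc, h3, h5, Nat.add_sub_cancel, ← mul_assoc]
      push_cast
      module
  have hcomm : h * G + Complex.I • (e * G) + Complex.I • (f * G) = Complex.I • (G * f) := by
    have e1 : h * G = G * h + (2 : ℂ) • (-Complex.I • (e * G)) := by
      rw [← hD1, hG, Finset.mul_sum, Finset.sum_mul, Finset.smul_sum, ← Finset.sum_add_distrib]
      refine Finset.sum_congr rfl fun k _ => ?_
      rw [mul_smul_comm, hhe, smul_mul_assoc]
      module
    have e2 : f * G = G * f - (-Complex.I • G) * h - (-(e * G)) := by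
      rw [← hD0, ← hD2, hG, Finset.mul_sum, Finset.sum_mul, Finset.sum_mul, ← Finset.sum_sub_distrib,
        ← Finset.sum_sub_distrib]
      refine Finset.sum_congr rfl fun k _ => ?_
      rw [mul_smul_comm, hfe, smul_mul_assoc, smul_mul_assoc]
      module
    rw [e1, e2, smul_mul_assoc]
    have hI := Complex.I_mul_I
    simp only [smul_sub, smul_neg, neg_smul, smul_smul, hI]
    module
  have hunit : IsUnit G := by
    have h1 : G = 1 + e * ∑ k ∈ Finset.range N, a (k + 1) • e ^ k := by
      simp only [G]
      rw [Finset.sum_range_succ', ha0, pow_zero, one_smul, add_comm, Finset.mul_sum]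
      congr 1
      refine Finset.sum_congr rfl fun k _ => ?_
      rw [mul_smul_comm, ← pow_succ']
    rw [h1]
    refine IsNilpotent.isUnit_one_add (Commute.isNilpotent_mul_right ?_ t.nil_e)
    exact Commute.sum_right _ _ _ fun k _ => ((Commute.refl e).pow_right k).smul_right _
  have hinj : Function.Injective G := ((Module.End.isUnit_iff G).mp hunit).injective
  refine ⟨LinearEquiv.ofInjectiveEndo G hinj, fun v => ?_, fun n σ u hu => ?_⟩
  · have h1 := LinearMap.congr_fun hcomm v
    simp only [LinearMap.add_apply, LinearMap.smul_apply, Module.End.mul_apply] at h1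
    simp only [LinearMap.smul_apply, LinearMap.add_apply]
    change (1 / 2 : ℂ) • (h (G v) + Complex.I • e (G v) + Complex.I • f (G v)) =
      (Complex.I / 2) • G (f v)
    rw [h1, smul_smul]
    congr 1
    ring
  · obtain ⟨hu1, hu2⟩ := mem_lowestSign.mp hu
    change S.L (G u) = _ • G u
    -- up to scalars `L` reverses the order of the chain of `u`
    have hGu : G u = ∑ k ∈ Finset.range (n + 1), a k • (e ^ k) u := by
      have h1 : ∀ m, n + 1 ≤ m → ∑ k ∈ Finset.range m, a k • (e ^ k) u =
          ∑ k ∈ Finset.range (n + 1), a k • (e ^ k) u := fun m hm => by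
        refine (Finset.sum_subset (Finset.range_mono hm) fun k _ hk => ?_).symm
        rw [t.e_pow_eq_zero hu1 t.nil_f (by simpa using hk), smul_zero]
      have h2 : ∀ m, N ≤ m → ∑ k ∈ Finset.range m, a k • (e ^ k) u =
          ∑ k ∈ Finset.range N, a k • (e ^ k) u := fun m hm => by
        refine (Finset.sum_subset (Finset.range_mono hm) fun k _ hk => ?_).symm
        rw [hpow k (by simpa using hk), LinearMap.zero_apply, smul_zero]
      simp only [G, LinearMap.sum_apply, LinearMap.smul_apply]
      rw [h2 (N + 1) (by omega), ← h2 (max N (n + 1)) (le_max_left _ _), h1 _ (le_max_right _ _)]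
    rw [hGu, map_sum, Finset.smul_sum, ← Finset.sum_range_reflect]
    refine Finset.sum_congr rfl fun m hm => ?_
    have hmn : m ≤ n := by simpa [Nat.lt_succ_iff] using hm
    obtain ⟨k, rfl⟩ := Nat.exists_eq_add_of_le' hmn
    rw [show k + m + 1 - 1 - m = k by omega, map_smul, t.L_e_pow, hu2, map_smul,
      t.f_pow_e_pow hu1 hmn, smul_smul, smul_smul, smul_smul, smul_smul]
    congr 1
    have hf1 : (k.factorial : ℂ) ≠ 0 := Nat.cast_ne_zero.mpr k.factorial_ne_zero
    have hf2 : (m.factorial : ℂ) ≠ 0 := Nat.cast_ne_zero.mpr m.factorial_ne_zero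
    have hf3 : ((k + m).factorial : ℂ) ≠ 0 := Nat.cast_ne_zero.mpr (Nat.factorial_ne_zero _)
    have h1 : (m.factorial : ℂ) * ((m + k).descFactorial k : ℂ) = ((k + m).factorial : ℂ) := by
      have := Nat.factorial_mul_descFactorial (Nat.le_add_left k m)
      rw [Nat.add_sub_cancel] at this
      rw [add_comm k m]
      exact_mod_cast this
    have hII : (-Complex.I) ^ k * (-1) ^ k * (-Complex.I) ^ k = 1 := by
      rw [← mul_pow, ← mul_pow]
      simp
    simp only [a, Nat.add_sub_cancel, Nat.descFactorial_self, Nat.cast_mul, pow_add]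
    field_simp
    linear_combination (plusEigenvalue η * ((m + k).descFactorial k : ℂ) * (m.factorial : ℂ)) * hII +
      plusEigenvalue η * h1

end Cayley

end EpsSpace

/-! ### The signed Young diagram in terms of signatures -/

namespace EpsSpace

section KeyFormula

variable {ε η : ℤˣ} {V : Type*} [NormedAddCommGroup V] [NormedSpace ℂ V]
  {S : EpsSpace ε η V}

theorem IsCompatibleTriple.isCartanTriple {h e f : V →L[ℂ] V} (t : S.IsCompatibleTriple h e f)
    (hn : IsNilpotent e) : S.IsCartanTriple (h : End ℂ V) (e : End ℂ V) (f : End ℂ V) where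
  he := congrArg (fun a : V →L[ℂ] V => (a : V →ₗ[ℂ] V)) t.lie_h_e
  hf := congrArg (fun a : V →L[ℂ] V => (a : V →ₗ[ℂ] V)) t.lie_h_f
  ef := congrArg (fun a : V →L[ℂ] V => (a : V →ₗ[ℂ] V)) t.lie_e_f
  skew_e u v := eq_neg_of_add_eq_zero_left (t.e_mem u v)
  conj_e := t.J_e
  L_e := t.L_e
  nil_e := by
    obtain ⟨n, hn⟩ := hn
    refine ⟨n, ?_⟩
    rw [← ContinuousLinearMap.toLinearMap_pow, hn]
    rfl

theorem isNilpotent_of_I_smul {e : V →L[ℂ] V} (h : IsNilpotent (Complex.I • e)) :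
    IsNilpotent e := by
  obtain ⟨n, hn⟩ := h
  refine ⟨n, ?_⟩
  rw [smul_pow, smul_eq_zero] at hn
  exact hn.resolve_left (pow_ne_zero _ Complex.I_ne_zero)

theorem isSelfAdj_of_mem {X : V →L[ℂ] V} (hX : X ∈ S.iLieReal) : S.IsSelfAdj (X : End ℂ V) :=
  fun u v => by
    have h1 := hX.1 u (S.J v)
    rw [hX.2, map_neg] at h1
    rw [ContinuousLinearMap.coe_coe]
    linear_combination h1

/-- The signed Young diagram, in terms of any chain basis of a compatible triple. -/
theorem exists_isCartanTriple_signedDiagram [FiniteDimensional ℂ V] {O : Set (V →L[ℂ] V)}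
    (hO : S.IsNilOrbit O) :
    ∃ h e f : End ℂ V, S.IsCartanTriple h e f ∧
      LinearMap.toContinuousLinearMap (Complex.I • e) ∈ O ∧
      ∀ (β : Type) (_ : Fintype β) (n : β → ℕ) (σ : β → ℤˣ) (u : β → V),
        S.IsChainBasis h e f n σ u → ∀ j, S.signedDiagram O j =
      ((Finset.univ.filter fun b => j ≤ n b ∧ σ b * (-1) ^ j = 1).card,
        (Finset.univ.filter fun b => j ≤ n b ∧ -(σ b * (-1) ^ j) = 1).card) := by
  have hne : (S.kostantSekiguchi O).Nonempty := by
    obtain ⟨h, e, f, t, he⟩ := hO.exists_isCompatibleTriple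
    exact ⟨_, h, e, f, t, he, 1, one_mem _, rfl⟩
  obtain ⟨h, e, f, t, he, k, hk, hY⟩ := hne.some_mem
  have hn : IsNilpotent e := isNilpotent_of_I_smul (hO.of_mem he).2.1
  have t' := t.isCartanTriple hn
  refine ⟨h, e, f, t', ?_, fun β _ n σ u c j => ?_⟩
  · exact he
  -- the Cayley transform followed by `k` conjugates `i / 2 f` to the chosen element `Y`
  obtain ⟨G, hG, hGL⟩ := t'.exists_cayley
  rw [signedDiagram, dif_pos hne]
  set Y := hne.some
  let K : V ≃ₗ[ℂ] V := (ContinuousLinearEquiv.ofUnit k).toLinearEquiv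
  have hK : ∀ v, K v = (k : V →L[ℂ] V) v := fun v => rfl
  have hkL : ∀ v, (k : V →L[ℂ] V) (S.L v) = S.L ((k : V →L[ℂ] V) v) := hk.2
  have hYk : ∀ v, Y ((k : V →L[ℂ] V) v) =
      (k : V →L[ℂ] V) (((1 / 2 : ℂ) • (h + Complex.I • e + Complex.I • f)) v) := fun v => by
    rw [hY, mul_apply_eq_comp, mul_apply_eq_comp, unit_inv_apply]
  have h1 := c.signSubquotient_eq t' (G.trans K) (Y : End ℂ V) (fun v => ?_) (fun b => ?_)
    (fun v => ?_) j
  · rw [kerSignatures, ContinuousLinearMap.toLinearMap_pow, ContinuousLinearMap.toLinearMap_pow]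
    exact h1
  · rw [LinearEquiv.trans_apply, LinearEquiv.trans_apply, hK, hK, ContinuousLinearMap.coe_coe, hYk,
      ← map_smul, ← hG]
    rfl
  · rw [LinearEquiv.trans_apply, hK, ← hkL, hGL _ _ _ (c.mem b), map_smul]
  · rw [ContinuousLinearMap.coe_coe]
    have hv := unit_apply_inv k v
    set w := ((k⁻¹ : (V →L[ℂ] V)ˣ) : V →L[ℂ] V) v
    rw [← hv, hYk, ← hkL, ← hkL, hYk, ← map_neg]
    congr 1
    simp only [ContinuousLinearMap.smul_apply, ContinuousLinearMap.add_apply, map_smul, map_add,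
      t.L_h, t.L_e, t.L_f, smul_neg]
    module

/-- The signatures of the forms `nilForm` are invariant under the real group. -/
theorem nilIndex_conj [FiniteDimensional ℂ V] {g : (V →L[ℂ] V)ˣ} (hg : g ∈ S.realGroup)
    {X Y : V →L[ℂ] V} (hX : X ∈ S.iLieReal)
    (hXY : ∀ v, Y ((g : V →L[ℂ] V) v) = (g : V →L[ℂ] V) (X v)) (j : ℕ) :
    S.nilIndex (X : End ℂ V) j = S.nilIndex (Y : End ℂ V) j := by
  have hsurj : ∀ v, ∃ w, (g : V →L[ℂ] V) w = v := fun v => ⟨_, unit_apply_inv g v⟩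
  have hY : Y ∈ S.iLieReal := by
    convert conj_mem_iLieReal hX hg using 1
    ext v
    obtain ⟨w, rfl⟩ := hsurj v
    rw [hXY, mul_apply_eq_comp, mul_apply_eq_comp, unit_inv_apply]
  have hpow : ∀ j v, ((Y : End ℂ V) ^ j) ((g : V →L[ℂ] V) v) =
      (g : V →L[ℂ] V) (((X : End ℂ V) ^ j) v) := by
    intro j
    induction j with
    | zero => simp
    | succ j ih =>
      intro v
      rw [pow_succ', Module.End.mul_apply, ih, pow_succ', Module.End.mul_apply]
      exact hXY _
  have hform : ∀ u, S.nilForm (X : End ℂ V) j u u = S.nilForm (Y : End ℂ V) j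
      ((g : V →L[ℂ] V) u) ((g : V →L[ℂ] V) u) := fun u => by
    rw [nilForm, nilForm, hpow, ← hg.2, hg.1]
  exact Prod.ext (posIndex_comap ((isSelfAdj_of_mem hY).isHerm j)
    ((g : V →L[ℂ] V) : V →ₗ[ℂ] V) hsurj hform)
    (negIndex_comap ((isSelfAdj_of_mem hY).isHerm j) ((g : V →L[ℂ] V) : V →ₗ[ℂ] V) hsurj hform)

/-- The signed Young diagram of the orbit of `X` records the differences of the signatures of the
Hermitian forms `κ ⟨X ^ j v, J u⟩`. -/
theorem IsNilOrbit.signedDiagram_add [FiniteDimensional ℂ V] {O : Set (V →L[ℂ] V)}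
    (hO : S.IsNilOrbit O) {X : V →L[ℂ] V} (hX : X ∈ O) (j : ℕ) :
    S.signedDiagram O j + S.nilIndex (X : End ℂ V) (j + 1) = S.nilIndex (X : End ℂ V) j := by
  obtain ⟨h, e, f, t, he, hd⟩ := exists_isCartanTriple_signedDiagram hO
  obtain ⟨β, _, n, σ, u, c⟩ := t.exists_isChainBasis
  have h1 := c.add_nilIndex t j
  rw [← hd β _ n σ u c] at h1
  obtain ⟨hXL, -, hXO⟩ := hO.of_mem hX
  rw [hXO] at he
  obtain ⟨g, hg, hge⟩ := he
  have h2 : ∀ j, S.nilIndex (X : End ℂ V) j = S.nilIndex (Complex.I • e) j := fun j => by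
    refine nilIndex_conj hg hXL (Y := LinearMap.toContinuousLinearMap (Complex.I • e))
      (fun v => ?_) j
    rw [hge, mul_apply_eq_comp, mul_apply_eq_comp, unit_inv_apply]
  rw [h2, h2, h1]

end KeyFormula

end EpsSpace

/-! ### Classification of nilpotent orbits -/

namespace EpsSpace

section Classification

variable {ε η : ℤˣ} {V : Type*} [AddCommGroup V] [Module ℂ V] [FiniteDimensional ℂ V]
  {S : EpsSpace ε η V} {h e f h' e' f' : End ℂ V}

omit [FiniteDimensional ℂ V] in
theorem IsChainBasis.comp {β β' : Type*} {n : β → ℕ} {σ : β → ℤˣ} {u : β → V}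
    (c : S.IsChainBasis h e f n σ u) (π : β' ≃ β) :
    S.IsChainBasis h e f (n ∘ π) (σ ∘ π) (u ∘ π) where
  mem b := c.mem _
  ip_self b := c.ip_self _
  ip_ne b b' hb := c.ip_ne _ _ fun h0 => hb (π.injective h0)
  span := by rw [Set.range_comp, π.surjective.range_eq, Set.image_univ]; exact c.span

/-- Matching chain bases give an invertible operator that carries `e`, `f`, `L` to `e'`, `f'`,
`L`. -/
theorem IsChainBasis.exists_intertwine {β : Type*} [Fintype β] {n : β → ℕ} {σ : β → ℤˣ}
    {u u' : β → V} (t : S.IsCartanTriple h e f) (c : S.IsChainBasis h e f n σ u)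
    (t' : S.IsCartanTriple h' e' f') (c' : S.IsChainBasis h' e' f' n σ u') :
    ∃ g : V →ₗ[ℂ] V, Function.Injective g ∧ (∀ v, g (e v) = e' (g v)) ∧
      (∀ v, g (f v) = f' (g v)) ∧ ∀ v, g (S.L v) = S.L (g v) := by
  let g : V ≃ₗ[ℂ] V := (c.basis t).equiv (c'.basis t') (Equiv.refl _)
  have hg : ∀ b k, g ((e ^ k) (u b)) = (e' ^ k) (u' b) := by
    intro b k
    by_cases hk : k ≤ n b
    · have h1 := (c.basis t).equiv_apply ⟨b, ⟨k, by omega⟩⟩ (c'.basis t') (Equiv.refl _)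
      rw [c.basis_apply, Equiv.refl_apply, c'.basis_apply] at h1
      exact h1
    · rw [t.e_pow_eq_zero (c.mem_lowest b) t.nil_f (by omega),
        t'.e_pow_eq_zero (c'.mem_lowest b) t'.nil_f (by omega), map_zero]
  have hext : ∀ A A' : End ℂ V, (∀ b k, g (A ((e ^ k) (u b))) = A' (g ((e ^ k) (u b)))) →
      ∀ v, g (A v) = A' (g v) := by
    intro A A' hA v
    have : g.toLinearMap ∘ₗ A = A' ∘ₗ g.toLinearMap := by
      refine (c.basis t).ext fun x => ?_
      rw [c.basis_apply]
      exact hA _ _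
    exact LinearMap.congr_fun this v
  have hf : ∀ v, g (f v) = f' (g v) := by
    refine hext f f' fun b k => ?_
    rcases k with - | k
    · rw [pow_zero, Module.End.one_apply, (_root_.mem_lowest.mp (c.mem_lowest b)).1, map_zero]
      have := hg b 0
      rw [pow_zero, pow_zero, Module.End.one_apply, Module.End.one_apply] at this
      rw [this, (_root_.mem_lowest.mp (c'.mem_lowest b)).1]
    · rw [t.f_pow_succ (c.mem_lowest b), map_smul, hg, hg, t'.f_pow_succ (c'.mem_lowest b)]
  have hfk : ∀ k v, g ((f ^ k) v) = (f' ^ k) (g v) := by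
    intro k
    induction k with
    | zero => simp
    | succ k ih =>
      intro v
      rw [pow_succ', Module.End.mul_apply, hf, ih, pow_succ' f', Module.End.mul_apply]
  refine ⟨g, g.injective, ?_, hf, ?_⟩
  · refine hext e e' fun b k => ?_
    rw [← Module.End.mul_apply, ← pow_succ', hg, hg, ← Module.End.mul_apply, ← pow_succ']
  · refine hext S.L S.L fun b k => ?_
    rw [t.L_e_pow, c.L_apply, map_smul, map_smul, map_smul, hfk, hg, hg, t'.L_e_pow, c'.L_apply,
      map_smul]

/-- An invertible operator that carries `e`, `f`, `L` to `e'`, `f'`, `L` can be replaced by one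
that lies in the real group: take a real point of the space of intertwining operators, then the
phase of its polar decomposition. -/
theorem IsCartanTriple.exists_real_intertwine (t : S.IsCartanTriple h e f)
    (t' : S.IsCartanTriple h' e' f') (g : V →ₗ[ℂ] V) (hinj : Function.Injective g)
    (hge : ∀ v, g (e v) = e' (g v)) (hgf : ∀ v, g (f v) = f' (g v))
    (hgL : ∀ v, g (S.L v) = S.L (g v)) (hfJ : S.IsConjPair f f) (hfJ' : S.IsConjPair f' f') :
    ∃ s : V →ₗ[ℂ] V, (∀ u v, S.form (s u) (s v) = S.form u v) ∧
      (∀ v, s (S.J v) = S.J (s v)) ∧ ∀ v, s (e v) = e' (s v) := by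
  have hP := S.isInner_ip
  obtain ⟨g', hg'⟩ := S.exists_isConjPair g
  have hg'i : ∀ a a' : End ℂ V, S.IsConjPair a a → S.IsConjPair a' a' →
      (∀ v, g (a v) = a' (g v)) → ∀ v, g' (a v) = a' (g' v) := fun a a' ha ha' hga v => by
    obtain ⟨v, rfl⟩ := S.J_surj v
    rw [ha, hg', hg', ha', hga]
  -- `A` and `B` are the real and the imaginary part of `g`
  let A : V →ₗ[ℂ] V := (1 / 2 : ℂ) • (g + g')
  let B : V →ₗ[ℂ] V := (-Complex.I / 2) • (g - g')
  have hI := Complex.I_mul_I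
  have hAB : A + Complex.I • B = g := by
    simp only [A, B, smul_smul]
    have : Complex.I * (-Complex.I / 2) = 1 / 2 := by linear_combination (-1 / 2 : ℂ) * hI
    rw [this]
    module
  obtain ⟨r, hr⟩ := exists_real_finrank_ker_le A B Complex.I
  rw [hAB, LinearMap.ker_eq_bot.mpr hinj, finrank_bot, Nat.le_zero, Submodule.finrank_eq_zero,
    LinearMap.ker_eq_bot] at hr
  set g₁ := A + (r : ℂ) • B with hg₁
  have hg₁v : ∀ v, g₁ v = (1 / 2 : ℂ) • (g v + g' v) + (r : ℂ) • (-Complex.I / 2) • (g v - g' v) :=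
    fun v => rfl
  have hint : ∀ a a' : End ℂ V, S.IsConjPair a a → S.IsConjPair a' a' →
      (∀ v, g (a v) = a' (g v)) → ∀ v, g₁ (a v) = a' (g₁ v) := fun a a' ha ha' hga v => by
    rw [hg₁v, hg₁v, hga, hg'i a a' ha ha' hga]
    simp only [map_add, map_sub, map_smul]
  have h1J : ∀ v, g₁ (S.J v) = S.J (g₁ v) := fun v => by
    rw [hg₁v, hg₁v, hg', hg'.symm]
    simp only [map_add, map_sub, map_smulₛₗ S.J, map_div₀, map_neg, map_one, map_ofNat,
      Complex.conj_I, Complex.conj_ofReal]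
    module
  have h1e := hint e e' t.conj_e t'.conj_e hge
  have h1f := hint f f' hfJ hfJ' hgf
  have h1L := hint S.L S.L S.L_J S.L_J hgL
  -- the positive part `s` of `g₁` commutes with `e`, `L` and `J`, so that `g₁ s⁻¹` is as required
  obtain ⟨C, s, hC, hs, hsP, hsT⟩ := hP.exists_polar hP g₁ hr
  have hse : ∀ v, e (s v) = s (e v) := hsT e (map_add e) (fun c v => map_smul e _ v) fun v =>
    hP.eq_of_forall fun u => by rw [← t.ip_f, hC, hC, h1f, h1e, t'.ip_f]
  have hsL : ∀ v, S.L (s v) = s (S.L v) := hsT S.L (map_add _) (fun c v => map_smul _ _ v) fun v =>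
    hP.eq_of_forall fun u => by
      have h2 := S.ip_L_left u (C v)
      have h3 := S.ip_L_left (g₁ u) (g₁ v)
      rw [hC, h1L, h3] at h2
      have h4 := congrArg (fun z => ((η : ℤ) : ℂ) * z) h2
      simp only [← mul_assoc, units_coe_mul_self, one_mul] at h4
      rw [← h4, hC, h1L]
  have hsJ : ∀ v, S.J (s v) = s (S.J v) := hsT S.J (map_add _)
    (fun c v => by rw [map_smulₛₗ, Complex.conj_ofReal]) fun v =>
    hP.eq_of_forall fun u => by
      obtain ⟨u, rfl⟩ := S.J_surj u
      rw [S.ip_J, hC, hC, h1J, h1J, S.ip_J]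
  let E := LinearEquiv.ofInjectiveEndo s hs
  have hE : ∀ v, s (E.symm v) = v := fun v => E.apply_symm_apply v
  have hcomm : ∀ T : V → V, (∀ v, T (s v) = s (T v)) → ∀ v, E.symm (T v) = T (E.symm v) :=
    fun T hT v => hs (by rw [hE, ← hT, hE])
  let q : V →ₗ[ℂ] V := g₁ ∘ₗ E.symm.toLinearMap
  have hq : ∀ v, q v = g₁ (E.symm v) := fun v => rfl
  have hqJ : ∀ v, q (S.J v) = S.J (q v) := fun v => by rw [hq, hcomm _ hsJ, h1J, hq]
  refine ⟨q, fun u v => ?_, hqJ, fun v => by rw [hq, hcomm _ hse, h1e, hq]⟩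
  obtain ⟨v, rfl⟩ := S.J_surj v
  rw [hqJ, S.form_eq_ip, S.form_eq_ip, hq, hq, ← h1L, ← hsP, hE, ← hsL, hE]

end Classification

section Orbits

variable {ε η : ℤˣ} {V : Type*} [NormedAddCommGroup V] [NormedSpace ℂ V] [FiniteDimensional ℂ V]
  {S : EpsSpace ε η V}

theorem IsCartanTriple.conj_f {W : Type*} [AddCommGroup W] [Module ℂ W] {T : EpsSpace ε η W}
    {h e f : End ℂ W} (t : T.IsCartanTriple h e f) : T.IsConjPair f f := fun v => by
  have hL : ∀ v, ∃ w, v = T.L w := fun v => ⟨((η : ℤ) : ℂ) • T.L v, by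
    rw [map_smul, T.L_L, units_coe_smul_smul]⟩
  obtain ⟨w, rfl⟩ := hL v
  rw [← T.L_J, ← neg_eq_iff_eq_neg.mpr (t.L_e _), ← neg_eq_iff_eq_neg.mpr (t.L_e _), t.conj_e,
    T.L_J, map_neg]

/-- A nilpotent orbit is determined by its signed Young diagram. -/
theorem IsNilOrbit.eq_of_signedDiagram_eq {O O' : Set (V →L[ℂ] V)} (hO : S.IsNilOrbit O)
    (hO' : S.IsNilOrbit O') (heq : S.signedDiagram O = S.signedDiagram O') : O = O' := by
  classical
  obtain ⟨h, e, f, t, he, hd⟩ := exists_isCartanTriple_signedDiagram hO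
  obtain ⟨h', e', f', t', he', hd'⟩ := exists_isCartanTriple_signedDiagram hO'
  obtain ⟨β, i, n, σ, u, c⟩ := t.exists_isChainBasis
  obtain ⟨β', i', n', σ', u', c'⟩ := t'.exists_isChainBasis
  -- the number of chains of given length and sign is a difference of two entries of the diagram
  have hcard : ∀ (γ : Type) (_ : Fintype γ) (m : γ → ℕ) (τ : γ → ℤˣ) (k : ℕ) (ρ : ℤˣ),
      Fintype.card {b // (m b, τ b) = (k, ρ)} +
        (Finset.univ.filter fun b => k + 1 ≤ m b ∧ ρ * (-1) ^ (k + 1) * (τ b * (-1) ^ (k + 1)) = 1).card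
      = (Finset.univ.filter fun b => k ≤ m b ∧ ρ * (-1) ^ k * (τ b * (-1) ^ k) = 1).card := by
    intro γ _ m τ k ρ
    have hsimp : ∀ (k : ℕ) b, ρ * (-1) ^ k * (τ b * (-1) ^ k) = 1 ↔ τ b = ρ := fun k b => by
      have : ρ * (-1) ^ k * (τ b * (-1) ^ k) = ρ * τ b := by
        rw [mul_mul_mul_comm, ← mul_pow]; simp
      rw [this, mul_eq_one_iff_eq_inv, Int.units_inv_eq_self, eq_comm]
    simp only [hsimp, Prod.mk.injEq]
    rw [Fintype.card_subtype, ← Finset.card_union_of_disjoint]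
    · congr 1
      ext b
      simp only [Finset.mem_union, Finset.mem_filter, Finset.mem_univ, true_and]
      constructor
      · rintro (⟨h1, h2⟩ | ⟨h1, h2⟩) <;> exact ⟨by omega, h2⟩
      · rintro ⟨h1, h2⟩
        rcases h1.eq_or_lt with h3 | h3
        · exact Or.inl ⟨h3.symm, h2⟩
        · exact Or.inr ⟨h3, h2⟩
    · rw [Finset.disjoint_filter]
      rintro b - ⟨h1, -⟩ ⟨h2, -⟩
      omega
  have hfil : ∀ k (ρ : ℤˣ), (Finset.univ.filter fun b => k ≤ n b ∧ ρ * (σ b * (-1) ^ k) = 1).card =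
      (Finset.univ.filter fun b => k ≤ n' b ∧ ρ * (σ' b * (-1) ^ k) = 1).card := by
    intro k ρ
    have h1 := congrFun heq k
    rw [hd β _ n σ u c, hd' β' _ n' σ' u' c'] at h1
    rcases Int.units_eq_one_or ρ with rfl | rfl
    · simpa only [one_mul] using congrArg Prod.fst h1
    · simpa only [neg_mul, one_mul] using congrArg Prod.snd h1
  -- hence the chain bases can be matched
  have hfib : ∀ p : ℕ × ℤˣ, Nonempty ({b // (n b, σ b) = p} ≃ {b // (n' b, σ' b) = p}) := by
    rintro ⟨k, ρ⟩
    refine Fintype.card_eq.mp ?_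
    have h1 := hcard β i n σ k ρ
    have h2 := hcard β' i' n' σ' k ρ
    rw [hfil, hfil] at h1
    omega
  let π : β ≃ β' := Equiv.ofFiberEquiv (f := fun b => (n b, σ b)) (g := fun b => (n' b, σ' b))
    fun p => (hfib p).some
  have hπ : ∀ b, (n' (π b), σ' (π b)) = (n b, σ b) := fun b =>
    Equiv.ofFiberEquiv_map (f := fun b => (n b, σ b)) (g := fun b => (n' b, σ' b))
      (fun p => (hfib p).some) b
  have hn : n' ∘ π = n := funext fun b => congrArg Prod.fst (hπ b)
  have hσ : σ' ∘ π = σ := funext fun b => congrArg Prod.snd (hπ b)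
  have c'' := c'.comp π
  rw [hn, hσ] at c''
  obtain ⟨g, h1, h2, h3, h4⟩ := c.exists_intertwine t t' c''
  obtain ⟨s, hs, hsJ, hse⟩ := t.exists_real_intertwine t' g h1 h2 h3 h4 t.conj_f t'.conj_f
  obtain ⟨k, hk, hks⟩ := exists_mem_realGroup s hs hsJ
  rw [(hO.of_mem he).2.2, (hO'.of_mem he').2.2]
  refine (orbit_eq_of_mem ⟨k, hk, ?_⟩).symm
  ext v
  have hv := unit_apply_inv k v
  set w := ((k⁻¹ : (V →L[ℂ] V)ˣ) : V →L[ℂ] V) v with hw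
  rw [mul_apply_eq_comp, mul_apply_eq_comp, ← hw, hks, ← hv, hks]
  change Complex.I • e' (s w) = s (Complex.I • e w)
  rw [map_smul, hse]

end Orbits

end EpsSpace

/-! ### Further facts on Hermitian forms -/

section HermitianSums

variable {V W : Type*} [AddCommGroup V] [Module ℂ V] [FiniteDimensional ℂ V]
  [AddCommGroup W] [Module ℂ W] [FiniteDimensional ℂ W]

/-- The radical of a Hermitian form. -/
def IsHerm.radical {Φ : V → V → ℂ} (h : IsHerm Φ) : Submodule ℂ V where
  carrier := {u | ∀ v, Φ v u = 0}
  add_mem' hu hv w := by rw [h.add_right, hu, hv, add_zero]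
  zero_mem' w := h.zero_right w
  smul_mem' c u hu w := by rw [h.smul_right, hu, mul_zero]

/-- A Hermitian form restricted to a subspace of codimension `k` loses at most `k` positive and at
most `k` negative squares; this bound is attained if the rank drops by `2 k`. -/
theorem posIndex_eq_add_of_restrict {Φ : W → W → ℂ} {Φ' : V → V → ℂ} (f : V →ₗ[ℂ] W)
    (hf : Function.Injective f) (hΦ : ∀ u, Φ' u u = Φ (f u) (f u)) {k r : ℕ}
    (hk : finrank ℂ V + k = finrank ℂ W) (hr : posIndex Φ + negIndex Φ + r = finrank ℂ W)
    (hr' : posIndex Φ' + negIndex Φ' + r + k ≤ finrank ℂ V) :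
    posIndex Φ = posIndex Φ' + k ∧ negIndex Φ = negIndex Φ' + k := by
  have key : ∀ {Ψ : W → W → ℂ} {Ψ' : V → V → ℂ}, (∀ u, Ψ' u u = Ψ (f u) (f u)) →
      posIndex Ψ ≤ posIndex Ψ' + k := by
    intro Ψ Ψ' hΨ
    obtain ⟨A, hA, hp⟩ := exists_finrank_eq_posIndex Ψ
    have h1 : finrank ℂ (A.comap f) ≤ posIndex Ψ' := le_posIndex _ fun u hu hu0 => by
      rw [hΨ]
      exact hp _ hu fun h0 => hu0 (hf (by rw [h0, map_zero]))
    have h2 : finrank ℂ (A.comap f) = finrank ℂ ↥(LinearMap.range f ⊓ A) := by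
      rw [← Submodule.map_comap_eq]
      exact (Submodule.equivMapOfInjective f hf _).finrank_eq
    have h3 := Submodule.finrank_sup_add_finrank_inf_eq (LinearMap.range f) A
    have h4 := (LinearMap.range f ⊔ A).finrank_le
    have h5 := LinearMap.finrank_range_of_inj hf
    omega
  have h1 := key hΦ
  have h2 : negIndex Φ ≤ negIndex Φ' + k := key (Ψ := fun u v => -Φ u v) (Ψ' := fun u v => -Φ' u v)
    fun u => by rw [hΦ]
  omega

omit [FiniteDimensional ℂ V] [FiniteDimensional ℂ W] in
theorem IsHerm.prod {Φ : V → V → ℂ} {Ψ : W → W → ℂ} (h : IsHerm Φ) (h' : IsHerm Ψ) :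
    IsHerm fun x y : V × W => Φ x.1 y.1 + Ψ x.2 y.2 where
  add_right u v w := by simp only [Prod.fst_add, Prod.snd_add, h.add_right, h'.add_right]; ring
  smul_right u c v := by simp only [Prod.smul_fst, Prod.smul_snd, h.smul_right, h'.smul_right]; ring
  conj_symm u v := by rw [map_add, h.conj_symm, h'.conj_symm]

theorem IsHerm.le_posIndex_prod {Φ : V → V → ℂ} {Ψ : W → W → ℂ} (h : IsHerm Φ) (h' : IsHerm Ψ) :
    posIndex Φ + posIndex Ψ ≤ posIndex fun x y : V × W => Φ x.1 y.1 + Ψ x.2 y.2 := by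
  obtain ⟨A, hA, hp⟩ := exists_finrank_eq_posIndex Φ
  obtain ⟨B, hB, hp'⟩ := exists_finrank_eq_posIndex Ψ
  have hinj : Function.Injective (A.subtype.prodMap B.subtype) :=
    Function.Injective.prodMap A.injective_subtype B.injective_subtype
  rw [← hA, ← hB, ← finrank_prod, ← LinearMap.finrank_range_of_inj hinj]
  refine le_posIndex _ ?_
  rintro _ ⟨⟨a, b⟩, rfl⟩ hne
  rw [Complex.add_re]
  change 0 < (Φ a a).re + (Ψ b b).re
  by_cases ha : (a : V) = 0
  · have hb : (b : W) ≠ 0 := fun hb => hne (by simp [ha, hb])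
    rw [ha, h.zero_left, Complex.zero_re, zero_add]
    exact hp' _ b.2 hb
  · by_cases hb : (b : W) = 0
    · rw [hb, h'.zero_left, Complex.zero_re, add_zero]
      exact hp _ a.2 ha
    · exact add_pos (hp _ a.2 ha) (hp' _ b.2 hb)

/-- The indices of an orthogonal sum: both are bounded from below, and the bounds add up together
with the dimension of the radical. -/
theorem IsHerm.posIndex_prod {Φ : V → V → ℂ} {Ψ : W → W → ℂ} (h : IsHerm Φ) (h' : IsHerm Ψ) :
    posIndex (fun x y : V × W => Φ x.1 y.1 + Ψ x.2 y.2) = posIndex Φ + posIndex Ψ ∧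
    negIndex (fun x y : V × W => Φ x.1 y.1 + Ψ x.2 y.2) = negIndex Φ + negIndex Ψ := by
  have h1 := h.le_posIndex_prod h'
  have h2 : negIndex Φ + negIndex Ψ ≤ negIndex fun x y : V × W => Φ x.1 y.1 + Ψ x.2 y.2 := by
    have := h.neg.le_posIndex_prod h'.neg
    simp only [← neg_add] at this
    exact this
  have h3 := posIndex_add_negIndex_add h h.radical fun u => Iff.rfl
  have h4 := posIndex_add_negIndex_add h' h'.radical fun u => Iff.rfl
  have h5 := posIndex_add_negIndex_add_le (h.prod h')
    (LinearMap.range (h.radical.subtype.prodMap h'.radical.subtype)) (by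
      rintro _ ⟨⟨a, b⟩, rfl⟩ v
      change Φ v.1 a + Ψ v.2 b = 0
      rw [a.2, b.2, add_zero])
  rw [LinearMap.finrank_range_of_inj (Function.Injective.prodMap h.radical.injective_subtype
    h'.radical.injective_subtype), finrank_prod, finrank_prod] at h5
  omega

end HermitianSums

section Complements

variable {V : Type*} [AddCommGroup V] [Module ℂ V] [FiniteDimensional ℂ V]

theorem IsInner.exists_orthogonal_complement {P : V → V → ℂ} (h : IsInner P) {A B : Submodule ℂ V}
    (hAB : A ≤ B) : ∃ C : Submodule ℂ V, (∀ v, v ∈ C ↔ v ∈ B ∧ ∀ a ∈ A, P a v = 0) ∧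
      finrank ℂ A + finrank ℂ C = finrank ℂ B := by
  let _ : NormedAddCommGroup V := @InnerProductSpace.Core.toNormedAddCommGroup ℂ V _ _ _ h.core
  let _ : InnerProductSpace ℂ V := InnerProductSpace.ofCore h.core.toCore
  refine ⟨Aᗮ ⊓ B, fun v => ?_, Submodule.finrank_add_inf_finrank_orthogonal hAB⟩
  rw [Submodule.mem_inf, and_comm]
  exact Iff.rfl

end Complements

/-! ### Spaces with a conjugate linear map -/

section RealStructures

variable {M N : Type*} [AddCommGroup M] [Module ℂ M] [FiniteDimensional ℂ M]
  [AddCommGroup N] [Module ℂ N] [FiniteDimensional ℂ N]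

/-- Spaces of equal dimension with conjugate linear maps of the same square `1` or `-1` are
isomorphic: any invertible linear map is a value of a real pencil of equivariant ones. -/
theorem exists_equivariant_equiv (J₁ : M →ₛₗ[starRingEnd ℂ] M) (J₂ : N →ₛₗ[starRingEnd ℂ] N)
    (a : ℤˣ) (h₁ : ∀ v, J₁ (J₁ v) = ((a : ℤ) : ℂ) • v) (h₂ : ∀ v, J₂ (J₂ v) = ((a : ℤ) : ℂ) • v)
    (hd : finrank ℂ M = finrank ℂ N) : ∃ Θ : M ≃ₗ[ℂ] N, ∀ v, Θ (J₁ v) = J₂ (Θ v) := by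
  let g : M ≃ₗ[ℂ] N := LinearEquiv.ofFinrankEq M N hd
  let g' : M →ₗ[ℂ] N :=
    { toFun := fun v => ((a : ℤ) : ℂ) • J₂ (g (J₁ v))
      map_add' := fun u v => by simp only [map_add, smul_add]
      map_smul' := fun c v => by
        simp only [map_smulₛₗ, RingHom.id_apply, Complex.conj_conj]
        rw [smul_comm] }
  have hg' : ∀ v, g' v = ((a : ℤ) : ℂ) • J₂ (g (J₁ v)) := fun v => rfl
  -- `A` and `B` are the real and the imaginary part of `g`
  let A : M →ₗ[ℂ] N := (1 / 2 : ℂ) • (g.toLinearMap + g')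
  let B : M →ₗ[ℂ] N := (-Complex.I / 2) • (g.toLinearMap - g')
  have hI := Complex.I_mul_I
  have hAB : A + Complex.I • B = g.toLinearMap := by
    simp only [A, B, smul_smul]
    have : Complex.I * (-Complex.I / 2) = 1 / 2 := by linear_combination (-1 / 2 : ℂ) * hI
    rw [this]
    module
  obtain ⟨r, hr⟩ := exists_real_finrank_ker_le A B Complex.I
  rw [hAB, LinearEquiv.ker, finrank_bot, Nat.le_zero, Submodule.finrank_eq_zero,
    LinearMap.ker_eq_bot] at hr
  refine ⟨LinearEquiv.ofInjectiveOfFinrankEq _ hr hd, fun v => ?_⟩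
  change (1 / 2 : ℂ) • (g (J₁ v) + g' (J₁ v)) + (r : ℂ) • (-Complex.I / 2) • (g (J₁ v) - g' (J₁ v)) =
    J₂ ((1 / 2 : ℂ) • (g v + g' v) + (r : ℂ) • (-Complex.I / 2) • (g v - g' v))
  have e1 : g' (J₁ v) = J₂ (g v) := by
    rw [hg', h₁, map_smul, map_smulₛₗ, conj_units_coe, units_coe_smul_smul]
  have e2 : J₂ (g' v) = g (J₁ v) := by
    rw [hg', map_smulₛₗ, h₂, conj_units_coe, units_coe_smul_smul]
  simp only [map_add, map_sub, map_smulₛₗ J₂, e1, e2, map_div₀, map_neg, map_one, map_ofNat,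
    Complex.conj_I, Complex.conj_ofReal]
  module

/-- A space with a quaternionic structure has even dimension, as it has a non-degenerate skew
form. -/
theorem even_finrank_of_quaternionic (J : M →ₛₗ[starRingEnd ℂ] M) (hJ : ∀ v, J (J v) = -v) :
    Even (finrank ℂ M) := by
  obtain ⟨P, hP⟩ := exists_isInner (V := M)
  -- the sum of two forms, both of which are positive at `(u, J u)`
  let ω : LinearMap.BilinForm ℂ M := LinearMap.mk₂ ℂ
    (fun u v => P (J u) v + starRingEnd ℂ (P (J (J u)) (J v)))
    (fun u u' v => by simp only [map_add, hP.add_left]; ring)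
    (fun c u v => by simp only [map_smulₛₗ, hP.smul_left, Complex.conj_conj, map_mul, smul_eq_mul]; ring)
    (fun u v v' => by simp only [map_add, hP.add_right]; ring)
    (fun c u v => by simp only [map_smulₛₗ, hP.smul_right, Complex.conj_conj, map_mul, smul_eq_mul]; ring)
  have hω : ∀ u v, ω u v = P (J u) v + starRingEnd ℂ (P (J (J u)) (J v)) := fun u v => rfl
  have hskew : ∀ u v, ω u v = -ω v u := fun u v => by
    rw [hω, hω, hP.conj_symm, hP.conj_symm, hJ, hJ, hP.neg_right, hP.neg_right]
    ring
  have hnd : ω.Nondegenerate := by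
    have h0 : ∀ u, (∀ v, ω u v = 0) → u = 0 := fun u hu => by
      by_contra hne
      have h1 : J u ≠ 0 := fun h0 => hne (by simpa [h0] using (hJ u).symm)
      have h2 : J (J u) ≠ 0 := fun h0 => hne (by simpa [h0] using (hJ u).symm)
      have h3 := congrArg Complex.re (hu (J u))
      rw [hω, Complex.add_re, Complex.conj_re, Complex.zero_re] at h3
      have := hP.pos _ h1
      have := hP.pos _ h2
      linarith
    exact ⟨h0, fun u hu => h0 u fun v => by rw [hskew, hu, neg_zero]⟩
  let b := finBasis ℂ M
  have hdet := (LinearMap.BilinForm.nondegenerate_iff_det_ne_zero b).mp hnd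
  have hT : (LinearMap.BilinForm.toMatrix b ω).transpose = -LinearMap.BilinForm.toMatrix b ω := by
    ext i j
    rw [Matrix.transpose_apply, Matrix.neg_apply, LinearMap.BilinForm.toMatrix_apply, LinearMap.BilinForm.toMatrix_apply,
      hskew]
  have h1 := congrArg Matrix.det hT
  rw [Matrix.det_transpose, Matrix.det_neg, Fintype.card_fin] at h1
  by_contra hodd
  rw [Nat.not_even_iff_odd] at hodd
  rw [hodd.neg_one_pow, neg_one_mul, self_eq_neg] at h1
  exact hdet h1

omit [FiniteDimensional ℂ M] in
/-- Symmetric forms can be non-degenerate, and skew forms can be so up to a radical whose dimension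
is the parity of the dimension of the space. -/
theorem exists_form_finrank_ker_le [FiniteDimensional ℂ M] (ε : ℤˣ) : ∃ c : M →ₗ[ℂ] M →ₗ[ℂ] ℂ,
    (∀ u v, c u v = -((ε : ℤ) : ℂ) * c v u) ∧
      finrank ℂ (LinearMap.ker c) ≤ if ε = 1 then finrank ℂ M % 2 else 0 := by
  let b := finBasis ℂ M
  set n := finrank ℂ M with hn
  -- for `ε = 1` a sum of hyperbolic planes, for `ε = -1` a sum of squares
  rcases Int.units_eq_one_or ε with rfl | rfl
  · let p : Fin (n / 2) → M →ₗ[ℂ] ℂ := fun i => b.coord ⟨2 * i, by omega⟩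
    let q : Fin (n / 2) → M →ₗ[ℂ] ℂ := fun i => b.coord ⟨2 * i + 1, by omega⟩
    let c : M →ₗ[ℂ] M →ₗ[ℂ] ℂ := ∑ i, ((p i).smulRight (q i) - (q i).smulRight (p i))
    have hc : ∀ u v, c u v = ∑ i, (p i u * q i v - q i u * p i v) := fun u v => by
      simp [c, LinearMap.sum_apply]
    refine ⟨c, fun u v => ?_, ?_⟩
    · rw [hc, hc, Finset.mul_sum]
      refine Finset.sum_congr rfl fun i _ => ?_
      push_cast
      ring
    · rw [if_pos rfl]
      let g : M →ₗ[ℂ] (Fin (n % 2) → ℂ) := LinearMap.pi fun j => b.coord ⟨2 * (n / 2) + j, by omega⟩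
      have hg : Function.Injective (g.domRestrict (LinearMap.ker c)) := by
        rw [← LinearMap.ker_eq_bot, eq_bot_iff]
        rintro ⟨u, hu⟩ hu'
        have h1 : ∀ v, c u v = 0 := fun v => by
          rw [LinearMap.mem_ker.mp hu, LinearMap.zero_apply]
        have h2 : ∀ j : Fin (n % 2), b.coord ⟨2 * (n / 2) + j, by omega⟩ u = 0 := fun j =>
          congrFun (LinearMap.mem_ker.mp hu') j
        have h3 : u = 0 := by
          apply b.ext_elem
          intro k
          rw [map_zero, Finsupp.zero_apply]
          by_cases hk : (k : ℕ) < 2 * (n / 2)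
          · rcases Nat.even_or_odd' (k : ℕ) with ⟨i, hi | hi⟩
            · have h4 := h1 (b ⟨2 * i + 1, by omega⟩)
              rw [hc, Finset.sum_eq_single ⟨i, by omega⟩] at h4
              · simpa [p, q, Finsupp.single_apply, Fin.ext_iff, ← hi] using h4
              · intro x _ hx
                have hx' : i ≠ x := fun h0 => hx (Fin.ext h0.symm)
                have : 2 * i + 1 ≠ 2 * x := by omega
                simp [p, q, Finsupp.single_apply, Fin.ext_iff, hx', this]
              · simp
            · have h4 := h1 (b ⟨2 * i, by omega⟩)
              rw [hc, Finset.sum_eq_single ⟨i, by omega⟩] at h4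
              · have h5 : ¬2 * i = (k : ℕ) := by omega
                simpa [p, q, Finsupp.single_apply, Fin.ext_iff, ← hi, h5] using h4
              · intro x _ hx
                have hx' : i ≠ x := fun h0 => hx (Fin.ext h0.symm)
                have : 2 * i ≠ 2 * x + 1 := by omega
                simp [p, q, Finsupp.single_apply, Fin.ext_iff, hx', this]
              · simp
          · have h4 := h2 ⟨k - 2 * (n / 2), by omega⟩
            rw [Basis.coord_apply] at h4
            convert h4 using 3
            simp only
            omega
        simp [h3]
      simpa using LinearMap.finrank_le_finrank_of_injective hg
  · let c : M →ₗ[ℂ] M →ₗ[ℂ] ℂ := ∑ i, (b.coord i).smulRight (b.coord i)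
    have hc : ∀ u v, c u v = ∑ i, b.coord i u * b.coord i v := fun u v => by
      simp [c, LinearMap.sum_apply]
    refine ⟨c, fun u v => ?_, ?_⟩
    · rw [hc, hc, Finset.mul_sum]
      refine Finset.sum_congr rfl fun i _ => ?_
      push_cast
      ring
    · have : LinearMap.ker c = ⊥ := by
        rw [eq_bot_iff]
        intro u hu
        apply b.ext_elem
        intro k
        have h1 : c u (b k) = 0 := by rw [LinearMap.mem_ker.mp hu, LinearMap.zero_apply]
        rw [hc] at h1
        simpa [Finsupp.single_apply] using h1
      rw [this, finrank_bot]
      exact Nat.zero_le _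

end RealStructures

namespace EpsSpace

variable {ε η : ℤˣ} {V : Type*} [AddCommGroup V] [Module ℂ V] [FiniteDimensional ℂ V]

/-- The signature of an `(ε, η)`-space is that of the Hermitian form `κ ⟨v, J u⟩`. -/
theorem sign_eq_nilIndex (S : EpsSpace ε η V) (X : End ℂ V) : S.sign = S.nilIndex X 0 := by
  have hκ := plusEigenvalue_mul_self η
  have hκ0 := plusEigenvalue_ne_zero η
  set κ := plusEigenvalue η with hκdef
  have hΦ : ∀ u v, S.nilForm X 0 u v = κ * S.form v (S.J u) := fun u v => by
    rw [nilForm, pow_zero, Module.End.one_apply]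
  have hdim : ∀ μ : ℂ, S.eigenDim ⊤ ⊥ μ = finrank ℂ (LinearMap.ker (S.L - μ • LinearMap.id)) := fun μ => by
    rw [eigenDim, top_inf_eq]
    exact (Submodule.equivMapOfInjective (⊥ : Submodule ℂ V).mkQ (by
      rw [← LinearMap.ker_eq_bot, Submodule.ker_mkQ]) _).finrank_eq.symm
  have hmem : ∀ (μ : ℂ) (v : V), v ∈ LinearMap.ker (S.L - μ • LinearMap.id) ↔ S.L v = μ • v := fun μ v => by
    rw [LinearMap.mem_ker, LinearMap.sub_apply, sub_eq_zero, LinearMap.smul_apply, LinearMap.id_apply]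
  -- on the eigenspaces of `L` the form agrees with the inner product up to sign
  have h1 : S.eigenDim ⊤ ⊥ κ ≤ posIndex (S.nilForm X 0) := by
    rw [hdim]
    refine le_posIndex _ fun v hv hv0 => ?_
    rw [hmem] at hv
    rw [hΦ, ← smul_eq_mul, ← LinearMap.smul_apply, ← map_smul, ← hv]
    exact S.pos v hv0
  have h2 : S.eigenDim ⊤ ⊥ (-κ) ≤ negIndex (S.nilForm X 0) := by
    rw [hdim]
    refine le_posIndex _ fun v hv hv0 => ?_
    rw [hmem] at hv
    rw [hΦ, ← neg_mul, ← smul_eq_mul, ← LinearMap.smul_apply, ← map_smul, ← hv]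
    exact S.pos v hv0
  have hherm : IsHerm (S.nilForm X 0) :=
    { add_right := fun u v w => by simp only [hΦ, map_add, LinearMap.add_apply, mul_add]
      smul_right := fun u c v => by
        simp only [hΦ, map_smul, LinearMap.smul_apply, smul_eq_mul]; ring
      conj_symm := by
        have h0 : S.IsSelfAdj 0 := fun u v => by simp
        have := (h0.isHerm 0).conj_symm
        simpa only [nilForm, pow_zero] using this }
  have h3 := posIndex_add_negIndex_add_le hherm ⊥ (by
    intro u hu v
    rw [(Submodule.mem_bot ℂ).mp hu, hherm.zero_right])
  rw [finrank_bot, add_zero] at h3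
  have h4 : finrank ℂ V ≤ S.eigenDim ⊤ ⊥ κ + S.eigenDim ⊤ ⊥ (-κ) := by
    rw [hdim, hdim, ← Submodule.finrank_sup_add_finrank_inf_eq, ← finrank_top ℂ V]
    refine le_trans (Submodule.finrank_mono fun v _ => ?_) (Nat.le_add_right _ _)
    have hv : v = (1 / 2 : ℂ) • (v + κ⁻¹ • S.L v) + (1 / 2 : ℂ) • (v - κ⁻¹ • S.L v) := by module
    have hη : κ⁻¹ * ((η : ℤ) : ℂ) = κ := by rw [← hκ, ← mul_assoc, inv_mul_cancel₀ hκ0, one_mul]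
    rw [hv]
    refine Submodule.add_mem_sup ?_ ?_
    · have h5 : κ • κ⁻¹ • S.L v = S.L v := smul_inv_smul₀ hκ0 _
      rw [hmem, map_smul, map_add, map_smul, S.L_L, smul_smul, hη, smul_comm κ, smul_add κ, h5,
        add_comm]
    · have h5 : κ • κ⁻¹ • S.L v = S.L v := smul_inv_smul₀ hκ0 _
      rw [hmem, map_smul, map_sub, map_smul, S.L_L, smul_smul, hη, smul_comm (-κ), smul_sub,
        neg_smul, smul_sub κ, h5]
      congr 1
      module
  refine Prod.ext ?_ ?_
  · change S.eigenDim ⊤ ⊥ κ = posIndex (S.nilForm X 0)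
    omega
  · change S.eigenDim ⊤ ⊥ (-κ) = negIndex (S.nilForm X 0)
    omega

theorem sign_add (S : EpsSpace ε η V) : S.sign.1 + S.sign.2 = finrank ℂ V := by
  have h0 : S.IsSelfAdj 0 := fun u v => by simp
  have h1 := h0.nilIndex_add_finrank_ker 0
  rw [← S.sign_eq_nilIndex, pow_zero] at h1
  have : LinearMap.ker (1 : End ℂ V) = ⊥ := by
    rw [eq_bot_iff]; intro v hv; exact hv
  rw [this, finrank_bot, add_zero] at h1
  exact h1

end EpsSpace

/-! ### The decomposition of the space along a parabolic subgroup -/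

/-- A subspace of a space with a non-degenerate form is its own double orthogonal. -/
theorem EpsSpace.mem_of_forall_form_eq_zero {ε η : ℤˣ} {W : Type*} [AddCommGroup W] [Module ℂ W]
    [FiniteDimensional ℂ W] (T : EpsSpace ε η W) (R : Submodule ℂ W) {e : W}
    (h : ∀ v, (∀ w ∈ R, T.form w v = 0) → T.form e v = 0) : e ∈ R := by
  by_contra he
  obtain ⟨f, hf, hR⟩ := Submodule.exists_le_ker_of_notMem he
  have hinj : Function.Injective T.form.flip := by
    rw [← LinearMap.ker_eq_bot, eq_bot_iff]
    intro u hu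
    refine T.nondegenerate u fun v => ?_
    rw [T.symm, ← LinearMap.flip_apply, LinearMap.mem_ker.mp hu, LinearMap.zero_apply, mul_zero]
  obtain ⟨v, hv⟩ := (LinearMap.injective_iff_surjective_of_finrank_eq_finrank
    (Subspace.dual_finrank_eq (K := ℂ) (V := W)).symm).mp hinj f
  have hv' : ∀ w, T.form w v = f w := fun w => by rw [← hv, LinearMap.flip_apply]
  exact hf ((hv' e).symm.trans (h v fun w hw => (hv' w).trans (hR hw)))

namespace LeviDecomposition

variable {ε η : ℤˣ} {V W : Type*} [NormedAddCommGroup V] [NormedSpace ℂ V]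
  [NormedAddCommGroup W] [NormedSpace ℂ W] {S : EpsSpace ε η V} {T : EpsSpace ε η W}
  (D : LeviDecomposition S T)

/-- The orthogonal `E^⊥` of the isotropic subspace. -/
def F : Submodule ℂ W where
  carrier := {w | ∀ u ∈ D.E, T.form u w = 0}
  add_mem' hu hv w hw := by rw [map_add, hu w hw, hv w hw, add_zero]
  zero_mem' w _ := map_zero _
  smul_mem' c u hu w hw := by rw [map_smul, hu w hw, smul_zero]

theorem form_E_incl {u : W} (hu : u ∈ D.E) (v : V) : T.form u (D.incl v) = 0 :=
  (D.mem_range_incl _).mp ⟨v, rfl⟩ u (Submodule.mem_sup_left hu)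

theorem form_L_incl {u : W} (hu : u ∈ D.E) (v : V) : T.form (T.L u) (D.incl v) = 0 :=
  (D.mem_range_incl _).mp ⟨v, rfl⟩ _ (Submodule.mem_sup_right ⟨u, hu, rfl⟩)

theorem form_incl_E {u : W} (hu : u ∈ D.E) (v : V) : T.form (D.incl v) u = 0 := by
  rw [T.symm, D.form_E_incl hu, mul_zero]

theorem form_incl_L {u : W} (hu : u ∈ D.E) (v : V) : T.form (D.incl v) (T.L u) = 0 := by
  rw [T.symm, D.form_L_incl hu, mul_zero]

theorem form_L_L {u w : W} (hu : u ∈ D.E) (hw : w ∈ D.E) : T.form (T.L u) (T.L w) = 0 := by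
  rw [T.form_L, D.isotropic u hu w hw]

theorem incl_mem_F (v : V) : D.incl v ∈ D.F := fun _ hu => D.form_E_incl hu v

theorem E_le_F : D.E ≤ D.F := fun w hw u hu => D.isotropic u hu w hw

theorem J_mem_F {w : W} (hw : w ∈ D.F) : T.J w ∈ D.F := fun u hu => by
  have h1 : T.form (T.J u) (T.J (T.J w)) = 0 := by
    rw [T.J_J, map_smul, hw _ (D.J_mem u hu), smul_zero]
  rw [T.form_J] at h1
  exact (map_eq_zero _).mp h1

/-- The pairing `⟨a, L b⟩` on `E` is non-degenerate, since `⟨a, L (J a)⟩` is not zero for `a ≠ 0`.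
-/
theorem eq_zero_of_form_L {a : W} (ha : a ∈ D.E) (h : ∀ b ∈ D.E, T.form a (T.L b) = 0) : a = 0 := by
  by_contra ha0
  have h1 := T.pos a ha0
  have h2 := h _ (D.J_mem a ha)
  rw [← T.form_L, T.L_L, map_smul, smul_eq_mul] at h2
  have h3 := (mul_eq_zero.mp h2).resolve_left (by
    intro h0
    have := units_coe_mul_self η
    rw [h0, zero_mul] at this
    exact zero_ne_one this)
  rw [h3, Complex.zero_re] at h1
  exact lt_irrefl _ h1

theorem form_left_L_eq {a b : W} : T.form (T.L a) b = ((η : ℤ) : ℂ) * T.form a (T.L b) := by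
  rw [← T.form_L a, T.L_L, map_smul, smul_eq_mul, ← mul_assoc, units_coe_mul_self, one_mul]

/-- The pairing `⟨a, L b⟩` on `E` is perfect. -/
theorem exists_form_L_eq [FiniteDimensional ℂ W] (f : D.E →ₗ[ℂ] ℂ) :
    ∃ a ∈ D.E, ∀ b : D.E, T.form a (T.L b) = f b := by
  let p : D.E →ₗ[ℂ] Dual ℂ D.E := (T.form.compl₂ (T.L ∘ₗ D.E.subtype)).domRestrict D.E
  have hp : ∀ a b : D.E, p a b = T.form a (T.L b) := fun a b => rfl
  have hinj : Function.Injective p := by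
    rw [← LinearMap.ker_eq_bot, eq_bot_iff]
    intro a ha
    refine (Submodule.mem_bot ℂ).mpr (Subtype.ext (D.eq_zero_of_form_L a.2 fun b hb => ?_))
    have := congrArg (fun g : Dual ℂ D.E => g ⟨b, hb⟩) (LinearMap.mem_ker.mp ha)
    exact this
  obtain ⟨a, ha⟩ := (LinearMap.injective_iff_surjective_of_finrank_eq_finrank
    (Subspace.dual_finrank_eq (K := ℂ) (V := D.E)).symm).mp hinj f
  exact ⟨a, a.2, fun b => by rw [← hp, ha]⟩

/-- The sum map `(a, v, b) ↦ a + v + L b`. -/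
def sumMap : D.E × V × D.E →ₗ[ℂ] W :=
  D.E.subtype.coprod (D.incl.coprod (T.L ∘ₗ D.E.subtype))

theorem sumMap_apply (a : D.E) (v : V) (b : D.E) :
    D.sumMap (a, v, b) = a + (D.incl v + T.L b) := by
  simp [sumMap]

theorem form_sumMap (a a' b b' : D.E) (v v' : V) :
    T.form (D.sumMap (a, v, b)) (D.sumMap (a', v', b')) =
      T.form a (T.L b') + S.form v v' + T.form (T.L b) a' := by
  simp only [sumMap_apply, map_add, LinearMap.add_apply]
  rw [D.isotropic _ a.2 _ a'.2, D.form_E_incl a.2, D.form_incl_E a'.2, D.form_incl,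
    D.form_L_incl b.2, D.form_incl_L b'.2, D.form_L_L b.2 b'.2]
  ring

theorem sumMap_injective : Function.Injective D.sumMap := by
  rw [← LinearMap.ker_eq_bot, eq_bot_iff]
  rintro ⟨a, v, b⟩ h
  have h0 : ∀ x, T.form (D.sumMap (a, v, b)) x = 0 := fun x => by
    rw [LinearMap.mem_ker.mp h, map_zero, LinearMap.zero_apply]
  have ha : a = 0 := Subtype.ext (D.eq_zero_of_form_L a.2 fun b' hb' => by
    have := h0 (D.sumMap (0, 0, ⟨b', hb'⟩))
    rw [form_sumMap] at this
    simpa using this)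
  have hb : b = 0 := Subtype.ext (D.eq_zero_of_form_L b.2 fun a' ha' => by
    have := h0 (D.sumMap (⟨a', ha'⟩, 0, 0))
    rw [form_sumMap, form_left_L_eq] at this
    simpa using this)
  have hv : v = 0 := S.nondegenerate v fun v' => by
    have := h0 (D.sumMap (0, v', 0))
    rw [form_sumMap] at this
    simpa using this
  rw [ha, hv, hb]
  exact Submodule.zero_mem _

theorem sumMap_surjective [FiniteDimensional ℂ W] : Function.Surjective D.sumMap := fun w => by
  obtain ⟨b, hb, hb'⟩ := D.exists_form_L_eq (((η : ℤ) : ℂ) • (T.form w).domRestrict D.E)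
  obtain ⟨a, ha, ha'⟩ := D.exists_form_L_eq ((T.form w) ∘ₗ T.L ∘ₗ D.E.subtype)
  have hr : w - a - T.L b ∈ LinearMap.range D.incl := by
    rw [D.mem_range_incl]
    intro u hu
    obtain ⟨x, hx, _, ⟨y, hy, rfl⟩, rfl⟩ := Submodule.mem_sup.mp hu
    have h1 : T.form (w - a - T.L b) x = 0 := by
      have := hb' ⟨x, hx⟩
      simp only [LinearMap.smul_apply, LinearMap.domRestrict_apply, smul_eq_mul] at this
      rw [map_sub, map_sub, LinearMap.sub_apply, LinearMap.sub_apply, D.isotropic a ha x hx,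
        form_left_L_eq, this, ← mul_assoc, units_coe_mul_self]
      ring
    have h2 : T.form (w - a - T.L b) (T.L y) = 0 := by
      have := ha' ⟨y, hy⟩
      rw [map_sub, map_sub, LinearMap.sub_apply, LinearMap.sub_apply, D.form_L_L hb hy, this]
      simp
    rw [T.symm, map_add, h1, h2, add_zero, mul_zero]
  obtain ⟨v, hv⟩ := hr
  refine ⟨(⟨a, ha⟩, v, ⟨b, hb⟩), ?_⟩
  rw [sumMap_apply, hv]
  abel

variable [FiniteDimensional ℂ W]

/-- The decomposition `W = E ⊕ V ⊕ L E` in the form `(a, v, b) ↦ a + v + L b`. -/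
def sumEquiv : (D.E × V × D.E) ≃ₗ[ℂ] W :=
  LinearEquiv.ofBijective D.sumMap ⟨D.sumMap_injective, D.sumMap_surjective⟩

/-- The projection to `V`. -/
def projV : W →ₗ[ℂ] V := LinearMap.fst ℂ V D.E ∘ₗ LinearMap.snd ℂ D.E (V × D.E) ∘ₗ D.sumEquiv.symm

theorem projV_sumMap (a : D.E) (v : V) (b : D.E) : D.projV (D.sumMap (a, v, b)) = v := by
  have : D.sumEquiv.symm (D.sumMap (a, v, b)) = (a, v, b) := D.sumEquiv.symm_apply_apply _
  simp [projV, this]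

theorem projV_incl (v : V) : D.projV (D.incl v) = v := by
  have := D.projV_sumMap 0 v 0
  rwa [sumMap_apply, Submodule.coe_zero, map_zero, add_zero, zero_add] at this

theorem projV_of_mem_E {w : W} (hw : w ∈ D.E) : D.projV w = 0 := by
  have := D.projV_sumMap ⟨w, hw⟩ 0 0
  rwa [sumMap_apply, Submodule.coe_zero, map_zero, map_zero, add_zero, add_zero] at this

theorem projV_L {w : W} (hw : w ∈ D.E) : D.projV (T.L w) = 0 := by
  have := D.projV_sumMap 0 0 ⟨w, hw⟩
  rwa [sumMap_apply, Submodule.coe_zero, map_zero, zero_add, zero_add] at this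

theorem sub_projV_mem {w : W} (hw : w ∈ D.F) : w - D.incl (D.projV w) ∈ D.E := by
  obtain ⟨⟨a, v, b⟩, rfl⟩ := D.sumMap_surjective w
  have hb : b = 0 := Subtype.ext (D.eq_zero_of_form_L b.2 fun a' ha' => by
    have := hw a' ha'
    rw [sumMap_apply, map_add, map_add, D.isotropic _ ha' _ a.2, D.form_E_incl ha'] at this
    rw [← units_coe_smul_smul η (T.form b (T.L a')), smul_eq_mul, smul_eq_mul, ← form_left_L_eq,
      T.symm]
    simp only [zero_add] at this
    rw [this, mul_zero, mul_zero])
  rw [projV_sumMap, sumMap_apply, hb, Submodule.coe_zero, map_zero, add_zero, add_sub_cancel_right]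
  exact a.2

theorem mem_E_iff {w : W} : w ∈ D.E ↔ w ∈ D.F ∧ D.projV w = 0 :=
  ⟨fun h => ⟨D.E_le_F h, D.projV_of_mem_E h⟩, fun h => by
    have := D.sub_projV_mem h.1
    rwa [h.2, map_zero, sub_zero] at this⟩

/-- The form on `E^⊥` is pulled back from `V`. -/
theorem form_of_mem_F {w w' : W} (hw : w ∈ D.F) (hw' : w' ∈ D.F) :
    T.form w w' = S.form (D.projV w) (D.projV w') := by
  have h1 := D.sub_projV_mem hw
  have h2 := D.sub_projV_mem hw'
  have h3 : T.form (w - D.incl (D.projV w)) w' = 0 := hw' _ h1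
  have h4 : T.form (D.incl (D.projV w)) (w' - D.incl (D.projV w')) = 0 := D.form_incl_E h2 _
  rw [map_sub, LinearMap.sub_apply, sub_eq_zero] at h3
  rw [map_sub, sub_eq_zero, D.form_incl] at h4
  rw [h3, h4]

theorem projV_J (w : W) : D.projV (T.J w) = S.J (D.projV w) := by
  obtain ⟨⟨a, v, b⟩, rfl⟩ := D.sumMap_surjective w
  rw [projV_sumMap]
  have : T.J (D.sumMap (a, v, b)) =
      D.sumMap (⟨T.J a, D.J_mem _ a.2⟩, S.J v, ⟨T.J b, D.J_mem _ b.2⟩) := by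
    rw [sumMap_apply, sumMap_apply, map_add, map_add, D.J_incl, T.L_J]
  rw [this, projV_sumMap]

theorem form_incl_left (v : V) (w : W) : T.form (D.incl v) w = S.form v (D.projV w) := by
  obtain ⟨⟨a, v', b⟩, rfl⟩ := D.sumMap_surjective w
  rw [projV_sumMap, sumMap_apply, map_add, map_add, D.form_incl, D.form_incl_E a.2,
    D.form_incl_L b.2, add_zero, zero_add]

theorem form_incl_right (v : V) (w : W) : T.form w (D.incl v) = S.form (D.projV w) v := by
  rw [T.symm, form_incl_left, ← S.symm]

variable [FiniteDimensional ℂ V]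

theorem finrank_eq : finrank ℂ W = 2 * finrank ℂ D.E + finrank ℂ V := by
  rw [← D.sumEquiv.finrank_eq, finrank_prod, finrank_prod]
  ring

/-- `Y` lies in `X + i 𝔫`. -/
structure IsLift (X : V →L[ℂ] V) (Y : W →L[ℂ] W) : Prop where
  mem : Y ∈ T.iLieReal
  apply_E : ∀ w ∈ D.E, Y w = 0
  sub_mem : ∀ v, Y (D.incl v) - D.incl (X v) ∈ D.E

namespace IsLift

variable {D} {X : V →L[ℂ] V} {Y : W →L[ℂ] W} (h : D.IsLift X Y)
include h

omit [FiniteDimensional ℂ V] [FiniteDimensional ℂ W] in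
theorem form_swap (u w : W) : T.form (Y u) w = -T.form u (Y w) := eq_neg_of_add_eq_zero_left (h.mem.1 u w)

omit [FiniteDimensional ℂ V] [FiniteDimensional ℂ W] in
theorem apply_mem_F (w : W) : Y w ∈ D.F := fun u hu => by
  have := h.form_swap u w
  rw [h.apply_E u hu, map_zero, LinearMap.zero_apply] at this
  exact neg_eq_zero.mp this.symm

omit [FiniteDimensional ℂ V] in
theorem projV_apply {w : W} (hw : w ∈ D.F) : D.projV (Y w) = X (D.projV w) := by
  have h1 := h.apply_E _ (D.sub_projV_mem hw)
  have h2 := D.projV_of_mem_E (h.sub_mem (D.projV w))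
  rw [map_sub, sub_eq_zero] at h1
  rwa [map_sub, D.projV_incl, ← h1, sub_eq_zero] at h2

omit [FiniteDimensional ℂ V] in
theorem projV_pow_apply (k : ℕ) {w : W} (hw : w ∈ D.F) :
    (Y ^ k) w ∈ D.F ∧ D.projV ((Y ^ k) w) = (X ^ k) (D.projV w) := by
  induction k with
  | zero => exact ⟨hw, rfl⟩
  | succ k ih =>
    rw [pow_succ', pow_succ']
    exact ⟨h.apply_mem_F _, (h.projV_apply ih.1).trans (congrArg _ ih.2)⟩

omit [FiniteDimensional ℂ V] in
theorem isNilpotent (hX : IsNilpotent X) : IsNilpotent Y := by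
  obtain ⟨k, hk⟩ := hX
  refine ⟨k + 2, ContinuousLinearMap.ext fun w => ?_⟩
  have h1 := h.projV_pow_apply k (h.apply_mem_F w)
  rw [hk] at h1
  have h2 : Y ^ (k + 2) = Y * (Y ^ k * Y) := by rw [← pow_succ, ← pow_succ']
  rw [h2]
  exact h.apply_E _ (D.mem_E_iff.mpr h1)

end IsLift

/-- The lifts of the elements of `O` are the elements of `O + i 𝔫`. -/
theorem mem_fiber_iff {O : Set (V →L[ℂ] V)} (hO : ∀ X ∈ O, X ∈ S.iLieReal) {Y : W →L[ℂ] W} :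
    Y ∈ D.fiber O ↔ ∃ X ∈ O, D.IsLift X Y := by
  refine exists_congr fun X => and_congr_right fun hX => ?_
  have key : ∀ X', D.IsExtension X X' → ∀ w, X' w = D.incl (X (D.projV w)) := fun X' hX' w => by
    obtain ⟨⟨a, v, b⟩, rfl⟩ := D.sumMap_surjective w
    have h1 : X' a = 0 := hX'.2 _ (Submodule.mem_sup_left a.2)
    have h2 : X' (T.L b) = 0 := hX'.2 _ (Submodule.mem_sup_right ⟨b, b.2, rfl⟩)
    rw [projV_sumMap, sumMap_apply, map_add, map_add, h1, h2, hX'.1, zero_add, add_zero]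
  have hmem : ∀ X', D.IsExtension X X' → X' ∈ T.iLieReal := fun X' hX' => by
    refine ⟨fun u w => ?_, fun w => ?_⟩
    · rw [key X' hX', key X' hX', form_incl_left, form_incl_right]
      exact (hO X hX).1 _ _
    · rw [key X' hX', key X' hX', projV_J, (hO X hX).2, map_neg, D.J_incl]
  constructor
  · rintro ⟨X', hX', N, hN, rfl⟩
    have h1 := hmem X' hX'
    refine ⟨⟨fun u w => ?_, fun w => ?_⟩, fun w hw => ?_, fun v => ?_⟩
    · have h2 := h1.1 u w
      have h3 := hN.1.1 u w
      simp only [add_apply, map_add, LinearMap.add_apply]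
      linear_combination h2 + h3
    · simp only [add_apply, map_add, h1.2, hN.1.2]
      abel
    · rw [add_apply, hN.2.1 w hw, hX'.2 w (Submodule.mem_sup_left hw), add_zero]
    · rw [add_apply, hX'.1, add_sub_cancel_left]
      exact hN.2.2 _ (D.incl_mem_F v)
  · intro hY
    let X' : W →L[ℂ] W := LinearMap.toContinuousLinearMap (D.incl ∘ₗ (X : V →ₗ[ℂ] V) ∘ₗ D.projV)
    have hX'a : ∀ w, X' w = D.incl (X (D.projV w)) := fun w => rfl
    have hX' : D.IsExtension X X' := by
      refine ⟨fun v => by rw [hX'a, projV_incl], fun w hw => ?_⟩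
      obtain ⟨x, hx, _, ⟨y, hy, rfl⟩, rfl⟩ := Submodule.mem_sup.mp hw
      rw [hX'a, map_add, D.projV_of_mem_E hx, D.projV_L hy, add_zero, map_zero, map_zero]
    have h1 := hmem X' hX'
    refine ⟨X', hX', Y - X', ⟨⟨fun u w => ?_, fun w => ?_⟩, fun w hw => ?_, fun w hw => ?_⟩,
      by rw [add_sub_cancel]⟩
    · have h2 := h1.1 u w
      have h3 := hY.mem.1 u w
      simp only [sub_apply, map_sub, LinearMap.sub_apply]
      linear_combination h3 - h2
    · simp only [sub_apply, map_sub, h1.2, hY.mem.2]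
      abel
    · rw [sub_apply, hY.apply_E w hw, hX'.2 w (Submodule.mem_sup_left hw), sub_zero]
    · have h2 : Y w - Y (D.incl (D.projV w)) = 0 := by
        rw [← map_sub]
        exact hY.apply_E _ (D.sub_projV_mem hw)
      rw [sub_apply, hX'a, sub_eq_zero.mp h2]
      exact hY.sub_mem _

end LeviDecomposition

/-! ### Generic elements of `O + i 𝔫` -/

theorem finrank_ker_domRestrict {V W : Type*} [AddCommGroup V] [Module ℂ V] [AddCommGroup W]
    [Module ℂ W] (A : V →ₗ[ℂ] W) (U : Submodule ℂ V) :
    finrank ℂ (LinearMap.ker (A.domRestrict U)) = finrank ℂ ↥(LinearMap.ker A ⊓ U) := by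
  rw [LinearMap.ker_domRestrict, inf_comm, ← Submodule.map_comap_subtype,
    Submodule.finrank_map_subtype_eq]

namespace EpsSpace

variable {ε η : ℤˣ} {W : Type*} [AddCommGroup W] [Module ℂ W] (T : EpsSpace ε η W)

/-- Every bilinear form is `⟨Y u, v⟩` for an operator `Y`. -/
theorem exists_form_apply_eq [FiniteDimensional ℂ W] (β : W →ₗ[ℂ] W →ₗ[ℂ] ℂ) :
    ∃ Y : W →ₗ[ℂ] W, ∀ u v, T.form (Y u) v = β u v := by
  have hinj : Function.Injective (T.form : W →ₗ[ℂ] Dual ℂ W) := by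
    rw [← LinearMap.ker_eq_bot, eq_bot_iff]
    intro u hu
    exact T.nondegenerate u fun v => by rw [LinearMap.mem_ker.mp hu, LinearMap.zero_apply]
  let e : W ≃ₗ[ℂ] Dual ℂ W := LinearEquiv.ofInjectiveOfFinrankEq _ hinj
    (Subspace.dual_finrank_eq (K := ℂ) (V := W)).symm
  refine ⟨e.symm.toLinearMap ∘ₗ β, fun u v => ?_⟩
  exact congrArg (fun g : Dual ℂ W => g v) (e.apply_symm_apply (β u))

end EpsSpace

namespace LeviDecomposition

variable {ε η : ℤˣ} {V W : Type*} [NormedAddCommGroup V] [NormedSpace ℂ V]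
  [NormedAddCommGroup W] [NormedSpace ℂ W] {S : EpsSpace ε η V} {T : EpsSpace ε η W}
  (D : LeviDecomposition S T)

/-- The kernel of `Y` is small: it meets `E^⊥` in a space of dimension at most `dim E`, and its
dimension is at most `dim E + r`. For suitable `r` the elements with this property are open and
dense in `O + i 𝔫`. -/
def IsGeneric (r : ℕ) (Y : W →L[ℂ] W) : Prop :=
  finrank ℂ ↥(LinearMap.ker (Y : W →ₗ[ℂ] W) ⊓ D.F) ≤ finrank ℂ D.E ∧
    finrank ℂ (LinearMap.ker (Y : W →ₗ[ℂ] W)) ≤ finrank ℂ D.E + r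

theorem isOpen_isGeneric [FiniteDimensional ℂ W] (r : ℕ) : IsOpen {Y | D.IsGeneric r Y} := by
  have h := isOpen_setOf_finrank_ker_inf_le (W := W) ⊤ (finrank ℂ D.E + r)
  have h' : ∀ Y : W →L[ℂ] W, finrank ℂ ↥(LinearMap.ker (Y : W →ₗ[ℂ] W) ⊓ ⊤) =
    finrank ℂ (LinearMap.ker (Y : W →ₗ[ℂ] W)) := fun Y => by rw [inf_top_eq]
  convert (isOpen_setOf_finrank_ker_inf_le D.F (finrank ℂ D.E)).inter h using 1
  ext Y
  exact and_congr_right fun _ => by rw [Set.mem_ofPred_eq, h']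

/-- Along an affine line that contains a generic element, all but finitely many elements are
generic. -/
theorem finite_setOf_not_isGeneric [FiniteDimensional ℂ W] (r : ℕ) (A B : W →L[ℂ] W) (t₀ : ℂ)
    (h : D.IsGeneric r (A + t₀ • B)) : {t : ℂ | ¬D.IsGeneric r (A + t • B)}.Finite := by
  have h1 := finite_setOf_lt_finrank_ker (A : W →ₗ[ℂ] W) B t₀
  have h2 := finite_setOf_lt_finrank_ker ((A : W →ₗ[ℂ] W).domRestrict D.F)
    ((B : W →ₗ[ℂ] W).domRestrict D.F) t₀
  have h4 : ∀ t : ℂ, finrank ℂ (LinearMap.ker ((A : W →ₗ[ℂ] W).domRestrict D.F +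
      t • (B : W →ₗ[ℂ] W).domRestrict D.F)) =
      finrank ℂ ↥(LinearMap.ker ((A + t • B : W →L[ℂ] W) : W →ₗ[ℂ] W) ⊓ D.F) := fun t =>
    finrank_ker_domRestrict ((A : W →ₗ[ℂ] W) + t • (B : W →ₗ[ℂ] W)) D.F
  refine (h1.union h2).subset fun t ht => ?_
  by_contra hn
  simp only [Set.mem_union, Set.mem_ofPred_eq, not_or, not_lt] at hn
  rw [h4, h4] at hn
  exact ht ⟨hn.2.trans h.1, (hn.1.trans h.2 :)⟩

variable [FiniteDimensional ℂ W]

/-- The coordinate `b` of `a + v + L b`. -/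
def projL : W →ₗ[ℂ] D.E :=
  LinearMap.snd ℂ V D.E ∘ₗ LinearMap.snd ℂ D.E (V × D.E) ∘ₗ D.sumEquiv.symm

theorem projL_sumMap (a : D.E) (v : V) (b : D.E) : D.projL (D.sumMap (a, v, b)) = b := by
  have : D.sumEquiv.symm (D.sumMap (a, v, b)) = (a, v, b) := D.sumEquiv.symm_apply_apply _
  simp [projL, this]

theorem projL_of_mem_E {w : W} (hw : w ∈ D.E) : D.projL w = 0 := by
  have := D.projL_sumMap ⟨w, hw⟩ 0 0
  rwa [sumMap_apply, Submodule.coe_zero, map_zero, map_zero, add_zero, add_zero] at this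

theorem projL_incl (v : V) : D.projL (D.incl v) = 0 := by
  have := D.projL_sumMap 0 v 0
  rwa [sumMap_apply, Submodule.coe_zero, map_zero, add_zero, zero_add] at this

theorem projL_L (b : D.E) : D.projL (T.L b) = b := by
  have := D.projL_sumMap 0 0 b
  rwa [sumMap_apply, Submodule.coe_zero, map_zero, zero_add, zero_add] at this

theorem mem_F_of_projL {w : W} (hw : D.projL w = 0) : w ∈ D.F := by
  obtain ⟨⟨a, v, b⟩, rfl⟩ := D.sumMap_surjective w
  rw [projL_sumMap] at hw
  rw [sumMap_apply, hw, Submodule.coe_zero, map_zero, add_zero]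
  exact D.F.add_mem (D.E_le_F a.2) (D.incl_mem_F v)

theorem projL_J (w : W) : (D.projL (T.J w) : W) = T.J (D.projL w) := by
  obtain ⟨⟨a, v, b⟩, rfl⟩ := D.sumMap_surjective w
  rw [projL_sumMap]
  have : T.J (D.sumMap (a, v, b)) =
      D.sumMap (⟨T.J a, D.J_mem _ a.2⟩, S.J v, ⟨T.J b, D.J_mem _ b.2⟩) := by
    rw [sumMap_apply, sumMap_apply, map_add, map_add, D.J_incl, T.L_J]
  rw [this, projL_sumMap]

/-- The restriction of `J` to `E`. -/
def JE : D.E →ₛₗ[starRingEnd ℂ] D.E where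
  toFun u := ⟨T.J u, D.J_mem _ u.2⟩
  map_add' _ _ := Subtype.ext (map_add T.J _ _)
  map_smul' _ _ := Subtype.ext (map_smulₛₗ T.J _ _)

omit [FiniteDimensional ℂ W] in
@[simp] theorem coe_JE (u : D.E) : (D.JE u : W) = T.J u := rfl

/-- An element of the complex Lie algebra that lifts `X` and has prescribed components `B : LE → V`
and `c` (the form `⟨Y L b, L b'⟩` on `E`). -/
structure IsComplexLift (X : V →L[ℂ] V) (B : D.E →ₗ[ℂ] V) (c : D.E →ₗ[ℂ] D.E →ₗ[ℂ] ℂ)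
    (Y : W →L[ℂ] W) : Prop where
  mem : Y ∈ T.lieAlg
  apply_E : ∀ w ∈ D.E, Y w = 0
  sub_mem : ∀ v, Y (D.incl v) - D.incl (X v) ∈ D.E
  form_apply : ∀ w w', T.form (Y w) w' = S.form (X (D.projV w) + B (D.projL w)) (D.projV w') -
    S.form (D.projV w) (B (D.projL w')) + c (D.projL w) (D.projL w')

/-- The conditions prescribe the bilinear form `⟨Y w, w'⟩`, hence `Y`. -/
theorem exists_isComplexLift {X : V →L[ℂ] V} (hX : X ∈ S.lieAlg) (B : D.E →ₗ[ℂ] V)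
    (c : D.E →ₗ[ℂ] D.E →ₗ[ℂ] ℂ) (hc : ∀ u v, c u v = -((ε : ℤ) : ℂ) * c v u) :
    ∃ Y, D.IsComplexLift X B c Y := by
  let β : W →ₗ[ℂ] W →ₗ[ℂ] ℂ := S.form.compl₁₂ ((X : V →ₗ[ℂ] V) ∘ₗ D.projV + B ∘ₗ D.projL) D.projV -
    S.form.compl₁₂ D.projV (B ∘ₗ D.projL) + c.compl₁₂ D.projL D.projL
  obtain ⟨Y, hY⟩ := T.exists_form_apply_eq β
  have hβ : ∀ w w', T.form (Y w) w' = S.form (X (D.projV w) + B (D.projL w)) (D.projV w') -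
    S.form (D.projV w) (B (D.projL w')) + c (D.projL w) (D.projL w') := fun w w' => hY w w'
  clear hY
  have hε := units_coe_mul_self ε
  refine ⟨LinearMap.toContinuousLinearMap Y, fun u w => ?_, fun w hw => ?_, fun v => ?_, hβ⟩
  · change T.form (Y u) w + T.form u (Y w) = 0
    have h1 := hX (D.projV u) (D.projV w)
    rw [T.symm u, hβ, hβ, hc (D.projL u), map_add, map_add, LinearMap.add_apply, LinearMap.add_apply,
      S.symm (B (D.projL u)), S.symm (B (D.projL w)), S.symm (X (D.projV w))]
    linear_combination h1 + (S.form (D.projV u) (B (D.projL w)) + S.form (D.projV u) (X (D.projV w))) * hε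
  · refine T.nondegenerate _ fun w' => ?_
    change T.form (Y w) w' = 0
    rw [hβ, D.projL_of_mem_E hw, D.projV_of_mem_E hw]
    simp
  · change Y (D.incl v) - D.incl (X v) ∈ D.E
    have hF : Y (D.incl v) ∈ D.F := fun u hu => by
      rw [T.symm, hβ, D.projV_of_mem_E hu, D.projL_of_mem_E hu]
      simp
    refine D.mem_E_iff.mpr ⟨D.F.sub_mem hF (D.incl_mem_F _), ?_⟩
    rw [map_sub, D.projV_incl, sub_eq_zero]
    refine sub_eq_zero.mp (S.nondegenerate _ fun v' => ?_)
    rw [map_sub, LinearMap.sub_apply, ← D.form_incl_right, hβ, D.projV_incl, D.projV_incl,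
      D.projL_incl, D.projL_incl]
    simp

namespace IsComplexLift

variable {D} {X : V →L[ℂ] V} {B : D.E →ₗ[ℂ] V} {c : D.E →ₗ[ℂ] D.E →ₗ[ℂ] ℂ} {Y : W →L[ℂ] W}
  (h : D.IsComplexLift X B c Y)
include h

/-- A complex lift is real if its components are anti-equivariant under `J`. -/
theorem isLift (hX : X ∈ S.iLieReal) (hB : ∀ b, B (D.JE b) = -S.J (B b))
    (hc : ∀ b b', c (D.JE b) (D.JE b') = -(starRingEnd ℂ) (c b b')) : D.IsLift X Y := by
  refine ⟨⟨h.mem, fun w => ?_⟩, h.apply_E, h.sub_mem⟩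
  rw [← sub_eq_zero]
  refine T.nondegenerate _ fun w' => ?_
  obtain ⟨w', rfl⟩ := T.J_surj w'
  have h1 : ∀ w, D.projL (T.J w) = D.JE (D.projL w) := fun w => Subtype.ext (D.projL_J w)
  rw [sub_neg_eq_add, map_add, LinearMap.add_apply, T.form_J, h.form_apply, h.form_apply,
    D.projV_J, D.projV_J, h1, h1, hB, hB, hc, hX.2, ← neg_add, ← map_add, map_neg, map_neg,
    LinearMap.neg_apply, S.form_J, S.form_J]
  simp only [map_add, map_sub]
  ring

/-- If `E` is identified with `ker X ⊕ M` in such a way that `B` is a multiple of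
`L : ker X → V` and `c` lives on `M`, then the lift is as generic as `c` is non-degenerate. -/
theorem isGeneric (hX : X ∈ S.iLieReal) {M : Type*} [AddCommGroup M] [Module ℂ M]
    [FiniteDimensional ℂ M] [FiniteDimensional ℂ V]
    (Θ : D.E ≃ₗ[ℂ] LinearMap.ker (X : V →ₗ[ℂ] V) × M) {z : ℂ} (hz : z ≠ 0)
    (hB : ∀ b, B b = z • S.L (Θ b).1) (c₀ : M →ₗ[ℂ] M →ₗ[ℂ] ℂ)
    (hc : ∀ b b', c b b' = c₀ (Θ b).2 (Θ b').2) : D.IsGeneric (finrank ℂ (LinearMap.ker c₀)) Y := by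
  have hXJ : ∀ v, X v = 0 → X (S.J v) = 0 := fun v hv => by rw [hX.2, hv, map_zero, neg_zero]
  have hpos : ∀ v, S.form v (S.L (S.J v)) = 0 → v = 0 := fun v hv => by
    by_contra hne
    have h1 := S.pos v hne
    rw [← S.form_L, S.L_L, map_smul, smul_eq_mul] at hv
    have h2 : S.form (S.L v) (S.J v) = 0 := by
      rw [← one_mul (S.form _ _), ← units_coe_mul_self η, mul_assoc, hv, mul_zero]
    rw [h2] at h1
    exact lt_irrefl _ h1
  have h0 : ∀ v, X v = 0 → (∀ x, X x = 0 → S.form v (S.L x) = 0) → v = 0 := fun v hv hx =>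
    hpos v (hx _ (hXJ v hv))
  -- vectors of the kernel have `B`-component zero and are orthogonal to `L (ker X)`
  have h1 : ∀ w, Y w = 0 → (Θ (D.projL w)).1 = 0 ∧ D.projV w = 0 ∧ c₀ (Θ (D.projL w)).2 = 0 := by
    intro w hw
    have hβ := h.form_apply w
    rw [hw] at hβ
    simp only [map_zero, LinearMap.zero_apply] at hβ
    have hV : X (D.projV w) + B (D.projL w) = 0 := S.nondegenerate _ fun v' => by
      have := hβ (D.incl v')
      rw [D.projV_incl, D.projL_incl, map_zero, map_zero, map_zero] at this
      simpa using this.symm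
    have hβ' : ∀ b', -S.form (D.projV w) (B b') + c (D.projL w) b' = 0 := fun b' => by
      have := hβ (T.L b')
      rw [hV, D.projV_L b'.2, D.projL_L] at this
      simpa using this.symm
    have hx : (Θ (D.projL w)).1 = 0 := by
      set x := (Θ (D.projL w)).1 with hxdef
      have hxX : X x = 0 := x.2
      refine Subtype.ext (by_contra fun hne => ?_)
      have h2 := S.pos x hne
      have h3 : S.form (X (D.projV w)) (S.J x) = 0 := by
        rw [eq_neg_of_add_eq_zero_left (hX.1 _ _), hXJ x hxX, map_zero, neg_zero]
      rw [eq_neg_of_add_eq_zero_left hV, hB, ← hxdef] at h3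
      simp only [map_neg, map_smul, LinearMap.neg_apply, LinearMap.smul_apply, smul_eq_mul,
        neg_eq_zero, mul_eq_zero, hz, false_or] at h3
      rw [h3] at h2
      exact lt_irrefl _ h2
    have hB0 : B (D.projL w) = 0 := by rw [hB, hx, Submodule.coe_zero, map_zero, smul_zero]
    have hv : D.projV w = 0 := by
      refine h0 _ (by rwa [hB0, add_zero] at hV) fun x hx => ?_
      have := hβ' (Θ.symm (⟨x, hx⟩, 0))
      rw [hB, hc, LinearEquiv.apply_symm_apply, map_zero, add_zero, map_smul, smul_eq_mul,
        neg_eq_zero] at this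
      exact (mul_eq_zero.mp this).resolve_left hz
    refine ⟨hx, hv, LinearMap.ext fun y => ?_⟩
    have := hβ' (Θ.symm (0, y))
    rwa [hv, map_zero, LinearMap.zero_apply, neg_zero, zero_add, hc, LinearEquiv.apply_symm_apply]
      at this
  have h2 : LinearMap.ker (Y : W →ₗ[ℂ] W) ⊓ D.F ≤ D.E := fun w hw =>
    D.mem_E_iff.mpr ⟨hw.2, (h1 w hw.1).2.1⟩
  refine ⟨Submodule.finrank_mono h2, ?_⟩
  -- the `M`-component maps the kernel to the radical of `c₀`, with kernel contained in `E`
  let φ : LinearMap.ker (Y : W →ₗ[ℂ] W) →ₗ[ℂ] LinearMap.ker c₀ := LinearMap.codRestrict _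
    (LinearMap.snd ℂ _ _ ∘ₗ Θ.toLinearMap ∘ₗ D.projL ∘ₗ Submodule.subtype _) fun w =>
      (h1 w w.2).2.2
  have h3 := LinearMap.finrank_range_add_finrank_ker φ
  have h4 := (LinearMap.range φ).finrank_le
  have h5 : finrank ℂ (LinearMap.ker φ) ≤ finrank ℂ D.E := by
    rw [← Submodule.finrank_map_subtype_eq]
    refine Submodule.finrank_mono ?_
    rintro _ ⟨w, hw, rfl⟩
    refine h2 ⟨w.2, D.mem_F_of_projL ?_⟩
    have h6 : (Θ (D.projL w)).2 = 0 := congrArg Subtype.val (LinearMap.mem_ker.mp hw)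
    have h7 : Θ (D.projL w) = 0 := Prod.ext (h1 w w.2).1 h6
    exact (LinearEquiv.map_eq_zero_iff Θ).mp h7
  omega

end IsComplexLift

/-- The dimension by which the kernels of generic elements exceed `dim E`, if `m` is the difference
of the dimensions of `E` and of the kernel of the given orbit. -/
def excess (ε : ℤˣ) (m : ℕ) : ℕ := if ε = 1 then m % 2 else 0

variable [FiniteDimensional ℂ V]

/-- Every `X` has a generic lift: there is one in the complex Lie algebra, and this is a value of a
real pencil of real lifts. -/
theorem exists_isLift_isGeneric {X : V →L[ℂ] V} (hX : X ∈ S.iLieReal) {m : ℕ}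
    (hm : finrank ℂ (LinearMap.ker (X : V →ₗ[ℂ] V)) + m = finrank ℂ D.E) :
    ∃ Y, D.IsLift X Y ∧ D.IsGeneric (excess ε m) Y := by
  obtain ⟨c₀, hc₀, hr⟩ := exists_form_finrank_ker_le (M := Fin m → ℂ) ε
  rw [finrank_fin_fun] at hr
  let Θ : D.E ≃ₗ[ℂ] LinearMap.ker (X : V →ₗ[ℂ] V) × (Fin m → ℂ) := LinearEquiv.ofFinrankEq _ _ (by
    rw [finrank_prod, finrank_fin_fun, hm])
  let c : D.E →ₗ[ℂ] D.E →ₗ[ℂ] ℂ := c₀.compl₁₂ (LinearMap.snd ℂ _ _ ∘ₗ Θ.toLinearMap)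
    (LinearMap.snd ℂ _ _ ∘ₗ Θ.toLinearMap)
  obtain ⟨Y, hY⟩ := D.exists_isComplexLift hX.1
    (S.L ∘ₗ Submodule.subtype _ ∘ₗ LinearMap.fst ℂ _ _ ∘ₗ Θ.toLinearMap) c fun u v => hc₀ _ _
  have hgen := hY.isGeneric hX Θ one_ne_zero (fun b => (one_smul ℂ _).symm) c₀ fun _ _ => rfl
  set a : ℂ := (((ε * η : ℤˣ) : ℤ) : ℂ) with ha
  have haa : a * a = 1 := units_coe_mul_self _
  have hca : (starRingEnd ℂ) a = a := conj_units_coe _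
  have hJJ : ∀ w, T.J (T.J w) = a • w := T.J_J
  -- the complex conjugate of `Y` is a lift of `-X`, as `X` is purely imaginary
  let Yτ : W →L[ℂ] W := LinearMap.toContinuousLinearMap
    { toFun := fun w => a • T.J (Y (T.J w))
      map_add' := fun u v => by simp only [map_add, smul_add]
      map_smul' := fun z w => by
        simp only [map_smulₛₗ, RingHom.id_apply, Complex.conj_conj]
        rw [smul_comm] }
  have hYτ : ∀ w, Yτ w = a • T.J (Y (T.J w)) := fun _ => rfl
  clear_value Yτ
  have hYτmem : Yτ ∈ T.lieAlg := fun u w => by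
    have h1 : T.form (Yτ u) w = a * (a * (starRingEnd ℂ) (T.form (Y (T.J u)) (T.J w))) := by
      rw [← T.form_J, hJJ, hYτ]
      simp only [map_smul, LinearMap.smul_apply, smul_eq_mul]
      linear_combination -(a * T.form (T.J (Y (T.J u))) w) * haa
    have h2 : T.form u (Yτ w) = a * (a * (starRingEnd ℂ) (T.form (T.J u) (Y (T.J w)))) := by
      rw [← T.form_J, hJJ, hYτ]
      simp only [map_smul, LinearMap.smul_apply, smul_eq_mul]
      linear_combination -(a * T.form u (T.J (Y (T.J w)))) * haa
    rw [h1, h2, ← mul_add, ← mul_add, ← map_add, hY.mem, map_zero, mul_zero, mul_zero]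
  have hYτE : ∀ w ∈ D.E, Yτ w = 0 := fun w hw => by
    rw [hYτ, hY.apply_E _ (D.J_mem w hw), map_zero, smul_zero]
  have hYτV : ∀ v, Yτ (D.incl v) + D.incl (X v) ∈ D.E := fun v => by
    have h1 := D.E.smul_mem a (D.J_mem _ (hY.sub_mem (S.J v)))
    rw [hX.2, map_neg, map_sub, map_neg, ← D.J_incl, ← D.J_incl, hJJ, smul_sub, smul_neg, smul_smul,
      haa, one_smul, sub_neg_eq_add] at h1
    rw [hYτ]
    exact h1
  have hYτJ : ∀ w, Yτ (T.J w) = T.J (Y w) := fun w => by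
    rw [hYτ, hJJ, map_smul, map_smulₛₗ, hca, smul_smul, haa, one_smul]
  have hJYτ : ∀ w, T.J (Yτ w) = Y (T.J w) := fun w => by
    rw [hYτ, map_smulₛₗ, hca, hJJ, smul_smul, haa, one_smul]
  -- `Y = A + i B`, where `A` is a lift of `X` and `B` is a lift of `0`, both in `i 𝔤_ℝ`
  let A : W →L[ℂ] W := (1 / 2 : ℂ) • (Y - Yτ)
  let B : W →L[ℂ] W := (-Complex.I / 2) • (Y + Yτ)
  have hAB : A + Complex.I • B = Y := by
    simp only [A, B, smul_smul]
    have : Complex.I * (-Complex.I / 2) = 1 / 2 := by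
      linear_combination (-1 / 2 : ℂ) * Complex.I_mul_I
    rw [this]
    module
  have hlift : ∀ t : ℝ, D.IsLift X (A + (t : ℂ) • B) := fun t => by
    have hval : ∀ w, (A + (t : ℂ) • B) w = (1 / 2 : ℂ) • (Y w - Yτ w) +
      (t : ℂ) • (-Complex.I / 2) • (Y w + Yτ w) := fun _ => rfl
    refine ⟨⟨fun u w => ?_, fun w => ?_⟩, fun w hw => ?_, fun v => ?_⟩
    · rw [hval, hval]
      simp only [map_add, map_sub, map_smul, LinearMap.add_apply, LinearMap.sub_apply,
        LinearMap.smul_apply, smul_eq_mul]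
      linear_combination ((1 / 2 : ℂ) + t * (-Complex.I / 2)) * hY.mem u w +
        (-(1 / 2 : ℂ) + t * (-Complex.I / 2)) * hYτmem u w
    · have h2 : (starRingEnd ℂ) (1 / 2 : ℂ) = 1 / 2 := by
        rw [map_div₀, map_one, map_ofNat]
      have h3 : (starRingEnd ℂ) (-Complex.I / 2 : ℂ) = -(-Complex.I / 2) := by
        rw [map_div₀, map_neg, Complex.conj_I, map_ofNat]
        ring
      rw [hval, hval, hYτJ]
      simp only [map_add, map_sub, map_smulₛₗ, Complex.conj_ofReal, h2, h3, hJYτ]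
      module
    · rw [hval, hY.apply_E w hw, hYτE w hw]
      simp
    · have h1 := D.E.add_mem (D.E.smul_mem ((1 / 2 : ℂ) + t * (-Complex.I / 2)) (hY.sub_mem v))
        (D.E.smul_mem (-(1 / 2 : ℂ) + t * (-Complex.I / 2)) (hYτV v))
      rw [hval]
      convert h1 using 1
      module
  rw [← hAB] at hgen
  have hfin := (D.finite_setOf_not_isGeneric _ A B Complex.I hgen).preimage
    (Complex.ofReal_injective.injOn (s := _))
  obtain ⟨t, ht⟩ := hfin.infinite_compl.nonempty
  have ht' : D.IsGeneric (finrank ℂ (LinearMap.ker c₀)) (A + (t : ℂ) • B) := not_not.mp ht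
  exact ⟨_, hlift t, ht'.1, ht'.2.trans (Nat.add_le_add_left hr _)⟩

/-- Generic lifts are dense. -/
theorem IsLift.exists_isGeneric_mem {D : LeviDecomposition S T} {X : V →L[ℂ] V} {Y : W →L[ℂ] W}
    (h : D.IsLift X Y) (hX : X ∈ S.iLieReal) {m : ℕ}
    (hm : finrank ℂ (LinearMap.ker (X : V →ₗ[ℂ] V)) + m = finrank ℂ D.E) {U : Set (W →L[ℂ] W)}
    (hU : IsOpen U) (hYU : Y ∈ U) : ∃ Y' ∈ U, D.IsLift X Y' ∧ D.IsGeneric (excess ε m) Y' := by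
  obtain ⟨Y₀, h₀, hg⟩ := D.exists_isLift_isGeneric hX hm
  have hgen : D.IsGeneric (excess ε m) (Y + (1 : ℂ) • (Y₀ - Y)) := by
    rwa [one_smul, add_sub_cancel]
  -- almost all points of the real line from `Y` to a generic lift are generic
  have hfin := (D.finite_setOf_not_isGeneric _ Y (Y₀ - Y) 1 hgen).preimage
    (Complex.ofReal_injective.injOn (s := _))
  have hcont : Continuous fun t : ℝ => Y + (t : ℂ) • (Y₀ - Y) := by fun_prop
  have hnhds : (fun t : ℝ => Y + (t : ℂ) • (Y₀ - Y)) ⁻¹' U ∈ 𝓝 (0 : ℝ) := by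
    refine (hU.preimage hcont).mem_nhds ?_
    simpa using hYU
  obtain ⟨t, ht, ht'⟩ := (infinite_of_mem_nhds 0 hnhds).exists_notMem_finite hfin
  refine ⟨_, ht, ?_, not_not.mp ht'⟩
  have hval : ∀ w, (Y + (t : ℂ) • (Y₀ - Y)) w = Y w + (t : ℂ) • (Y₀ w - Y w) := fun _ => rfl
  refine ⟨⟨fun u w => ?_, fun w => ?_⟩, fun w hw => ?_, fun v => ?_⟩
  · rw [hval, hval]
    simp only [map_add, map_sub, map_smul, LinearMap.add_apply, LinearMap.sub_apply,
      LinearMap.smul_apply, smul_eq_mul]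
    linear_combination (1 - t : ℂ) * h.mem.1 u w + t * h₀.mem.1 u w
  · rw [hval, hval, h.mem.2, h₀.mem.2]
    simp only [map_add, map_sub, map_smulₛₗ, Complex.conj_ofReal]
    module
  · rw [hval, h.apply_E w hw, h₀.apply_E w hw]
    simp
  · have h1 := D.E.add_mem (D.E.smul_mem (1 - t : ℂ) (h.sub_mem v))
      (D.E.smul_mem (t : ℂ) (h₀.sub_mem v))
    rw [hval]
    convert h1 using 1
    module

end LeviDecomposition

/-! ### Signatures of the elements of `O + i 𝔫` -/

namespace EpsSpace

variable {ε η : ℤˣ} {V : Type*} [NormedAddCommGroup V] [NormedSpace ℂ V] {S : EpsSpace ε η V}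

theorem nilForm_apply (X : V →L[ℂ] V) (j : ℕ) (u v : V) :
    S.nilForm (X : End ℂ V) j u v = plusEigenvalue η * S.form ((X ^ j) v) (S.J u) := by
  rw [nilForm, ← ContinuousLinearMap.toLinearMap_pow]
  rfl

variable [FiniteDimensional ℂ V]

theorem nilIndex_add_finrank_ker {X : V →L[ℂ] V} (hX : X ∈ S.iLieReal) (j : ℕ) :
    (S.nilIndex (X : End ℂ V) j).1 + (S.nilIndex (X : End ℂ V) j).2 +
      finrank ℂ (LinearMap.ker ((X ^ j : V →L[ℂ] V) : V →ₗ[ℂ] V)) = finrank ℂ V := by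
  rw [ContinuousLinearMap.toLinearMap_pow]
  exact (isSelfAdj_of_mem hX).nilIndex_add_finrank_ker j

theorem nilIndex_zero_add {X : V →L[ℂ] V} (hX : X ∈ S.iLieReal) :
    (S.nilIndex (X : End ℂ V) 0).1 + (S.nilIndex (X : End ℂ V) 0).2 = finrank ℂ V := by
  have h := nilIndex_add_finrank_ker hX 0
  have h1 : LinearMap.ker ((X ^ 0 : V →L[ℂ] V) : V →ₗ[ℂ] V) = ⊥ := by
    rw [eq_bot_iff]
    intro v hv
    exact hv
  rwa [h1, finrank_bot, add_zero] at h

theorem nilIndex_one_add {X : V →L[ℂ] V} (hX : X ∈ S.iLieReal) :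
    (S.nilIndex (X : End ℂ V) 1).1 + (S.nilIndex (X : End ℂ V) 1).2 +
      finrank ℂ (LinearMap.ker (X : V →ₗ[ℂ] V)) = finrank ℂ V := by
  have h := nilIndex_add_finrank_ker hX 1
  rwa [pow_one] at h

/-- For `η = 1` the map `J` changes the sign of the form `⟨X v, J u⟩`. -/
theorem nilIndex_one_fst_eq_snd (hη : η = 1) {X : V →L[ℂ] V} (hX : X ∈ S.iLieReal) :
    (S.nilIndex (X : End ℂ V) 1).1 = (S.nilIndex (X : End ℂ V) 1).2 := by
  refine posIndex_eq_negIndex S.J S.J_inj fun u => ?_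
  rw [nilForm_apply, nilForm_apply, pow_one, hX.2, map_neg, LinearMap.neg_apply, S.form_J,
    plusEigenvalue, if_pos hη, one_mul, one_mul, Complex.neg_re, Complex.conj_re]

/-- Nilpotent orbits are determined by the signatures of the forms `κ ⟨X ^ j v, J u⟩`. -/
theorem IsNilOrbit.eq_of_nilIndex_eq {O O' : Set (V →L[ℂ] V)} (hO : S.IsNilOrbit O)
    (hO' : S.IsNilOrbit O') {X X' : V →L[ℂ] V} (hX : X ∈ O) (hX' : X' ∈ O')
    (h : ∀ j, S.nilIndex (X : End ℂ V) j = S.nilIndex (X' : End ℂ V) j) : O = O' := by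
  refine hO.eq_of_signedDiagram_eq hO' (funext fun j => ?_)
  have h1 := hO.signedDiagram_add hX j
  have h2 := hO'.signedDiagram_add hX' j
  rw [h, h, ← h2] at h1
  exact add_right_cancel h1

theorem IsNilOrbit.signedDiagram_zero_add {O : Set (V →L[ℂ] V)} (hO : S.IsNilOrbit O)
    {X : V →L[ℂ] V} (hX : X ∈ O) : (S.signedDiagram O 0).1 + (S.signedDiagram O 0).2 =
      finrank ℂ (LinearMap.ker (X : V →ₗ[ℂ] V)) := by
  have h1 := hO.signedDiagram_add hX 0
  have h2 := nilIndex_one_add (hO.of_mem hX).1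
  have h3 := nilIndex_zero_add (hO.of_mem hX).1
  have h4 := congrArg Prod.fst h1
  have h5 := congrArg Prod.snd h1
  rw [Prod.fst_add, zero_add] at h4
  rw [Prod.snd_add, zero_add] at h5
  omega

end EpsSpace

namespace LeviDecomposition

open EpsSpace

variable {ε η : ℤˣ} {V W : Type*} [NormedAddCommGroup V] [NormedSpace ℂ V] [FiniteDimensional ℂ V]
  [NormedAddCommGroup W] [NormedSpace ℂ W] [FiniteDimensional ℂ W]
  {S : EpsSpace ε η V} {T : EpsSpace ε η W} {D : LeviDecomposition S T}
  {X : V →L[ℂ] V} {Y : W →L[ℂ] W}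

theorem IsLift.E_le_ker (h : D.IsLift X Y) : D.E ≤ LinearMap.ker (Y : W →ₗ[ℂ] W) :=
  fun w hw => h.apply_E w hw

theorem IsLift.ker_inf_eq (h : D.IsLift X Y) {r : ℕ} (hg : D.IsGeneric r Y) :
    LinearMap.ker (Y : W →ₗ[ℂ] W) ⊓ D.F = D.E :=
  (Submodule.eq_of_le_of_finrank_le (le_inf h.E_le_ker D.E_le_F) hg.1).symm

/-- The range of the projection of `Y` to `V` is the orthogonal of the vectors of `V` that are in
the kernel of `Y`, and there are none if `ker Y ∩ E^⊥ = E`. -/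
theorem IsLift.projV_surjective (h : D.IsLift X Y)
    (hE : LinearMap.ker (Y : W →ₗ[ℂ] W) ⊓ D.F = D.E) :
    Function.Surjective (D.projV ∘ₗ (Y : W →ₗ[ℂ] W)) := by
  rw [← LinearMap.range_eq_top, eq_top_iff]
  intro e _
  refine S.mem_of_forall_form_eq_zero _ fun v hv => ?_
  have h1 : Y (D.incl v) = 0 := T.nondegenerate _ fun w => by
    have hw : S.form (D.projV (Y w)) v = 0 := hv _ ⟨w, rfl⟩
    rw [h.form_swap, D.form_incl_left, S.symm, hw, mul_zero, neg_zero]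
  have h2 : D.incl v ∈ D.E := by
    rw [← hE]
    exact ⟨h1, D.incl_mem_F v⟩
  have h3 := D.projV_of_mem_E h2
  rw [D.projV_incl] at h3
  rw [h3, map_zero]

/-- The form `κ ⟨Y ^ (j + 2) v, J u⟩` on `W` is the pullback of `κ ⟨X ^ j v, J u⟩` under the
surjection `projV ∘ Y`, since `⟨Y ^ (j + 2) v, J u⟩ = ⟨Y ^ j (Y v), J (Y u)⟩`. -/
theorem IsLift.nilIndex_add_two (h : D.IsLift X Y) (hX : X ∈ S.iLieReal)
    (hE : LinearMap.ker (Y : W →ₗ[ℂ] W) ⊓ D.F = D.E) (j : ℕ) :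
    T.nilIndex (Y : End ℂ W) (j + 2) = S.nilIndex (X : End ℂ V) j := by
  have hform : ∀ u, T.nilForm (Y : End ℂ W) (j + 2) u u =
      S.nilForm (X : End ℂ V) j ((D.projV ∘ₗ (Y : W →ₗ[ℂ] W)) u)
        ((D.projV ∘ₗ (Y : W →ₗ[ℂ] W)) u) := fun u => by
    have h1 : (Y ^ (j + 2)) u = Y ((Y ^ j) (Y u)) := by rw [pow_succ, pow_succ']; rfl
    have h2 : T.J (Y u) ∈ D.F := D.J_mem_F (h.apply_mem_F u)
    have h3 := h.projV_pow_apply j (h.apply_mem_F u)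
    rw [nilForm_apply, nilForm_apply, h1, h.form_swap, h.mem.2, map_neg, neg_neg,
      D.form_of_mem_F h3.1 h2, h3.2, D.projV_J]
    rfl
  exact Prod.ext
    (posIndex_comap ((isSelfAdj_of_mem hX).isHerm j) _ (h.projV_surjective hE) hform)
    (negIndex_comap ((isSelfAdj_of_mem hX).isHerm j) _ (h.projV_surjective hE) hform)

/-- The form `κ ⟨v, J u⟩` on `E^⊥ = V ⊕ E` is pulled back from `V`. The codimension of `E^⊥` is
`dim E`, and the form on `W` is non-degenerate. -/
theorem IsLift.nilIndex_zero (h : D.IsLift X Y) (hX : X ∈ S.iLieReal) :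
    T.nilIndex (Y : End ℂ W) 0 =
      S.nilIndex (X : End ℂ V) 0 + (finrank ℂ D.E, finrank ℂ D.E) := by
  let f : V × D.E →ₗ[ℂ] W := D.incl.coprod D.E.subtype
  have hf : ∀ v a, f (v, a) = D.incl v + a := fun v a => by simp [f]
  have hinj : Function.Injective f := by
    rw [← LinearMap.ker_eq_bot, eq_bot_iff]
    rintro ⟨v, a⟩ hva
    rw [LinearMap.mem_ker, hf] at hva
    have h1 := congrArg D.projV hva
    rw [map_add, D.projV_incl, D.projV_of_mem_E a.2, add_zero, map_zero] at h1
    rw [h1, map_zero, zero_add] at hva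
    exact Prod.ext h1 (Subtype.ext hva)
  let Φ' : V × D.E → V × D.E → ℂ := fun x y => S.nilForm (X : End ℂ V) 0 x.1 y.1
  have hS := (isSelfAdj_of_mem hX).isHerm 0
  have h1 := posIndex_comap (Φ := Φ') hS (LinearMap.fst ℂ V D.E) Prod.fst_surjective fun _ => rfl
  have h2 := negIndex_comap (Φ := Φ') hS (LinearMap.fst ℂ V D.E) Prod.fst_surjective fun _ => rfl
  have h3 := nilIndex_zero_add hX
  have h4 := nilIndex_zero_add h.mem
  have h5 := D.finrank_eq
  have h6 : (S.nilIndex (X : End ℂ V) 0).1 = posIndex (S.nilForm (X : End ℂ V) 0) := rfl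
  have h7 : (S.nilIndex (X : End ℂ V) 0).2 = negIndex (S.nilForm (X : End ℂ V) 0) := rfl
  obtain ⟨hp, hn⟩ := posIndex_eq_add_of_restrict (Φ := T.nilForm (Y : End ℂ W) 0) (Φ' := Φ')
    (k := finrank ℂ D.E) (r := 0) f hinj (by
      rintro ⟨v, a⟩
      have h8 : f (v, a) ∈ D.F := by
        rw [hf]
        exact D.F.add_mem (D.incl_mem_F v) (D.E_le_F a.2)
      have h9 : D.projV (f (v, a)) = v := by
        rw [hf, map_add, D.projV_incl, D.projV_of_mem_E a.2, add_zero]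
      change S.nilForm (X : End ℂ V) 0 v v = _
      rw [nilForm_apply, nilForm_apply, pow_zero, pow_zero, one_apply_eq_self, one_apply_eq_self,
        D.form_of_mem_F h8 (D.J_mem_F h8), D.projV_J, h9])
    (by rw [finrank_prod]; omega) h4 (by rw [finrank_prod]; omega)
  exact Prod.ext (by rw [Prod.fst_add, h6, ← h1]; exact hp) (by rw [Prod.snd_add, h7, ← h2]; exact hn)

/-- If the kernel of `Y` is `E`, then the form `κ ⟨Y v, J u⟩` is the sum of the corresponding form
on `V`, of a split form, and of its restriction to a complement of `M ∩ E^⊥` in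
`M = Y⁻¹(E)`. -/
theorem IsLift.nilIndex_one (h : D.IsLift X Y) (hX : X ∈ S.iLieReal)
    (hE : LinearMap.ker (Y : W →ₗ[ℂ] W) = D.E) {U : Type*} [AddCommGroup U] [Module ℂ U]
    [FiniteDimensional ℂ U] (g : U →ₗ[ℂ] W) (hgE : ∀ u, Y (g u) ∈ D.E)
    (hgF : ∀ u, g u ∈ D.F → u = 0)
    (hU : finrank ℂ (LinearMap.ker (X : V →ₗ[ℂ] V)) + finrank ℂ U = finrank ℂ D.E) :
    (T.nilIndex (Y : End ℂ W) 1).1 = (S.nilIndex (X : End ℂ V) 1).1 +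
        finrank ℂ (LinearMap.ker (X : V →ₗ[ℂ] V)) +
        posIndex (fun u u' => T.nilForm (Y : End ℂ W) 1 (g u) (g u')) ∧
      (T.nilIndex (Y : End ℂ W) 1).2 = (S.nilIndex (X : End ℂ V) 1).2 +
        finrank ℂ (LinearMap.ker (X : V →ₗ[ℂ] V)) +
        negIndex (fun u u' => T.nilForm (Y : End ℂ W) 1 (g u) (g u')) := by
  set Ψ : U → U → ℂ := fun u u' => T.nilForm (Y : End ℂ W) 1 (g u) (g u') with hΨ
  set Φ : V → V → ℂ := S.nilForm (X : End ℂ V) 1 with hΦ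
  have hS : IsHerm Φ := (isSelfAdj_of_mem hX).isHerm 1
  have hΨh : IsHerm Ψ := ((isSelfAdj_of_mem h.mem).isHerm 1).comap g
  -- restrict the form to `V ⊕ U ⊕ E`, of codimension `dim ker X`
  let f : (V × U) × D.E →ₗ[ℂ] W := (D.incl.coprod g).coprod D.E.subtype
  have hf : ∀ v u a, f ((v, u), a) = D.incl v + g u + a := fun v u a => by simp [f]
  have hinj : Function.Injective f := by
    rw [← LinearMap.ker_eq_bot, eq_bot_iff]
    rintro ⟨⟨v, u⟩, a⟩ hva
    rw [LinearMap.mem_ker, hf] at hva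
    have hu : u = 0 := hgF u (by
      have : g u = -(D.incl v + a) := by
        rw [eq_neg_iff_add_eq_zero, ← hva]
        abel
      rw [this]
      exact D.F.neg_mem (D.F.add_mem (D.incl_mem_F v) (D.E_le_F a.2)))
    rw [hu, map_zero, add_zero] at hva
    have h1 := congrArg D.projV hva
    rw [map_add, D.projV_incl, D.projV_of_mem_E a.2, add_zero, map_zero] at h1
    rw [h1, map_zero, zero_add] at hva
    exact Prod.ext (Prod.ext h1 hu) (Subtype.ext hva)
  let Φ₁ : V × U → V × U → ℂ := fun x y => Φ x.1 y.1 + Ψ x.2 y.2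
  let Φ' : (V × U) × D.E → (V × U) × D.E → ℂ := fun x y => Φ₁ x.1 y.1
  have hΦ₁ : IsHerm Φ₁ := hS.prod hΨh
  obtain ⟨h1, h2⟩ := hS.posIndex_prod hΨh
  have h3 := posIndex_comap (Φ := Φ') hΦ₁ (LinearMap.fst ℂ (V × U) D.E) Prod.fst_surjective
    fun _ => rfl
  have h4 := negIndex_comap (Φ := Φ') hΦ₁ (LinearMap.fst ℂ (V × U) D.E) Prod.fst_surjective
    fun _ => rfl
  have h5 := posIndex_add_negIndex_add_le hΨh ⊥ (by
    intro u hu v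
    rw [(Submodule.mem_bot ℂ).mp hu, hΨh.zero_right])
  rw [finrank_bot, add_zero] at h5
  have h6 : posIndex Φ + negIndex Φ + _ = _ := nilIndex_one_add hX
  have h7 : posIndex (T.nilForm (Y : End ℂ W) 1) + negIndex (T.nilForm (Y : End ℂ W) 1) + _ = _ :=
    nilIndex_one_add h.mem
  rw [hE] at h7
  have h8 := D.finrank_eq
  have h9 : posIndex Φ' = posIndex Φ + posIndex Ψ := h3.trans h1
  have h10 : negIndex Φ' = negIndex Φ + negIndex Ψ := h4.trans h2
  obtain ⟨hp, hn⟩ := posIndex_eq_add_of_restrict (Φ := T.nilForm (Y : End ℂ W) 1) (Φ' := Φ')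
    (k := finrank ℂ (LinearMap.ker (X : V →ₗ[ℂ] V))) f hinj (by
      rintro ⟨⟨v, u⟩, a⟩
      change Φ v v + Ψ u u = _
      have hv := D.incl_mem_F v
      have hYv := h.apply_mem_F (D.incl v)
      have e1 : Y (f ((v, u), a)) = Y (D.incl v) + Y (g u) := by
        rw [hf, map_add, map_add, h.apply_E _ a.2, add_zero]
      have e2 : T.form (Y (D.incl v)) (T.J (D.incl v)) = S.form (X v) (S.J v) := by
        rw [D.form_of_mem_F hYv (D.J_mem_F hv), D.projV_J, h.projV_apply hv, D.projV_incl]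
      have e3 : T.form (Y (D.incl v)) (T.J (g u)) = 0 := by
        rw [h.form_swap, h.mem.2, map_neg, neg_neg, D.form_incl_E (D.J_mem _ (hgE u))]
      have e4 : T.form (Y (D.incl v)) (T.J a) = 0 := by
        rw [T.symm, hYv _ (D.J_mem _ a.2), mul_zero]
      have e5 : T.form (Y (g u)) (T.J (D.incl v)) = 0 := D.J_mem_F hv _ (hgE u)
      have e6 : T.form (Y (g u)) (T.J a) = 0 := D.isotropic _ (hgE u) _ (D.J_mem _ a.2)
      rw [hΦ, hΨ]
      simp only [nilForm_apply, pow_one]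
      rw [e1, hf]
      simp only [map_add, LinearMap.add_apply]
      rw [e2, e3, e4, e5, e6]
      ring)
    (by rw [finrank_prod, finrank_prod]; omega) h7 (by rw [finrank_prod, finrank_prod]; omega)
  have hc : (S.nilIndex (X : End ℂ V) 1).1 = posIndex Φ := rfl
  have hc' : (S.nilIndex (X : End ℂ V) 1).2 = negIndex Φ := rfl
  have hd : (T.nilIndex (Y : End ℂ W) 1).1 = posIndex (T.nilForm (Y : End ℂ W) 1) := rfl
  have hd' : (T.nilIndex (Y : End ℂ W) 1).2 = negIndex (T.nilForm (Y : End ℂ W) 1) := rfl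
  omega

/-- The signed Young diagram of the orbit of a lift, in terms of the signature of
`κ ⟨Y v, J u⟩`. -/
theorem IsLift.signedDiagram_eq (h : D.IsLift X Y) {O : Set (V →L[ℂ] V)} (hO : S.IsNilOrbit O)
    (hXO : X ∈ O) {O' : Set (W →L[ℂ] W)} (hO' : T.IsNilOrbit O') (hYO : Y ∈ O')
    (hE : LinearMap.ker (Y : W →ₗ[ℂ] W) ⊓ D.F = D.E) {s t : ℕ × ℕ}
    (h₁ : (T.nilIndex (Y : End ℂ W) 1).1 = (S.nilIndex (X : End ℂ V) 1).1 +
        finrank ℂ (LinearMap.ker (X : V →ₗ[ℂ] V)) + t.1)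
    (h₂ : (T.nilIndex (Y : End ℂ W) 1).2 = (S.nilIndex (X : End ℂ V) 1).2 +
        finrank ℂ (LinearMap.ker (X : V →ₗ[ℂ] V)) + t.2)
    (hs₁ : finrank ℂ (LinearMap.ker (X : V →ₗ[ℂ] V)) + t.1 + s.1 = finrank ℂ D.E)
    (hs₂ : finrank ℂ (LinearMap.ker (X : V →ₗ[ℂ] V)) + t.2 + s.2 = finrank ℂ D.E) :
    T.signedDiagram O' = addTwoColumns (S.signedDiagram O 0 + s) ((S.signedDiagram O 0).swap + t)
      (S.signedDiagram O) := by
  have hX := (hO.of_mem hXO).1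
  have hd := hO.signedDiagram_zero_add hXO
  have key := hO.signedDiagram_add hXO
  have key' := hO'.signedDiagram_add hYO
  have h0 := h.nilIndex_zero hX
  have h2 := h.nilIndex_add_two hX hE 0
  have a1 := congrArg Prod.fst (key 0)
  have a2 := congrArg Prod.snd (key 0)
  have b1 := congrArg Prod.fst (key' 0)
  have b2 := congrArg Prod.snd (key' 0)
  have c1 := congrArg Prod.fst (key' 1)
  have c2 := congrArg Prod.snd (key' 1)
  have d1 := congrArg Prod.fst h0
  have d2 := congrArg Prod.snd h0
  have e1 := congrArg Prod.fst h2
  have e2 := congrArg Prod.snd h2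
  simp only [Prod.fst_add, Prod.snd_add, zero_add, Nat.reduceAdd] at a1 a2 b1 b2 c1 c2 d1 d2 e1 e2
  funext j
  match j with
  | 0 =>
    refine Prod.ext ?_ ?_
    · simp only [addTwoColumns, Prod.fst_add]
      omega
    · simp only [addTwoColumns, Prod.snd_add]
      omega
  | 1 =>
    refine Prod.ext ?_ ?_
    · simp only [addTwoColumns, Prod.fst_add, Prod.fst_swap]
      omega
    · simp only [addTwoColumns, Prod.snd_add, Prod.snd_swap]
      omega
  | j + 2 =>
    have h3 := key' (j + 2)
    rw [show j + 2 + 1 = j + 1 + 2 from rfl, h.nilIndex_add_two hX hE, h.nilIndex_add_two hX hE,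
      ← key j] at h3
    exact add_right_cancel h3

end LeviDecomposition

/-! ### The orbits induced in the case of invertible generic forms -/

namespace EpsSpace

variable {ε η : ℤˣ} {V : Type*} [NormedAddCommGroup V] [NormedSpace ℂ V] [FiniteDimensional ℂ V]
  (S : EpsSpace ε η V)

theorem continuous_J : Continuous S.J := by
  let f : V →ₗ[ℝ] V :=
    { toFun := S.J
      map_add' := map_add S.J
      map_smul' := fun r v => by
        rw [← Complex.coe_smul, map_smulₛₗ, Complex.conj_ofReal, Complex.coe_smul, RingHom.id_apply] }
  exact f.continuous_of_finiteDimensional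

theorem continuous_form : Continuous fun p : V × V => S.form p.1 p.2 := by
  let f : V →ₗ[ℂ] (V →L[ℂ] ℂ) := LinearMap.toContinuousLinearMap.toLinearMap ∘ₗ S.form
  have hf : Continuous f := f.continuous_of_finiteDimensional
  have h : Continuous fun p : V × V => f p.1 p.2 := (hf.comp continuous_fst).clm_apply continuous_snd
  exact h

variable {S}

/-- The signature of the form `κ ⟨X v, J u⟩` is lower semicontinuous in `X`. -/
theorem eventually_nilIndex_one_le (X : V →L[ℂ] V) :
    ∀ᶠ X' : V →L[ℂ] V in 𝓝 X, (S.nilIndex (X : End ℂ V) 1).1 ≤ (S.nilIndex (X' : End ℂ V) 1).1 ∧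
      (S.nilIndex (X : End ℂ V) 1).2 ≤ (S.nilIndex (X' : End ℂ V) 1).2 := by
  let q : (V →L[ℂ] V) → V → ℝ := fun X u => (plusEigenvalue η * S.form (X u) (S.J u)).re
  have hq : Continuous fun p : (V →L[ℂ] V) × V => q p.1 p.2 := by
    have h1 : Continuous fun p : (V →L[ℂ] V) × V => (p.1 p.2, S.J p.2) :=
      (continuous_fst.clm_apply continuous_snd).prodMk (S.continuous_J.comp continuous_snd)
    exact Complex.continuous_re.comp (continuous_const.mul (S.continuous_form.comp h1))
  have hs : ∀ X (c : ℝ) u, q X ((c : ℂ) • u) = c ^ 2 * q X u := fun X c u => by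
    have : plusEigenvalue η * S.form (X ((c : ℂ) • u)) (S.J ((c : ℂ) • u)) =
        ((c ^ 2 : ℝ) : ℂ) * (plusEigenvalue η * S.form (X u) (S.J u)) := by
      simp only [map_smul, map_smulₛₗ, LinearMap.smul_apply, smul_eq_mul, Complex.conj_ofReal]
      push_cast
      ring
    rw [show q X ((c : ℂ) • u) = _ from congrArg Complex.re this, Complex.re_ofReal_mul]
  have hval : ∀ (X : V →L[ℂ] V) u, (S.nilForm (X : End ℂ V) 1 u u).re = q X u := fun X u => by
    rw [nilForm_apply, pow_one]
  obtain ⟨A, hA, hp⟩ := exists_finrank_eq_posIndex (S.nilForm (X : End ℂ V) 1)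
  obtain ⟨B, hB, hn⟩ := exists_finrank_eq_negIndex (S.nilForm (X : End ℂ V) 1)
  have e1 := eventually_posDef q hq hs A X fun u hu hu0 => by
    rw [← hval]
    exact hp u hu hu0
  have e2 := eventually_posDef (fun X u => -q X u) hq.neg (fun X c u => by rw [hs, mul_neg]) B X
    fun u hu hu0 => by
      have := hn u hu hu0
      rw [hval] at this
      linarith
  filter_upwards [e1, e2] with X' h1 h2
  constructor
  · change posIndex _ ≤ posIndex _
    rw [← hA]
    refine le_posIndex _ fun u hu hu0 => ?_
    rw [hval]
    exact h1 u hu hu0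
  · change negIndex _ ≤ negIndex _
    rw [← hB]
    refine le_posIndex _ fun u hu hu0 => ?_
    rw [Complex.neg_re, hval]
    exact h2 u hu hu0

/-- The form `κ ⟨X ^ j v, J u⟩` has the same signature for all elements of an orbit. -/
theorem IsNilOrbit.nilIndex_eq {O : Set (V →L[ℂ] V)} (hO : S.IsNilOrbit O) {X X' : V →L[ℂ] V}
    (hX : X ∈ O) (hX' : X' ∈ O) (j : ℕ) :
    S.nilIndex (X : End ℂ V) j = S.nilIndex (X' : End ℂ V) j := by
  obtain ⟨hXL, -, hXO⟩ := hO.of_mem hX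
  rw [hXO] at hX'
  obtain ⟨g, hg, rfl⟩ := hX'
  refine (nilIndex_conj hg hXL (Y := (g : V →L[ℂ] V) * X * ((g⁻¹ : (V →L[ℂ] V)ˣ) : V →L[ℂ] V))
    (fun v => ?_) j)
  rw [mul_apply_eq_comp, mul_apply_eq_comp, unit_inv_apply]

end EpsSpace

namespace LeviDecomposition

open EpsSpace

variable {ε η : ℤˣ} {V W : Type*} [NormedAddCommGroup V] [NormedSpace ℂ V] [FiniteDimensional ℂ V]
  [NormedAddCommGroup W] [NormedSpace ℂ W] [FiniteDimensional ℂ W]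
  {S : EpsSpace ε η V} {T : EpsSpace ε η W} {D : LeviDecomposition S T}
  {X : V →L[ℂ] V} {Y : W →L[ℂ] W} {m : ℕ}

/-- A lift with a kernel of the smallest possible dimension has kernel `E`. -/
theorem IsLift.ker_eq (h : D.IsLift X Y)
    (hk : finrank ℂ (LinearMap.ker (Y : W →ₗ[ℂ] W)) ≤ finrank ℂ D.E) :
    LinearMap.ker (Y : W →ₗ[ℂ] W) = D.E :=
  (Submodule.eq_of_le_of_finrank_le h.E_le_ker hk).symm

/-- If the form on the complement is, up to sign, the Hermitian form of a `(-ε, -η)`-space, then the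
complement contributes the signature of this space with its entries exchanged. -/
theorem IsLift.nilIndex_one_eq_sign (h : D.IsLift X Y) (hX : X ∈ S.iLieReal)
    (hE : LinearMap.ker (Y : W →ₗ[ℂ] W) = D.E) (S' : EpsSpace (-ε) (-η) (Fin m → ℂ))
    (g : (Fin m → ℂ) →ₗ[ℂ] W) (hgE : ∀ u, Y (g u) ∈ D.E) (hgF : ∀ u, g u ∈ D.F → u = 0)
    (hm : finrank ℂ (LinearMap.ker (X : V →ₗ[ℂ] V)) + m = finrank ℂ D.E)
    (hs : ∀ u v, plusEigenvalue (-η) * S'.form v (S'.J u) =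
      -(plusEigenvalue η * T.form (Y (g v)) (T.J (g u)))) :
    (T.nilIndex (Y : End ℂ W) 1).1 = (S.nilIndex (X : End ℂ V) 1).1 +
        finrank ℂ (LinearMap.ker (X : V →ₗ[ℂ] V)) + S'.sign.swap.1 ∧
      (T.nilIndex (Y : End ℂ W) 1).2 = (S.nilIndex (X : End ℂ V) 1).2 +
        finrank ℂ (LinearMap.ker (X : V →ₗ[ℂ] V)) + S'.sign.swap.2 := by
  have h1 := h.nilIndex_one hX hE g hgE hgF (by rwa [finrank_fin_fun])
  have h2 : S'.nilForm 0 0 = fun u v => -T.nilForm (Y : End ℂ W) 1 (g u) (g v) := by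
    funext u v
    rw [nilForm_apply, pow_one, ← hs]
    rfl
  have h3 : S'.sign = (negIndex fun u v => T.nilForm (Y : End ℂ W) 1 (g u) (g v),
      posIndex fun u v => T.nilForm (Y : End ℂ W) 1 (g u) (g v)) := by
    rw [S'.sign_eq_nilIndex 0, nilIndex, h2]
    refine Prod.ext rfl ?_
    simp only [negIndex, neg_neg]
  rw [h3]
  exact h1

/-- On a `J`-stable complement of `Y⁻¹(E) ∩ E^⊥` in `Y⁻¹(E)` the form `⟨Y u, v⟩` and a multiple
of `J` define a `(-ε, -η)`-space. -/
theorem IsLift.exists_epsSpace (h : D.IsLift X Y) (hX : X ∈ S.iLieReal)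
    (hE : LinearMap.ker (Y : W →ₗ[ℂ] W) = D.E)
    (hm : finrank ℂ (LinearMap.ker (X : V →ₗ[ℂ] V)) + m = finrank ℂ D.E) :
    ∃ S' : EpsSpace (-ε) (-η) (Fin m → ℂ),
      (T.nilIndex (Y : End ℂ W) 1).1 = (S.nilIndex (X : End ℂ V) 1).1 +
        finrank ℂ (LinearMap.ker (X : V →ₗ[ℂ] V)) + S'.sign.swap.1 ∧
      (T.nilIndex (Y : End ℂ W) 1).2 = (S.nilIndex (X : End ℂ V) 1).2 +
        finrank ℂ (LinearMap.ker (X : V →ₗ[ℂ] V)) + S'.sign.swap.2 := by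
  have hEF : LinearMap.ker (Y : W →ₗ[ℂ] W) ⊓ D.F = D.E := by rw [hE, inf_eq_left.mpr D.E_le_F]
  set M := LinearMap.ker (D.projV ∘ₗ (Y : W →ₗ[ℂ] W)) with hM
  have hmem : ∀ w, w ∈ M ↔ Y w ∈ D.E := fun w => by
    rw [D.mem_E_iff]
    exact ⟨fun hw => ⟨h.apply_mem_F w, hw⟩, fun hw => hw.2⟩
  have hMdim : finrank ℂ V + finrank ℂ M = finrank ℂ W := by
    rw [← LinearMap.finrank_range_add_finrank_ker (D.projV ∘ₗ (Y : W →ₗ[ℂ] W)),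
      LinearMap.range_eq_top.mpr (h.projV_surjective hEF), finrank_top]
  let f : LinearMap.ker (X : V →ₗ[ℂ] V) × D.E →ₗ[ℂ] W :=
    (D.incl ∘ₗ Submodule.subtype _).coprod D.E.subtype
  have hf : ∀ v a, f (v, a) = D.incl v + a := fun v a => by simp [f]
  have hinj : Function.Injective f := by
    rw [← LinearMap.ker_eq_bot, eq_bot_iff]
    rintro ⟨v, a⟩ hva
    rw [LinearMap.mem_ker, hf] at hva
    have h1 := congrArg D.projV hva
    rw [map_add, D.projV_incl, D.projV_of_mem_E a.2, add_zero, map_zero] at h1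
    rw [h1, map_zero, zero_add] at hva
    exact Prod.ext (Subtype.ext h1) (Subtype.ext hva)
  have hrange : M ⊓ D.F = LinearMap.range f := by
    ext w
    constructor
    · rintro ⟨hw, hwF⟩
      have h1 : X (D.projV w) = 0 := by
        rw [← h.projV_apply hwF]
        exact hw
      refine ⟨(⟨D.projV w, h1⟩, ⟨_, D.sub_projV_mem hwF⟩), ?_⟩
      rw [hf, add_sub_cancel]
    · rintro ⟨⟨v, a⟩, rfl⟩
      have hF : f (v, a) ∈ D.F := by
        rw [hf]
        exact D.F.add_mem (D.incl_mem_F v) (D.E_le_F a.2)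
      refine ⟨?_, hF⟩
      change D.projV (Y (f (v, a))) = 0
      rw [h.projV_apply hF, hf, map_add, D.projV_incl, D.projV_of_mem_E a.2, add_zero]
      exact v.2
  have hMF := LinearMap.finrank_range_of_inj hinj
  rw [← hrange, finrank_prod] at hMF
  -- the orthogonal complement for the inner product of `W` is stable under `J`
  obtain ⟨C, hC, hCdim⟩ := T.isInner_ip.exists_orthogonal_complement (inf_le_left : M ⊓ D.F ≤ M)
  have hCm : finrank ℂ C = m := by
    have := D.finrank_eq
    omega
  have hMJ : ∀ w ∈ M, T.J w ∈ M := fun w hw => by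
    rw [hmem] at hw ⊢
    rw [h.mem.2]
    exact D.E.neg_mem (D.J_mem _ hw)
  have hCJ : ∀ w ∈ C, T.J w ∈ C := fun w hw => by
    rw [hC] at hw ⊢
    refine ⟨hMJ w hw.1, fun a ha => ?_⟩
    have h1 := hw.2 (T.J a) ⟨hMJ a ha.1, D.J_mem_F ha.2⟩
    have h2 := T.ip_J (T.J a) w
    rw [h1, map_zero, T.J_J, T.isInner_ip.smul_left, conj_units_coe] at h2
    refine (mul_eq_zero.mp h2).resolve_left fun h0 => ?_
    have := units_coe_mul_self (ε * η)
    rw [h0, zero_mul] at this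
    exact zero_ne_one this
  have hCF : ∀ w ∈ C, w ∈ D.F → w = 0 := fun w hw hwF =>
    T.isInner_ip.eq_zero_of_self (((hC w).mp hw).2 w ⟨((hC w).mp hw).1, hwF⟩)
  let e : C ≃ₗ[ℂ] (Fin m → ℂ) := LinearEquiv.ofFinrankEq _ _ (by rw [hCm, finrank_fin_fun])
  let g : (Fin m → ℂ) →ₗ[ℂ] W := C.subtype ∘ₗ e.symm.toLinearMap
  have hgC : ∀ u, g u ∈ C := fun u => (e.symm u).2
  have hginj : Function.Injective g := C.injective_subtype.comp e.symm.injective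
  have hgE : ∀ u, Y (g u) ∈ D.E := fun u => (hmem _).mp ((hC _).mp (hgC u)).1
  have hgF : ∀ u, g u ∈ D.F → u = 0 := fun u hu => hginj ((hCF _ (hgC u) hu).trans (map_zero g).symm)
  -- the multiple of `J` that serves as the conjugate linear map
  set κ := plusEigenvalue η with hκ
  set κ' := plusEigenvalue (-η) with hκ'
  have hκ0 : κ ≠ 0 := plusEigenvalue_ne_zero η
  have hκ0' : κ' ≠ 0 := plusEigenvalue_ne_zero (-η)
  have hη : ((η : ℤ) : ℂ) * ((η : ℤ) : ℂ) = 1 := units_coe_mul_self η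
  have hκκ : κ * κ = ((η : ℤ) : ℂ) := plusEigenvalue_mul_self η
  have hκκ' : κ' * κ' = -((η : ℤ) : ℂ) := by
    rw [hκ', plusEigenvalue_mul_self]
    push_cast
    ring
  obtain ⟨α, hα⟩ : ∃ α : ℂ, κ' * α = -κ := ⟨-κ / κ', by field_simp⟩
  have hα2 : α * α = -1 := by
    have h1 : (κ' * κ') * (α * α) = κ * κ := by linear_combination (κ' * α - κ) * hα
    rw [hκκ, hκκ'] at h1
    linear_combination -((η : ℤ) : ℂ) * h1 - (α * α + 1) * hη
  have hαc : α * (starRingEnd ℂ) α = 1 := by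
    have h1 := congrArg (starRingEnd ℂ) hα
    rw [map_mul, map_neg, hκ, hκ', conj_plusEigenvalue, conj_plusEigenvalue, ← hκ, ← hκ'] at h1
    push_cast at h1
    have h2 : κ' * (starRingEnd ℂ) α = κ := by
      linear_combination (-((η : ℤ) : ℂ)) * h1 + (κ - κ' * (starRingEnd ℂ) α) * hη
    have h3 : (κ' * κ') * (α * (starRingEnd ℂ) α) = -(κ * κ) := by
      linear_combination (κ' * (starRingEnd ℂ) α) * hα - κ * h2
    rw [hκκ, hκκ'] at h3
    linear_combination -((η : ℤ) : ℂ) * h3 + (1 - α * (starRingEnd ℂ) α) * hη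
  let form : (Fin m → ℂ) →ₗ[ℂ] (Fin m → ℂ) →ₗ[ℂ] ℂ := T.form.compl₁₂ ((Y : W →ₗ[ℂ] W) ∘ₗ g) g
  have hform : ∀ u v, form u v = T.form (Y (g u)) (g v) := fun _ _ => rfl
  let JC : C →ₛₗ[starRingEnd ℂ] C :=
    { toFun := fun u => ⟨T.J u, hCJ _ u.2⟩
      map_add' := fun u v => Subtype.ext (map_add T.J _ _)
      map_smul' := fun c u => Subtype.ext (map_smulₛₗ T.J _ _) }
  let J : (Fin m → ℂ) →ₛₗ[starRingEnd ℂ] (Fin m → ℂ) :=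
    { toFun := fun u => α • e (JC (e.symm u))
      map_add' := fun u v => by rw [map_add, map_add, map_add, smul_add]
      map_smul' := fun c u => by rw [map_smul, map_smulₛₗ, map_smul, smul_comm] }
  have hgJ : ∀ u, g (J u) = α • T.J (g u) := fun u => by
    change (e.symm (α • e (JC (e.symm u))) : W) = _
    rw [map_smul, LinearEquiv.symm_apply_apply]
    rfl
  clear_value form J g
  have h1 := h.nilIndex_one hX hE g hgE hgF (by rwa [finrank_fin_fun])
  -- the form is non-degenerate, since otherwise the kernel of `Y` would be larger
  have hrad : ∀ u, (∀ v, form u v = 0) → u = 0 := by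
    set Ψ : (Fin m → ℂ) → (Fin m → ℂ) → ℂ :=
      fun u u' => T.nilForm (Y : End ℂ W) 1 (g u) (g u') with hΨ
    have hΨh : IsHerm Ψ := ((isSelfAdj_of_mem h.mem).isHerm 1).comap g
    have h2 := posIndex_add_negIndex_add hΨh hΨh.radical fun u => Iff.rfl
    have h3 := nilIndex_one_add hX
    have h4 := nilIndex_one_add h.mem
    rw [hE] at h4
    have h5 := D.finrank_eq
    rw [finrank_fin_fun] at h2
    have h6 : finrank ℂ hΨh.radical = 0 := by omega
    rw [Submodule.finrank_eq_zero] at h6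
    intro u hu
    have h7 : u ∈ hΨh.radical := fun v => by
      have h8 := hu (J v)
      rw [hform, hgJ, map_smul, smul_eq_mul] at h8
      have h9 := (mul_eq_zero.mp h8).resolve_left fun h0 => by
        rw [h0, zero_mul] at hα2
        simp at hα2
      rw [hΨ]
      simp only [nilForm_apply, pow_one]
      rw [h9, mul_zero]
    rw [h6] at h7
    simpa using h7
  have hP : IsInner fun u v => T.ip (g u) (g v) :=
    { T.isInner_ip.toIsHerm.comap g with
      pos := fun u hu => T.isInner_ip.pos _ fun h0 => hu (hginj (h0.trans (map_zero g).symm)) }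
  obtain ⟨S', hS'f, hS'J, -⟩ := exists_of_inner (ε := -ε) (η := -η) form J
    (fun u v => by
      rw [hform, hform, h.form_swap, T.symm]
      push_cast
      ring)
    hrad
    (fun v => by
      apply hginj
      rw [hgJ, hgJ, map_smulₛₗ, T.J_J, smul_smul, hαc, one_smul, map_smul, neg_mul_neg])
    (fun u v => by
      rw [hform, hform, hgJ, hgJ, map_smul, map_smul, h.mem.2]
      simp only [map_smul, map_neg, LinearMap.smul_apply, LinearMap.neg_apply, smul_eq_mul]
      rw [T.form_J]
      linear_combination -((starRingEnd ℂ) (T.form (Y (g u)) (g v))) * hα2)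
    hP
    (fun u v => by
      rw [hgJ, hgJ, T.isInner_ip.smul_left, T.isInner_ip.smul_right, T.ip_J]
      linear_combination ((starRingEnd ℂ) (T.ip (g u) (g v))) * hαc)
  refine ⟨S', h.nilIndex_one_eq_sign hX hE S' g hgE hgF hm fun u v => ?_⟩
  rw [hS'f, hS'J, hform, hgJ, map_smul, smul_eq_mul, ← mul_assoc, hα, neg_mul]

omit [FiniteDimensional ℂ V] in
theorem IsComplexLift.projV_apply_L {B : D.E →ₗ[ℂ] V} {c : D.E →ₗ[ℂ] D.E →ₗ[ℂ] ℂ}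
    (h : D.IsComplexLift X B c Y) (b : D.E) : D.projV (Y (T.L b)) = B b := by
  refine sub_eq_zero.mp (S.nondegenerate _ fun v' => ?_)
  rw [map_sub, LinearMap.sub_apply, ← D.form_incl_right, h.form_apply, D.projV_incl,
    D.projV_L b.2, D.projL_incl, D.projL_L]
  simp

/-- Every `(-ε, -η)`-space of the right dimension comes from a lift. -/
theorem exists_isLift_of_epsSpace (D : LeviDecomposition S T) (hX : X ∈ S.iLieReal)
    (S' : EpsSpace (-ε) (-η) (Fin m → ℂ))
    (hm : finrank ℂ (LinearMap.ker (X : V →ₗ[ℂ] V)) + m = finrank ℂ D.E) :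
    ∃ Y, D.IsLift X Y ∧ LinearMap.ker (Y : W →ₗ[ℂ] W) = D.E ∧
      (T.nilIndex (Y : End ℂ W) 1).1 = (S.nilIndex (X : End ℂ V) 1).1 +
        finrank ℂ (LinearMap.ker (X : V →ₗ[ℂ] V)) + S'.sign.swap.1 ∧
      (T.nilIndex (Y : End ℂ W) 1).2 = (S.nilIndex (X : End ℂ V) 1).2 +
        finrank ℂ (LinearMap.ker (X : V →ₗ[ℂ] V)) + S'.sign.swap.2 := by
  have hXJ : ∀ v ∈ LinearMap.ker (X : V →ₗ[ℂ] V), S.J v ∈ LinearMap.ker (X : V →ₗ[ℂ] V) :=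
    fun v hv => by
      have hv' : X v = 0 := hv
      change X (S.J v) = 0
      rw [hX.2, hv', map_zero, neg_zero]
  let J₂ : LinearMap.ker (X : V →ₗ[ℂ] V) × (Fin m → ℂ) →ₛₗ[starRingEnd ℂ]
      LinearMap.ker (X : V →ₗ[ℂ] V) × (Fin m → ℂ) :=
    { toFun := fun x => (⟨S.J x.1, hXJ _ x.1.2⟩, S'.J x.2)
      map_add' := fun x y => Prod.ext (Subtype.ext (map_add S.J _ _)) (map_add S'.J _ _)
      map_smul' := fun c x =>
        Prod.ext (Subtype.ext (map_smulₛₗ S.J _ _)) (map_smulₛₗ S'.J _ _) }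
  -- identify `E` with `ker X ⊕ S'`, compatibly with `J`
  obtain ⟨Θ, hΘ⟩ := exists_equivariant_equiv D.JE J₂ (ε * η) (fun v => Subtype.ext (T.J_J v))
    (fun v => Prod.ext (Subtype.ext (S.J_J v.1)) (by
      have := S'.J_J v.2
      rwa [neg_mul_neg] at this))
    (by rw [finrank_prod, finrank_fin_fun, hm])
  have hΘ1 : ∀ b, ((Θ (D.JE b)).1 : V) = S.J (Θ b).1 := fun b => by rw [hΘ]; rfl
  have hΘ2 : ∀ b, (Θ (D.JE b)).2 = S'.J (Θ b).2 := fun b => by rw [hΘ]; rfl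
  set κ := plusEigenvalue η with hκ
  set κ' := plusEigenvalue (-η) with hκ'
  have hκ0 : κ ≠ 0 := plusEigenvalue_ne_zero η
  have hκ0' : κ' ≠ 0 := plusEigenvalue_ne_zero (-η)
  have hη : ((η : ℤ) : ℂ) * ((η : ℤ) : ℂ) = 1 := units_coe_mul_self η
  -- the multiple of the form of `S'` that serves as the component on `E`
  obtain ⟨z, hz⟩ : ∃ z : ℂ, κ * z = -κ' := ⟨-κ' / κ, by field_simp⟩
  have hz0 : z ≠ 0 := fun h0 => hκ0' (by rw [h0, mul_zero] at hz; exact neg_eq_zero.mp hz.symm)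
  have hzc : (starRingEnd ℂ) z = -z := by
    have h1 := congrArg (starRingEnd ℂ) hz
    rw [map_mul, map_neg, hκ, hκ', conj_plusEigenvalue, conj_plusEigenvalue, ← hκ, ← hκ'] at h1
    push_cast at h1
    have h2 : κ * (starRingEnd ℂ) z = κ * -z := by
      linear_combination ((η : ℤ) : ℂ) * h1 + (κ' - κ * (starRingEnd ℂ) z) * hη + hz
    exact mul_left_cancel₀ hκ0 h2
  let c₀ : (Fin m → ℂ) →ₗ[ℂ] (Fin m → ℂ) →ₗ[ℂ] ℂ := z • S'.form
  have hc₀ : ∀ u v, c₀ u v = z * S'.form u v := fun _ _ => rfl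
  let c : D.E →ₗ[ℂ] D.E →ₗ[ℂ] ℂ := c₀.compl₁₂ (LinearMap.snd ℂ _ _ ∘ₗ Θ.toLinearMap)
    (LinearMap.snd ℂ _ _ ∘ₗ Θ.toLinearMap)
  have hc : ∀ b b', c b b' = c₀ (Θ b).2 (Θ b').2 := fun _ _ => rfl
  let B : D.E →ₗ[ℂ] V := Complex.I • (S.L ∘ₗ Submodule.subtype _ ∘ₗ LinearMap.fst ℂ _ _ ∘ₗ
    Θ.toLinearMap)
  have hB : ∀ b, B b = Complex.I • S.L (Θ b).1 := fun _ => rfl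
  clear_value c B
  obtain ⟨Y, hY⟩ := D.exists_isComplexLift hX.1 B c fun u v => by
    rw [hc, hc, hc₀, hc₀, S'.symm]
    push_cast
    ring
  have hlift := hY.isLift hX
    (fun b => by rw [hB, hB, hΘ1, map_smulₛₗ, Complex.conj_I, S.L_J, neg_smul, neg_neg])
    (fun b b' => by
      rw [hc, hc, hc₀, hc₀, hΘ2, hΘ2, S'.form_J, map_mul, hzc]
      ring)
  have hgen := hY.isGeneric hX Θ Complex.I_ne_zero hB c₀ hc
  have hker : LinearMap.ker c₀ = ⊥ := by
    rw [eq_bot_iff]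
    intro u hu
    refine S'.nondegenerate u fun v => ?_
    have : c₀ u v = 0 := by rw [LinearMap.mem_ker.mp hu, LinearMap.zero_apply]
    exact (mul_eq_zero.mp this).resolve_left hz0
  rw [hker, finrank_bot] at hgen
  have hE := hlift.ker_eq hgen.2
  let g : (Fin m → ℂ) →ₗ[ℂ] W := T.L ∘ₗ D.E.subtype ∘ₗ Θ.symm.toLinearMap ∘ₗ LinearMap.inr ℂ _ _
  have hg : ∀ u, g u = T.L (Θ.symm (0, u)) := fun _ => rfl
  clear_value g
  refine ⟨Y, hlift, hE, hlift.nilIndex_one_eq_sign hX hE S' g (fun u => ?_) (fun u hu => ?_) hm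
    fun u v => ?_⟩
  · refine D.mem_E_iff.mpr ⟨hlift.apply_mem_F _, ?_⟩
    rw [hg, hY.projV_apply_L, hB, LinearEquiv.apply_symm_apply, Submodule.coe_zero, map_zero,
      smul_zero]
  · have h1 := D.projL_of_mem_E (D.sub_projV_mem hu)
    rw [map_sub, D.projL_incl, sub_zero, hg, D.projL_L] at h1
    have h2 := (LinearEquiv.map_eq_zero_iff Θ.symm).mp h1
    exact congrArg Prod.snd h2
  · have h1 : T.J (g u) = T.L (D.JE (Θ.symm (0, u))) := by rw [hg, coe_JE, T.L_J]
    rw [h1, hg, hY.form_apply, D.projV_L (Subtype.prop _), D.projV_L (Subtype.prop _), D.projL_L,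
      D.projL_L, hc, hc₀, hΘ2, LinearEquiv.apply_symm_apply, LinearEquiv.apply_symm_apply]
    simp only [map_zero, LinearMap.zero_apply, sub_zero, zero_add]
    rw [← mul_assoc, hz]
    ring

end LeviDecomposition

/-! ### The induced orbits -/

namespace LeviDecomposition

open EpsSpace

variable {ε η : ℤˣ} {V W : Type*} [NormedAddCommGroup V] [NormedSpace ℂ V] [FiniteDimensional ℂ V]
  [NormedAddCommGroup W] [NormedSpace ℂ W] [FiniteDimensional ℂ W]
  {S : EpsSpace ε η V} {T : EpsSpace ε η W} {D : LeviDecomposition S T}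
  {X : V →L[ℂ] V} {Y : W →L[ℂ] W} {m : ℕ} {O : Set (V →L[ℂ] V)} {O' : Set (W →L[ℂ] W)}

/-- If `J² = -1`, the spaces `E` and `ker X` are quaternionic, hence of even dimension. -/
theorem excess_eq_zero (D : LeviDecomposition S T) (hεη : ¬(ε = 1 ∧ η = 1)) (hX : X ∈ S.iLieReal)
    (hm : finrank ℂ (LinearMap.ker (X : V →ₗ[ℂ] V)) + m = finrank ℂ D.E) : excess ε m = 0 := by
  rw [excess]
  split_ifs with hε
  · have hη : η = -1 := (Int.units_eq_one_or η).resolve_left fun h0 => hεη ⟨hε, h0⟩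
    have hJ : (((ε * η : ℤˣ) : ℤ) : ℂ) = -1 := by rw [hε, hη]; simp
    have h1 := even_finrank_of_quaternionic D.JE fun v => Subtype.ext (by
      rw [coe_JE, coe_JE, T.J_J, hJ, neg_one_smul]
      rfl)
    let JX : LinearMap.ker (X : V →ₗ[ℂ] V) →ₛₗ[starRingEnd ℂ] LinearMap.ker (X : V →ₗ[ℂ] V) :=
      { toFun := fun v => ⟨S.J v, by
          have hv : X v = 0 := v.2
          change X (S.J v) = 0
          rw [hX.2, hv, map_zero, neg_zero]⟩
        map_add' := fun u v => Subtype.ext (map_add S.J _ _)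
        map_smul' := fun c u => Subtype.ext (map_smulₛₗ S.J _ _) }
    have h2 := even_finrank_of_quaternionic JX fun v => Subtype.ext (by
      change S.J (S.J v) = _
      rw [S.J_J, hJ, neg_one_smul]
      rfl)
    rw [← hm] at h1
    exact Nat.even_iff.mp ((Nat.even_add.mp h1).mp h2)
  · rfl

omit [FiniteDimensional ℂ V] in
theorem exists_mem_of_isNilOrbit (hO : S.IsNilOrbit O) : ∃ X, X ∈ O := by
  obtain ⟨X, _, _, rfl⟩ := hO
  exact ⟨X, mem_orbit_self X⟩

theorem mem_fiber (hO : S.IsNilOrbit O) :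
    Y ∈ D.fiber O ↔ ∃ X ∈ O, D.IsLift X Y :=
  D.mem_fiber_iff fun _ hX => (hO.of_mem hX).1

/-- An induced orbit contains generic elements. -/
theorem exists_isGeneric_of_mem_induced (hO : S.IsNilOrbit O)
    (hm : ∀ X ∈ O, finrank ℂ (LinearMap.ker (X : V →ₗ[ℂ] V)) + m = finrank ℂ D.E)
    (hO' : O' ∈ D.induced O) : ∃ X ∈ O, ∃ Y ∈ O', D.IsLift X Y ∧ D.IsGeneric (excess ε m) Y := by
  obtain ⟨-, ⟨Y, hY⟩, U, hU, hUeq⟩ := hO'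
  obtain ⟨X, hX, hXY⟩ := (mem_fiber hO).mp hY.2
  rw [hUeq] at hY
  obtain ⟨Y', hY'U, hY', hg⟩ := hXY.exists_isGeneric_mem (hO.of_mem hX).1 (hm X hX) hU hY.1
  have h1 : Y' ∈ U ∩ D.fiber O := ⟨hY'U, (mem_fiber hO).mpr ⟨X, hX, hY'⟩⟩
  rw [← hUeq] at h1
  exact ⟨X, hX, Y', h1.1, hY', hg⟩

/-- Lifts with the same signature of `κ ⟨Y v, J u⟩` are conjugate. -/
theorem IsLift.mem_of_nilIndex_one_eq (h : D.IsLift X Y) (hO : S.IsNilOrbit O) (hX : X ∈ O)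
    (hE : LinearMap.ker (Y : W →ₗ[ℂ] W) ⊓ D.F = D.E) (hO' : T.IsNilOrbit O') (hY : Y ∈ O')
    {X₁ : V →L[ℂ] V} {Y₁ : W →L[ℂ] W} (h₁ : D.IsLift X₁ Y₁) (hX₁ : X₁ ∈ O)
    (hE₁ : LinearMap.ker (Y₁ : W →ₗ[ℂ] W) ⊓ D.F = D.E)
    (heq : T.nilIndex (Y : End ℂ W) 1 = T.nilIndex (Y₁ : End ℂ W) 1) : Y₁ ∈ O' := by
  have hX' := hO.of_mem hX
  have hX₁' := hO.of_mem hX₁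
  have h2 := isNilOrbit_orbit h₁.mem (h₁.isNilpotent hX₁'.2.1)
  rw [hO'.eq_of_nilIndex_eq h2 hY (mem_orbit_self Y₁) fun j => ?_]
  · exact mem_orbit_self Y₁
  · match j with
    | 0 => rw [h.nilIndex_zero hX'.1, h₁.nilIndex_zero hX₁'.1, hO.nilIndex_eq hX hX₁]
    | 1 => exact heq
    | j + 2 =>
      rw [h.nilIndex_add_two hX'.1 hE, h₁.nilIndex_add_two hX₁'.1 hE₁, hO.nilIndex_eq hX hX₁]

/-- Lifts near a lift with kernel `E` are conjugate to it: its signature is lower semicontinuous,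
and the dimension of its kernel is minimal. -/
theorem IsLift.eventually_mem (h : D.IsLift X Y) (hO : S.IsNilOrbit O) (hX : X ∈ O)
    (hE : LinearMap.ker (Y : W →ₗ[ℂ] W) = D.E) (hO' : T.IsNilOrbit O') (hY : Y ∈ O') :
    ∀ᶠ Z in 𝓝 Y, Z ∈ D.fiber O → Z ∈ O' := by
  have hEF : LinearMap.ker (Y : W →ₗ[ℂ] W) ⊓ D.F = D.E := by rw [hE, inf_eq_left.mpr D.E_le_F]
  have hg : D.IsGeneric 0 Y := ⟨by rw [hEF], by rw [hE, add_zero]⟩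
  filter_upwards [eventually_nilIndex_one_le (S := T) Y, (D.isOpen_isGeneric 0).mem_nhds hg]
    with Z hZ hZg hZf
  obtain ⟨X₁, hX₁, h₁⟩ := (mem_fiber hO).mp hZf
  have hZE := h₁.ker_eq hZg.2
  refine h.mem_of_nilIndex_one_eq hO hX hEF hO' hY h₁ hX₁ (h₁.ker_inf_eq hZg) ?_
  have h2 := nilIndex_one_add h.mem
  have h3 := nilIndex_one_add h₁.mem
  rw [hE] at h2
  rw [hZE] at h3
  exact Prod.ext (by omega) (by omega)

/-- The first entry of the diagram gives the dimension of the kernel: it is `dim E` here, and the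
kernel of a lift contains `E`. -/
theorem ker_eq_of_signedDiagram (hO : S.IsNilOrbit O)
    (hm : ∀ X ∈ O, finrank ℂ (LinearMap.ker (X : V →ₗ[ℂ] V)) + m = finrank ℂ D.E)
    (hO' : T.IsNilOrbit O') {s : ℕ × ℕ} (hs : IsSignatureOfDim (-ε) (-η) m s) {a : ℕ × ℕ}
    (hd : T.signedDiagram O' = addTwoColumns (S.signedDiagram O 0 + s) a (S.signedDiagram O))
    (hY : Y ∈ O') (hX : X ∈ O) (h : D.IsLift X Y) : LinearMap.ker (Y : W →ₗ[ℂ] W) = D.E := by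
  refine h.ker_eq ?_
  obtain ⟨S', rfl⟩ := hs
  have h1 := hO'.signedDiagram_zero_add hY
  have h2 := hO.signedDiagram_zero_add hX
  have h3 := S'.sign_add
  rw [finrank_fin_fun] at h3
  have h4 := hm X hX
  rw [hd] at h1
  simp only [addTwoColumns, Prod.fst_add, Prod.snd_add] at h1
  omega

/-- The induced orbits, if there are lifts with kernel `E`. Such a lift determines a
`(-ε, -η)`-space, whose signature determines the diagram; conversely every signature occurs, and all lifts
in an orbit with such a diagram have kernel `E`, so that the orbit is relatively open in `O + i 𝔫`.
-/
theorem induced_eq_setOf_signedDiagram (hO : S.IsNilOrbit O)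
    (hm : ∀ X ∈ O, finrank ℂ (LinearMap.ker (X : V →ₗ[ℂ] V)) + m = finrank ℂ D.E)
    (hex : excess ε m = 0) :
    D.induced O = {O' | T.IsNilOrbit O' ∧ ∃ s : ℕ × ℕ, IsSignatureOfDim (-ε) (-η) m s ∧
      T.signedDiagram O' = addTwoColumns (S.signedDiagram O 0 + s)
        ((S.signedDiagram O 0).swap + s.swap) (S.signedDiagram O)} := by
  have key : ∀ {X Y} {O' : Set (W →L[ℂ] W)} (S' : EpsSpace (-ε) (-η) (Fin m → ℂ)), X ∈ O →
      T.IsNilOrbit O' → Y ∈ O' → D.IsLift X Y → LinearMap.ker (Y : W →ₗ[ℂ] W) = D.E →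
      ((T.nilIndex (Y : End ℂ W) 1).1 = (S.nilIndex (X : End ℂ V) 1).1 +
        finrank ℂ (LinearMap.ker (X : V →ₗ[ℂ] V)) + S'.sign.swap.1 ∧
      (T.nilIndex (Y : End ℂ W) 1).2 = (S.nilIndex (X : End ℂ V) 1).2 +
        finrank ℂ (LinearMap.ker (X : V →ₗ[ℂ] V)) + S'.sign.swap.2) →
      T.signedDiagram O' = addTwoColumns (S.signedDiagram O 0 + S'.sign)
        ((S.signedDiagram O 0).swap + S'.sign.swap) (S.signedDiagram O) := by
    intro X Y O' S' hX hO' hY h hE hi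
    have h1 := S'.sign_add
    rw [finrank_fin_fun] at h1
    have h2 := hm X hX
    refine h.signedDiagram_eq hO hX hO' hY (by rw [hE, inf_eq_left.mpr D.E_le_F]) hi.1 hi.2 ?_ ?_
    · rw [Prod.fst_swap]
      omega
    · rw [Prod.snd_swap]
      omega
  ext O'
  constructor
  · intro hO'
    obtain ⟨X, hX, Y, hY, h, hg⟩ := exists_isGeneric_of_mem_induced hO hm hO'
    rw [hex] at hg
    have hE := h.ker_eq hg.2
    obtain ⟨S', hS'⟩ := h.exists_epsSpace (hO.of_mem hX).1 hE (hm X hX)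
    exact ⟨hO'.1, _, ⟨S', rfl⟩, key S' hX hO'.1 hY h hE hS'⟩
  · rintro ⟨hO', s, ⟨S', rfl⟩, hd⟩
    obtain ⟨X, hX⟩ := exists_mem_of_isNilOrbit hO
    have hX' := hO.of_mem hX
    obtain ⟨Y, h, hE, hi⟩ := D.exists_isLift_of_epsSpace hX'.1 S' (hm X hX)
    have hY := isNilOrbit_orbit h.mem (h.isNilpotent hX'.2.1)
    have hYO' : O' = T.orbit Y := hO'.eq_of_signedDiagram_eq hY
      (hd.trans (key S' hX hY (mem_orbit_self Y) h hE hi).symm)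
    refine ⟨hO', ⟨Y, hYO' ▸ mem_orbit_self Y, (mem_fiber hO).mpr ⟨X, hX, h⟩⟩,
      interior (O' ∪ (D.fiber O)ᶜ), isOpen_interior, ?_⟩
    ext Z
    constructor
    · rintro ⟨hZ, hZf⟩
      obtain ⟨X₁, hX₁, h₁⟩ := (mem_fiber hO).mp hZf
      have hZE := ker_eq_of_signedDiagram hO hm hO' ⟨S', rfl⟩ hd hZ hX₁ h₁
      refine ⟨mem_interior_iff_mem_nhds.mpr ?_, hZf⟩
      filter_upwards [h₁.eventually_mem hO hX₁ hZE hO' hZ] with Z' hZ'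
      exact (em (Z' ∈ D.fiber O)).imp hZ' id
    · rintro ⟨hZ, hZf⟩
      exact ⟨(interior_subset hZ).resolve_right fun h0 => h0 hZf, hZf⟩

/-- In the real orthogonal case all generic lifts have the same signatures, since the forms
`⟨X v, J u⟩` are split. -/
theorem IsLift.nilIndex_one_orthogonal (hη : η = 1) (h : D.IsLift X Y) (hX : X ∈ S.iLieReal) {r : ℕ}
    (hm : finrank ℂ (LinearMap.ker (X : V →ₗ[ℂ] V)) + (2 * r + 1) = finrank ℂ D.E)
    (hg : D.IsGeneric 1 Y) :
    finrank ℂ (LinearMap.ker (Y : W →ₗ[ℂ] W)) = finrank ℂ D.E + 1 ∧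
      (T.nilIndex (Y : End ℂ W) 1).1 = (S.nilIndex (X : End ℂ V) 1).1 +
        finrank ℂ (LinearMap.ker (X : V →ₗ[ℂ] V)) + r ∧
      (T.nilIndex (Y : End ℂ W) 1).2 = (S.nilIndex (X : End ℂ V) 1).2 +
        finrank ℂ (LinearMap.ker (X : V →ₗ[ℂ] V)) + r := by
  have h1 := nilIndex_one_fst_eq_snd hη hX
  have h2 := nilIndex_one_fst_eq_snd hη h.mem
  have h3 := nilIndex_one_add hX
  have h4 := nilIndex_one_add h.mem
  have h5 := Submodule.finrank_mono h.E_le_ker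
  have h6 := hg.2
  have h7 := D.finrank_eq
  omega

/-- If `E^⊥` contained the kernel of `Y`, then `E` would be contained in the intersection of the
kernel and the range of `Y`, and the kernel of `Y ^ 2` would have dimension greater than
`2 dim E`. -/
theorem IsLift.isGeneric_of_finrank_ker (h : D.IsLift X Y)
    (h1 : finrank ℂ (LinearMap.ker (Y : W →ₗ[ℂ] W)) = finrank ℂ D.E + 1)
    (h2 : finrank ℂ (LinearMap.ker ((Y ^ 2 : W →L[ℂ] W) : W →ₗ[ℂ] W)) ≤ 2 * finrank ℂ D.E) :
    D.IsGeneric 1 Y := by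
  refine ⟨?_, h1.le⟩
  by_contra! hlt
  have h3 : LinearMap.ker (Y : W →ₗ[ℂ] W) ⊓ D.F = LinearMap.ker (Y : W →ₗ[ℂ] W) :=
    Submodule.eq_of_le_of_finrank_le inf_le_left (by omega)
  have h4 : D.E ≤ LinearMap.range (Y : W →ₗ[ℂ] W) := fun e he => by
    refine T.mem_of_forall_form_eq_zero _ fun v hv => ?_
    have hv0 : Y v = 0 := T.nondegenerate _ fun w => by
      have hw : T.form (Y w) v = 0 := hv _ ⟨w, rfl⟩
      rw [h.form_swap, neg_eq_zero] at hw
      rw [T.symm, hw, mul_zero]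
    have hvF : v ∈ LinearMap.ker (Y : W →ₗ[ℂ] W) ⊓ D.F := by rw [h3]; exact hv0
    exact hvF.2 e he
  let K := LinearMap.ker ((Y ^ 2 : W →L[ℂ] W) : W →ₗ[ℂ] W)
  let φ : K →ₗ[ℂ] W := (Y : W →ₗ[ℂ] W).domRestrict K
  have h5 := LinearMap.finrank_range_add_finrank_ker φ
  have h6 : D.E ≤ LinearMap.range φ := fun e he => by
    obtain ⟨w, rfl⟩ := h4 he
    refine ⟨⟨w, ?_⟩, rfl⟩
    change (Y ^ 2) w = 0
    rw [pow_two]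
    exact h.apply_E _ he
  have h7 : finrank ℂ (LinearMap.ker φ) = finrank ℂ (LinearMap.ker (Y : W →ₗ[ℂ] W)) := by
    rw [finrank_ker_domRestrict, inf_eq_left.mpr]
    intro w hw
    change (Y ^ 2) w = 0
    have hw' : Y w = 0 := hw
    rw [pow_two, mul_apply_eq_comp, hw', map_zero]
  have h8 := Submodule.finrank_mono h6
  have h9 : finrank ℂ K ≤ 2 * finrank ℂ D.E := h2
  omega

/-- In the real orthogonal case, if `dim E - dim ker X` is odd, the generic lifts form a single
orbit, and all lifts in this orbit are generic. -/
theorem exists_induced_eq_singleton (hε : ε = 1) (hη : η = 1) (hO : S.IsNilOrbit O) {r : ℕ}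
    (hm : ∀ X ∈ O, finrank ℂ (LinearMap.ker (X : V →ₗ[ℂ] V)) + (2 * r + 1) = finrank ℂ D.E) :
    ∃ O', D.induced O = {O'} ∧ T.signedDiagram O' = addTwoColumns
      (S.signedDiagram O 0 + (r + 1, r + 1)) ((S.signedDiagram O 0).swap + (r, r))
      (S.signedDiagram O) ∧
      ∀ Y ∈ O' ∩ D.fiber O, ∃ X ∈ O, D.IsLift X Y ∧ D.IsGeneric 1 Y ∧
        finrank ℂ (LinearMap.ker (Y : W →ₗ[ℂ] W)) = finrank ℂ D.E + 1 := by
  have hex : excess ε (2 * r + 1) = 1 := by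
    rw [excess, if_pos hε]
    omega
  obtain ⟨X, hX⟩ := exists_mem_of_isNilOrbit hO
  have hX' := hO.of_mem hX
  obtain ⟨Y, h, hg⟩ := D.exists_isLift_isGeneric hX'.1 (hm X hX)
  rw [hex] at hg
  have hO' := isNilOrbit_orbit h.mem (h.isNilpotent hX'.2.1)
  have hY := mem_orbit_self (S := T) Y
  have hEF := h.ker_inf_eq hg
  obtain ⟨i0, i1, i2⟩ := h.nilIndex_one_orthogonal hη hX'.1 (hm X hX) hg
  -- the kernels of `Z` and of `Z ^ 2` have the same dimensions as for `Y`
  have hgen : ∀ Z ∈ T.orbit Y, ∀ X₁ ∈ O, D.IsLift X₁ Z → D.IsGeneric 1 Z ∧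
      finrank ℂ (LinearMap.ker (Z : W →ₗ[ℂ] W)) = finrank ℂ D.E + 1 := fun Z hZ X₁ hX₁ h₁ => by
    have h1 : finrank ℂ (LinearMap.ker (Z : W →ₗ[ℂ] W)) = finrank ℂ D.E + 1 := by
      have e1 := nilIndex_one_add h.mem
      have e2 := nilIndex_one_add h₁.mem
      rw [hO'.nilIndex_eq hY hZ] at e1
      omega
    have h2 : finrank ℂ (LinearMap.ker ((Z ^ 2 : W →L[ℂ] W) : W →ₗ[ℂ] W)) ≤ 2 * finrank ℂ D.E := by
      have e1 := EpsSpace.nilIndex_add_finrank_ker h₁.mem 2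
      rw [← hO'.nilIndex_eq hY hZ, h.nilIndex_add_two hX'.1 hEF 0] at e1
      have e2 := nilIndex_zero_add hX'.1
      have e3 := D.finrank_eq
      omega
    exact ⟨h₁.isGeneric_of_finrank_ker h1 h2, h1⟩
  have hmem : ∀ Z X₁, X₁ ∈ O → D.IsLift X₁ Z → D.IsGeneric 1 Z → Z ∈ T.orbit Y := by
    intro Z X₁ hX₁ h₁ hg₁
    refine h.mem_of_nilIndex_one_eq hO hX hEF hO' hY h₁ hX₁ (h₁.ker_inf_eq hg₁) ?_
    obtain ⟨-, j1, j2⟩ := h₁.nilIndex_one_orthogonal hη (hO.of_mem hX₁).1 (hm X₁ hX₁) hg₁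
    have h3 := hO.nilIndex_eq hX hX₁ 1
    have h4 := hm X hX
    have h5 := hm X₁ hX₁
    rw [← h3] at j1 j2
    exact Prod.ext (by omega) (by omega)
  refine ⟨T.orbit Y, ?_, ?_, ?_⟩
  · ext O''
    rw [Set.mem_singleton_iff]
    constructor
    · intro hO''
      obtain ⟨X₁, hX₁, Z, hZ, h₁, hg₁⟩ := exists_isGeneric_of_mem_induced hO hm hO''
      rw [hex] at hg₁
      rw [(hO''.1.of_mem hZ).2.2]
      exact orbit_eq_of_mem (hmem Z X₁ hX₁ h₁ hg₁)
    · rintro rfl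
      refine ⟨hO', ⟨Y, hY, (mem_fiber hO).mpr ⟨X, hX, h⟩⟩, _, D.isOpen_isGeneric 1, ?_⟩
      ext Z
      refine and_congr_left fun hZ => ?_
      obtain ⟨X₁, hX₁, h₁⟩ := (mem_fiber hO).mp hZ
      exact ⟨fun hZ => (hgen Z hZ X₁ hX₁ h₁).1, fun hZ => hmem Z X₁ hX₁ h₁ hZ⟩
  · have h4 := hm X hX
    exact h.signedDiagram_eq hO hX hO' hY hEF (s := (r + 1, r + 1)) (t := (r, r)) i1 i2
      (by simp only; omega) (by simp only; omega)
  · rintro Z ⟨hZ, hZf⟩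
    obtain ⟨X₁, hX₁, h₁⟩ := (mem_fiber hO).mp hZf
    obtain ⟨g1, g2⟩ := hgen Z hZ X₁ hX₁ h₁
    exact ⟨X₁, hX₁, h₁, g1, g2⟩

end LeviDecomposition

/-! ### Component groups of centralizers -/

section ComponentGroups

variable {A : Type*} [TopologicalSpace A] [Group A] [IsTopologicalGroup A] {H₁ H₂ : Subgroup A}

theorem componentMap_bijective_of_eq (h : H₁ ≤ H₂) (heq : H₁ = H₂) :
    Function.Bijective (componentMap h) := by
  subst heq
  have : ⇑(componentMap h) = id := by
    funext x
    induction x using QuotientGroup.induction_on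
    rfl
  rw [this]
  exact Function.bijective_id

/-- A closed subgroup of index two is open, so that it contains the identity component. -/
theorem componentMap_of_index_two (h : H₁ ≤ H₂) (hc : IsClosed {b : H₂ | (b : A) ∈ H₁}) {a : A}
    (ha : a ∈ H₂) (hab : ∀ b ∈ H₂, Xor (a * b ∈ H₁) (b ∈ H₁)) :
    Function.Injective (componentMap h) ∧ (componentMap h).range.index = 2 := by
  set s : Set H₂ := {b : H₂ | (b : A) ∈ H₁} with hs
  have hcompl : sᶜ = (fun b : H₂ => ⟨a, ha⟩ * b) ⁻¹' s := by
    ext b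
    have := hab b b.2
    simp only [Set.mem_compl_iff, Set.mem_preimage, hs, Set.mem_ofPred_eq, Subgroup.coe_mul]
    rw [xor_def] at this
    tauto
  have hclopen : IsClopen s :=
    ⟨hc, isClosed_compl_iff.mp (hcompl ▸ hc.preimage (continuous_const_mul _))⟩
  have hsub : connectedComponent (1 : H₂) ⊆ s := hclopen.connectedComponent_subset H₁.one_mem
  have hind : Topology.IsInducing (Subgroup.inclusion h) :=
    Topology.IsInducing.of_comp (continuous_subtype_val.subtype_mk _) continuous_subtype_val
      Topology.IsInducing.subtypeVal
  have hmem : ∀ b : H₂, (b : ComponentGroup H₂) ∈ (componentMap h).range ↔ (b : A) ∈ H₁ := by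
    intro b
    constructor
    · rintro ⟨x, hx⟩
      induction x using QuotientGroup.induction_on with
      | H y =>
        have h1 : (y : A)⁻¹ * b ∈ H₁ := hsub (QuotientGroup.eq.mp hx)
        have := H₁.mul_mem y.2 h1
        rwa [mul_inv_cancel_left] at this
    · exact fun hb => ⟨((⟨b, hb⟩ : H₁) : ComponentGroup H₁), rfl⟩
  constructor
  · rw [injective_iff_map_eq_one]
    intro x hx
    induction x using QuotientGroup.induction_on with
    | H y =>
      have hy : Subgroup.inclusion h y ∈ connectedComponent (1 : H₂) :=
        (QuotientGroup.eq_one_iff _).mp hx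
      rw [QuotientGroup.eq_one_iff]
      have himage : Subgroup.inclusion h '' (Subgroup.inclusion h ⁻¹' connectedComponent (1 : H₂)) =
          connectedComponent (1 : H₂) := by
        rw [Set.image_preimage_eq_iff]
        exact fun z hz => ⟨⟨z, hsub hz⟩, rfl⟩
      have hpre : IsPreconnected (Subgroup.inclusion h ⁻¹' connectedComponent (1 : H₂)) := by
        rw [← hind.isPreconnected_image, himage]
        exact isPreconnected_connectedComponent
      exact hpre.subset_connectedComponent
        (by rw [Set.mem_preimage, map_one]; exact mem_connectedComponent) hy
  · rw [Subgroup.index_eq_two_iff']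
    refine ⟨((⟨a, ha⟩ : H₂) : ComponentGroup H₂), fun b => ?_⟩
    induction b using QuotientGroup.induction_on with
    | H b =>
      rw [← QuotientGroup.mk_mul, hmem, hmem]
      exact hab b b.2

end ComponentGroups

namespace LeviDecomposition

open EpsSpace

variable {ε η : ℤˣ} {V W : Type*} [NormedAddCommGroup V] [NormedSpace ℂ V] [FiniteDimensional ℂ V]
  [NormedAddCommGroup W] [NormedSpace ℂ W] [FiniteDimensional ℂ W]
  {S : EpsSpace ε η V} {T : EpsSpace ε η W} {D : LeviDecomposition S T}
  {X : V →L[ℂ] V} {Y : W →L[ℂ] W}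

omit [FiniteDimensional ℂ V] [FiniteDimensional ℂ W] in
/-- If `E` is the kernel of `Y`, the centralizer of `Y` stabilizes `E`. -/
theorem componentMap_bijective (hE : LinearMap.ker (Y : W →ₗ[ℂ] W) = D.E) :
    Function.Bijective (D.componentMap Y) := by
  refine componentMap_bijective_of_eq _ (le_antisymm (D.centralizer_le Y) fun g hg => ?_)
  refine ⟨⟨hg.1, fun w => ?_⟩, hg.2⟩
  rw [← hE]
  change Y ((g : W →L[ℂ] W) w) = 0 ↔ Y w = 0
  rw [← hg.2 w]
  constructor
  · intro h0
    rw [← unit_inv_apply g (Y w), h0, map_zero]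
  · intro h0
    rw [h0, map_zero]

omit [FiniteDimensional ℂ V] in
/-- An element of the real group that maps `E` into itself lies in the parabolic subgroup. -/
theorem mem_parabolic_of_le {g : (W →L[ℂ] W)ˣ} (hg : g ∈ T.realGroup)
    (h : ∀ w ∈ D.E, (g : W →L[ℂ] W) w ∈ D.E) : g ∈ D.parabolic := by
  refine ⟨hg, fun w => ⟨fun hw => ?_, h w⟩⟩
  have hinj : Function.Injective (g : W →L[ℂ] W) := fun x y hxy => by
    rw [← unit_inv_apply g x, hxy, unit_inv_apply]
  have h1 : D.E.map ((g : W →L[ℂ] W) : W →ₗ[ℂ] W) = D.E := by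
    refine Submodule.eq_of_le_of_finrank_eq ?_ ?_
    · rintro _ ⟨x, hx, rfl⟩
      exact h x hx
    · exact (Submodule.equivMapOfInjective ((g : W →L[ℂ] W) : W →ₗ[ℂ] W) hinj D.E).finrank_eq.symm
  rw [← h1] at hw
  obtain ⟨x, hx, hxw⟩ := hw
  rwa [← hinj hxw]

/-- In the real orthogonal case the kernel of a generic lift contains a real anisotropic vector,
since it is not contained in `E^⊥`. -/
theorem IsLift.exists_real_anisotropic (hε : ε = 1) (hη : η = 1) (h : D.IsLift X Y)
    (hg : D.IsGeneric 1 Y)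
    (hk : finrank ℂ (LinearMap.ker (Y : W →ₗ[ℂ] W)) = finrank ℂ D.E + 1) :
    ∃ u, Y u = 0 ∧ T.J u = u ∧ T.form u u ≠ 0 := by
  by_contra! hc
  have hJJ : ∀ w, T.J (T.J w) = w := fun w => by
    rw [T.J_J, hε, hη]
    simp
  have hYJ : ∀ w, Y w = 0 → Y (T.J w) = 0 := fun w hw => by
    rw [h.mem.2, hw, map_zero, neg_zero]
  have hsymm : ∀ u v, T.form u v = T.form v u := fun u v => by
    have h1 : ((ε : ℤ) : ℂ) = 1 := by rw [hε]; simp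
    rw [T.symm, h1, one_mul]
  -- otherwise the form vanishes on the kernel, by polarization and passage to complex linear
  -- combinations
  have h1 : ∀ u v, Y u = 0 → Y v = 0 → T.J u = u → T.J v = v → T.form u v = 0 := by
    intro u v hu hv hu' hv'
    have e1 := hc (u + v) (by rw [map_add, hu, hv, add_zero]) (by rw [map_add, hu', hv'])
    simp only [map_add, LinearMap.add_apply] at e1
    rw [hc u hu hu', hc v hv hv', hsymm v u] at e1
    linear_combination e1 / 2
  have h2 : ∀ u v, Y u = 0 → Y v = 0 → T.J u = u → T.form u v = 0 := by
    intro u v hu hv hu'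
    have e1 := h1 u (v + T.J v) hu (by rw [map_add, hv, hYJ v hv, add_zero]) hu'
      (by rw [map_add, hJJ, add_comm])
    have e2 := h1 u (Complex.I • (v - T.J v)) hu
      (by rw [map_smul, map_sub, hv, hYJ v hv, sub_zero, smul_zero]) hu'
      (by rw [map_smulₛₗ, map_sub, hJJ, Complex.conj_I, neg_smul, ← smul_neg, neg_sub])
    rw [map_add] at e1
    rw [map_smul, smul_eq_mul, mul_eq_zero, map_sub] at e2
    have e3 := e2.resolve_left Complex.I_ne_zero
    linear_combination e1 / 2 + e3 / 2
  have h3 : ∀ u v, Y u = 0 → Y v = 0 → T.form u v = 0 := by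
    intro u v hu hv
    have e1 := h2 (u + T.J u) v (by rw [map_add, hu, hYJ u hu, add_zero]) hv
      (by rw [map_add, hJJ, add_comm])
    have e2 := h2 (Complex.I • (u - T.J u)) v
      (by rw [map_smul, map_sub, hu, hYJ u hu, sub_zero, smul_zero]) hv
      (by rw [map_smulₛₗ, map_sub, hJJ, Complex.conj_I, neg_smul, ← smul_neg, neg_sub])
    rw [map_add, LinearMap.add_apply] at e1
    rw [map_smul, LinearMap.smul_apply, smul_eq_mul, mul_eq_zero, map_sub,
      LinearMap.sub_apply] at e2
    have e3 := e2.resolve_left Complex.I_ne_zero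
    linear_combination e1 / 2 + e3 / 2
  have h4 : LinearMap.ker (Y : W →ₗ[ℂ] W) ≤ D.F := fun w hw e he => h3 e w (h.apply_E e he) hw
  have h5 := hg.1
  rw [inf_eq_left.mpr h4] at h5
  omega

/-- In the real orthogonal case `E` is one of the two maximal isotropic subspaces of the kernel of a
generic lift `Y`. The centralizer of `Y` permutes them, and they are exchanged by the
reflection in a real anisotropic vector of the kernel. -/
theorem componentMap_index_two (hε : ε = 1) (hη : η = 1) (h : D.IsLift X Y)
    (hg : D.IsGeneric 1 Y)
    (hk : finrank ℂ (LinearMap.ker (Y : W →ₗ[ℂ] W)) = finrank ℂ D.E + 1) :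
    Function.Injective (D.componentMap Y) ∧ (D.componentMap Y).range.index = 2 := by
  obtain ⟨u, hYu, hJu, hq⟩ := h.exists_real_anisotropic hε hη hg hk
  have hsymm : ∀ u v, T.form u v = T.form v u := fun u v => by
    have h1 : ((ε : ℤ) : ℂ) = 1 := by rw [hε]; simp
    rw [T.symm, h1, one_mul]
  have hEF := h.ker_inf_eq hg
  set q := T.form u u with hqdef
  have hqc : (starRingEnd ℂ) q = q := by
    rw [hqdef, ← T.form_J, hJu]
  have huE : u ∉ D.E := fun hu => hq (D.isotropic u hu u hu)
  obtain ⟨e₀, he₀, he₀u⟩ : ∃ e ∈ D.E, T.form e u ≠ 0 := by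
    by_contra! hc
    refine huE ?_
    rw [← hEF]
    exact ⟨hYu, hc⟩
  -- the kernel is spanned by `E` and `u`
  have hspan : ∀ w, Y w = 0 → ∃ e ∈ D.E, ∃ c : ℂ, w = e + c • u := by
    have h1 : D.E ⊔ ℂ ∙ u = LinearMap.ker (Y : W →ₗ[ℂ] W) := by
      refine Submodule.eq_of_le_of_finrank_le (sup_le h.E_le_ker ?_) ?_
      · rw [Submodule.span_singleton_le_iff_mem]
        exact hYu
      · have h2 : D.E < D.E ⊔ ℂ ∙ u := by
          refine lt_of_le_of_ne le_sup_left fun h0 => huE ?_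
          rw [h0]
          exact Submodule.mem_sup_right (Submodule.mem_span_singleton_self u)
        have := Submodule.finrank_lt_finrank_of_lt h2
        omega
    intro w hw
    have hw' : w ∈ D.E ⊔ ℂ ∙ u := by
      rw [h1]
      exact hw
    obtain ⟨e, he, _, hx, rfl⟩ := Submodule.mem_sup.mp hw'
    obtain ⟨c, rfl⟩ := Submodule.mem_span_singleton.mp hx
    exact ⟨e, he, c, rfl⟩
  -- the reflection in `u`
  let s : W →ₗ[ℂ] W := LinearMap.id - (2 / q) • (T.form u).smulRight u
  have hs : ∀ w, s w = w - ((2 / q) * T.form u w) • u := fun w => by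
    simp only [s, LinearMap.sub_apply, LinearMap.smul_apply, LinearMap.smulRight_apply, smul_smul,
      LinearMap.id_apply]
  clear_value s
  obtain ⟨a, ha, has⟩ := exists_mem_realGroup (S := T) s
    (fun v w => by
      rw [hs, hs]
      simp only [map_sub, map_smul, LinearMap.sub_apply, LinearMap.smul_apply, smul_eq_mul]
      rw [hsymm v u, ← hqdef]
      field_simp
      ring)
    (fun w => by
      have h1 : T.form u (T.J w) = (starRingEnd ℂ) (T.form u w) := by rw [← T.form_J, hJu]
      rw [hs, hs, map_sub, map_smulₛₗ, hJu, h1, map_mul, map_div₀, hqc, map_ofNat])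
  have haY : ∀ w, (a : W →L[ℂ] W) (Y w) = Y ((a : W →L[ℂ] W) w) := fun w => by
    have h1 : T.form u (Y w) = 0 := by
      have := h.form_swap u w
      rw [hYu, map_zero, LinearMap.zero_apply] at this
      exact neg_eq_zero.mp this.symm
    rw [has, has, hs, hs, map_sub, map_smul, hYu, h1, mul_zero, zero_smul, smul_zero]
  have haH : a ∈ centralizerIn T.realGroup Y := ⟨ha, haY⟩
  have hclosed : IsClosed {b : centralizerIn T.realGroup Y |
      (b : (W →L[ℂ] W)ˣ) ∈ centralizerIn D.parabolic Y} := by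
    have h1 : {b : centralizerIn T.realGroup Y |
        (b : (W →L[ℂ] W)ˣ) ∈ centralizerIn D.parabolic Y} =
        ⋂ w ∈ D.E, {b : centralizerIn T.realGroup Y | (((b : (W →L[ℂ] W)ˣ) : W →L[ℂ] W)) w ∈ D.E} := by
      ext b
      simp only [Set.mem_iInter, Set.mem_ofPred_eq]
      exact ⟨fun hb w hw => (hb.1.2 w).mpr hw, fun hb => ⟨mem_parabolic_of_le b.2.1 hb, b.2.2⟩⟩
    rw [h1]
    refine isClosed_biInter fun w _ => ?_
    have h2 : Continuous fun b : centralizerIn T.realGroup Y =>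
        (((b : (W →L[ℂ] W)ˣ) : W →L[ℂ] W)) w :=
      (Units.continuous_val.comp continuous_subtype_val).clm_apply continuous_const
    exact D.E.closed_of_finiteDimensional.preimage h2
  refine componentMap_of_index_two _ hclosed haH fun b hb => ?_
  -- an isotropic vector of the kernel lies in `E` or in the image of `E` under the reflection
  have hor : ∀ e ∈ D.E, (b : W →L[ℂ] W) e ∈ D.E ∨ s ((b : W →L[ℂ] W) e) ∈ D.E := by
    intro e he
    have h1 : Y ((b : W →L[ℂ] W) e) = 0 := by
      rw [← hb.2, h.apply_E e he, map_zero]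
    obtain ⟨e', he', c, hc⟩ := hspan _ h1
    have h2 : c * (2 * T.form u e' + c * q) = 0 := by
      have h3 := hb.1.1 e e
      rw [hc, D.isotropic e he e he] at h3
      simp only [map_add, map_smul, LinearMap.add_apply, LinearMap.smul_apply, smul_eq_mul] at h3
      rw [D.isotropic e' he' e' he', hsymm e' u, ← hqdef] at h3
      linear_combination h3
    rw [hc]
    rcases mul_eq_zero.mp h2 with h3 | h3
    · left
      rwa [h3, zero_smul, add_zero]
    · right
      have h4 : s (e' + c • u) = e' := by
        rw [hs, map_add, map_smul, smul_eq_mul, ← hqdef, add_sub_assoc, ← sub_smul]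
        have : c - 2 / q * (T.form u e' + c * q) = 0 := by
          field_simp
          linear_combination -h3
        rw [this, zero_smul, add_zero]
      rwa [h4]
  have hmem : ∀ g ∈ centralizerIn T.realGroup Y,
      (g ∈ centralizerIn D.parabolic Y ↔ ∀ w ∈ D.E, (g : W →L[ℂ] W) w ∈ D.E) := fun g hg =>
    ⟨fun h1 w hw => (h1.1.2 w).mpr hw, fun h1 => ⟨mem_parabolic_of_le hg.1 h1, hg.2⟩⟩
  have hab : ∀ w, ((a * b : (W →L[ℂ] W)ˣ) : W →L[ℂ] W) w = s ((b : W →L[ℂ] W) w) := fun w => by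
    rw [Units.val_mul, mul_apply_eq_comp, has]
  -- the two alternatives describe subspaces of `E`, one of which must be all of `E`
  have hunion : (∀ w ∈ D.E, (b : W →L[ℂ] W) w ∈ D.E) ∨ ∀ w ∈ D.E, s ((b : W →L[ℂ] W) w) ∈ D.E := by
    by_contra! hc
    obtain ⟨⟨x, hx, hx'⟩, y, hy, hy'⟩ := hc
    have hx2 := (hor x hx).resolve_left hx'
    have hy2 := (hor y hy).resolve_right hy'
    rcases hor (x + y) (D.E.add_mem hx hy) with h1 | h1
    · rw [map_add] at h1
      exact hx' ((D.E.add_mem_iff_left hy2).mp h1)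
    · rw [map_add, map_add] at h1
      exact hy' ((D.E.add_mem_iff_right hx2).mp h1)
  -- `E` is not stable under the reflection
  have hnot : ¬((∀ w ∈ D.E, (b : W →L[ℂ] W) w ∈ D.E) ∧
      ∀ w ∈ D.E, s ((b : W →L[ℂ] W) w) ∈ D.E) := by
    rintro ⟨h1, h2⟩
    have h3 := (mem_parabolic_of_le hb.1 h1 : b ∈ D.parabolic)
    have h4 := (inv_mem h3).2 e₀
    have h5 := h2 _ (h4.mpr he₀)
    rw [unit_apply_inv, hs] at h5
    have h6 : (2 / q * T.form u e₀) • u ∈ D.E := by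
      have := D.E.sub_mem he₀ h5
      rwa [sub_sub_cancel] at this
    refine huE ((D.E.smul_mem_iff ?_).mp h6)
    rw [hsymm]
    exact mul_ne_zero (div_ne_zero two_ne_zero hq) he₀u
  rw [hmem _ (mul_mem haH hb), hmem _ hb]
  simp only [hab]
  rw [xor_def]
  tauto

end LeviDecomposition

/-- A space and its negative have the same real group and the same nilpotent orbits. -/
theorem EpsSpace.isNilOrbit_neg {ε η : ℤˣ} {V : Type*} [NormedAddCommGroup V] [NormedSpace ℂ V]
    (S : EpsSpace ε η V) {O : Set (V →L[ℂ] V)} (hO : S.IsNilOrbit O) : S.neg.IsNilOrbit O := by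
  have hG : S.neg.realGroup = S.realGroup := by
    ext g
    refine and_congr_left fun _ => forall₂_congr fun u v => ?_
    change -S.form _ _ = -S.form _ _ ↔ _
    rw [neg_inj]
  obtain ⟨X, hX, hn, h⟩ := hO
  refine ⟨X, ⟨fun u v => ?_, hX.2⟩, hn, by rw [hG]; exact h⟩
  change -S.form _ _ + -S.form _ _ = 0
  rw [← neg_add, hX.1, neg_zero]

end

theorem mainTheorem8 {ε η : ℤˣ} {V W : Type*}
    [NormedAddCommGroup V] [NormedSpace ℂ V] [FiniteDimensional ℂ V]
    [NormedAddCommGroup W] [NormedSpace ℂ W] [FiniteDimensional ℂ W]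
    (S : EpsSpace ε η V) (T : EpsSpace ε η W) (D : LeviDecomposition S.neg T)
    (O : Set (V →L[ℂ] V)) (hO : S.IsNilOrbit O)
    (l c₁ : ℕ) (hl : Module.finrank ℂ D.E = l)
    (hc₁ : ∀ X ∈ O, Module.finrank ℂ (LinearMap.ker (X : V →ₗ[ℂ] V)) = c₁)
    (hle : c₁ ≤ l) (hodd : ε = 1 → η = 1 → Odd (l - c₁))
    (d : ℕ → ℕ × ℕ) (hd : S.neg.signedDiagram O = d) :
    ((ε = 1 ∧ η = 1) →
      ∃ O' : Set (W →L[ℂ] W), D.induced O = {O'} ∧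
        T.signedDiagram O' =
          addTwoColumns (d 0 + ((l - c₁ - 1) / 2, (l - c₁ - 1) / 2) + (1, 1))
            ((d 0).swap + ((l - c₁ - 1) / 2, (l - c₁ - 1) / 2).swap) d ∧
        ∀ X ∈ O' ∩ D.fiber O,
          Function.Injective (D.componentMap X) ∧ (D.componentMap X).range.index = 2) ∧
    (¬ (ε = 1 ∧ η = 1) →
      D.induced O =
        {O' | T.IsNilOrbit O' ∧ ∃ s : ℕ × ℕ, IsSignatureOfDim (-ε) (-η) (l - c₁) s ∧
          T.signedDiagram O' = addTwoColumns (d 0 + s) ((d 0).swap + s.swap) d} ∧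
      ∀ O' ∈ D.induced O, ∀ X ∈ O' ∩ D.fiber O, Function.Bijective (D.componentMap X)) := by
  subst hd
  have hO' : S.neg.IsNilOrbit O := S.isNilOrbit_neg hO
  -- the generic kernel has dimension `l + 1` in the real orthogonal case and is `E` otherwise
  constructor
  · rintro ⟨hε, hη⟩
    obtain ⟨r, hr⟩ := hodd hε hη
    have hr' : (l - c₁ - 1) / 2 = r := by omega
    obtain ⟨O', h1, h2, h3⟩ := LeviDecomposition.exists_induced_eq_singleton (D := D) hε hη hO'
      (r := r) fun X hX => by rw [hc₁ X hX, hl]; omega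
    refine ⟨O', h1, ?_, fun Y hY => ?_⟩
    · rw [h2, hr', add_assoc]
      rfl
    · obtain ⟨X, -, hXY, hg, hk⟩ := h3 Y hY
      exact LeviDecomposition.componentMap_index_two hε hη hXY hg hk
  · intro hεη
    have hm : ∀ X ∈ O, finrank ℂ (LinearMap.ker (X : V →ₗ[ℂ] V)) + (l - c₁) = finrank ℂ D.E :=
      fun X hX => by rw [hc₁ X hX, hl]; omega
    obtain ⟨X₀, hX₀⟩ := LeviDecomposition.exists_mem_of_isNilOrbit hO'
    have h1 := LeviDecomposition.induced_eq_setOf_signedDiagram (D := D) hO' hm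
      (D.excess_eq_zero hεη (hO'.of_mem hX₀).1 (hm X₀ hX₀))
    refine ⟨h1, fun O' hO'' Y hY => ?_⟩
    rw [h1] at hO''
    obtain ⟨hN, s, hs, hsd⟩ := hO''
    obtain ⟨X, hX, hXY⟩ := (LeviDecomposition.mem_fiber hO').mp hY.2
    exact LeviDecomposition.componentMap_bijective
      (LeviDecomposition.ker_eq_of_signedDiagram hO' hm hN hs hsd hY.1 hX hXY)
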